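/- **Setting.** Let $\mathfrak g$ be a finite dimensional simple complex Lie algebra with Killing form $k$, $\mathfrak h\subset\mathfrak g$ a Cartan subalgebra and $\mathfrak b\supset\mathfrak h$ a Borel subalgebra. Let $\widehat{\mathfrak g}=\mathfrak g\otimes_{\mathbb C}\mathbb C[t,t^{-1}]\oplus\mathbb CK\oplus\mathbb CD$ be the affine Kac–Moody algebra, with $[x\otimes t^n,y\otimes t^m]=[x,y]\otimes t^{n+m}+n\,\delta_{m,-n}\,k(x,y)K$, $K$ central and $[D,x\otimes t^n]=n\,x\otimes t^n$. Put $\widehat{\mathfrak h}=\mathfrak h\oplus\mathbb CK\oplus\mathbb CD$ and $\widehat{\mathfrak b}=\mathfrak g\otimes t\mathbb C[t]\oplus\mathfrak b\oplus\mathbb CK\oplus\mathbb CD$. Let $R$ be the set of roots of $\mathfrak g$ and $R^+$ the set of roots of $\mathfrak b$ with respect to $\mathfrak h$, extended by $0$ to $\mathbb CK\oplus\mathbb CD$, and let $\delta\in\widehat{\mathfrak h}^\star$ be given by $\delta(\mathfrak h\oplus\mathbb CK)=0$, $\delta(D)=1$. The positive affine roots are $\widehat R^+=R^+\cup\{\alpha+n\delta\mid\alpha\in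 R,\ n>0\}\cup\{n\delta\mid n>0\}$. For $\lambda,\mu\in\widehat{\mathfrak h}^\star$ write $\mu\le\lambda$ if $\lambda-\mu\in\mathbb Z_{\ge0}\widehat R^+$. A subset $\mathcal J\subset\widehat{\mathfrak h}^\star$ is *open* if $\lambda\in\mathcal J$ and $\mu\le\lambda$ imply $\mu\in\mathcal J$, and *locally bounded* if $\{\gamma\in\mathcal J\mid\gamma\ge\mu\}$ is finite for all $\mu\in\widehat{\mathfrak h}^\star$. A *deformation algebra* is a commutative, unital, Noetherian algebra $A$ over the symmetric algebra $S(\mathfrak h)$. Let $\tau\colon\widehat{\mathfrak h}\to A$ be the canonical map on $\mathfrak h$ and zero on $\mathbb CK\oplus\mathbb CD$. A $\widehat{\mathfrak g}_A$-module is an $A$-module with an $A$-linear action of $\widehat{\mathfrak g}$; its weight spaces are $M_\lambda=\{m\mid Hm=(\lambda(H)+\tau(H))m\ \text{for all } H\in\widehat{\mathfrak h}\}$, $\lambda\in\widehat{\mathfrak h}^\star$. The category $\widehat{\mathcal O}_A$ consists of the $\widehat{\mathfrak g}_A$-modules $M$ with $M=\bigoplus_\lambda M_\lambda$ in which every element lies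 in an $A$-submodule that is finitely generated over $A$ and stable under $\widehat{\mathfrak b}$. Its full subcategory $\widehat{\mathcal O}_A^{\mathcal J}$ consists of the $M$ such that $M_\lambda\neq0$ implies $\lambda\in\mathcal J$. The *deformed Verma module* is $\Delta_A(\lambda)=U(\widehat{\mathfrak g})\otimes_{U(\widehat{\mathfrak b})}A_\lambda$, where $A_\lambda$ is free of rank one over $A$, $\widehat{\mathfrak h}$ acts on it by $\lambda+\tau$ and $[\widehat{\mathfrak b},\widehat{\mathfrak b}]$ acts by zero. A *Verma flag* of $M$ is a finite filtration $0=M_0\subset M_1\subset\dots\subset M_n=M$ by $\widehat{\mathfrak g}_A$-submodules with $M_i/M_{i-1}\cong\Delta_A(\mu_i)$ for some $\mu_i\in\widehat{\mathfrak h}^\star$; put $(M:\Delta_A(\nu))=\#\{i\mid\mu_i=\nu\}$. Let $A$ be local with residue field $\mathbb K$ (again a deformation algebra). Let $L_{\mathbb K}(\lambda)$ be the simple quotient of $\Delta_{\mathbb K}(\lambda)$, and let $L_A(\lambda)$ be $L_{\mathbb K}(\lambda)$ regarded as a $\widehat{\mathfrak g}_A$-module through $A\to\mathbb K$. The *dual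 Verma module* $\nabla_{\mathbb K}(\lambda)$ is the restricted dual of $\Delta_{\mathbb K}(\lambda)$: the set of $\widehat{\mathfrak h}$-finite vectors in $\operatorname{Hom}_{\mathbb K}(\Delta_{\mathbb K}(\lambda),\mathbb K)$ with the action $(Xf)(m)=-f(\omega(X)m)$, where $\omega$ is the Chevalley involution of $\widehat{\mathfrak g}$ ($x\otimes t^n\mapsto\omega_0(x)\otimes t^{-n}$, $K\mapsto-K$, $D\mapsto-D$, with $\omega_0$ an automorphism of $\mathfrak g$ that is $-1$ on $\mathfrak h$). For a $\widehat{\mathfrak g}_{\mathbb K}$-module $M$ let $[M:L_{\mathbb K}(\mu)]\in\mathbb Z_{\ge0}\cup\{\infty\}$ be the supremum, over all finite chains of submodules $M_0\subset M_1\subset\dots\subset M_n$ of $M$, of the number of $i$ with $M_i/M_{i-1}\cong L_{\mathbb K}(\mu)$. A *projective cover* of $L_A(\mu)$ in $\widehat{\mathcal O}_A^{\mathcal J}$ is a projective object $P$ of $\widehat{\mathcal O}_A^{\mathcal J}$ with a surjective homomorphism $c\colon P\to L_A(\mu)$ such that every homomorphism $g\colon M\to P$ in $\widehat{\mathcal O}_A^{\mathcal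 J}$ with $c\circ g$ surjective is surjective. **Theorem (Deformed BGGH-reciprocity).** Let $A$ be a local deformation algebra with residue field $\mathbb K$, let $\mathcal J\subset\widehat{\mathfrak h}^\star$ be open and locally bounded, and let $\mu\in\mathcal J$. Then $L_A(\mu)$ has a projective cover $P_A^{\mathcal J}(\mu)\to L_A(\mu)$ in $\widehat{\mathcal O}_A^{\mathcal J}$. Every such projective cover $P_A^{\mathcal J}(\mu)$ admits a Verma flag, and for every Verma flag of it and every $\lambda\in\widehat{\mathfrak h}^\star$ $$ (P_A^{\mathcal J}(\mu):\Delta_A(\lambda))=\begin{cases}[\nabla_{\mathbb K}(\lambda):L_{\mathbb K}(\mu)],&\lambda\in\mathcal J,\\ 0,&\lambda\notin\mathcal J.\end{cases} $$ In particular these multiplicities $[\nabla_{\mathbb K}(\lambda):L_{\mathbb K}(\mu)]$ with $\lambda\in\mathcal J$ are finite. -/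

import Mathlib

set_option linter.unusedSectionVars false

universe u v w

open scoped TensorProduct

noncomputable section

namespace AffineO

section Chevalley

open LieAlgebra LieAlgebra.IsKilling LieModule

theorem exists_equiv_h {ι L K : Type*} [Finite ι] [LieRing L] [Field K] [CharZero K]
    [LieAlgebra K L] [FiniteDimensional K L] [LieAlgebra.IsSimple K L] {H : LieSubalgebra K L}
    (b : LieAlgebra.Basis ι H) :
    ∃ φ : L ≃ₗ⁅K⁆ L, ∀ i, φ (b.h i) = - b.h i := by
  have key : ∃ (P : LieSubalgebra K (L × L)) (E : P ≃ₗ⁅K⁆ L) (F : P ≃ₗ⁅K⁆ L),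
      LieAlgebra.Basis.equivOfReindex (Equiv.refl ι) b b.symm (by simp) = E.symm.trans F ∧
      (∀ p, E p = p.1.1) ∧ (∀ p, F p = p.1.2) ∧ ∀ i, (b.h i, - b.h i) ∈ P :=
    ⟨_, _, _, rfl, fun _ => rfl, fun _ => rfl, fun i => LieSubalgebra.subset_lieSpan
      (Or.inl (Or.inl ⟨i, rfl⟩))⟩
  obtain ⟨P, E, F, -, hE, hF, hP⟩ := key
  refine ⟨E.symm.trans F, fun i => ?_⟩
  have h1 : E.symm (b.h i) = ⟨(b.h i, -b.h i), hP i⟩ := by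
    rw [LieEquiv.symm_apply_eq]
    rw [hE]
  simp [LieEquiv.trans_apply, h1, hF]

section
variable {K L : Type*} [Field K] [CharZero K] [LieRing L] [LieAlgebra K L] [FiniteDimensional K L]
  [LieAlgebra.IsKilling K L] {H : LieSubalgebra K L} [H.IsCartanSubalgebra] 
  [LieModule.IsTriangularizable K H L]

theorem exists_lie_ne_zero_aux {α β γ : Weight K H L} (hα : α.IsNonZero) (hβ : β.IsNonZero)
    (hγ : (γ : H → K) = α + β) 
    {e x : L} (he : e ∈ rootSpace H α) (he0 : e ≠ 0) (hx : x ∈ rootSpace H β) (hx0 : x ≠ 0) :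
    ⁅e, x⁆ ≠ 0 := by
  obtain ⟨h, e', f, t, he', hf⟩ := exists_isSl2Triple_of_weight_isNonZero hα
  obtain rfl := t.h_eq_coroot hα he' hf
  obtain ⟨c, hc⟩ : ∃ c : K, c • (⟨e, he⟩ : rootSpace H α) = ⟨e', he'⟩ :=
    (finrank_eq_one_iff_of_nonzero' _ (by simpa [LieSubmodule.mk_eq_zero] using he0)).mp
      (finrank_rootSpace_eq_one α hα) _
  replace hc : c • e = e' := congrArg Subtype.val hc
  suffices ⁅e', x⁆ ≠ 0 by
    rw [← hc, smul_lie] at this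
    exact fun h => this (by rw [h, smul_zero])
  obtain ⟨y, hy, y_ne0⟩ := (chainTop α β).exists_ne_zero
  have prim : t.HasPrimitiveVectorWith y (chainLength α β : K) :=
    have := lie_mem_genWeightSpace_of_mem_genWeightSpace he' hy
    ⟨y_ne0, (chainLength_smul _ _ hy).symm, by rwa [genWeightSpace_add_chainTop _ _ hα] at this⟩
  obtain ⟨q, hq⟩ : ∃ q, chainTopCoeff α β = q + 1 := by
    refine Nat.exists_eq_succ_of_ne_zero fun h0 => ?_
    have := (rootSpace_zsmul_add_ne_bot_iff α β hα 1).mp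
      (by rw [one_smul, ← hγ]; exact γ.genWeightSpace_ne_bot)
    omega
  have hle : q + 1 ≤ chainLength α β := by
    rw [← chainBotCoeff_add_chainTopCoeff, hq]; omega
  have hz0 := prim.pow_toEnd_f_ne_zero_of_eq_nat rfl hle
  have hz : ((toEnd K L L) f ^ (q + 1)) y ∈ rootSpace H β := by
    have := toEnd_pow_apply_mem hf hy (q + 1)
    rwa [coe_chainTop', hq, smul_neg, neg_add_cancel_left] at this
  obtain ⟨d, hd⟩ : ∃ d : K, d • (⟨x, hx⟩ : rootSpace H β) = ⟨_, hz⟩ :=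
    (finrank_eq_one_iff_of_nonzero' _ (by simpa [LieSubmodule.mk_eq_zero] using hx0)).mp
      (finrank_rootSpace_eq_one β hβ) _
  replace hd : d • x = ((toEnd K L L) f ^ (q + 1)) y := congrArg Subtype.val hd
  intro h0
  have h1 := prim.lie_e_pow_succ_toEnd_f q
  rw [← hd, lie_smul, h0, smul_zero, eq_comm, smul_eq_zero] at h1
  have hz1 := prim.pow_toEnd_f_ne_zero_of_eq_nat rfl (Nat.le_of_succ_le hle)
  rcases h1.resolve_right hz1 |> mul_eq_zero.mp with h | h
  · exact absurd h (by exact_mod_cast Nat.succ_ne_zero q)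
  · rw [sub_eq_zero] at h
    have : chainLength α β = q := by exact_mod_cast h
    omega

theorem nonempty_basis_of_base (b : (rootSystem H).Base) :
    Nonempty (LieAlgebra.Basis b.support H) := by
  have hnz (i : H.root) : (i : Weight K H L).IsNonZero := H.isNonZero_coe_root i
  choose h e f t he hf using fun i : H.root =>
    exists_isSl2Triple_of_weight_isNonZero (hnz i)
  have hh (i) : h i = coroot (i : Weight K H L) := (t i).h_eq_coroot (hnz i) (he i) (hf i)
  have hspan : Submodule.span K (Set.range fun i : b.support => coroot (i.1 : Weight K H L)) = ⊤ := by
    have h2 : (rootSystem H).corootSpan K = ⊤ :=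
      RootPairing.IsRootSystem.span_coroot_eq_top
    rw [← h2, ← b.span_coroot_support, Set.image_eq_range]
    rfl
  have hspan' : (H : Submodule K L) = Submodule.span K (Set.range fun i : b.support => h i) := by
    have h3 := congrArg (Submodule.map H.toSubmodule.subtype) hspan
    rw [Submodule.map_span, ← Set.range_comp, Submodule.map_top, Submodule.range_subtype] at h3
    rw [← h3]
    congr 2
    ext i
    simp [hh]
  have hhj (i j : H.root) {x : L} {χ : H → K} (hx : x ∈ rootSpace H χ) :
      ⁅h j, x⁆ = χ (coroot (j : Weight K H L)) • x := by
    rw [hh, ← lie_eq_smul_of_mem_rootSpace hx]; rfl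
  have hhh (i j : b.support) : ⁅h i, h j⁆ = 0 := by
    rw [hh, hh, ← LieSubalgebra.coe_bracket, trivial_lie_zero, ZeroMemClass.coe_zero]
  have line {χ : Weight K H L} (hχ : χ.IsNonZero) {S : Submodule K L} {x : L}
      (hx : x ∈ rootSpace H χ) (hx0 : x ≠ 0) (hxS : x ∈ S) : (rootSpace H χ).toSubmodule ≤ S := by
    intro y hy
    obtain ⟨c, hc⟩ : ∃ c : K, c • (⟨x, hx⟩ : rootSpace H χ) = ⟨y, hy⟩ :=
      (finrank_eq_one_iff_of_nonzero' _ (by simpa [LieSubmodule.mk_eq_zero] using hx0)).mp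
        (finrank_rootSpace_eq_one χ hχ) _
    rw [show y = c • x from (congrArg Subtype.val hc).symm]
    exact S.smul_mem _ hxS
  have hA (i j : b.support) : ((b.cartanMatrix i j : ℤ) : K) =
      (i.1 : Weight K H L) (coroot (j.1 : Weight K H L)) :=
    b.algebraMap_cartanMatrixIn_apply ℤ i j
  have hspan_ef : LieSubalgebra.lieSpan K L
      ((Set.range fun i : b.support => e i) ∪ (Set.range fun i : b.support => f i)) = ⊤ := by
    set S := LieSubalgebra.lieSpan K L
      ((Set.range fun i : b.support => e i) ∪ (Set.range fun i : b.support => f i)) with hS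
    have heS (i : b.support) : e i ∈ S := LieSubalgebra.subset_lieSpan (Or.inl ⟨i, rfl⟩)
    have hfS (i : b.support) : f i ∈ S := LieSubalgebra.subset_lieSpan (Or.inr ⟨i, rfl⟩)
    have step {α β γ : Weight K H L} (hα : α.IsNonZero) (hβ : β.IsNonZero) (hγ0 : γ.IsNonZero)
        (hγ : (γ : H → K) = α + β) (h1 : (rootSpace H α).toSubmodule ≤ S.toSubmodule)
        (h2 : (rootSpace H β).toSubmodule ≤ S.toSubmodule) :
        (rootSpace H γ).toSubmodule ≤ S.toSubmodule := by
      obtain ⟨x, hx, hx0⟩ := α.exists_ne_zero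
      obtain ⟨y, hy, hy0⟩ := β.exists_ne_zero
      have h3 := exists_lie_ne_zero_aux hα hβ hγ hx hx0 hy hy0
      refine line hγ0 (hγ ▸ lie_mem_genWeightSpace_of_mem_genWeightSpace hx hy) h3 ?_
      exact S.lie_mem (h1 hx) (h2 hy)
    have key (k : H.root) : (rootSpace H (k : Weight K H L)).toSubmodule ≤ S.toSubmodule ∧
        (rootSpace H (-(k : Weight K H L) : Weight K H L)).toSubmodule ≤ S.toSubmodule := by
      refine b.induction_add k (p := fun k : H.root =>
        (rootSpace H (k : Weight K H L)).toSubmodule ≤ S.toSubmodule ∧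
        (rootSpace H (-(k : Weight K H L) : Weight K H L)).toSubmodule ≤ S.toSubmodule) ?_ ?_ ?_
      · intro i hi
        have h4 : (((rootSystem H).reflectionPerm i i : H.root) : Weight K H L) = -i := by
          have : (rootSystem H).root ((rootSystem H).reflectionPerm i i) =
              -(rootSystem H).root i := by
            rw [RootPairing.root_reflectionPerm, RootPairing.reflection_apply_self]
          apply DFunLike.coe_injective
          ext x
          exact LinearMap.congr_fun this x
        rw [h4, neg_neg]
        exact ⟨hi.2, hi.1⟩
      · intro i hi
        exact ⟨line (hnz i) (he i) (t i).e_ne_zero (heS ⟨i, hi⟩),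
          line (hnz i).neg (hf i) (t i).f_ne_zero (hfS ⟨i, hi⟩)⟩
      · intro i j k hk hi hj
        have hj' : (rootSpace H (j : Weight K H L)).toSubmodule ≤ S.toSubmodule ∧
          (rootSpace H (-(j : Weight K H L) : Weight K H L)).toSubmodule ≤ S.toSubmodule :=
          ⟨line (hnz j) (he j) (t j).e_ne_zero (heS ⟨j, hj⟩),
          line (hnz j).neg (hf j) (t j).f_ne_zero (hfS ⟨j, hj⟩)⟩
        have hk' : ((k : Weight K H L) : H → K) = (i : Weight K H L) + (j : Weight K H L) := by
          ext x
          simpa using LinearMap.congr_fun hk x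
        refine ⟨step (hnz i) (hnz j) (hnz k) hk' hi.1 hj'.1, 
          step (hnz i).neg (hnz j).neg (hnz k).neg ?_ hi.2 hj'.2⟩
        simp only [Weight.coe_neg, hk', neg_add]
    rw [← LieSubalgebra.toSubmodule_inj, LieSubalgebra.top_toSubmodule, eq_top_iff]
    have h5 := congrArg LieSubmodule.toSubmodule (iSup_genWeightSpace_eq_top' K H L)
    rw [LieSubmodule.top_toSubmodule, LieSubmodule.iSup_toSubmodule] at h5
    rw [← h5]
    refine iSup_le fun χ => ?_
    by_cases hχ : χ.IsZero
    · rw [hχ.eq, show genWeightSpace L (0 : H → K) = rootSpace H 0 from rfl, rootSpace_zero_eq]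
      change (H : Submodule K L) ≤ _
      rw [hspan', Submodule.span_le]
      rintro - ⟨i, rfl⟩
      change h i ∈ S
      rw [← (t i).lie_e_f]
      exact S.lie_mem (heS i) (hfS i)
    · exact (key ⟨χ, by simpa using hχ⟩).1
  exact ⟨{
    A := b.cartanMatrix
    h i := h i
    e i := e i
    f i := f i
    cartan_eq_lieSpan := by
      rw [← LieSubalgebra.toSubmodule_inj, hspan']
      refine (LieSubalgebra.coe_lieSpan_eq_span_of_forall_lie_eq_zero ?_).symm
      rintro - ⟨i, rfl⟩ - ⟨j, rfl⟩
      exact hhh i j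
    span_ef := hspan_ef
    linInd := by
      have h6 : LinearIndependent K fun i : b.support => coroot (i.1 : Weight K H L) :=
        b.linearIndepOn_coroot
      have h7 := h6.map' H.toSubmodule.subtype (Submodule.ker_subtype _)
      have h8 : (fun i : b.support => h i) =
          H.toSubmodule.subtype ∘ fun i : b.support => coroot (i.1 : Weight K H L) :=
        funext fun i => hh i
      rw [h8]
      exact h7
    nondegen := b.cartanMatrix_nondegenerate
    sl2 i := t i
    lie_h_h := hhh
    lie_h_e i j := by
      rw [hhj i j (he i), ← hA, Int.cast_smul_eq_zsmul]
    lie_h_f i j := by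
      rw [hhj i j (hf i), Pi.neg_apply, ← hA, neg_smul, neg_smul, Int.cast_smul_eq_zsmul]
    lie_e_f_ne i j hij := by
      have h8 := lie_mem_genWeightSpace_of_mem_genWeightSpace (he i) (hf j)
      have h9 : rootSpace H ((i.1 : Weight K H L) + -(j.1 : Weight K H L) : H → K) = ⊥ := by
        by_contra h10
        refine b.sub_notMem_range_root i.2 j.2 ?_
        have h11 : (⟨_, h10⟩ : Weight K H L).IsNonZero := by
          intro h12
          refine hij (Subtype.ext (Subtype.ext (DFunLike.coe_injective ?_)))
          exact add_neg_eq_zero.mp h12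
        refine ⟨⟨⟨_, h10⟩, by simpa using h11⟩, ?_⟩
        ext x
        simp [sub_eq_add_neg]
      replace h8 : ⁅e i, f j⁆ ∈ rootSpace H ((i.1 : Weight K H L) + -(j.1 : Weight K H L)) := h8
      rw [h9] at h8
      simpa using h8 }⟩
end

theorem exists_chevalley {𝔤 : Type*} [LieRing 𝔤] [LieAlgebra ℂ 𝔤] [FiniteDimensional ℂ 𝔤]
    [LieAlgebra.IsSimple ℂ 𝔤] (𝔥 : LieSubalgebra ℂ 𝔤) [𝔥.IsCartanSubalgebra] :
    ∃ φ : 𝔤 ≃ₗ⁅ℂ⁆ 𝔤, ∀ x ∈ 𝔥, φ x = -x := by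
  obtain ⟨b⟩ := RootPairing.nonempty_base (rootSystem 𝔥)
  obtain ⟨B⟩ := nonempty_basis_of_base b
  obtain ⟨φ, hφ⟩ := exists_equiv_h B
  refine ⟨φ, fun x hx => ?_⟩
  rw [← LieSubalgebra.mem_toSubmodule, B.coe_cartan_eq_span] at hx
  induction hx using Submodule.span_induction with
  | mem x h => obtain ⟨i, rfl⟩ := h; exact hφ i
  | zero => simp
  | add x y _ _ hx hy => rw [map_add, hx, hy, neg_add]
  | smul c x _ hx => rw [map_smul, hx, smul_neg]

end Chevalley

section Affine

variable (𝔤 : Type u) [LieRing 𝔤] [LieAlgebra ℂ 𝔤]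

/-- The space `𝔤 ⊗ ℂ[t, t⁻¹] = ⨁ₙ 𝔤 ⊗ tⁿ`; the element `x ⊗ tⁿ` is `Finsupp.single n x`. -/
abbrev Loop : Type u := ℤ →₀ 𝔤

variable {𝔤}

/-- The bilinear map on `𝔤 ⊗ ℂ[t, t⁻¹]` with `(x ⊗ tⁿ, y ⊗ tᵐ) ↦ B n m x y`. -/
def bilin {V : Type*} [AddCommGroup V] [Module ℂ V] (B : ℤ → ℤ → 𝔤 →ₗ[ℂ] 𝔤 →ₗ[ℂ] V) :
    Loop 𝔤 →ₗ[ℂ] Loop 𝔤 →ₗ[ℂ] V :=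
  Finsupp.lsum ℂ fun n => (Finsupp.lsum ℂ fun m => (B n m).flip).flip

@[simp]
theorem bilin_single {V : Type*} [AddCommGroup V] [Module ℂ V]
    (B : ℤ → ℤ → 𝔤 →ₗ[ℂ] 𝔤 →ₗ[ℂ] V) (n m : ℤ) (x y : 𝔤) :
    bilin B (Finsupp.single n x) (Finsupp.single m y) = B n m x y := by
  simp [bilin]

/-- The bracket `[x ⊗ tⁿ, y ⊗ tᵐ] = [x, y] ⊗ tⁿ⁺ᵐ` of the loop algebra. -/
def loopBracket : Loop 𝔤 →ₗ[ℂ] Loop 𝔤 →ₗ[ℂ] Loop 𝔤 :=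
  bilin fun n m => (LieAlgebra.ad ℂ 𝔤 : 𝔤 →ₗ[ℂ] 𝔤 →ₗ[ℂ] 𝔤).compr₂ (Finsupp.lsingle (n + m))

/-- The bilinear form with `(x ⊗ tⁿ, y ⊗ tᵐ) ↦ n δ_{m,-n} k(x, y)`, where `k` is the Killing
form. -/
def cocycle : Loop 𝔤 →ₗ[ℂ] Loop 𝔤 →ₗ[ℂ] ℂ :=
  bilin fun n m => if m = -n then (n : ℂ) • killingForm ℂ 𝔤 else 0

/-- The derivation `t d/dt` of the loop algebra, `x ⊗ tⁿ ↦ n x ⊗ tⁿ`. -/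
def euler : Loop 𝔤 →ₗ[ℂ] Loop 𝔤 :=
  Finsupp.lsum ℂ fun n => (n : ℂ) • Finsupp.lsingle n

theorem euler_single (n : ℤ) (x : 𝔤) :
    euler (Finsupp.single n x) = (n : ℂ) • Finsupp.single n x := by
  simp [euler]

theorem loopBracket_single (n m : ℤ) (x y : 𝔤) :
    loopBracket (Finsupp.single n x) (Finsupp.single m y) = Finsupp.single (n + m) ⁅x, y⁆ := by
  simp [loopBracket]

theorem cocycle_single (n m : ℤ) (x y : 𝔤) :
    cocycle (Finsupp.single n x) (Finsupp.single m y) =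
      if m = -n then (n : ℂ) * killingForm ℂ 𝔤 x y else 0 := by
  by_cases h : m = -n
  · simp [cocycle, h]
  · simp [cocycle, h]

theorem loopBracket_skew (x y : Loop 𝔤) : loopBracket x y = -loopBracket y x := by
  induction x using Finsupp.induction_linear with
  | zero => simp
  | add a b ha hb => simp only [map_add, LinearMap.add_apply, ha, hb]; abel
  | single n x =>
    induction y using Finsupp.induction_linear with
    | zero => simp
    | add a b ha hb => simp only [map_add, LinearMap.add_apply, ha, hb]; abel
    | single m y =>
      rw [loopBracket_single, loopBracket_single, ← lie_skew, add_comm, Finsupp.single_neg]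

theorem loopBracket_jacobi (x y z : Loop 𝔤) :
    loopBracket x (loopBracket y z) =
      loopBracket (loopBracket x y) z + loopBracket y (loopBracket x z) := by
  induction x using Finsupp.induction_linear with
  | zero => simp
  | add a b ha hb => simp only [map_add, LinearMap.add_apply, ha, hb]; abel
  | single n x =>
    induction y using Finsupp.induction_linear with
    | zero => simp
    | add a b ha hb => simp only [map_add, LinearMap.add_apply, ha, hb]; abel
    | single m y =>
      induction z using Finsupp.induction_linear with
      | zero => simp
      | add a b ha hb => simp only [map_add, ha, hb]; abel
      | single l z =>
        simp only [loopBracket_single]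
        rw [leibniz_lie, Finsupp.single_add, ← add_assoc, ← add_assoc, add_comm m n]

theorem euler_loopBracket (x y : Loop 𝔤) :
    euler (loopBracket x y) = loopBracket (euler x) y + loopBracket x (euler y) := by
  induction x using Finsupp.induction_linear with
  | zero => simp
  | add a b ha hb => simp only [map_add, LinearMap.add_apply, ha, hb]; abel
  | single n x =>
    induction y using Finsupp.induction_linear with
    | zero => simp
    | add a b ha hb => simp only [map_add, ha, hb]; abel
    | single m y =>
      simp only [euler_single, loopBracket_single, map_smul, LinearMap.smul_apply, ← add_smul]
      push_cast; rfl

theorem cocycle_skew (x y : Loop 𝔤) : cocycle x y = -cocycle y x := by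
  induction x using Finsupp.induction_linear with
  | zero => simp
  | add a b ha hb => simp only [map_add, LinearMap.add_apply, ha, hb]; abel
  | single n x =>
    induction y using Finsupp.induction_linear with
    | zero => simp
    | add a b ha hb => simp only [map_add, LinearMap.add_apply, ha, hb]; abel
    | single m y =>
      rw [cocycle_single, cocycle_single, LieModule.traceForm_comm ℂ 𝔤 𝔤 y x]
      by_cases h : m = -n
      · subst h; simp
      · rw [if_neg h, if_neg (by omega), neg_zero]

theorem cocycle_euler (x y : Loop 𝔤) : cocycle (euler x) y + cocycle x (euler y) = 0 := by
  induction x using Finsupp.induction_linear with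
  | zero => simp
  | add a b ha hb =>
    simp only [map_add, LinearMap.add_apply]; linear_combination ha + hb
  | single n x =>
    induction y using Finsupp.induction_linear with
    | zero => simp
    | add a b ha hb => simp only [map_add]; linear_combination ha + hb
    | single m y =>
      simp only [euler_single, map_smul, LinearMap.smul_apply, cocycle_single, smul_eq_mul]
      by_cases h : m = -n
      · subst h; simp
      · simp [h]

theorem cocycle_loopBracket (x y z : Loop 𝔤) :
    cocycle x (loopBracket y z) =
      cocycle (loopBracket x y) z + cocycle y (loopBracket x z) := by
  induction x using Finsupp.induction_linear with
  | zero => simp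
  | add a b ha hb => simp only [map_add, LinearMap.add_apply, ha, hb]; abel
  | single n x =>
    induction y using Finsupp.induction_linear with
    | zero => simp
    | add a b ha hb => simp only [map_add, LinearMap.add_apply, ha, hb]; abel
    | single m y =>
      induction z using Finsupp.induction_linear with
      | zero => simp
      | add a b ha hb => simp only [map_add, ha, hb]; abel
      | single l z =>
        simp only [loopBracket_single, cocycle_single]
        have h1 : killingForm ℂ 𝔤 ⁅x, y⁆ z = killingForm ℂ 𝔤 x ⁅y, z⁆ :=
          LieModule.traceForm_apply_lie_apply ℂ 𝔤 𝔤 x y z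
        have h2 : killingForm ℂ 𝔤 y ⁅x, z⁆ = - killingForm ℂ 𝔤 x ⁅y, z⁆ := by
          have h3 : killingForm ℂ 𝔤 ⁅y, x⁆ z = killingForm ℂ 𝔤 y ⁅x, z⁆ :=
            LieModule.traceForm_apply_lie_apply ℂ 𝔤 𝔤 y x z
          rw [← h3, ← h1, ← lie_skew, map_neg, LinearMap.neg_apply]
        rw [h1, h2]
        by_cases h : n + m + l = 0
        · rw [if_pos (by omega), if_pos (by omega), if_pos (by omega)]
          push_cast; ring
        · rw [if_neg (by omega), if_neg (by omega), if_neg (by omega), add_zero]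

variable (𝔤)

/-- The affine Kac–Moody algebra `𝔤 ⊗ ℂ[t, t⁻¹] ⊕ ℂ K ⊕ ℂ D`; the fields `cent` and `der` are
the coefficients of the central element `K` and of the derivation `D`. -/
@[ext]
structure Affine : Type u where
  loop : Loop 𝔤
  cent : ℂ
  der : ℂ

variable {𝔤}

namespace Affine

/-- The identification with the underlying triple. -/
def equivProd : Affine 𝔤 ≃ Loop 𝔤 × ℂ × ℂ where
  toFun X := (X.loop, X.cent, X.der)
  invFun p := ⟨p.1, p.2.1, p.2.2⟩
  left_inv _ := rfl
  right_inv _ := rfl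

instance : AddCommGroup (Affine 𝔤) := equivProd.addCommGroup

instance : Module ℂ (Affine 𝔤) := equivProd.module ℂ

@[simp] theorem loop_zero : (0 : Affine 𝔤).loop = 0 := rfl
@[simp] theorem cent_zero : (0 : Affine 𝔤).cent = 0 := rfl
@[simp] theorem der_zero : (0 : Affine 𝔤).der = 0 := rfl
@[simp] theorem loop_add (X Y : Affine 𝔤) : (X + Y).loop = X.loop + Y.loop := rfl
@[simp] theorem cent_add (X Y : Affine 𝔤) : (X + Y).cent = X.cent + Y.cent := rfl
@[simp] theorem der_add (X Y : Affine 𝔤) : (X + Y).der = X.der + Y.der := rfl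
@[simp] theorem loop_smul (c : ℂ) (X : Affine 𝔤) : (c • X).loop = c • X.loop := rfl
@[simp] theorem cent_smul (c : ℂ) (X : Affine 𝔤) : (c • X).cent = c • X.cent := rfl
@[simp] theorem der_smul (c : ℂ) (X : Affine 𝔤) : (c • X).der = c • X.der := rfl

/-- The bracket: `[x ⊗ tⁿ, y ⊗ tᵐ] = [x, y] ⊗ tⁿ⁺ᵐ + n δ_{m,-n} k(x, y) K`, `K` is central and
`[D, x ⊗ tⁿ] = n x ⊗ tⁿ`. -/
instance : Bracket (Affine 𝔤) (Affine 𝔤) where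
  bracket X Y := ⟨loopBracket X.loop Y.loop + X.der • euler Y.loop - Y.der • euler X.loop,
    cocycle X.loop Y.loop, 0⟩

@[simp] theorem loop_lie (X Y : Affine 𝔤) : ⁅X, Y⁆.loop =
    loopBracket X.loop Y.loop + X.der • euler Y.loop - Y.der • euler X.loop := rfl
@[simp] theorem cent_lie (X Y : Affine 𝔤) : ⁅X, Y⁆.cent = cocycle X.loop Y.loop := rfl
@[simp] theorem der_lie (X Y : Affine 𝔤) : ⁅X, Y⁆.der = 0 := rfl

instance : LieRing (Affine 𝔤) where
  add_lie X Y Z := by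
    ext1
    · simp only [loop_lie, loop_add, der_add, LinearMap.add_apply, map_add]; module
    · simp
    · simp
  lie_add X Y Z := by
    ext1
    · simp only [loop_lie, loop_add, der_add, map_add]; module
    · simp
    · simp
  lie_self X := by
    ext1
    · have := loopBracket_skew X.loop X.loop
      have h2 : loopBracket X.loop X.loop = 0 := by
        rwa [eq_neg_iff_add_eq_zero, ← two_smul ℂ, smul_eq_zero_iff_right two_ne_zero] at this
      simp [h2]
    · have := cocycle_skew X.loop X.loop
      simp only [cent_lie, cent_zero]
      linear_combination this / 2
    · simp
  leibniz_lie X Y Z := by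
    ext1
    · simp only [loop_lie, der_lie, loop_add, map_add, map_sub, map_smul, euler_loopBracket,
        LinearMap.add_apply, LinearMap.sub_apply, LinearMap.smul_apply,
        loopBracket_jacobi X.loop Y.loop Z.loop, loopBracket_skew Y.loop (euler X.loop)]
      module
    · have h1 := cocycle_euler Y.loop Z.loop
      have h2 := cocycle_euler X.loop Z.loop
      have h3 := cocycle_euler X.loop Y.loop
      have h4 := cocycle_skew Y.loop (euler X.loop)
      simp only [cent_lie, loop_lie, cent_add, map_add, map_sub, map_smul, LinearMap.add_apply,
        LinearMap.sub_apply, LinearMap.smul_apply, smul_eq_mul,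
        cocycle_loopBracket X.loop Y.loop Z.loop]
      linear_combination (-X.der) * h1 + Y.der * h2 - Z.der * h3 + Z.der * h4
    · simp

instance : LieAlgebra ℂ (Affine 𝔤) where
  lie_smul c X Y := by
    ext1
    · simp only [loop_lie, loop_smul, der_smul, map_smul]; module
    · simp
    · simp

end Affine

section Triangular

variable (𝔥 𝔟 : LieSubalgebra ℂ 𝔤)

/-- A Borel subalgebra of `𝔤`: a maximal solvable subalgebra. -/
def IsBorel (𝔟 : LieSubalgebra ℂ 𝔤) : Prop :=
  Maximal (fun 𝔰 : LieSubalgebra ℂ 𝔤 => LieAlgebra.IsSolvable 𝔰) 𝔟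

/-- The Cartan subalgebra `𝔥 ⊕ ℂ K ⊕ ℂ D` of the affine Kac–Moody algebra. -/
abbrev CartanHat : Type u := 𝔥 × ℂ × ℂ

/-- The dual space of `𝔥 ⊕ ℂ K ⊕ ℂ D`. -/
abbrev Weight : Type u := Module.Dual ℂ (CartanHat 𝔥)

variable {𝔥} in
/-- The inclusion of `𝔥 ⊕ ℂ K ⊕ ℂ D` into the affine Kac–Moody algebra. -/
def cartanIncl (H : CartanHat 𝔥) : Affine 𝔤 :=
  ⟨Finsupp.single 0 (H.1 : 𝔤), H.2.1, H.2.2⟩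

/-- The space `𝔟 ⊕ 𝔤 ⊗ tℂ[t]`. -/
def loopBorel : Submodule ℂ (Loop 𝔤) :=
  Submodule.span ℂ {f | ∃ (n : ℤ) (x : 𝔤), (0 < n ∨ n = 0 ∧ x ∈ 𝔟) ∧ f = Finsupp.single n x}

theorem euler_mem_loopBorel {f : Loop 𝔤} (hf : f ∈ loopBorel 𝔟) : euler f ∈ loopBorel 𝔟 := by
  induction hf using Submodule.span_induction with
  | mem f h =>
    obtain ⟨n, x, h, rfl⟩ := h
    rw [euler_single]
    exact Submodule.smul_mem _ _ (Submodule.subset_span ⟨n, x, h, rfl⟩)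
  | zero => simp
  | add f g _ _ hf hg => rw [map_add]; exact add_mem hf hg
  | smul c f _ hf => rw [map_smul]; exact Submodule.smul_mem _ _ hf

theorem loopBracket_mem_loopBorel {f g : Loop 𝔤} (hf : f ∈ loopBorel 𝔟)
    (hg : g ∈ loopBorel 𝔟) : loopBracket f g ∈ loopBorel 𝔟 := by
  induction hf, hg using Submodule.span_induction₂ with
  | mem_mem f g hf hg =>
    obtain ⟨n, x, h, rfl⟩ := hf
    obtain ⟨m, y, h', rfl⟩ := hg
    rw [loopBracket_single]
    refine Submodule.subset_span ⟨n + m, ⁅x, y⁆, ?_, rfl⟩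
    rcases h with h | ⟨h, hx⟩ <;> rcases h' with h' | ⟨h', hy⟩
    · left; omega
    · left; omega
    · left; omega
    · exact Or.inr ⟨by omega, 𝔟.lie_mem hx hy⟩
  | zero_left => simp
  | zero_right => simp
  | add_left f g k _ _ _ hf hg => rw [map_add, LinearMap.add_apply]; exact add_mem hf hg
  | add_right f g k _ _ _ hf hg => rw [map_add]; exact add_mem hf hg
  | smul_left c f g _ _ hf =>
    rw [map_smul, LinearMap.smul_apply]; exact Submodule.smul_mem _ _ hf
  | smul_right c f g _ _ hf => rw [map_smul]; exact Submodule.smul_mem _ _ hf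

/-- The Borel subalgebra `𝔤 ⊗ tℂ[t] ⊕ 𝔟 ⊕ ℂ K ⊕ ℂ D` of the affine Kac–Moody algebra. -/
def borelHat : LieSubalgebra ℂ (Affine 𝔤) where
  carrier := {X | X.loop ∈ loopBorel 𝔟}
  add_mem' hX hY := (loopBorel 𝔟).add_mem hX hY
  zero_mem' := zero_mem (loopBorel 𝔟)
  smul_mem' c _ hX := (loopBorel 𝔟).smul_mem c hX
  lie_mem' {X Y} hX hY := by
    change _ - _ ∈ loopBorel 𝔟
    exact sub_mem (add_mem (loopBracket_mem_loopBorel 𝔟 hX hY)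
      ((loopBorel 𝔟).smul_mem _ (euler_mem_loopBorel 𝔟 hY)))
      ((loopBorel 𝔟).smul_mem _ (euler_mem_loopBorel 𝔟 hX))

/-- `x` is a simultaneous eigenvector of `𝔥` with eigenvalue `α`. -/
def IsRootVector (α : Module.Dual ℂ 𝔥) (x : 𝔤) : Prop :=
  x ≠ 0 ∧ ∀ h : 𝔥, ⁅(h : 𝔤), x⁆ = α h • x

/-- The roots of `𝔤` with respect to `𝔥`. -/
def roots : Set (Module.Dual ℂ 𝔥) := {α | α ≠ 0 ∧ ∃ x : 𝔤, IsRootVector 𝔥 α x}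

/-- The positive roots: the roots of `𝔟` with respect to `𝔥`. -/
def posRoots : Set (Module.Dual ℂ 𝔥) := {α | α ≠ 0 ∧ ∃ x ∈ 𝔟, IsRootVector 𝔥 α x}

/-- The extension of a linear form on `𝔥` by zero on `ℂ K ⊕ ℂ D`. -/
def extend (α : Module.Dual ℂ 𝔥) : Weight 𝔥 := α ∘ₗ LinearMap.fst ℂ 𝔥 (ℂ × ℂ)

/-- The linear form `δ`, zero on `𝔥 ⊕ ℂ K` and with `δ(D) = 1`. -/
def delta : Weight 𝔥 := LinearMap.snd ℂ ℂ ℂ ∘ₗ LinearMap.snd ℂ 𝔥 (ℂ × ℂ)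

/-- The positive affine roots. -/
def affinePosRoots : Set (Weight 𝔥) :=
  {β | (∃ α ∈ posRoots 𝔥 𝔟, β = extend 𝔥 α) ∨
    (∃ α ∈ roots 𝔥, ∃ n : ℕ, 0 < n ∧ β = extend 𝔥 α + n • delta 𝔥) ∨
    ∃ n : ℕ, 0 < n ∧ β = n • delta 𝔥}

/-- `μ ≤ lam`: the difference `lam - μ` is a sum of positive affine roots. -/
def WeightLE (μ lam : Weight 𝔥) : Prop :=
  lam - μ ∈ AddSubmonoid.closure (affinePosRoots 𝔥 𝔟)

/-- A set of weights is open if it is closed under passing to smaller weights. -/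
def IsOpenSet (J : Set (Weight 𝔥)) : Prop :=
  ∀ lam ∈ J, ∀ μ, WeightLE 𝔥 𝔟 μ lam → μ ∈ J

/-- A set of weights is locally bounded if above each weight it has only finitely many elements. -/
def IsLocallyBounded (J : Set (Weight 𝔥)) : Prop :=
  ∀ μ, {γ ∈ J | WeightLE 𝔥 𝔟 μ γ}.Finite

end Triangular

section Involution

variable [FiniteDimensional ℂ 𝔤] [LieAlgebra.IsSimple ℂ 𝔤]
variable (𝔥 : LieSubalgebra ℂ 𝔤) [𝔥.IsCartanSubalgebra]

/-- A Chevalley involution of `𝔤`: an automorphism that acts on `𝔥` as `-1`. -/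
def chevalley : 𝔤 ≃ₗ⁅ℂ⁆ 𝔤 := (exists_chevalley 𝔥).choose

theorem chevalley_apply {x : 𝔤} (hx : x ∈ 𝔥) : chevalley 𝔥 x = -x :=
  (exists_chevalley 𝔥).choose_spec x hx

/-- The map `x ⊗ tⁿ ↦ ω(x) ⊗ t⁻ⁿ` on the loop algebra, where `ω` is the Chevalley involution. -/
def chevalleyLoop : Loop 𝔤 →ₗ[ℂ] Loop 𝔤 :=
  Finsupp.lsum ℂ fun n => Finsupp.lsingle (-n) ∘ₗ (chevalley 𝔥 : 𝔤 →ₗ[ℂ] 𝔤)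

theorem chevalleyLoop_single (n : ℤ) (x : 𝔤) :
    chevalleyLoop 𝔥 (Finsupp.single n x) = Finsupp.single (-n) (chevalley 𝔥 x) := by
  simp [chevalleyLoop]

theorem chevalleyLoop_euler (f : Loop 𝔤) :
    chevalleyLoop 𝔥 (euler f) = -euler (chevalleyLoop 𝔥 f) := by
  induction f using Finsupp.induction_linear with
  | zero => simp
  | add f g hf hg => simp only [map_add, hf, hg]; abel
  | single n x => simp [euler_single, chevalleyLoop_single]

theorem chevalleyLoop_loopBracket (f g : Loop 𝔤) : chevalleyLoop 𝔥 (loopBracket f g) =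
    loopBracket (chevalleyLoop 𝔥 f) (chevalleyLoop 𝔥 g) := by
  induction f using Finsupp.induction_linear with
  | zero => simp
  | add a b ha hb => simp only [map_add, LinearMap.add_apply, ha, hb]
  | single n x =>
    induction g using Finsupp.induction_linear with
    | zero => simp
    | add a b ha hb => simp only [map_add, ha, hb]
    | single m y =>
      simp only [loopBracket_single, chevalleyLoop_single, LieEquiv.map_lie, neg_add]

theorem cocycle_chevalleyLoop (f g : Loop 𝔤) :
    cocycle (chevalleyLoop 𝔥 f) (chevalleyLoop 𝔥 g) = -cocycle f g := by
  induction f using Finsupp.induction_linear with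
  | zero => simp
  | add a b ha hb => simp only [map_add, LinearMap.add_apply, ha, hb]; ring
  | single n x =>
    induction g using Finsupp.induction_linear with
    | zero => simp
    | add a b ha hb => simp only [map_add, ha, hb]; ring
    | single m y =>
      simp only [cocycle_single, chevalleyLoop_single, LieAlgebra.killingForm_of_equiv_apply]
      by_cases h : m = -n
      · subst h; simp
      · rw [if_neg h, if_neg (by omega), neg_zero]

/-- The Chevalley involution of the affine Kac–Moody algebra: `x ⊗ tⁿ ↦ ω(x) ⊗ t⁻ⁿ`, `K ↦ -K`,
`D ↦ -D`. It acts on the affine Cartan subalgebra as `-1` and exchanges opposite root spaces. -/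
def chevalleyHat : Affine 𝔤 →ₗ⁅ℂ⁆ Affine 𝔤 where
  toFun X := ⟨chevalleyLoop 𝔥 X.loop, -X.cent, -X.der⟩
  map_add' X Y := by
    ext1
    · exact map_add _ _ _
    · exact neg_add _ _
    · exact neg_add _ _
  map_smul' c X := by
    ext1
    · exact map_smul _ _ _
    · exact (mul_neg _ _).symm
    · exact (mul_neg _ _).symm
  map_lie' {X Y} := by
    ext1
    · simp only [Affine.loop_lie, map_add, map_sub, map_smul, chevalleyLoop_euler,
        chevalleyLoop_loopBracket]
      module
    · exact (cocycle_chevalleyLoop 𝔥 X.loop Y.loop).symm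
    · exact neg_zero

theorem chevalleyHat_cartanIncl (H : CartanHat 𝔥) :
    chevalleyHat 𝔥 (cartanIncl H) = -cartanIncl H := by
  have h0 : -cartanIncl H = (-1 : ℂ) • cartanIncl H := by simp
  rw [h0]
  ext1
  · change chevalleyLoop 𝔥 (Finsupp.single 0 (H.1 : 𝔤)) = (-1 : ℂ) • Finsupp.single 0 (H.1 : 𝔤)
    rw [chevalleyLoop_single, chevalley_apply 𝔥 H.1.2]
    simp
  · change -H.2.1 = -1 * H.2.1
    ring
  · change -H.2.2 = -1 * H.2.2
    ring

end Involution

end Affine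
section Modules

attribute [local instance 100] LieRing.ofAssociativeRing

variable {𝔤 : Type u} [LieRing 𝔤] [LieAlgebra ℂ 𝔤]

variable (𝔤) in
/-- The ring `A ⊗ U(ĝ)`. Its left modules are the `A`-modules with an `A`-linear action of the
affine Kac–Moody algebra `ĝ`. -/
abbrev Env (A : Type v) [CommRing A] [Algebra ℂ A] : Type (max u v) :=
  A ⊗[ℂ] UniversalEnvelopingAlgebra ℂ (Affine 𝔤)

/-- An element of the affine Kac–Moody algebra as an element of `A ⊗ U(ĝ)`. -/
def act (A : Type v) [CommRing A] [Algebra ℂ A] (X : Affine 𝔤) : Env 𝔤 A :=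
  1 ⊗ₜ UniversalEnvelopingAlgebra.ι ℂ X

section Deformation

variable (𝔥 𝔟 : LieSubalgebra ℂ 𝔤)
variable (A : Type v) [CommRing A] [Algebra ℂ A] [Algebra (SymmetricAlgebra ℂ 𝔥) A]
  [IsScalarTower ℂ (SymmetricAlgebra ℂ 𝔥) A]

/-- The value `lam(H) + τ(H)` in `A` for `H` in the affine Cartan subalgebra. Here `τ` is the
structure map `S(𝔥) → A` on `𝔥` and zero on `ℂ K ⊕ ℂ D`. -/
def deformedWeight (lam : Weight 𝔥) (H : CartanHat 𝔥) : A :=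
  algebraMap ℂ A (lam H) +
    algebraMap (SymmetricAlgebra ℂ 𝔥) A (SymmetricAlgebra.ι ℂ 𝔥 H.1)

section

variable (M : Type w) [AddCommGroup M] [Module A M] [Module (Env 𝔤 A) M]
  [IsScalarTower A (Env 𝔤 A) M]

/-- The weight space `M_lam = {m | H m = (lam(H) + τ(H)) m for all H}`. -/
def weightSpace (lam : Weight 𝔥) : Submodule A M where
  carrier := {m | ∀ H : CartanHat 𝔥, act A (cartanIncl H) • m = deformedWeight 𝔥 A lam H • m}
  add_mem' hm hn H := by rw [smul_add, smul_add, hm H, hn H]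
  zero_mem' H := by rw [smul_zero, smul_zero]
  smul_mem' a m hm H := by rw [smul_comm, hm H, smul_comm]

/-- `M` is an object of the deformed category `O`: it is a weight module, i.e. the direct sum of
its weight spaces, and every element lies in an `A`-submodule that is stable under the affine Borel
subalgebra and finitely generated over `A`. -/
structure IsInO : Prop where
  indep : iSupIndep (weightSpace 𝔥 A M)
  iSup_eq_top : ⨆ lam, weightSpace 𝔥 A M lam = ⊤
  locallyFinite : ∀ m : M, ∃ N : Submodule A M, m ∈ N ∧ N.FG ∧
    ∀ X ∈ borelHat 𝔟, ∀ n ∈ N, act A X • n ∈ N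

/-- `M` is an object of the truncated deformed category `O` attached to a set `J` of weights. -/
structure IsInTruncatedO (J : Set (Weight 𝔥)) : Prop extends IsInO 𝔥 𝔟 A M where
  mem_of_weightSpace_ne_bot : ∀ lam, weightSpace 𝔥 A M lam ≠ ⊥ → lam ∈ J

end

/-- The left ideal of `A ⊗ U(ĝ)` generated by the elements `H - (lam(H) + τ(H))` for `H` in the
affine Cartan subalgebra and by the derived algebra of the affine Borel subalgebra. -/
def vermaIdeal (lam : Weight 𝔥) : Submodule (Env 𝔤 A) (Env 𝔤 A) :=
  Submodule.span (Env 𝔤 A)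
    ({u | ∃ H : CartanHat 𝔥,
        u = act A (cartanIncl H) - algebraMap A (Env 𝔤 A) (deformedWeight 𝔥 A lam H)} ∪
      {u | ∃ X ∈ borelHat 𝔟, ∃ Y ∈ borelHat 𝔟, u = act A ⁅X, Y⁆})

/-- The deformed Verma module `U(ĝ) ⊗_{U(b̂)} A_lam`, where `A_lam` is the free `A`-module of rank
one on which the affine Cartan subalgebra acts by `lam + τ` and `[b̂, b̂]` acts trivially. -/
abbrev Verma (lam : Weight 𝔥) : Type (max u v) := Env 𝔤 A ⧸ vermaIdeal 𝔥 𝔟 A lam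

/-- The sum of all proper submodules of the Verma module. -/
def vermaMaxSubmodule (lam : Weight 𝔥) : Submodule (Env 𝔤 A) (Verma 𝔥 𝔟 A lam) :=
  sSup {N | N ≠ ⊤}

/-- The simple quotient `L(lam)` of the Verma module; to be used when `A` is a field. -/
abbrev SimpleQuotient (lam : Weight 𝔥) : Type (max u v) :=
  Verma 𝔥 𝔟 A lam ⧸ vermaMaxSubmodule 𝔥 𝔟 A lam

section Flag

variable (M : Type w) [AddCommGroup M] [Module (Env 𝔤 A) M]

/-- A Verma flag of `M`: a finite filtration `0 = M₀ ⊆ M₁ ⊆ ... ⊆ Mₙ = M` by submodules whose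
successive quotients are isomorphic to deformed Verma modules, of highest weights `wt`. -/
structure VermaFlag where
  length : ℕ
  filtration : Fin (length + 1) → Submodule (Env 𝔤 A) M
  monotone : Monotone filtration
  filtration_zero : filtration 0 = ⊥
  filtration_last : filtration (Fin.last length) = ⊤
  wt : Fin length → Weight 𝔥
  quotient_iso : ∀ i : Fin length,
    Nonempty ((filtration i.succ ⧸ (filtration i.castSucc).submoduleOf (filtration i.succ))
      ≃ₗ[Env 𝔤 A] Verma 𝔥 𝔟 A (wt i))

variable {M} in
/-- The multiplicity of `Δ_A(lam)` in a Verma flag. -/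
def VermaFlag.multiplicity {𝔥 𝔟 : LieSubalgebra ℂ 𝔤} {A : Type v} [CommRing A] [Algebra ℂ A]
    [Algebra (SymmetricAlgebra ℂ 𝔥) A] [IsScalarTower ℂ (SymmetricAlgebra ℂ 𝔥) A]
    [Module (Env 𝔤 A) M] (F : VermaFlag 𝔥 𝔟 A M) (lam : Weight 𝔥) : ℕ :=
  Nat.card {i : Fin F.length // F.wt i = lam}

end Flag

end Deformation

section Multiplicity

/-- The multiplicity `[M : L]` of a simple module `L` as a subquotient of `M`: the supremum, over
all finite chains of submodules `M₀ ⊆ M₁ ⊆ ... ⊆ Mₙ` of `M`, of the number of indices `i` with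
`Mᵢ₊₁ / Mᵢ` isomorphic to `L`. -/
def subquotientMultiplicity (R : Type*) [Ring R] (M : Type*) [AddCommGroup M] [Module R M]
    (L : Type*) [AddCommGroup L] [Module R L] : ℕ∞ :=
  ⨆ (n : ℕ) (c : Fin (n + 1) →o Submodule R M),
    Set.encard {i : Fin n |
      Nonempty ((c i.succ ⧸ (c i.castSucc).submoduleOf (c i.succ)) ≃ₗ[R] L)}

end Multiplicity

section CartanFinite

theorem act_add (A : Type v) [CommRing A] [Algebra ℂ A] (X Y : Affine 𝔤) :
    act A (X + Y) = act A X + act A Y := by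
  simp only [act, map_add, TensorProduct.tmul_add]

theorem act_smul (A : Type v) [CommRing A] [Algebra ℂ A] (c : ℂ) (X : Affine 𝔤) :
    act A (c • X) = algebraMap ℂ A c • act A X := by
  simp only [act, map_smul, TensorProduct.tmul_smul, algebraMap_smul]

theorem act_lie (A : Type v) [CommRing A] [Algebra ℂ A] (X Y : Affine 𝔤) :
    act A ⁅X, Y⁆ = act A X * act A Y - act A Y * act A X := by
  simp only [act, LieHom.map_lie, LieRing.of_associative_ring_bracket,
    Algebra.TensorProduct.tmul_mul_tmul, mul_one, TensorProduct.tmul_sub]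

theorem env_induction {A : Type v} [CommRing A] [Algebra ℂ A] {p : Env 𝔤 A → Prop}
    (hA : ∀ a : A, p (algebraMap A _ a)) (hX : ∀ X : Affine 𝔤, p (act A X))
    (hadd : ∀ u v, p u → p v → p (u + v)) (hmul : ∀ u v, p u → p v → p (u * v))
    (u : Env 𝔤 A) : p u := by
  have h1 (x : UniversalEnvelopingAlgebra ℂ (Affine 𝔤)) : p (1 ⊗ₜ x) := by
    let S : Subalgebra ℂ (UniversalEnvelopingAlgebra ℂ (Affine 𝔤)) :=
      { carrier := {x | p (1 ⊗ₜ x)}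
        mul_mem' := fun {x y} hx hy => by
          have := hmul _ _ hx hy
          rwa [Algebra.TensorProduct.tmul_mul_tmul, mul_one] at this
        add_mem' := fun {x y} hx hy => by
          have := hadd _ _ hx hy
          rwa [← TensorProduct.tmul_add] at this
        algebraMap_mem' := fun c => by
          have := hA (algebraMap ℂ A c)
          rwa [Algebra.TensorProduct.algebraMap_apply, Algebra.algebraMap_self, RingHom.id_apply,
            Algebra.algebraMap_eq_smul_one, TensorProduct.smul_tmul,
            ← Algebra.algebraMap_eq_smul_one] at this }
    let f : Affine 𝔤 →ₗ⁅ℂ⁆ S :=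
      { toFun := fun X => ⟨UniversalEnvelopingAlgebra.ι ℂ X, hX X⟩
        map_add' := fun X Y => Subtype.ext (map_add _ _ _)
        map_smul' := fun c X => Subtype.ext (map_smul _ _ _)
        map_lie' := fun {X Y} => Subtype.ext (LieHom.map_lie _ _ _) }
    have h2 : S.val.comp (UniversalEnvelopingAlgebra.lift ℂ f) = AlgHom.id ℂ _ := by
      ext X
      simp only [LieHom.comp_apply, AlgHom.coe_toLieHom, AlgHom.comp_apply, AlgHom.id_apply]
      rw [UniversalEnvelopingAlgebra.lift_ι_apply]
      rfl
    have h3 := DFunLike.congr_fun h2 x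
    simp only [AlgHom.comp_apply, AlgHom.id_apply] at h3
    rw [← h3]
    exact (UniversalEnvelopingAlgebra.lift ℂ f x).2
  induction u using TensorProduct.induction_on with
  | zero => simpa using hA 0
  | add u v hu hv => exact hadd _ _ hu hv
  | tmul a x =>
    have := hmul _ _ (hA a) (h1 x)
    rwa [Algebra.TensorProduct.algebraMap_apply, Algebra.TensorProduct.tmul_mul_tmul, mul_one,
      one_mul] at this

variable [FiniteDimensional ℂ 𝔤] (𝔥 : LieSubalgebra ℂ 𝔤)

/-- The affine Cartan subalgebra acts locally finitely on the affine Kac–Moody algebra. -/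
theorem exists_cartan_stable (X : Affine 𝔤) : ∃ W : Submodule ℂ (Affine 𝔤), X ∈ W ∧ W.FG ∧
    ∀ H : CartanHat 𝔥, ∀ Y ∈ W, ⁅cartanIncl H, Y⁆ ∈ W := by
  let T : (X.loop.support → 𝔤) × ℂ × ℂ →ₗ[ℂ] Affine 𝔤 :=
    { toFun := fun g => ⟨∑ n : X.loop.support, Finsupp.single (n : ℤ) (g.1 n), g.2.1, g.2.2⟩
      map_add' := fun g g' => by
        ext1
        · simp [Finset.sum_add_distrib]
        · simp
        · simp
      map_smul' := fun c g => by
        ext1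
        · simp [Finset.smul_sum]
        · simp
        · simp }
  refine ⟨LinearMap.range T, ⟨(fun n => X.loop n, X.cent, X.der), ?_⟩, ?_, ?_⟩
  · ext1
    · change ∑ n : X.loop.support, Finsupp.single (n : ℤ) (X.loop n) = X.loop
      rw [Finset.sum_coe_sort X.loop.support fun n => Finsupp.single n (X.loop n)]
      exact Finsupp.sum_single X.loop
    · rfl
    · rfl
  · exact (Submodule.fg_top (LinearMap.range T)).mp Module.Finite.fg_top
  · rintro H - ⟨g, rfl⟩
    refine ⟨(fun n => ⁅(H.1 : 𝔤), g.1 n⁆ + (H.2.2 * (n : ℤ)) • g.1 n,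
      ⁅cartanIncl H, T g⁆.cent, 0), ?_⟩
    ext1
    · simp only [T, cartanIncl, LinearMap.coe_mk, AddHom.coe_mk, Affine.loop_lie, map_sum,
        loopBracket_single, euler_single, Finset.smul_sum, zero_add, Int.cast_zero, zero_smul,
        smul_zero, sub_zero, ← Finset.sum_add_distrib, Finsupp.single_add, Finsupp.smul_single,
        smul_smul]
    · rfl
    · rfl

variable (F : Type v) [CommRing F] [Algebra ℂ F]
variable (M : Type w) [AddCommGroup M] [Module F M] [Module (Env 𝔤 F) M]
  [IsScalarTower F (Env 𝔤 F) M]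

/-- The submodule of `ĥ`-finite vectors of `M`: the elements that lie in a finitely generated
`F`-submodule stable under the affine Cartan subalgebra `ĥ`. -/
def cartanFinite : Submodule (Env 𝔤 F) M where
  carrier := {m | ∃ N : Submodule F M, m ∈ N ∧ N.FG ∧
    ∀ H : CartanHat 𝔥, ∀ n ∈ N, act F (cartanIncl H) • n ∈ N}
  add_mem' := by
    rintro m m' ⟨N, hm, hN, hH⟩ ⟨N', hm', hN', hH'⟩
    refine ⟨N ⊔ N', Submodule.add_mem_sup hm hm', hN.sup hN', fun H n hn => ?_⟩
    obtain ⟨a, ha, b, hb, rfl⟩ := Submodule.mem_sup.mp hn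
    rw [smul_add]
    exact Submodule.add_mem_sup (hH H a ha) (hH' H b hb)
  zero_mem' := ⟨⊥, zero_mem _, Submodule.fg_bot, by simp⟩
  smul_mem' u := by
    induction u using env_induction with
    | hA a =>
      rintro m ⟨N, hm, hN, hH⟩
      exact ⟨N, by rw [algebraMap_smul]; exact N.smul_mem a hm, hN, hH⟩
    | hadd u v hu hv =>
      intro m hm
      obtain ⟨N, hm1, hN, hH⟩ := hu hm
      obtain ⟨N', hm', hN', hH'⟩ := hv hm
      refine ⟨N ⊔ N', by rw [add_smul]; exact Submodule.add_mem_sup hm1 hm', hN.sup hN',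
        fun H n hn => ?_⟩
      obtain ⟨a, ha, b, hb, rfl⟩ := Submodule.mem_sup.mp hn
      rw [smul_add]
      exact Submodule.add_mem_sup (hH H a ha) (hH' H b hb)
    | hmul u v hu hv =>
      intro m hm
      rw [mul_smul]
      exact hu (hv hm)
    | hX X =>
      rintro m ⟨N, hm, hN, hH⟩
      obtain ⟨W, hXW, ⟨s, hs⟩, hW⟩ := exists_cartan_stable 𝔥 X
      obtain ⟨t, ht⟩ := hN
      have hle (Y : Affine 𝔤) (hY : Y ∈ W) (n : M) (hn : n ∈ N) : act F Y • n ∈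
          Submodule.span F 
            (Set.image2 (fun Y n => act F Y • n) (s : Set (Affine 𝔤)) (t : Set M)) := by
        rw [← hs] at hY
        rw [← ht] at hn
        induction hY using Submodule.span_induction with
        | zero =>
          have h0 : act F (0 : Affine 𝔤) = 0 := by
            simp only [act, map_zero, TensorProduct.tmul_zero]
          rw [h0, zero_smul]
          exact zero_mem _
        | add Y Z _ _ h1 h2 => rw [act_add, add_smul]; exact add_mem h1 h2
        | smul c Y _ h1 => rw [act_smul, smul_assoc]; exact Submodule.smul_mem _ _ h1
        | mem Y hY =>
          induction hn using Submodule.span_induction with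
          | zero => rw [smul_zero]; exact zero_mem _
          | add a b _ _ ha hb => rw [smul_add]; exact add_mem ha hb
          | smul c a _ ha => rw [smul_comm]; exact Submodule.smul_mem _ c ha
          | mem a ha => exact Submodule.subset_span ⟨Y, hY, a, ha, rfl⟩
      refine ⟨_, hle X hXW m hm, 
        ⟨(s.finite_toSet.image2 (fun Y n => act F Y • n) t.finite_toSet).toFinset, by simp⟩,
        fun H n hn => ?_⟩
      induction hn using Submodule.span_induction with
      | zero => rw [smul_zero]; exact zero_mem _
      | add a b _ _ ha hb => rw [smul_add]; exact add_mem ha hb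
      | smul c a _ ha => rw [smul_comm]; exact Submodule.smul_mem _ c ha
      | mem a ha =>
        obtain ⟨Y, hY, n, hn, rfl⟩ := ha
        have hY' : Y ∈ W := hs ▸ Submodule.subset_span hY
        have hn' : n ∈ N := ht ▸ Submodule.subset_span hn
        have h4 : act F (cartanIncl H) • act F Y • n =
            act F ⁅cartanIncl H, Y⁆ • n + act F Y • act F (cartanIncl H) • n := by
          rw [act_lie, sub_smul, mul_smul, mul_smul, sub_add_cancel]
        change act F (cartanIncl H) • act F Y • n ∈ _
        rw [h4]
        exact add_mem (hle _ (hW H Y hY') n hn') (hle Y hY' _ (hH H n hn'))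

end CartanFinite

section Dual

variable [FiniteDimensional ℂ 𝔤] [LieAlgebra.IsSimple ℂ 𝔤]
variable (𝔥 𝔟 : LieSubalgebra ℂ 𝔤) [𝔥.IsCartanSubalgebra]
variable (F : Type v) [Field F] [Algebra ℂ F]

section Twisted

variable (M : Type w) [AddCommGroup M] [Module F M] [Module (Env 𝔤 F) M]
  [IsScalarTower F (Env 𝔤 F) M]

/-- The representation of the affine Kac–Moody algebra dual to `M`, twisted by the Chevalley
involution `ω`: `(X f)(m) = -f(ω(X) m)`. -/
def dualRep : Affine 𝔤 →ₗ⁅ℂ⁆ Module.End F (Module.Dual F M) where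
  toFun X := -Module.Dual.transpose (Algebra.lsmul F F M (act F (chevalleyHat 𝔥 X)))
  map_add' X Y := by
    ext f m
    change -f (act F (chevalleyHat 𝔥 (X + Y)) • m) =
      -f (act F (chevalleyHat 𝔥 X) • m) + -f (act F (chevalleyHat 𝔥 Y) • m)
    rw [map_add, act_add, add_smul, map_add, neg_add]
  map_smul' c X := by
    ext f m
    change -f (act F (chevalleyHat 𝔥 (c • X)) • m) = c • -f (act F (chevalleyHat 𝔥 X) • m)
    rw [map_smul (chevalleyHat 𝔥) c X, act_smul, smul_assoc, f.map_smul, algebraMap_smul, smul_neg]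
  map_lie' {X Y} := by
    ext f m
    change -f (act F (chevalleyHat 𝔥 ⁅X, Y⁆) • m) =
      -(-f (act F (chevalleyHat 𝔥 Y) • act F (chevalleyHat 𝔥 X) • m)) -
        -(-f (act F (chevalleyHat 𝔥 X) • act F (chevalleyHat 𝔥 Y) • m))
    rw [LieHom.map_lie, act_lie, sub_smul, mul_smul, mul_smul, map_sub]
    ring

theorem dualAction_commute (a : F) (x : UniversalEnvelopingAlgebra ℂ (Affine 𝔤)) :
    Commute (Algebra.ofId F (Module.End F (Module.Dual F M)) a)
      (UniversalEnvelopingAlgebra.lift ℂ (dualRep 𝔥 F M) x) :=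
  Algebra.commutes a _

/-- The action of `F ⊗ U(ĝ)` on the twisted dual of `M`. -/
def dualAction : Env 𝔤 F →ₐ[F] Module.End F (Module.Dual F M) :=
  Algebra.TensorProduct.lift (Algebra.ofId F _)
    (UniversalEnvelopingAlgebra.lift ℂ (dualRep 𝔥 F M)) (dualAction_commute 𝔥 F M)

/-- The dual space of `M`, with the action twisted by the Chevalley involution. -/
def TwistedDual (_ : LieSubalgebra ℂ 𝔤) : Type _ := Module.Dual F M

instance : AddCommGroup (TwistedDual F M 𝔥) := inferInstanceAs (AddCommGroup (Module.Dual F M))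

instance : Module F (TwistedDual F M 𝔥) := inferInstanceAs (Module F (Module.Dual F M))

instance : Module (Env 𝔤 F) (TwistedDual F M 𝔥) :=
  letI : Module (Module.End F (Module.Dual F M)) (TwistedDual F M 𝔥) :=
    inferInstanceAs (Module (Module.End F (Module.Dual F M)) (Module.Dual F M))
  Module.compHom _ (dualAction 𝔥 F M).toRingHom

instance : IsScalarTower F (Env 𝔤 F) (TwistedDual F M 𝔥) where
  smul_assoc a u f := by
    change (dualAction 𝔥 F M (a • u)) f = a • (dualAction 𝔥 F M u) f
    rw [map_smul]
    rfl

theorem act_smul_twistedDual (X : Affine 𝔤) (f : Module.Dual F M) (m : M) :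
    (show Module.Dual F M from act F X • (show TwistedDual F M 𝔥 from f)) m =
      -f (act F (chevalleyHat 𝔥 X) • m) := by
  change dualAction 𝔥 F M (act F X) f m = _
  rw [dualAction, act, Algebra.TensorProduct.lift_tmul, map_one, one_mul,
    UniversalEnvelopingAlgebra.lift_ι_apply]
  rfl

end Twisted

variable [Algebra (SymmetricAlgebra ℂ 𝔥) F] [IsScalarTower ℂ (SymmetricAlgebra ℂ 𝔥) F]

/-- The dual Verma module over a field: the restricted dual of the Verma module, i.e. the
submodule of `ĥ`-finite vectors in its dual representation (twisted by the Chevalley involution, so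
that it has the same weights as the Verma module). -/
abbrev DualVerma (lam : Weight 𝔥) : Type _ := cartanFinite 𝔥 F (TwistedDual F (Verma 𝔥 𝔟 F lam) 𝔥)

end Dual

section Local

variable (𝔥 𝔟 : LieSubalgebra ℂ 𝔤)
variable (A : Type v) [CommRing A] [IsLocalRing A] [Algebra ℂ A]
  [Algebra (SymmetricAlgebra ℂ 𝔥) A] [IsScalarTower ℂ (SymmetricAlgebra ℂ 𝔥) A]

/-- The homomorphism `A ⊗ U(ĝ) → 𝕂 ⊗ U(ĝ)`, where `𝕂` is the residue field of `A`. -/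
def envResidue : Env 𝔤 A →ₐ[ℂ] Env 𝔤 (IsLocalRing.ResidueField A) :=
  Algebra.TensorProduct.map (IsScalarTower.toAlgHom ℂ A (IsLocalRing.ResidueField A))
    (AlgHom.id ℂ _)

theorem envResidue_smul (a : A) (u : Env 𝔤 A) : envResidue A (a • u) =
    algebraMap A (IsLocalRing.ResidueField A) a • envResidue A u := by
  induction u using TensorProduct.induction_on with
  | zero => rw [smul_zero, map_zero, smul_zero]
  | add u v hu hv => rw [smul_add, map_add, hu, hv, map_add, smul_add]
  | tmul b x =>
    rw [TensorProduct.smul_tmul', envResidue, Algebra.TensorProduct.map_tmul,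
      Algebra.TensorProduct.map_tmul, TensorProduct.smul_tmul', smul_eq_mul, map_mul, smul_eq_mul]
    rfl

/-- The simple object `L_A(lam)`: the simple quotient `L_𝕂(lam)` of the Verma module over the
residue field `𝕂` of `A`, on which `A` acts through `A → 𝕂`. -/
def SimpleObject (lam : Weight 𝔥) : Type (max u v) :=
  SimpleQuotient 𝔥 𝔟 (IsLocalRing.ResidueField A) lam

variable (lam : Weight 𝔥)

instance : AddCommGroup (SimpleObject 𝔥 𝔟 A lam) :=
  inferInstanceAs (AddCommGroup (SimpleQuotient 𝔥 𝔟 (IsLocalRing.ResidueField A) lam))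

instance : Module (IsLocalRing.ResidueField A) (SimpleObject 𝔥 𝔟 A lam) :=
  inferInstanceAs (Module (IsLocalRing.ResidueField A)
    (SimpleQuotient 𝔥 𝔟 (IsLocalRing.ResidueField A) lam))

instance : Module A (SimpleObject 𝔥 𝔟 A lam) :=
  Module.compHom _ (algebraMap A (IsLocalRing.ResidueField A))

instance : Module (Env 𝔤 A) (SimpleObject 𝔥 𝔟 A lam) :=
  letI : Module (Env 𝔤 (IsLocalRing.ResidueField A)) (SimpleObject 𝔥 𝔟 A lam) :=
    inferInstanceAs (Module (Env 𝔤 (IsLocalRing.ResidueField A))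
      (SimpleQuotient 𝔥 𝔟 (IsLocalRing.ResidueField A) lam))
  Module.compHom _ (envResidue A).toRingHom

instance : IsScalarTower A (Env 𝔤 A) (SimpleObject 𝔥 𝔟 A lam) where
  smul_assoc a u m := by
    change (envResidue A (a • u)) • (show SimpleQuotient 𝔥 𝔟 (IsLocalRing.ResidueField A) lam from m)
      = (algebraMap A (IsLocalRing.ResidueField A) a) • (envResidue A u) •
        (show SimpleQuotient 𝔥 𝔟 (IsLocalRing.ResidueField A) lam from m)
    rw [← smul_assoc, envResidue_smul]

variable (J : Set (Weight 𝔥))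

/-- `P` is a projective object of the truncated category `O`: homomorphisms from `P` lift through
surjective homomorphisms of the category. -/
structure IsProjectiveObject (P : Type (max u v)) [AddCommGroup P] [Module A P]
    [Module (Env 𝔤 A) P] [IsScalarTower A (Env 𝔤 A) P] : Prop where
  isInTruncatedO : IsInTruncatedO 𝔥 𝔟 A P J
  exists_lift : ∀ (M N : Type (max u v)) [AddCommGroup M] [Module A M] [Module (Env 𝔤 A) M]
    [IsScalarTower A (Env 𝔤 A) M] [AddCommGroup N] [Module A N] [Module (Env 𝔤 A) N]
    [IsScalarTower A (Env 𝔤 A) N], IsInTruncatedO 𝔥 𝔟 A M J → IsInTruncatedO 𝔥 𝔟 A N J →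
    ∀ (f : M →ₗ[Env 𝔤 A] N) (g : P →ₗ[Env 𝔤 A] N), Function.Surjective f →
      ∃ h : P →ₗ[Env 𝔤 A] M, f ∘ₗ h = g

/-- `c : P → L_A(μ)` is a projective cover in the truncated category `O`: `P` is projective, `c` is
surjective, and a homomorphism `g : M → P` is surjective as soon as `c ∘ g` is. -/
structure IsProjectiveCover (μ : Weight 𝔥) (P : Type (max u v)) [AddCommGroup P] [Module A P]
    [Module (Env 𝔤 A) P] [IsScalarTower A (Env 𝔤 A) P]
    (c : P →ₗ[Env 𝔤 A] SimpleObject 𝔥 𝔟 A μ) : Prop where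
  isProjectiveObject : IsProjectiveObject 𝔥 𝔟 A J P
  surjective : Function.Surjective c
  essential : ∀ (M : Type (max u v)) [AddCommGroup M] [Module A M] [Module (Env 𝔤 A) M]
    [IsScalarTower A (Env 𝔤 A) M], IsInTruncatedO 𝔥 𝔟 A M J →
    ∀ g : M →ₗ[Env 𝔤 A] P, Function.Surjective (c ∘ₗ g) → Function.Surjective g

end Local

end Modules

end AffineO

end

/-! Write n̂₊ and n̂₋ for the sums of the positive and of the negative affine root spaces, so that ĝ
= n̂₋ ⊕ b̂ and b̂ = ĥ ⊕ n̂₊. The working notion is not a Verma flag but a finite family of weight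
vectors over which a module is free as an A ⊗ U(n̂₋)-module (`IsStdBasis`). The two notions are
equivalent for weight modules. Applying n̂₊ to a basis vector involves only basis vectors of
strictly higher weight, so a basis ordered by descending weight yields a filtration with Verma
quotients; conversely, highest weight vectors of the quotients lift to a basis
(`IsStdBasis.nonempty_vermaFlag`, `VermaFlag.exists_isStdBasis`).

Projectives. Distinct deformed weights differ by a unit of A at some H, so taking vectors of weight
μ is exact on weight modules. In the truncated category this functor is represented by Q = U(ĝ)
⊗_{U(b̂)} (V ⊗ A_μ), where V is the quotient of U(n̂₊) by the weights ν with μ + ν ∉ J. Openness of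
J makes V a b̂-module and local boundedness makes it finite dimensional
(`exists_projective_generator`). Hence Q is projective and has a basis. Over a local A every direct
summand of a module with a basis has a basis as well: this is linear algebra modulo the augmentation
ideal and the maximal ideal, lifted by a nilpotency argument (`IsStdBasis.isUnit_of_augmentation`,
`IsStdBasis.exists_split`). The cover of L_A(μ) arises from Q by splitting off covers of L_A(λ) with
λ > μ. The splitting stops because the bases shrink, and these covers exist by induction on the
number of weights of J above μ (`hasProjectiveCover`). Any projective cover P is a summand of Q, so
it has a basis and a Verma flag.

Multiplicities. For λ ∈ J both sides equal dim Hom(P, ∇_𝕂(λ)). A homomorphism to ∇_𝕂(λ) is the same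
as an A-linear form P → 𝕂 that vanishes on n̂₋P and on the weights other than λ; in terms of a basis
this is one free scalar for each basis vector of weight λ (`nonempty_hom_equiv`). On the other hand
Hom(P, –) counts L_𝕂(μ). In a chain of submodules, each subquotient L_𝕂(μ) strictly enlarges the
space of homomorphisms into the members of the chain (`subquotientMultiplicity_le`). Conversely, a
suitably minimal homomorphism produces a new subquotient L_𝕂(μ) at the cost of at most one dimension
(`exists_extension`). No finite length of ∇_𝕂(λ) is needed. For λ ∉ J there is no vector of weight λ
in P, so no basis vector either. -/

noncomputable section

namespace AffineO

/-! ### Induced modules for a decomposition L = N ⊕ B -/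

section Induced

attribute [local instance 100] LieRing.ofAssociativeRing

variable (A : Type v) [CommRing A] [Algebra ℂ A]

/-- The algebra `A ⊗ U(L)`. -/
abbrev EnvAlg (L : Type w) [LieRing L] [LieAlgebra ℂ L] : Type (max v w) :=
  A ⊗[ℂ] UniversalEnvelopingAlgebra ℂ L

variable {L : Type w} [LieRing L] [LieAlgebra ℂ L]

/-- An element of `L` as an element of `A ⊗ U(L)`. -/
def gen (x : L) : EnvAlg A L := 1 ⊗ₜ UniversalEnvelopingAlgebra.ι ℂ x

theorem gen_add (x y : L) : gen A (x + y) = gen A x + gen A y := by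
  simp only [gen, map_add, TensorProduct.tmul_add]

theorem gen_smul (c : ℂ) (x : L) : gen A (c • x) = algebraMap ℂ A c • gen A x := by
  simp only [gen, map_smul, TensorProduct.tmul_smul, algebraMap_smul]

theorem gen_zero : gen A (0 : L) = 0 := by
  simp only [gen, map_zero, TensorProduct.tmul_zero]

theorem gen_lie (x y : L) : gen A ⁅x, y⁆ = gen A x * gen A y - gen A y * gen A x := by
  simp only [gen, LieHom.map_lie, LieRing.of_associative_ring_bracket,
    Algebra.TensorProduct.tmul_mul_tmul, mul_one, TensorProduct.tmul_sub]

variable {A}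

/-- The universal property yields a map from U(L) back to the subalgebra generated by L. Its
composite with the inclusion fixes L, hence is the identity. -/
theorem adjoin_range_gen : Algebra.adjoin A (Set.range (gen A : L → EnvAlg A L)) = ⊤ := by
  rw [eq_top_iff]
  rintro u -
  have h1 (x : UniversalEnvelopingAlgebra ℂ L) :
      (1 ⊗ₜ x : EnvAlg A L) ∈ Algebra.adjoin A (Set.range (gen A : L → EnvAlg A L)) := by
    set T := Algebra.adjoin A (Set.range (gen A : L → EnvAlg A L))
    let S : Subalgebra ℂ (UniversalEnvelopingAlgebra ℂ L) :=
      (T.restrictScalars ℂ).comap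
        (Algebra.TensorProduct.includeRight : UniversalEnvelopingAlgebra ℂ L →ₐ[ℂ] EnvAlg A L)
    let f : L →ₗ⁅ℂ⁆ S :=
      { toFun := fun X => ⟨UniversalEnvelopingAlgebra.ι ℂ X, Algebra.subset_adjoin ⟨X, rfl⟩⟩
        map_add' := fun X Y => Subtype.ext (map_add _ _ _)
        map_smul' := fun c X => Subtype.ext (map_smul _ _ _)
        map_lie' := fun {X Y} => Subtype.ext (LieHom.map_lie _ _ _) }
    have h2 : S.val.comp (UniversalEnvelopingAlgebra.lift ℂ f) = AlgHom.id ℂ _ := by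
      ext X
      simp only [LieHom.comp_apply, AlgHom.coe_toLieHom, AlgHom.comp_apply, AlgHom.id_apply]
      rw [UniversalEnvelopingAlgebra.lift_ι_apply]
      rfl
    have h3 := DFunLike.congr_fun h2 x
    simp only [AlgHom.comp_apply, AlgHom.id_apply] at h3
    rw [← h3]
    exact (UniversalEnvelopingAlgebra.lift ℂ f x).2
  induction u using TensorProduct.induction_on with
  | zero => exact zero_mem _
  | add u v hu hv => exact add_mem hu hv
  | tmul a x =>
    have : (a ⊗ₜ x : EnvAlg A L) = a • (1 ⊗ₜ x : EnvAlg A L) := by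
      rw [TensorProduct.smul_tmul', smul_eq_mul, mul_one]
    rw [this]
    exact Subalgebra.smul_mem _ (h1 x) a

/-- An `A`-submodule of `A ⊗ U(L)` that contains `1` and is stable under left multiplication by `L`
is everything. -/
theorem envAlg_eq_top {T : Submodule A (EnvAlg A L)} (h1 : (1 : EnvAlg A L) ∈ T)
    (hT : ∀ x : L, ∀ s ∈ T, gen A x * s ∈ T) : T = ⊤ := by
  rw [eq_top_iff]
  rintro u -
  have hu : u ∈ Algebra.adjoin A (Set.range (gen A : L → EnvAlg A L)) := by
    rw [adjoin_range_gen]; trivial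
  suffices ∀ s ∈ T, u * s ∈ T by simpa using this 1 h1
  induction hu using Algebra.adjoin_induction with
  | mem x h => obtain ⟨x, rfl⟩ := h; exact hT x
  | algebraMap a =>
    intro s hs
    rw [← Algebra.smul_def]
    exact T.smul_mem a hs
  | add x y _ _ hx hy => intro s hs; rw [add_mul]; exact add_mem (hx s hs) (hy s hs)
  | mul x y _ _ hx hy => intro s hs; rw [mul_assoc]; exact hx _ (hy s hs)

theorem commute_ofId {E : Type*} [Ring E] [Algebra A E] (a : A) (x : E) :
    Commute (Algebra.ofId A E a) x :=
  Algebra.commutes a x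

/-- The action of `A ⊗ U(L)` on an `A`-module defined by an `A`-linear representation of `L`. -/
def repAlgHom {Z : Type*} [AddCommGroup Z] [Module A Z] [Module ℂ Z] [IsScalarTower ℂ A Z]
    (ρ : L →ₗ⁅ℂ⁆ Module.End A Z) : EnvAlg A L →ₐ[A] Module.End A Z :=
  Algebra.TensorProduct.lift (Algebra.ofId A _)
    (UniversalEnvelopingAlgebra.lift ℂ ρ) (fun a _ => commute_ofId a _)

@[simp]
theorem repAlgHom_gen {Z : Type*} [AddCommGroup Z] [Module A Z] [Module ℂ Z] [IsScalarTower ℂ A Z]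
    (ρ : L →ₗ⁅ℂ⁆ Module.End A Z) (x : L) : repAlgHom ρ (gen A x) = ρ x := by
  rw [repAlgHom, gen, Algebra.TensorProduct.lift_tmul, map_one, one_mul,
    UniversalEnvelopingAlgebra.lift_ι_apply]

/-- The homomorphism `A ⊗ U(N) → A ⊗ U(L)` for a subalgebra `N` of `L`. -/
def inclAlg (N : LieSubalgebra ℂ L) : EnvAlg A N →ₐ[A] EnvAlg A L :=
  Algebra.TensorProduct.map (AlgHom.id A A)
    (UniversalEnvelopingAlgebra.lift ℂ ((UniversalEnvelopingAlgebra.ι ℂ).comp N.incl))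

@[simp]
theorem inclAlg_gen (N : LieSubalgebra ℂ L) (x : N) : inclAlg N (gen A x) = gen A (x : L) := by
  rw [inclAlg, gen, Algebra.TensorProduct.map_tmul, map_one,
    UniversalEnvelopingAlgebra.lift_ι_apply]
  rfl

/-- The augmentation `A ⊗ U(L) → A`, which vanishes on `L`. -/
def augmentation : EnvAlg A L →ₐ[A] A :=
  Algebra.TensorProduct.lift (Algebra.ofId A _)
    (UniversalEnvelopingAlgebra.lift ℂ (0 : L →ₗ⁅ℂ⁆ A)) (fun a _ => commute_ofId a _)

@[simp]
theorem augmentation_gen (x : L) : augmentation (gen A x) = 0 := by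
  rw [augmentation, gen, Algebra.TensorProduct.lift_tmul, map_one, one_mul,
    UniversalEnvelopingAlgebra.lift_ι_apply]
  rfl

section HomRep

variable {N : LieSubalgebra ℂ L}
variable (W : Type*) [AddCommGroup W] [Module A W] [Module ℂ W] [IsScalarTower ℂ A W]
  [Module (EnvAlg A N) W] [IsScalarTower A (EnvAlg A N) W]

/-- The representation of `N` on `Hom(L, W)`, for an `N`-module `W`. -/
def homRep : N →ₗ⁅ℂ⁆ Module.End A (L →ₗ[ℂ] W) where
  toFun x :=
    -- The formula is dictated by l·(x·w) = x·(l·w) + [l, x]·w. It makes the action map w ↦ (l ↦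
    -- l·w) of an L-module W a homomorphism of N-modules W → Hom(L, W). If W is free over U(N), such
    -- a map can be prescribed on a basis.
    { toFun := fun c =>
        { toFun := fun l => gen A x • c l + c ⁅l, (x : L)⁆
          map_add' := fun l l' => by simp only [map_add, add_lie, smul_add]; abel
          map_smul' := fun t l => by
            simp only [map_smul, smul_lie, RingHom.id_apply, smul_add]
            rw [← algebraMap_smul A t (c l), smul_comm (gen A x), algebraMap_smul] }
      map_add' := fun c c' => by
        ext l; simp only [LinearMap.add_apply, LinearMap.coe_mk, AddHom.coe_mk, smul_add]; abel
      map_smul' := fun a c => by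
        ext l
        simp only [LinearMap.smul_apply, LinearMap.coe_mk, AddHom.coe_mk, smul_add,
          RingHom.id_apply]
        rw [smul_comm] }
  map_add' x y := by
    ext c l
    simp only [LinearMap.add_apply, LinearMap.coe_mk, AddHom.coe_mk, gen_add, add_smul,
      AddMemClass.coe_add, lie_add, map_add]
    abel
  map_smul' t x := by
    ext c l
    simp only [LinearMap.smul_apply, LinearMap.coe_mk, AddHom.coe_mk, gen_smul, smul_assoc,
      SetLike.val_smul, lie_smul, map_smul, RingHom.id_apply, smul_add]
    simp only [algebraMap_smul]
  map_lie' {x y} := by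
    ext c l
    simp only [LieRing.of_associative_ring_bracket, LinearMap.sub_apply, Module.End.mul_apply,
      LinearMap.coe_mk, AddHom.coe_mk, gen_lie, sub_smul, mul_smul, smul_add,
      LieSubalgebra.coe_bracket]
    have : ⁅l, ⁅(x : L), (y : L)⁆⁆ = ⁅⁅l, (x : L)⁆, (y : L)⁆ - ⁅⁅l, (y : L)⁆, (x : L)⁆ := by
      rw [leibniz_lie, ← lie_skew ⁅l, (y : L)⁆ (x : L)]; abel
    rw [this, map_sub]
    abel

theorem homRep_apply (x : N) (c : L →ₗ[ℂ] W) (l : L) :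
    homRep (A := A) W x c l = gen A x • c l + c ⁅l, (x : L)⁆ := rfl

end HomRep

section

variable {N B : LieSubalgebra ℂ L} {ι : Type} [Fintype ι] [DecidableEq ι]
variable (pN : L →ₗ[ℂ] N) (pB : L →ₗ[ℂ] B)
  (hp : ∀ x, (pN x : L) + pB x = x)
  (hNN : ∀ x : N, pN x = x) (hNB : ∀ x : N, pB x = 0)
  (hBN : ∀ x : B, pN x = 0) (hBB : ∀ x : B, pB x = x)
  (ρ : B →ₗ⁅ℂ⁆ Module.End A (ι → A))

/-- The inclusion of the free `A`-module on `ι` into the free `A ⊗ U(N)`-module on `ι`. -/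
def baseIncl (A : Type v) [CommRing A] [Algebra ℂ A] (N : LieSubalgebra ℂ L) (ι : Type) :
    (ι → A) →ₗ[A] (ι → EnvAlg A N) :=
  (Algebra.linearMap A (EnvAlg A N)).compLeft ι

theorem baseIncl_single (i : ι) :
    baseIncl A N ι (Pi.single i 1) = Pi.single i 1 := by
  ext j
  by_cases hj : j = i
  · subst hj; simp [baseIncl, Algebra.TensorProduct.one_def]
  · simp [baseIncl, hj]

/-- The value `l ↦ l · e i` of the action map of the induced module on the basis. -/
def inducedBase (i : ι) : L →ₗ[ℂ] (ι → EnvAlg A N) where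
  toFun l := Pi.single i (gen A (pN l)) + baseIncl A N ι (ρ (pB l) (Pi.single i 1))
  map_add' l l' := by
    simp only [map_add, gen_add, Pi.single_add, LinearMap.add_apply]; abel
  map_smul' t l := by
    simp only [map_smul, gen_smul, LinearMap.smul_apply, RingHom.id_apply, smul_add]
    rw [Pi.single_smul, algebraMap_smul]
    congr 1

/-- The action map `w ↦ (l ↦ l · w)` of the induced module. -/
def inducedAct : (ι → EnvAlg A N) →ₗ[A] (L →ₗ[ℂ] (ι → EnvAlg A N)) :=
  ∑ i, (LinearMap.applyₗ (inducedBase pN pB ρ i)) ∘ₗ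
    (repAlgHom (homRep (A := A) (N := N) (ι → EnvAlg A N))).toLinearMap ∘ₗ LinearMap.proj i

/-- This is the N-equivariance for which the action map was defined through `homRep`. -/
theorem inducedAct_gen_smul (x : N) (w : ι → EnvAlg A N) (l : L) :
    inducedAct pN pB ρ (gen A x • w) l =
      gen A x • inducedAct pN pB ρ w l + inducedAct pN pB ρ w ⁅l, (x : L)⁆ := by
  rw [← homRep_apply]
  congr 1
  simp only [inducedAct, LinearMap.sum_apply, LinearMap.comp_apply, LinearMap.proj_apply,
    Pi.smul_apply, smul_eq_mul, AlgHom.toLinearMap_apply, map_mul, repAlgHom_gen,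
    LinearMap.applyₗ_apply_apply, Module.End.mul_apply, map_sum]

theorem inducedAct_single (i : ι) (l : L) :
    inducedAct pN pB ρ (Pi.single i 1) l = inducedBase pN pB ρ i l := by
  simp only [inducedAct, LinearMap.sum_apply, LinearMap.comp_apply, LinearMap.proj_apply,
    AlgHom.toLinearMap_apply, LinearMap.applyₗ_apply_apply]
  rw [Finset.sum_eq_single i]
  · simp
  · intro j _ hj
    simp [Pi.single_eq_of_ne hj]
  · simp

theorem inducedAct_baseIncl (f : ι → A) (l : L) :
    inducedAct pN pB ρ (baseIncl A N ι f) l =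
      gen A (pN l) • baseIncl A N ι f + baseIncl A N ι (ρ (pB l) f) := by
  have h : f = ∑ i, f i • (Pi.single i 1 : ι → A) := by
    ext j
    simp [Finset.sum_apply, Pi.single_apply]
  rw [h]
  simp only [map_sum, map_smul, LinearMap.sum_apply, LinearMap.smul_apply, Finset.smul_sum, baseIncl_single,
    inducedAct_single, ← Finset.sum_add_distrib, smul_comm (gen A (pN l)), ← smul_add]
  refine Finset.sum_congr rfl fun i _ => ?_
  congr 1
  simp only [inducedBase, LinearMap.coe_mk, AddHom.coe_mk]
  rw [← Pi.single_smul, smul_eq_mul, mul_one]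

omit [DecidableEq ι] in
theorem induced_induction {p : (ι → EnvAlg A N) → Prop} (h0 : ∀ f, p (baseIncl A N ι f))
    (hadd : ∀ s t, p s → p t → p (s + t)) (hsmul : ∀ (a : A) s, p s → p (a • s))
    (hgen : ∀ (x : N) s, p s → p (gen A x • s)) (s : ι → EnvAlg A N) : p s := by
  classical
  have h00 : p 0 := by simpa using h0 0
  have key (i : ι) (u : EnvAlg A N) : p (Pi.single i u) := by
    let T : Submodule A (EnvAlg A N) :=
      { carrier := {u | p (Pi.single i u)}
        add_mem' := fun {u v} hu hv => by
          rw [Set.mem_ofPred_eq, Pi.single_add]; exact hadd _ _ hu hv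
        zero_mem' := by rw [Set.mem_ofPred_eq, Pi.single_zero]; exact h00
        smul_mem' := fun a u hu => by
          rw [Set.mem_ofPred_eq, Pi.single_smul]; exact hsmul a _ hu }
    have hT : T = ⊤ := envAlg_eq_top
      (by
        change p (Pi.single i 1)
        rw [← baseIncl_single]
        exact h0 _)
      (fun x s hs => by
        change p (Pi.single i (gen A x * s))
        rw [← smul_eq_mul, Pi.single_smul]
        exact hgen x _ hs)
    have : u ∈ T := hT ▸ trivial
    exact this
  rw [← Finset.univ_sum_single s]
  exact Finset.sum_induction _ p hadd h00 fun i _ => key i _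

include hp hNN hNB in
-- Equivariance propagates the rule from the basis vectors: for y ∈ N, x·(y·s) = y·(x·s) + [x, y]·s,
-- and the bracket stays in N.
theorem inducedAct_of_mem (x : N) (w : ι → EnvAlg A N) :
    inducedAct pN pB ρ w (x : L) = gen A x • w := by
  induction w using induced_induction generalizing x with
  | h0 f => rw [inducedAct_baseIncl, hNN, hNB, map_zero, LinearMap.zero_apply, map_zero, add_zero]
  | hadd s t hs ht => rw [map_add, LinearMap.add_apply, hs, ht, smul_add]
  | hsmul a s hs => rw [map_smul, LinearMap.smul_apply, hs, smul_comm]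
  | hgen y s hs =>
    rw [inducedAct_gen_smul, hs, ← LieSubalgebra.coe_bracket, hs, gen_lie, sub_smul, mul_smul,
      mul_smul]
    abel

include hp hNN hNB hBN hBB in
-- Equivariance gives the identity on every w as soon as l' lies in N (`hx'`), and by antisymmetry
-- as soon as l does. On basis elements only l, l' ∈ B remain, where ρ is a representation. The
-- identity then passes from s to x·s for x ∈ N by the Jacobi identity.
theorem inducedAct_lie (l l' : L) (w : ι → EnvAlg A N) :
    inducedAct pN pB ρ w ⁅l, l'⁆ = inducedAct pN pB ρ (inducedAct pN pB ρ w l') l -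
      inducedAct pN pB ρ (inducedAct pN pB ρ w l) l' := by
  set Φ := inducedAct pN pB ρ with hΦ
  have hN (x : N) (w) : Φ w (x : L) = gen A x • w := inducedAct_of_mem pN pB hp hNN hNB ρ x w
  have hx (x : N) (w) (l : L) : Φ (gen A x • w) l = gen A x • Φ w l + Φ w ⁅l, (x : L)⁆ :=
    inducedAct_gen_smul pN pB ρ x w l
  have hx' (x : N) (w) (l : L) : Φ w ⁅l, (x : L)⁆ = Φ (Φ w (x : L)) l - Φ (Φ w l) (x : L) := by
    rw [hN, hN, hx]; abel
  induction w using induced_induction generalizing l l' with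
  | h0 f =>
    have hb (b b' : B) : Φ (baseIncl A N ι f) ⁅(b : L), (b' : L)⁆ =
        Φ (Φ (baseIncl A N ι f) (b' : L)) b - Φ (Φ (baseIncl A N ι f) (b : L)) b' := by
      have h1 (b : B) (f) : Φ (baseIncl A N ι f) (b : L) = baseIncl A N ι (ρ b f) := by
        rw [hΦ, inducedAct_baseIncl, hBN, hBB, gen_zero, zero_smul, zero_add]
      rw [← LieSubalgebra.coe_bracket, h1, h1, h1, h1, h1, LieHom.map_lie, ← map_sub]
      rfl
    have hb' (l : L) (b' : B) : Φ (baseIncl A N ι f) ⁅l, (b' : L)⁆ =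
        Φ (Φ (baseIncl A N ι f) (b' : L)) l - Φ (Φ (baseIncl A N ι f) l) b' := by
      rw [← hp l, add_lie]
      simp only [map_add, LinearMap.add_apply]
      rw [hb, ← lie_skew, map_neg, hx']
      abel
    rw [← hp l', lie_add]
    simp only [map_add, LinearMap.add_apply]
    rw [hb', hx']
    abel
  | hadd s t hs ht => simp only [map_add, LinearMap.add_apply, hs, ht]; abel
  | hsmul a s hs => simp only [map_smul, LinearMap.smul_apply, hs, smul_sub]
  | hgen x s hs =>
    simp only [hx, map_add, LinearMap.add_apply]
    have e1 : ⁅⁅l, l'⁆, (x : L)⁆ = ⁅⁅l, (x : L)⁆, l'⁆ + ⁅l, ⁅l', (x : L)⁆⁆ := by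
      rw [lie_lie, ← lie_skew l' ⁅l, (x : L)⁆]
      abel
    rw [e1, map_add, hs ⁅l, (x : L)⁆ l', hs l ⁅l', (x : L)⁆, hs l l', smul_sub]
    abel

/-- The representation of `L` on the induced module `U(L) ⊗_{U(B)} (ι → A) = ι → A ⊗ U(N)`. -/
def inducedRep (hp : ∀ x, (pN x : L) + pB x = x)
    (hNN : ∀ x : N, pN x = x) (hNB : ∀ x : N, pB x = 0)
    (hBN : ∀ x : B, pN x = 0) (hBB : ∀ x : B, pB x = x) :
    L →ₗ⁅ℂ⁆ Module.End A (ι → EnvAlg A N) where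
  toFun l :=
    { toFun := fun w => inducedAct pN pB ρ w l
      map_add' := fun w w' => by rw [map_add, LinearMap.add_apply]
      map_smul' := fun a w => by rw [map_smul, LinearMap.smul_apply]; rfl }
  map_add' l l' := LinearMap.ext fun w => map_add (inducedAct pN pB ρ w) l l'
  map_smul' t l := LinearMap.ext fun w => map_smul (inducedAct pN pB ρ w) t l
  map_lie' {l l'} := LinearMap.ext fun w => inducedAct_lie pN pB hp hNN hNB hBN hBB ρ l l' w

end

/-- The existence of induced modules: if `L = N ⊕ B` for subalgebras `N` and `B`, and `B` acts on
the free `A`-module with basis `ι`, then the `L`-module induced from it is free over `A ⊗ U(N)`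
with basis `ι`. -/
theorem exists_induced {N B : LieSubalgebra ℂ L} (hNB : IsCompl N.toSubmodule B.toSubmodule)
    {ι : Type} [Fintype ι] [DecidableEq ι] (ρ : B →ₗ⁅ℂ⁆ Module.End A (ι → A)) :
    ∃ (W : Type (max v w)) (_ : AddCommGroup W) (_ : Module A W) (_ : Module (EnvAlg A L) W)
      (_ : IsScalarTower A (EnvAlg A L) W) (i : (ι → A) →ₗ[A] W),
      (∀ (b : B) f, gen A (b : L) • i f = i (ρ b f)) ∧
      Function.Bijective
        (fun s : ι → EnvAlg A N => ∑ k, inclAlg N (s k) • i (Pi.single k 1)) := by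
  let pN : L →ₗ[ℂ] N := N.toSubmodule.projectionOnto B.toSubmodule hNB
  let pB : L →ₗ[ℂ] B := B.toSubmodule.projectionOnto N.toSubmodule hNB.symm
  have hp (x) : (pN x : L) + pB x = x :=
    Submodule.projection_add_projection_eq_self hNB x
  have hNN (x : N) : pN x = x := Submodule.projectionOnto_apply_left hNB x
  have hBB (x : B) : pB x = x := Submodule.projectionOnto_apply_left hNB.symm x
  have hNB' (x : N) : pB x = 0 := Submodule.projectionOnto_apply_right hNB.symm x
  have hBN (x : B) : pN x = 0 := Submodule.projectionOnto_apply_right hNB x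
  let R := inducedRep pN pB ρ hp hNN hNB' hBN hBB
  let : Module (EnvAlg A L) (ι → EnvAlg A N) := Module.compHom _ (repAlgHom R).toRingHom
  have hgen (l : L) (w : ι → EnvAlg A N) : gen A l • w = inducedAct pN pB ρ w l := by
    change (repAlgHom R (gen A l)) w = _
    rw [repAlgHom_gen]
    rfl
  have hST : IsScalarTower A (EnvAlg A L) (ι → EnvAlg A N) := ⟨fun a u w => by
    change (repAlgHom R (a • u)) w = a • (repAlgHom R u) w
    rw [map_smul]
    rfl⟩
  refine ⟨ι → EnvAlg A N, inferInstance, inferInstance, inferInstance, hST, baseIncl A N ι, ?_, ?_⟩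
  · intro b f
    rw [hgen, inducedAct_baseIncl, hBN, hBB, gen_zero, zero_smul, zero_add]
  · have hincl (u : EnvAlg A N) (w : ι → EnvAlg A N) : inclAlg N u • w = u • w := by
      let T : Submodule A (EnvAlg A N) :=
        { carrier := {u | ∀ w : ι → EnvAlg A N, inclAlg N u • w = u • w}
          add_mem' := fun {u v} hu hv w => by rw [map_add, add_smul, hu, hv, add_smul]
          zero_mem' := fun w => by rw [map_zero, zero_smul, zero_smul]
          smul_mem' := fun a u hu w => by rw [map_smul, smul_assoc, hu, smul_assoc] }
      have hT : T = ⊤ := envAlg_eq_top (fun w => by rw [map_one, one_smul, one_smul])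
        (fun x s hs w => by
          rw [map_mul, mul_smul, hs, inclAlg_gen, hgen,
            inducedAct_of_mem pN pB hp hNN hNB' ρ, mul_smul])
      have : u ∈ T := hT ▸ trivial
      exact this w
    -- In this model A ⊗ U(N) acts by left multiplication and the generators are the coordinate
    -- vectors, so the map is the identity.
    have : (fun s : ι → EnvAlg A N =>
        ∑ k, inclAlg N (s k) • baseIncl A N ι (Pi.single k 1)) = id := by
      funext s
      simp only [hincl, baseIncl_single, id]
      ext j
      simp [Finset.sum_apply, Pi.single_apply]
    rw [this]
    exact Function.bijective_id

end Induced

/-! ### Simultaneous eigenvectors whose eigenvalues differ by units -/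

section WeightGeneral

variable {A M Γ I : Type*} [CommRing A] [AddCommGroup M] [Module A M]

/-- If a submodule stable under a family of operators contains a sum of simultaneous eigenvectors
whose eigenvalues differ pairwise by units, then it contains all the summands. -/
theorem mem_of_sum_mem {θ : I → Module.End A M} {c : Γ → I → A}
    (hc : ∀ γ γ', γ ≠ γ' → ∃ i, IsUnit (c γ i - c γ' i)) {N : Submodule A M}
    (hN : ∀ i, ∀ m ∈ N, θ i m ∈ N) (s : Finset Γ) (f : Γ → M)
    (hf : ∀ γ ∈ s, ∀ i, θ i (f γ) = c γ i • f γ) (h : ∑ γ ∈ s, f γ ∈ N) : ∀ γ ∈ s, f γ ∈ N := by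
  classical
  induction s using Finset.induction_on generalizing f with
  | empty => simp
  | insert γ₀ s hγ₀ ih =>
    -- Applying θ i - c γ₀ i kills the summand of γ₀ and multiplies the summand of γ by c γ i - c γ₀
    -- i, which is a unit for a suitable i.
    have h1 (i : I) : ∀ γ ∈ s, (c γ i - c γ₀ i) • f γ ∈ N := by
      apply ih (fun γ => (c γ i - c γ₀ i) • f γ)
      · intro γ hγ j
        rw [map_smul, hf γ (Finset.mem_insert_of_mem hγ), smul_comm]
      · have h2 := sub_mem (hN i _ h) (N.smul_mem (c γ₀ i) h)
        rw [map_sum, Finset.smul_sum, ← Finset.sum_sub_distrib, Finset.sum_insert hγ₀,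
          hf γ₀ (Finset.mem_insert_self _ _), sub_self, zero_add] at h2
        convert h2 using 2 with γ hγ
        rw [hf γ (Finset.mem_insert_of_mem hγ), sub_smul]
    have h3 : ∀ γ ∈ s, f γ ∈ N := by
      intro γ hγ
      obtain ⟨i, u, hu⟩ := hc γ γ₀ (fun h => hγ₀ (h ▸ hγ))
      have h4 := N.smul_mem (↑u⁻¹ : A) (h1 i γ hγ)
      rwa [← hu, smul_smul, Units.inv_mul, one_smul] at h4
    intro γ hγ
    rcases Finset.mem_insert.mp hγ with rfl | hγ
    · rw [Finset.sum_insert hγ₀] at h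
      exact (Submodule.add_mem_iff_left _ (sum_mem h3)).mp h
    · exact h3 γ hγ

/-- If a submodule stable under a family of operators contains an element of the span of a set `Z`
of simultaneous eigenvectors, then it is spanned by them. -/
theorem exists_sum_of_mem_span {θ : I → Module.End A M} {c : Γ → I → A} {P : Γ → M → Prop} {m : M}
    (hm : m ∈ Submodule.span A {z | ∃ γ, (∀ i, θ i z = c γ i • z) ∧ P γ z}) :
    ∃ (s : Finset Γ) (f : Γ → M), m = ∑ γ ∈ s, f γ ∧ (∀ γ, ∀ i, θ i (f γ) = c γ i • f γ) ∧
      ∀ γ, f γ ∈ Submodule.span A {z | (∀ i, θ i z = c γ i • z) ∧ P γ z} := by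
  classical
  induction hm using Submodule.span_induction with
  | mem m h =>
    obtain ⟨γ, h1, h2⟩ := h
    refine ⟨{γ}, fun γ' => if γ' = γ then m else 0, by simp, fun γ' i => ?_, fun γ' => ?_⟩
    · by_cases h : γ' = γ
      · subst h; simpa using h1 i
      · simp [h]
    · by_cases h : γ' = γ
      · subst h; beta_reduce; rw [if_pos rfl]; exact Submodule.subset_span ⟨h1, h2⟩
      · simp [h]
  | zero => exact ⟨∅, 0, by simp, by simp, by simp⟩
  | add m m' _ _ h h' =>
    obtain ⟨s, f, rfl, h1, h2⟩ := h
    obtain ⟨s', f', rfl, h1', h2'⟩ := h'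
    refine ⟨s ∪ s', fun γ => (if γ ∈ s then f γ else 0) + if γ ∈ s' then f' γ else 0, ?_,
      fun γ i => ?_, fun γ => ?_⟩
    · rw [Finset.sum_add_distrib, Finset.sum_ite_mem, Finset.sum_ite_mem,
        Finset.inter_eq_right.mpr Finset.subset_union_left,
        Finset.inter_eq_right.mpr Finset.subset_union_right]
    · rw [map_add, smul_add]
      congr 1
      · split_ifs
        · exact h1 γ i
        · simp
      · split_ifs
        · exact h1' γ i
        · simp
    · refine add_mem ?_ ?_
      · split_ifs
        · exact h2 γ
        · exact zero_mem _
      · split_ifs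
        · exact h2' γ
        · exact zero_mem _
  | smul a m _ h =>
    obtain ⟨s, f, rfl, h1, h2⟩ := h
    refine ⟨s, fun γ => a • f γ, Finset.smul_sum, fun γ i => ?_,
      fun γ => Submodule.smul_mem _ a (h2 γ)⟩
    rw [map_smul, h1, smul_comm]

/-- A simultaneous eigenvector in the span of a set of simultaneous eigenvectors lies in the span of
those of them that have the same eigenvalues. -/
theorem mem_span_of_eigenvector {θ : I → Module.End A M} {c : Γ → I → A}
    (hc : ∀ γ γ', γ ≠ γ' → ∃ i, IsUnit (c γ i - c γ' i)) {P : Γ → M → Prop} {m : M} {γ : Γ}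
    (hγ : ∀ i, θ i m = c γ i • m)
    (hm : m ∈ Submodule.span A {z | ∃ γ, (∀ i, θ i z = c γ i • z) ∧ P γ z}) :
    m ∈ Submodule.span A {z | (∀ i, θ i z = c γ i • z) ∧ P γ z} := by
  classical
  obtain ⟨s, f, hs, h1, h2⟩ := exists_sum_of_mem_span hm
  -- The relation ∑ f γ' - m = 0 is a sum of eigenvectors lying in ⊥, so its component at γ
  -- vanishes.
  have h3 := mem_of_sum_mem hc (N := ⊥) (by simp) (insert γ s)
    (fun γ' => (if γ' ∈ s then f γ' else 0) - if γ' = γ then m else 0)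
    (fun γ' _ i => by
      rw [map_sub, smul_sub]
      congr 1
      · split_ifs
        · exact h1 γ' i
        · simp
      · split_ifs with h
        · rw [h]; exact hγ i
        · simp)
    (by
      rw [Finset.sum_sub_distrib, Finset.sum_ite_mem,
        Finset.inter_eq_right.mpr (Finset.subset_insert _ _), ← hs, Finset.sum_ite_eq',
        if_pos (Finset.mem_insert_self _ _), sub_self]
      exact zero_mem _) γ (Finset.mem_insert_self _ _)
  rw [Submodule.mem_bot, if_pos rfl, sub_eq_zero] at h3
  rw [← h3]
  split_ifs
  · exact h2 γ
  · exact zero_mem _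

end WeightGeneral

/-! ### Weight spaces, sub- and quotient modules -/

section WeightModules

attribute [local instance 100] LieRing.ofAssociativeRing

variable {𝔤 : Type u} [LieRing 𝔤] [LieAlgebra ℂ 𝔤]
variable {𝔥 𝔟 : LieSubalgebra ℂ 𝔤}
variable {A : Type v} [CommRing A] [Algebra ℂ A] [Algebra (SymmetricAlgebra ℂ 𝔥) A]
  [IsScalarTower ℂ (SymmetricAlgebra ℂ 𝔥) A]

theorem deformedWeight_sub (lam μ : Weight 𝔥) (H : CartanHat 𝔥) :
    deformedWeight 𝔥 A lam H - deformedWeight 𝔥 A μ H = algebraMap ℂ A ((lam - μ) H) := by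
  simp [deformedWeight]

theorem deformedWeight_add (lam μ : Weight 𝔥) (H : CartanHat 𝔥) :
    deformedWeight 𝔥 A (lam + μ) H = algebraMap ℂ A (μ H) + deformedWeight 𝔥 A lam H := by
  simp [deformedWeight]; ring

/-- The deformation τ cancels in the difference of two weights. What remains is a complex number,
and a nonzero one is a unit in every A. This makes weight spaces behave over A as over a field. -/
theorem exists_isUnit_deformedWeight_sub (lam μ : Weight 𝔥) (h : lam ≠ μ) :
    ∃ H, IsUnit (deformedWeight 𝔥 A lam H - deformedWeight 𝔥 A μ H) := by
  obtain ⟨H, hH⟩ : ∃ H, (lam - μ) H ≠ 0 := by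
    by_contra! h'
    exact h (sub_eq_zero.mp (LinearMap.ext h'))
  exact ⟨H, by rw [deformedWeight_sub]; exact (IsUnit.mk0 _ hH).map _⟩

variable {M : Type w} [AddCommGroup M] [Module A M] [Module (Env 𝔤 A) M]
  [IsScalarTower A (Env 𝔤 A) M]

variable (M) in
/-- The action of an element of `A ⊗ U(ĝ)` as an `A`-linear map. -/
def actLin (u : Env 𝔤 A) : Module.End A M where
  toFun m := u • m
  map_add' := smul_add u
  map_smul' a m := smul_comm u a m

@[simp] theorem actLin_apply (u : Env 𝔤 A) (m : M) : actLin M u m = u • m := rfl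

theorem mem_of_sum_weight_mem {N : Submodule A M}
    (hN : ∀ H : CartanHat 𝔥, ∀ m ∈ N, act A (cartanIncl H) • m ∈ N) (s : Finset (Weight 𝔥))
    (f : Weight 𝔥 → M) (hf : ∀ γ ∈ s, f γ ∈ weightSpace 𝔥 A M γ) (h : ∑ γ ∈ s, f γ ∈ N) :
    ∀ γ ∈ s, f γ ∈ N :=
  mem_of_sum_mem (θ := fun H : CartanHat 𝔥 => actLin M (act A (cartanIncl H)))
    (c := deformedWeight 𝔥 A) exists_isUnit_deformedWeight_sub hN s f hf h

theorem mem_span_of_mem_weightSpace {P : Weight 𝔥 → M → Prop} {m : M} {γ : Weight 𝔥}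
    (hγ : m ∈ weightSpace 𝔥 A M γ)
    (hm : m ∈ Submodule.span A {z | ∃ γ, z ∈ weightSpace 𝔥 A M γ ∧ P γ z}) :
    m ∈ Submodule.span A {z | z ∈ weightSpace 𝔥 A M γ ∧ P γ z} :=
  mem_span_of_eigenvector (θ := fun H : CartanHat 𝔥 => actLin M (act A (cartanIncl H)))
    (c := deformedWeight 𝔥 A) exists_isUnit_deformedWeight_sub hγ hm

theorem iSupIndep_weightSpace : iSupIndep (weightSpace 𝔥 A M) := by
  classical
  rw [iSupIndep_def]
  intro γ
  rw [Submodule.disjoint_def]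
  intro m hm hm'
  have h1 : m ∈ Submodule.span A {z | ∃ γ', z ∈ weightSpace 𝔥 A M γ' ∧ γ' ≠ γ} := by
    have h0 : ⨆ γ', ⨆ (_ : γ' ≠ γ), weightSpace 𝔥 A M γ' ≤
        Submodule.span A {z | ∃ γ', z ∈ weightSpace 𝔥 A M γ' ∧ γ' ≠ γ} :=
      iSup₂_le fun γ' hγ' z hz => Submodule.subset_span ⟨γ', hz, hγ'⟩
    exact h0 hm'
  have h2 := mem_span_of_mem_weightSpace (P := fun γ' _ => γ' ≠ γ) hm h1
  simpa using h2

theorem span_weight_eq_top (h : ⨆ lam, weightSpace 𝔥 A M lam = ⊤) :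
    Submodule.span A {z : M | ∃ γ, z ∈ weightSpace 𝔥 A M γ ∧ True} = ⊤ := by
  rw [eq_top_iff, ← h]
  exact iSup_le fun γ m hm => Submodule.subset_span ⟨γ, hm, trivial⟩

theorem exists_sum_weight (h : ⨆ lam, weightSpace 𝔥 A M lam = ⊤) (m : M) :
    ∃ (s : Finset (Weight 𝔥)) (f : Weight 𝔥 → M), m = ∑ γ ∈ s, f γ ∧
      ∀ γ, f γ ∈ weightSpace 𝔥 A M γ := by
  have hm : m ∈ Submodule.span A {z : M | ∃ γ, z ∈ weightSpace 𝔥 A M γ ∧ True} := by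
    rw [span_weight_eq_top h]; trivial
  obtain ⟨s, f, h1, h2, -⟩ := exists_sum_of_mem_span
    (θ := fun H : CartanHat 𝔥 => actLin M (act A (cartanIncl H)))
    (c := deformedWeight 𝔥 A) hm
  exact ⟨s, f, h1, h2⟩

variable {M' : Type*} [AddCommGroup M'] [Module A M'] [Module (Env 𝔤 A) M']
  [IsScalarTower A (Env 𝔤 A) M']

theorem env_map_smul (f : M →ₗ[Env 𝔤 A] M') (a : A) (m : M) : f (a • m) = a • f m := by
  rw [← algebraMap_smul (Env 𝔤 A) a m, map_smul, algebraMap_smul]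

theorem map_mem_weightSpace (f : M →ₗ[Env 𝔤 A] M') {γ : Weight 𝔥} {m : M}
    (hm : m ∈ weightSpace 𝔥 A M γ) : f m ∈ weightSpace 𝔥 A M' γ := fun H => by
  rw [← map_smul, hm H, env_map_smul]

/-- Weight vectors lift to weight vectors through surjective homomorphisms. -/
theorem exists_weight_lift (h : ⨆ lam, weightSpace 𝔥 A M lam = ⊤) (f : M →ₗ[Env 𝔤 A] M')
    (hf : Function.Surjective f) {γ : Weight 𝔥} {m' : M'} (hm' : m' ∈ weightSpace 𝔥 A M' γ) :
    ∃ m ∈ weightSpace 𝔥 A M γ, f m = m' := by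
  classical
  obtain ⟨m, rfl⟩ := hf m'
  obtain ⟨s, g, rfl, hg⟩ := exists_sum_weight h m
  have h3 := mem_span_of_mem_weightSpace (P := fun γ' z => ∃ y ∈ weightSpace 𝔥 A M γ', f y = z) hm'
    (by
      rw [map_sum]
      exact sum_mem fun γ' _ => Submodule.subset_span
        ⟨γ', map_mem_weightSpace f (hg γ'), _, hg γ', rfl⟩)
  suffices Submodule.span A {z | z ∈ weightSpace 𝔥 A M' γ ∧
      ∃ y ∈ weightSpace 𝔥 A M γ, f y = z} ≤
      (weightSpace 𝔥 A M γ).map (f.restrictScalars A) by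
    obtain ⟨y, hy, hy'⟩ := this h3
    exact ⟨y, hy, hy'⟩
  rw [Submodule.span_le]
  rintro - ⟨-, y, hy, rfl⟩
  exact ⟨y, hy, rfl⟩

theorem iSup_weightSpace_eq_top_of_surjective (h : ⨆ lam, weightSpace 𝔥 A M lam = ⊤)
    (f : M →ₗ[Env 𝔤 A] M') (hf : Function.Surjective f) :
    ⨆ lam, weightSpace 𝔥 A M' lam = ⊤ := by
  rw [eq_top_iff]
  rintro m' -
  obtain ⟨m, rfl⟩ := hf m'
  obtain ⟨s, g, rfl, hg⟩ := exists_sum_weight h m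
  rw [map_sum]
  exact sum_mem fun γ _ => Submodule.mem_iSup_of_mem γ (map_mem_weightSpace f (hg γ))

theorem mem_weightSpace_of_injective (f : M →ₗ[Env 𝔤 A] M') (hf : Function.Injective f)
    {γ : Weight 𝔥} {m : M} (hm : f m ∈ weightSpace 𝔥 A M' γ) : m ∈ weightSpace 𝔥 A M γ :=
  fun H => hf (by rw [map_smul, hm H, env_map_smul])

/-- The image is stable under ĥ, so it contains the weight components of its elements. -/
theorem iSup_weightSpace_eq_top_of_injective (h : ⨆ lam, weightSpace 𝔥 A M' lam = ⊤)
    (f : M →ₗ[Env 𝔤 A] M') (hf : Function.Injective f) :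
    ⨆ lam, weightSpace 𝔥 A M lam = ⊤ := by
  rw [eq_top_iff]
  rintro m -
  obtain ⟨s, g, hs, hg⟩ := exists_sum_weight h (f m)
  have h1 := mem_of_sum_weight_mem (N := LinearMap.range (f.restrictScalars A))
    (by
      rintro H - ⟨y, rfl⟩
      exact ⟨act A (cartanIncl H) • y, map_smul f _ _⟩) s g (fun γ _ => hg γ)
    (hs ▸ ⟨m, rfl⟩)
  choose! y hy using h1
  have h2 : m = ∑ γ ∈ s, y γ := hf (by
    rw [hs, map_sum]
    exact Finset.sum_congr rfl fun γ hγ => (hy γ hγ).symm)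
  rw [h2]
  refine sum_mem fun γ hγ => Submodule.mem_iSup_of_mem γ (mem_weightSpace_of_injective f hf ?_)
  rw [show f (y γ) = g γ from hy γ hγ]
  exact hg γ

variable [IsNoetherianRing A]

/-- The preimage of a finitely generated b̂-stable submodule embeds into it, and is finitely
generated because A is Noetherian. -/
theorem IsInTruncatedO.of_injective {J : Set (Weight 𝔥)} (h : IsInTruncatedO 𝔥 𝔟 A M' J)
    (f : M →ₗ[Env 𝔤 A] M') (hf : Function.Injective f) : IsInTruncatedO 𝔥 𝔟 A M J where
  indep := iSupIndep_weightSpace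
  iSup_eq_top := iSup_weightSpace_eq_top_of_injective h.iSup_eq_top f hf
  locallyFinite m := by
    obtain ⟨N, hN, hfg, hst⟩ := h.locallyFinite (f m)
    refine ⟨N.comap (f.restrictScalars A), hN, ?_, fun X hX n hn => ?_⟩
    · have : Module.Finite A N := Module.Finite.iff_fg.mpr hfg
      let g : N.comap (f.restrictScalars A) →ₗ[A] N := (f.restrictScalars A).restrict fun x hx => hx
      have hg : Function.Injective g := fun x y hxy =>
        Subtype.ext (hf (congrArg Subtype.val hxy))
      exact Module.Finite.iff_fg.mp (Module.Finite.of_injective g hg)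
    · change f (act A X • n) ∈ N
      rw [map_smul]
      exact hst X hX _ hn
  mem_of_weightSpace_ne_bot γ hγ := by
    refine h.mem_of_weightSpace_ne_bot γ fun h0 => hγ ?_
    rw [eq_bot_iff]
    intro m hm
    have := map_mem_weightSpace f hm
    rw [h0, Submodule.mem_bot] at this
    exact (Submodule.mem_bot A).mpr (hf (this.trans (map_zero f).symm))

omit [IsNoetherianRing A] in
theorem IsInTruncatedO.of_surjective {J : Set (Weight 𝔥)} (h : IsInTruncatedO 𝔥 𝔟 A M J)
    (f : M →ₗ[Env 𝔤 A] M') (hf : Function.Surjective f) : IsInTruncatedO 𝔥 𝔟 A M' J where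
  indep := iSupIndep_weightSpace
  iSup_eq_top := iSup_weightSpace_eq_top_of_surjective h.iSup_eq_top f hf
  locallyFinite m' := by
    obtain ⟨m, rfl⟩ := hf m'
    obtain ⟨N, hN, hfg, hst⟩ := h.locallyFinite m
    refine ⟨N.map (f.restrictScalars A), ⟨m, hN, rfl⟩, hfg.map _, ?_⟩
    rintro X hX - ⟨n, hn, rfl⟩
    exact ⟨act A X • n, hst X hX n hn, map_smul f _ _⟩
  mem_of_weightSpace_ne_bot γ hγ := by
    refine h.mem_of_weightSpace_ne_bot γ fun h0 => hγ ?_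
    rw [eq_bot_iff]
    intro m' hm'
    obtain ⟨m, hm, rfl⟩ := exists_weight_lift h.iSup_eq_top f hf hm'
    rw [h0, Submodule.mem_bot] at hm
    rw [hm, map_zero]
    exact zero_mem _

end WeightModules

/-! ### A Borel subalgebra is the nonnegative part of an integral grading -/

section Borel

open LieAlgebra LieAlgebra.IsKilling LieModule

variable {𝔤 : Type u} [LieRing 𝔤] [LieAlgebra ℂ 𝔤] [FiniteDimensional ℂ 𝔤]
  [LieAlgebra.IsSimple ℂ 𝔤] {𝔥 : LieSubalgebra ℂ 𝔤} [𝔥.IsCartanSubalgebra]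

theorem mem_rootSpace_iff {χ : 𝔥 → ℂ} {x : 𝔤} :
    x ∈ rootSpace 𝔥 χ ↔ ∀ h : 𝔥, ⁅(h : 𝔤), x⁆ = χ h • x := by
  refine ⟨fun hx h => lie_eq_smul_of_mem_rootSpace hx h, fun hx => ?_⟩
  refine LieModule.weightSpace_le_genWeightSpace 𝔤 χ ?_
  rw [LieModule.mem_weightSpace]
  exact hx

/-- A subspace stable under the Cartan subalgebra is the sum of its weight spaces. -/
theorem exists_sum_rootSpace {V : Submodule ℂ 𝔤} (hV : ∀ h ∈ 𝔥, ∀ x ∈ V, ⁅h, x⁆ ∈ V) {x : 𝔤}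
    (hx : x ∈ V) : ∃ (s : Finset (LieModule.Weight ℂ 𝔥 𝔤)) (f : LieModule.Weight ℂ 𝔥 𝔤 → 𝔤),
      x = ∑ χ ∈ s, f χ ∧ ∀ χ ∈ s, f χ ∈ rootSpace 𝔥 χ ∧ f χ ∈ V := by
  have h5 := congrArg LieSubmodule.toSubmodule (iSup_genWeightSpace_eq_top' ℂ 𝔥 𝔤)
  rw [LieSubmodule.top_toSubmodule, LieSubmodule.iSup_toSubmodule] at h5
  have h6 : x ∈ Submodule.span ℂ {z | ∃ χ : LieModule.Weight ℂ 𝔥 𝔤,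
      (∀ h : 𝔥, (ad ℂ 𝔤 (h : 𝔤)) z = χ h • z) ∧ True} := by
    have h7 : x ∈ (⊤ : Submodule ℂ 𝔤) := trivial
    rw [← h5] at h7
    refine (iSup_le fun χ z hz => ?_ : ⨆ χ : LieModule.Weight ℂ 𝔥 𝔤,
      (genWeightSpace 𝔤 χ).toSubmodule ≤ _) h7
    exact Submodule.subset_span ⟨χ, mem_rootSpace_iff.mp hz, trivial⟩
  obtain ⟨s, f, hs, hf, -⟩ := exists_sum_of_mem_span (θ := fun h : 𝔥 => ad ℂ 𝔤 (h : 𝔤))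
    (c := fun (χ : LieModule.Weight ℂ 𝔥 𝔤) h => χ h) h6
  refine ⟨s, f, hs, fun χ hχ => ⟨mem_rootSpace_iff.mpr (hf χ), ?_⟩⟩
  refine mem_of_sum_mem (θ := fun h : 𝔥 => ad ℂ 𝔤 (h : 𝔤))
    (c := fun (χ : LieModule.Weight ℂ 𝔥 𝔤) h => χ h) ?_ (fun h x hx => hV h h.2 x hx) s f
    (fun χ _ => hf χ) (hs ▸ hx) χ hχ
  intro χ χ' hne
  by_contra! h
  refine hne (DFunLike.coe_injective (funext fun i => ?_))
  by_contra h'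
  exact h i (IsUnit.mk0 _ (sub_ne_zero.mpr h'))

theorem rootSpace_le_of_mem {χ : LieModule.Weight ℂ 𝔥 𝔤} (hχ : χ.IsNonZero) {V : Submodule ℂ 𝔤}
    {x : 𝔤} (hx : x ∈ rootSpace 𝔥 χ) (hx0 : x ≠ 0) (hxV : x ∈ V) :
    (rootSpace 𝔥 χ).toSubmodule ≤ V := by
  intro y hy
  obtain ⟨c, hc⟩ : ∃ c : ℂ, c • (⟨x, hx⟩ : rootSpace 𝔥 χ) = ⟨y, hy⟩ :=
    (finrank_eq_one_iff_of_nonzero' _ (by simpa [LieSubmodule.mk_eq_zero] using hx0)).mp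
      (finrank_rootSpace_eq_one χ hχ) _
  rw [show y = c • x from (congrArg Subtype.val hc).symm]
  exact V.smul_mem _ hxV

section Solvable

variable (𝔥)

/-- The eigenspace of the adjoint action of `w`. -/
def adEigen (w : 𝔥) (n : ℕ) : Submodule ℂ 𝔤 := (ad ℂ 𝔤 (w : 𝔤)).eigenspace (n : ℂ)

variable {𝔥}

theorem mem_adEigen {w : 𝔥} {n : ℕ} {x : 𝔤} : x ∈ adEigen 𝔥 w n ↔ ⁅(w : 𝔤), x⁆ = (n : ℂ) • x := by
  rw [adEigen, Module.End.mem_eigenspace_iff, ad_apply]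

theorem cartan_lie_cartan (h h' : 𝔥) : ⁅(h : 𝔤), (h' : 𝔤)⁆ = 0 := by
  rw [← LieSubalgebra.coe_bracket, trivial_lie_zero, ZeroMemClass.coe_zero]

/-- The sum of the eigenspaces of `w` with eigenvalue at least `k`. -/
def adFilt (w : 𝔥) (k : ℕ) : Submodule ℂ 𝔤 := ⨆ n : ℕ, ⨆ (_ : k ≤ n), adEigen 𝔥 w n

theorem adFilt_induction {w : 𝔥} {k : ℕ} {V : Submodule ℂ 𝔤}
    (h : ∀ n, k ≤ n → ∀ x, ⁅(w : 𝔤), x⁆ = (n : ℂ) • x → x ∈ V) : adFilt w k ≤ V :=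
  iSup₂_le fun n hn x hx => h n hn x (mem_adEigen.mp hx)

theorem mem_adFilt {w : 𝔥} {k n : ℕ} (hn : k ≤ n) {x : 𝔤} (hx : ⁅(w : 𝔤), x⁆ = (n : ℂ) • x) :
    x ∈ adFilt w k :=
  Submodule.mem_iSup_of_mem n (Submodule.mem_iSup_of_mem hn (mem_adEigen.mpr hx))

theorem adFilt_lie {w : 𝔥} {k l : ℕ} {x y : 𝔤} (hx : x ∈ adFilt w k) (hy : y ∈ adFilt w l) :
    ⁅x, y⁆ ∈ adFilt w (k + l) := by
  have h1 : adFilt w k ≤ ((adFilt w (k + l)).comap ((ad ℂ 𝔤 : 𝔤 →ₗ[ℂ] 𝔤 →ₗ[ℂ] 𝔤).flip y)) := by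
    refine adFilt_induction fun n hn x hx => ?_
    have h2 : adFilt w l ≤ ((adFilt w (k + l)).comap (ad ℂ 𝔤 x)) := by
      refine adFilt_induction fun m hm y hy => ?_
      refine mem_adFilt (n := n + m) (by omega) ?_
      rw [ad_apply, leibniz_lie, hx, hy, smul_lie, lie_smul, ← add_smul]
      push_cast; rfl
    exact h2 hy
  exact h1 hx

theorem cartan_lie_adFilt {w : 𝔥} {k : ℕ} (h : 𝔥) {x : 𝔤} (hx : x ∈ adFilt w k) :
    ⁅(h : 𝔤), x⁆ ∈ adFilt w k := by
  have := adFilt_lie (k := 0) (mem_adFilt le_rfl (x := (h : 𝔤)) (by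
    rw [cartan_lie_cartan, Nat.cast_zero, zero_smul])) hx
  rwa [zero_add] at this

theorem adFilt_antitone (w : 𝔥) {k l : ℕ} (h : k ≤ l) : adFilt w l ≤ adFilt w k :=
  iSup₂_le fun n hn => le_iSup₂_of_le n (h.trans hn) le_rfl

theorem sup_adFilt_lie {w : 𝔥} {x y : 𝔤} (hx : x ∈ 𝔥.toSubmodule ⊔ adFilt w 1)
    (hy : y ∈ 𝔥.toSubmodule ⊔ adFilt w 1) : ⁅x, y⁆ ∈ adFilt w 1 := by
  obtain ⟨h, hh, x', hx', hx⟩ := Submodule.mem_sup.mp hx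
  obtain ⟨h', hh', y', hy', hy⟩ := Submodule.mem_sup.mp hy
  have e1 : ⁅h, h'⁆ = 0 := cartan_lie_cartan ⟨h, hh⟩ ⟨h', hh'⟩
  have e2 : ⁅h, y'⁆ ∈ adFilt w 1 := cartan_lie_adFilt ⟨h, hh⟩ hy'
  have e3 : ⁅h', x'⁆ ∈ adFilt w 1 := cartan_lie_adFilt ⟨h', hh'⟩ hx'
  have e4 : ⁅x', y'⁆ ∈ adFilt w 1 := adFilt_antitone w (Nat.le_add_left 1 1) (adFilt_lie hx' hy')
  have e5 : ⁅x, y⁆ = ⁅h, y'⁆ + (-⁅h', x'⁆ + ⁅x', y'⁆) := by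
    rw [← hx, ← hy, add_lie, lie_add, lie_add, e1, zero_add, lie_skew]
  rw [e5]
  exact add_mem e2 (add_mem (neg_mem e3) e4)

/-- The subalgebra `𝔥 ⊕ ⨁_{n > 0} 𝔤_n`, where `𝔤_n` is the eigenspace of `w`. -/
def eigenBorel (w : 𝔥) : LieSubalgebra ℂ 𝔤 where
  __ := 𝔥.toSubmodule ⊔ adFilt w 1
  lie_mem' hx hy := Submodule.mem_sup_right (sup_adFilt_lie hx hy)

theorem exists_adFilt_eq_bot (w : 𝔥) : ∃ k, adFilt w (k + 1) = ⊥ := by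
  have hfin : {c : ℂ | (ad ℂ 𝔤 (w : 𝔤)).HasEigenvalue c}.Finite :=
    Module.End.finite_hasEigenvalue _
  obtain ⟨k, hk⟩ : ∃ k : ℕ, ∀ n : ℕ, (ad ℂ 𝔤 (w : 𝔤)).HasEigenvalue (n : ℂ) → n ≤ k := by
    have h1 : {n : ℕ | (ad ℂ 𝔤 (w : 𝔤)).HasEigenvalue (n : ℂ)}.Finite :=
      hfin.preimage Nat.cast_injective.injOn
    obtain ⟨k, hk⟩ := h1.bddAbove
    exact ⟨k, fun n hn => hk hn⟩
  refine ⟨k, ?_⟩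
  rw [eq_bot_iff]
  refine iSup₂_le fun n hn => ?_
  by_contra h
  have := hk n (fun h' => h (le_of_eq h'))
  omega

/-- The first derived algebra lies in the eigenspaces with eigenvalue at least 1. Each further
derivation raises this bound by at least 1, and ad w has only finitely many eigenvalues. -/
theorem isSolvable_eigenBorel (w : 𝔥) : LieAlgebra.IsSolvable (eigenBorel w) := by
  have key (k : ℕ) : ∀ x ∈ derivedSeries ℂ (eigenBorel w) (k + 1), (x : 𝔤) ∈ adFilt w (k + 1) := by
    induction k with
    | zero =>
      intro x hx
      rw [derivedSeries_def, derivedSeriesOfIdeal_succ, derivedSeriesOfIdeal_zero,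
        ← LieSubmodule.mem_toSubmodule, LieSubmodule.lieIdeal_oper_eq_linear_span'] at hx
      induction hx using Submodule.span_induction with
      | mem x h =>
        obtain ⟨x, -, y, -, rfl⟩ := h
        exact sup_adFilt_lie x.2 y.2
      | zero => exact zero_mem _
      | add x y _ _ hx hy => exact add_mem hx hy
      | smul c x _ hx => exact Submodule.smul_mem _ c hx
    | succ k ih =>
      intro x hx
      rw [derivedSeries_def, derivedSeriesOfIdeal_succ,
        ← LieSubmodule.mem_toSubmodule, LieSubmodule.lieIdeal_oper_eq_linear_span'] at hx
      induction hx using Submodule.span_induction with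
      | mem x h =>
        obtain ⟨x, hx, y, hy, rfl⟩ := h
        have := adFilt_lie (ih x hx) (ih y hy)
        exact adFilt_antitone w (by omega) this
      | zero => exact zero_mem _
      | add x y _ _ hx hy => exact add_mem hx hy
      | smul c x _ hx => exact Submodule.smul_mem _ c hx
  obtain ⟨k, hk⟩ := exists_adFilt_eq_bot w
  refine LieAlgebra.IsSolvable.mk (R := ℂ) (k := k + 1) ?_
  rw [LieSubmodule.eq_bot_iff]
  intro x hx
  have := key k x hx
  rw [hk, Submodule.mem_bot] at this
  exact Subtype.ext this

end Solvable

section BorelRoots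

variable {𝔟 : LieSubalgebra ℂ 𝔤}

/-- A solvable subalgebra does not contain two opposite root spaces. -/
theorem not_rootSpace_neg_le [LieAlgebra.IsSolvable 𝔟] {χ : LieModule.Weight ℂ 𝔥 𝔤} (hχ : χ.IsNonZero)
    (h1 : (rootSpace 𝔥 χ).toSubmodule ≤ 𝔟.toSubmodule)
    (h2 : (rootSpace 𝔥 (-χ)).toSubmodule ≤ 𝔟.toSubmodule) : False := by
  obtain ⟨h, e, f, t, he, hf⟩ := exists_isSl2Triple_of_weight_isNonZero hχ
  have he' : e ∈ 𝔟 := h1 he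
  have hf' : f ∈ 𝔟 := h2 hf
  have hh' : h ∈ 𝔟 := by rw [← t.lie_e_f]; exact 𝔟.lie_mem he' hf'
  -- Up to scalars each of e, f, h is a bracket of two members of the triple, so the triple survives
  -- in every term of the derived series.
  have key (k : ℕ) : (⟨e, he'⟩ : 𝔟) ∈ derivedSeries ℂ 𝔟 k ∧ (⟨f, hf'⟩ : 𝔟) ∈ derivedSeries ℂ 𝔟 k ∧
      (⟨h, hh'⟩ : 𝔟) ∈ derivedSeries ℂ 𝔟 k := by
    induction k with
    | zero => exact ⟨trivial, trivial, trivial⟩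
    | succ k ih =>
      obtain ⟨i1, i2, i3⟩ := ih
      rw [derivedSeries_def, derivedSeriesOfIdeal_succ]
      refine ⟨?_, ?_, ?_⟩
      · have h3 := LieSubmodule.lie_mem_lie i3 i1
        have h4 : (⟨e, he'⟩ : 𝔟) = (2⁻¹ : ℂ) • ⁅(⟨h, hh'⟩ : 𝔟), (⟨e, he'⟩ : 𝔟)⁆ := by
          refine Subtype.ext ?_
          change e = (2⁻¹ : ℂ) • ⁅h, e⁆
          rw [t.lie_h_e_nsmul, ← Nat.cast_smul_eq_nsmul ℂ, smul_smul]; norm_num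
        rw [h4]
        exact SMulMemClass.smul_mem _ h3
      · have h3 := LieSubmodule.lie_mem_lie i3 i2
        have h4 : (⟨f, hf'⟩ : 𝔟) = (-2⁻¹ : ℂ) • ⁅(⟨h, hh'⟩ : 𝔟), (⟨f, hf'⟩ : 𝔟)⁆ := by
          refine Subtype.ext ?_
          change f = (-2⁻¹ : ℂ) • ⁅h, f⁆
          rw [t.lie_h_f_nsmul, ← Nat.cast_smul_eq_nsmul ℂ, smul_neg, smul_smul]; norm_num
        rw [h4]
        exact SMulMemClass.smul_mem _ h3
      · have h3 := LieSubmodule.lie_mem_lie i1 i2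
        have h4 : (⟨h, hh'⟩ : 𝔟) = ⁅(⟨e, he'⟩ : 𝔟), (⟨f, hf'⟩ : 𝔟)⁆ := Subtype.ext t.lie_e_f.symm
        rw [h4]
        exact h3
  obtain ⟨k, hk⟩ := LieAlgebra.IsSolvable.solvable (R := ℂ) (L := 𝔟)
  have := (key k).1
  rw [hk, LieSubmodule.mem_bot] at this
  exact t.e_ne_zero (congrArg Subtype.val this)

theorem rootSpace_add_le {α β γ : LieModule.Weight ℂ 𝔥 𝔤} (hα : α.IsNonZero) (hβ : β.IsNonZero)
    (hγ : γ.IsNonZero) (h : (γ : 𝔥 → ℂ) = α + β)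
    (h1 : (rootSpace 𝔥 α).toSubmodule ≤ 𝔟.toSubmodule)
    (h2 : (rootSpace 𝔥 β).toSubmodule ≤ 𝔟.toSubmodule) :
    (rootSpace 𝔥 γ).toSubmodule ≤ 𝔟.toSubmodule := by
  obtain ⟨x, hx, hx0⟩ := α.exists_ne_zero
  obtain ⟨y, hy, hy0⟩ := β.exists_ne_zero
  exact rootSpace_le_of_mem hγ (h ▸ lie_mem_genWeightSpace_of_mem_genWeightSpace hx hy)
    (exists_lie_ne_zero_aux hα hβ h hx hx0 hy hy0) (𝔟.lie_mem (h1 hx) (h2 hy))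

variable (𝔥 𝔟) in
/-- The roots whose root spaces are contained in `𝔟`. -/
def borelRoots : Set 𝔥.root :=
  {i | (rootSpace 𝔥 (i : LieModule.Weight ℂ 𝔥 𝔤)).toSubmodule ≤ 𝔟.toSubmodule}

/-- The reflected root is j + k i with k = -⟨j, i^∨⟩ > 0. The i-string through j is unbroken, and
each step up adds a root of 𝔟, so it stays in 𝔟. The string cannot meet 0, since then the opposite
root spaces of i and -i would both lie in the solvable 𝔟. -/
theorem reflectionPerm_mem_borelRoots [LieAlgebra.IsSolvable 𝔟] {i j : 𝔥.root}
    (hi : i ∈ borelRoots 𝔥 𝔟) (hj : j ∈ borelRoots 𝔥 𝔟)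
    (hij : (rootSystem 𝔥).pairingIn ℤ j i < 0) :
    (rootSystem 𝔥).reflectionPerm i j ∈ borelRoots 𝔥 𝔟 := by
  have hnz (i : 𝔥.root) : (i : LieModule.Weight ℂ 𝔥 𝔤).IsNonZero := 𝔥.isNonZero_coe_root i
  set P := rootSystem 𝔥
  obtain ⟨k, hk⟩ := Int.exists_eq_neg_ofNat hij.le
  set r := P.reflectionPerm i j with hr
  have hrk : ((r : LieModule.Weight ℂ 𝔥 𝔤) : 𝔥 → ℂ) =
      (k : ℤ) • ((i : LieModule.Weight ℂ 𝔥 𝔤) : 𝔥 → ℂ) + (j : LieModule.Weight ℂ 𝔥 𝔤) := by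
    have h1 : P.root r = P.root j - P.pairing j i • P.root i := by
      rw [hr, RootPairing.root_reflectionPerm, RootPairing.reflection_apply_root]
    have h2 : P.pairing j i = -(k : ℂ) := by
      rw [← P.algebraMap_pairingIn ℤ, hk]; simp
    rw [h2] at h1
    ext x
    have h3 := LinearMap.congr_fun h1 x
    simp only [neg_smul, sub_neg_eq_add, LinearMap.add_apply, LinearMap.smul_apply,
      smul_eq_mul] at h3
    simp only [Pi.add_apply, zsmul_eq_mul, Int.cast_natCast]
    rw [add_comm]
    exact h3
  have key (m : ℕ) (hm : m ≤ k) : ∃ l ∈ borelRoots 𝔥 𝔟, ((l : LieModule.Weight ℂ 𝔥 𝔤) : 𝔥 → ℂ) =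
      (m : ℤ) • ((i : LieModule.Weight ℂ 𝔥 𝔤) : 𝔥 → ℂ) + (j : LieModule.Weight ℂ 𝔥 𝔤) := by
    induction m with
    | zero => exact ⟨j, hj, by simp⟩
    | succ m ih =>
      obtain ⟨l, hl, hlm⟩ := ih (by omega)
      have h0 := (rootSpace_zsmul_add_ne_bot_iff (i : LieModule.Weight ℂ 𝔥 𝔤)
        (j : LieModule.Weight ℂ 𝔥 𝔤) (hnz i) (k : ℤ)).mp
          (by rw [← hrk]; exact (r : LieModule.Weight ℂ 𝔥 𝔤).genWeightSpace_ne_bot)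
      have h1 := (rootSpace_zsmul_add_ne_bot_iff (i : LieModule.Weight ℂ 𝔥 𝔤)
        (j : LieModule.Weight ℂ 𝔥 𝔤) (hnz i) ((m + 1 : ℕ) : ℤ)).mpr (by omega)
      set χ : LieModule.Weight ℂ 𝔥 𝔤 := ⟨_, h1⟩ with hχ
      have h2 : (χ : 𝔥 → ℂ) = (i : LieModule.Weight ℂ 𝔥 𝔤) + (l : LieModule.Weight ℂ 𝔥 𝔤) := by
        rw [hlm, hχ]
        change ((m + 1 : ℕ) : ℤ) • ((i : LieModule.Weight ℂ 𝔥 𝔤) : 𝔥 → ℂ) + _ = _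
        push_cast
        rw [add_smul, one_smul]
        abel
      by_cases h3 : χ.IsNonZero
      · exact ⟨⟨χ, by simpa using h3⟩, rootSpace_add_le (hnz i) (hnz l) h3 h2 hi hl, rfl⟩
      · exfalso
        rw [LieModule.Weight.IsNonZero, not_not] at h3
        have h4 : (l : LieModule.Weight ℂ 𝔥 𝔤) = -(i : LieModule.Weight ℂ 𝔥 𝔤) := by
          refine DFunLike.coe_injective ?_
          rw [LieModule.Weight.coe_neg]
          refine (neg_eq_of_add_eq_zero_right ?_).symm
          rw [← h2]
          exact h3
        refine not_rootSpace_neg_le (hnz i) hi (𝔟 := 𝔟) ?_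
        rw [← LieModule.Weight.coe_neg, ← h4]
        exact hl
  obtain ⟨l, hl, hlk⟩ := key k le_rfl
  rw [← hrk] at hlk
  have : l = r := Subtype.ext (DFunLike.coe_injective hlk)
  rwa [← this]

/-- The element w is the sum of the coroots j^∨ over the roots j of 𝔟. Let i be a root of 𝔟. If ⟨i,
j^∨⟩ is negative, the term of j is cancelled by that of s_i(j), which belongs to 𝔟 by
`reflectionPerm_mem_borelRoots`. The term of j = i contributes 2 and is not used up in this
cancellation. -/
theorem exists_borel_pos [LieAlgebra.IsSolvable 𝔟] : ∃ w : 𝔥, ∀ i : 𝔥.root, ∃ n : ℤ,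
    (i : LieModule.Weight ℂ 𝔥 𝔤) w = n ∧ (i ∈ borelRoots 𝔥 𝔟 → 0 < n) := by
  classical
  have hnz (i : 𝔥.root) : (i : LieModule.Weight ℂ 𝔥 𝔤).IsNonZero := 𝔥.isNonZero_coe_root i
  set P := rootSystem 𝔥
  let S : Finset 𝔥.root := {i | i ∈ borelRoots 𝔥 𝔟}
  refine ⟨∑ j ∈ S, P.coroot j, fun i => ⟨∑ j ∈ S, P.pairingIn ℤ i j, ?_, fun hi => ?_⟩⟩
  · have h1 : P.toLinearMap (P.root i) (∑ j ∈ S, P.coroot j) = ∑ j ∈ S, P.pairing i j := by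
      rw [map_sum]
      rfl
    have h2 : P.toLinearMap (P.root i) (∑ j ∈ S, P.coroot j) =
      (i : LieModule.Weight ℂ 𝔥 𝔤) (∑ j ∈ S, P.coroot j) := rfl
    rw [← h2, h1, Int.cast_sum]
    refine Finset.sum_congr rfl fun j _ => ?_
    rw [← P.algebraMap_pairingIn ℤ]
    rfl
  · let T : Finset 𝔥.root := {j ∈ S | P.pairingIn ℤ i j < 0}
    have hσ (j) : P.pairingIn ℤ i (P.reflectionPerm i j) = -P.pairingIn ℤ i j := by
      apply (algebraMap ℤ ℂ).injective_int
      rw [map_neg, P.algebraMap_pairingIn, P.algebraMap_pairingIn, P.pairing_reflectionPerm,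
        P.pairing_reflectionPerm_self_left]
    have hT {j} (hj : j ∈ T) : j ∈ S ∧ P.pairingIn ℤ i j < 0 := by simpa [T] using hj
    have hTσ {j} (hj : j ∈ T) : P.reflectionPerm i j ∈ S := by
      obtain ⟨h1, h2⟩ := hT hj
      have h3 : P.pairingIn ℤ j i < 0 := (P.pairingIn_lt_zero_iff ℤ).mp h2
      have h1' : j ∈ borelRoots 𝔥 𝔟 := by simpa [S] using h1
      simpa [S] using reflectionPerm_mem_borelRoots hi h1' h3
    -- If i = s_i(j), then j = -i, and 𝔟 would contain two opposite root spaces.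
    have hi' : i ∉ T.image (P.reflectionPerm i) := by
      intro h
      obtain ⟨j, hj, hji⟩ := Finset.mem_image.mp h
      have h1' : j ∈ borelRoots 𝔥 𝔟 := by simpa [S] using (hT hj).1
      have h4 : j = P.reflectionPerm i i := by
        rw [← congrArg (P.reflectionPerm i) hji, P.reflectionPerm_self]
      have h5 : ((j : 𝔥.root) : LieModule.Weight ℂ 𝔥 𝔤) = -i := by
        have : P.root (P.reflectionPerm i i) = -P.root i := by
          rw [RootPairing.root_reflectionPerm, RootPairing.reflection_apply_self]
        rw [← h4] at this
        apply DFunLike.coe_injective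
        ext x
        exact LinearMap.congr_fun this x
      refine not_rootSpace_neg_le (hnz i) hi (𝔟 := 𝔟) ?_
      rw [← LieModule.Weight.coe_neg, ← h5]
      exact h1'
    have hsub : insert i (T.image (P.reflectionPerm i)) ⊆ S \ T := by
      intro j hj
      rw [Finset.mem_insert] at hj
      rw [Finset.mem_sdiff]
      rcases hj with rfl | hj
      · refine ⟨by simpa [S] using hi, fun h => ?_⟩
        have := (hT h).2
        rw [P.pairingIn_same] at this
        omega
      · obtain ⟨j, hj', rfl⟩ := Finset.mem_image.mp hj
        refine ⟨hTσ hj', fun h => ?_⟩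
        have h6 := (hT h).2
        have h7 := (hT hj').2
        rw [hσ] at h6
        omega
    have hTS : T ⊆ S := Finset.filter_subset _ _
    have h8 : ∑ j ∈ insert i (T.image (P.reflectionPerm i)), P.pairingIn ℤ i j ≤
        ∑ j ∈ S \ T, P.pairingIn ℤ i j := by
      refine Finset.sum_le_sum_of_subset_of_nonneg hsub fun j hj _ => ?_
      rw [Finset.mem_sdiff] at hj
      by_contra! h
      exact hj.2 (by simp only [T, Finset.mem_filter]; exact ⟨hj.1, h⟩)
    rw [Finset.sum_insert hi', Finset.sum_image (P.reflectionPerm i).injective.injOn,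
      P.pairingIn_same] at h8
    simp only [hσ, Finset.sum_neg_distrib] at h8
    rw [← Finset.sum_sdiff hTS]
    omega

theorem borel_le_eigenBorel (h𝔥𝔟 : 𝔥 ≤ 𝔟) {w : 𝔥} (hw : ∀ i ∈ borelRoots 𝔥 𝔟, ∃ n : ℕ, 0 < n ∧
    (i : LieModule.Weight ℂ 𝔥 𝔤) w = n) : 𝔟 ≤ eigenBorel w := by
  intro x hx
  obtain ⟨s, f, rfl, hf⟩ := exists_sum_rootSpace (𝔥 := 𝔥) (V := 𝔟.toSubmodule)
    (fun h hh x hx => 𝔟.lie_mem (h𝔥𝔟 hh) hx) hx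
  refine sum_mem fun χ hχ => ?_
  obtain ⟨h1, h2⟩ := hf χ hχ
  by_cases h0 : f χ = 0
  · rw [h0]; exact zero_mem _
  by_cases h3 : χ.IsZero
  · refine Submodule.mem_sup_left (?_ : f χ ∈ 𝔥.toSubmodule)
    rw [h3.eq, rootSpace_zero_eq] at h1
    exact h1
  · obtain ⟨n, hn, hn'⟩ := hw ⟨χ, by simpa using h3⟩ (rootSpace_le_of_mem h3 h1 h0 h2)
    refine Submodule.mem_sup_right (mem_adFilt (n := n) hn ?_)
    rw [mem_rootSpace_iff.mp h1]
    exact congrArg (· • f χ) hn'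

/-- If w' is integral on roots and positive on those of 𝔟, then 𝔥 together with the positive
eigenspaces of w' is a solvable algebra containing 𝔟, so it equals 𝔟 by maximality. Hence the roots
of 𝔟 are exactly the roots that are positive on w'. This freedom in the choice of w' also excludes
roots that vanish on w. -/
theorem exists_borel_grading (h𝔟 : IsBorel 𝔟) (h𝔥𝔟 : 𝔥 ≤ 𝔟) : ∃ w : 𝔥, ∀ i : 𝔥.root, ∃ n : ℤ,
    (i : LieModule.Weight ℂ 𝔥 𝔤) w = n ∧ n ≠ 0 ∧ (i ∈ borelRoots 𝔥 𝔟 ↔ 0 < n) := by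
  classical
  have hsolv : LieAlgebra.IsSolvable 𝔟 := h𝔟.1
  obtain ⟨w, hw⟩ := exists_borel_pos (𝔥 := 𝔥) (𝔟 := 𝔟)
  choose n hn hn' using hw
  have hmax (w' : 𝔥) (n' : 𝔥.root → ℤ) (h1 : ∀ i : 𝔥.root, (i : LieModule.Weight ℂ 𝔥 𝔤) w' = n' i)
      (h2 : ∀ i ∈ borelRoots 𝔥 𝔟, 0 < n' i) (i : 𝔥.root) (hi : 0 < n' i) : i ∈ borelRoots 𝔥 𝔟 := by
    have h3 : 𝔟 ≤ eigenBorel w' := borel_le_eigenBorel h𝔥𝔟 fun i hi =>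
      ⟨(n' i).toNat, by have := h2 i hi; omega, by
        rw [h1, ← Int.cast_natCast, Int.toNat_of_nonneg (h2 i hi).le]⟩
    have h4 := h𝔟.2 (isSolvable_eigenBorel w') h3
    intro x hx
    refine h4 (Submodule.mem_sup_right (mem_adFilt (n := (n' i).toNat) (by omega) ?_))
    rw [mem_rootSpace_iff.mp hx, h1, ← Int.cast_natCast, Int.toNat_of_nonneg hi.le]
  have h1 (i) : i ∈ borelRoots 𝔥 𝔟 ↔ 0 < n i := ⟨hn' i, hmax w n hn hn' i⟩
  refine ⟨w, fun i => ⟨n i, hn i, fun h0 => ?_, h1 i⟩⟩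
  set P := rootSystem 𝔥
  obtain ⟨N, hN⟩ : ∃ N : ℕ, ∀ j, |P.pairingIn ℤ j i| < N := by
    refine ⟨∑ j, (P.pairingIn ℤ j i).natAbs + 1, fun j => ?_⟩
    rw [Int.abs_eq_natAbs]
    have := Finset.single_le_sum (f := fun j => (P.pairingIn ℤ j i).natAbs)
      (fun _ _ => Nat.zero_le _) (Finset.mem_univ j)
    omega
  -- Perturbation: if i vanishes on w, then N w + i^∨ takes the value 2 on i. It stays positive on
  -- the roots of 𝔟, because N exceeds every |⟨j, i^∨⟩|. So i would be a root of 𝔟, against the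
  -- vanishing.
  have h3 := hmax ((N : ℂ) • w + P.coroot i) (fun j => N * n j + P.pairingIn ℤ j i)
    (fun j => by
      have h5 : (j : LieModule.Weight ℂ 𝔥 𝔤) ((N : ℂ) • w + P.coroot i) =
          (N : ℂ) * (j : LieModule.Weight ℂ 𝔥 𝔤) w + P.pairing j i := by
        have := map_add (P.toLinearMap (P.root j)) ((N : ℂ) • w) (P.coroot i)
        rw [map_smul] at this
        exact this
      rw [h5, hn, ← P.algebraMap_pairingIn ℤ]
      push_cast
      rfl)
    (fun j hj => by
      have h6 := (h1 j).mp hj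
      have h7 := neg_lt_of_abs_lt (hN j)
      nlinarith)
    i (by rw [h0, P.pairingIn_same]; norm_num)
  have := hn' i h3
  omega

end BorelRoots

end Borel

/-! ### Affine root spaces and the affine grading element -/

section Grading

variable {𝔤 : Type u} [LieRing 𝔤] [LieAlgebra ℂ 𝔤] (𝔥 𝔟 : LieSubalgebra ℂ 𝔤)

/-- The root space of the affine Kac–Moody algebra for the weight `β`. -/
def rootSpaceHat (β : Weight 𝔥) : Submodule ℂ (Affine 𝔤) where
  carrier := {X | ∀ H : CartanHat 𝔥, ⁅cartanIncl H, X⁆ = β H • X}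
  add_mem' hX hY H := by rw [lie_add, smul_add, hX H, hY H]
  zero_mem' H := by rw [lie_zero, smul_zero]
  smul_mem' c X hX H := by rw [lie_smul, hX H, smul_comm]

/-- An element of the affine Cartan subalgebra that defines an integral grading with finite
dimensional pieces and with the affine Cartan subalgebra as piece of degree zero. -/
structure IsGrading (a : CartanHat 𝔥) : Prop where
  integral : ∀ β : Weight 𝔥, rootSpaceHat 𝔥 β ≠ ⊥ → ∃ n : ℤ, β a = (n : ℂ)
  eq_zero : ∀ β : Weight 𝔥, rootSpaceHat 𝔥 β ≠ ⊥ → β a = 0 → β = 0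
  cartan : ∀ X ∈ rootSpaceHat 𝔥 0, ∃ H : CartanHat 𝔥, X = cartanIncl H
  iSup_eq_top : ⨆ β : Weight 𝔥, rootSpaceHat 𝔥 β = ⊤
  finite : ∀ n : ℤ, FiniteDimensional ℂ ↥(⨆ β : Weight 𝔥, ⨆ (_ : β a = (n : ℂ)), rootSpaceHat 𝔥 β)

/-- A grading element is adapted to the Borel subalgebra `𝔟` if the positive affine roots are the
roots of positive degree. -/
structure IsBorelGrading (a : CartanHat 𝔥) : Prop extends IsGrading 𝔥 a where
  pos : ∀ β : Weight 𝔥, β ∈ affinePosRoots 𝔥 𝔟 → ∃ n : ℕ, 0 < n ∧ β a = (n : ℂ)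
  mem : ∀ β : Weight 𝔥, rootSpaceHat 𝔥 β ≠ ⊥ → (∃ n : ℕ, 0 < n ∧ β a = (n : ℂ)) → β ∈ affinePosRoots 𝔥 𝔟
  borel : (borelHat 𝔟).toSubmodule = ⨆ β : Weight 𝔥, ⨆ (_ : ∃ n : ℕ, β a = (n : ℂ)), rootSpaceHat 𝔥 β

variable {𝔥 𝔟}

theorem loopBracket_single_zero_apply (x : 𝔤) (f : Loop 𝔤) (n : ℤ) :
    loopBracket (Finsupp.single 0 x) f n = ⁅x, f n⁆ := by
  induction f using Finsupp.induction_linear with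
  | zero => simp
  | add f g hf hg => simp only [map_add, Finsupp.add_apply, hf, hg, lie_add]
  | single m y =>
    rw [loopBracket_single, zero_add, Finsupp.single_apply, Finsupp.single_apply]
    split_ifs <;> simp

theorem euler_apply (f : Loop 𝔤) (n : ℤ) : euler f n = (n : ℂ) • f n := by
  induction f using Finsupp.induction_linear with
  | zero => simp
  | add f g hf hg => simp only [map_add, Finsupp.add_apply, hf, hg, smul_add]
  | single m y =>
    rw [euler_single, Finsupp.smul_apply, Finsupp.single_apply]
    split_ifs with h
    · rw [h]
    · simp

theorem cocycle_single_zero (x : 𝔤) (f : Loop 𝔤) : cocycle (Finsupp.single 0 x) f = 0 := by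
  induction f using Finsupp.induction_linear with
  | zero => simp
  | add f g hf hg => rw [map_add, hf, hg, add_zero]
  | single m y => rw [cocycle_single]; simp

theorem cartanIncl_lie_loop (H : CartanHat 𝔥) (X : Affine 𝔤) (n : ℤ) :
    ⁅cartanIncl H, X⁆.loop n = ⁅(H.1 : 𝔤), X.loop n⁆ + (H.2.2 * n) • X.loop n := by
  have h0 : euler (Finsupp.single 0 (H.1 : 𝔤)) = 0 := by simp [euler_single]
  simp only [Affine.loop_lie, cartanIncl, h0, smul_zero, sub_zero, Finsupp.add_apply,
    Finsupp.smul_apply, loopBracket_single_zero_apply, euler_apply, smul_smul]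

theorem cartanIncl_lie_cent (H : CartanHat 𝔥) (X : Affine 𝔤) : ⁅cartanIncl H, X⁆.cent = 0 :=
  cocycle_single_zero _ _

variable (𝔤) in
/-- The inclusion `x ↦ x ⊗ tⁿ` of `𝔤` in the affine Kac–Moody algebra. -/
def loopIncl (n : ℤ) : 𝔤 →ₗ[ℂ] Affine 𝔤 where
  toFun x := ⟨Finsupp.single n x, 0, 0⟩
  map_add' x y := by ext1 <;> simp
  map_smul' c x := by ext1 <;> simp

theorem affine_eq_sum [DecidableEq ℤ] (X : Affine 𝔤) :
    X = ∑ n ∈ X.loop.support, loopIncl 𝔤 n (X.loop n) + cartanIncl (𝔥 := 𝔥) (0, X.cent, X.der) := by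
  have h1 (s : Finset ℤ) (f : ℤ → 𝔤) : ∑ n ∈ s, loopIncl 𝔤 n (f n) =
      ⟨∑ n ∈ s, Finsupp.single n (f n), 0, 0⟩ := by
    induction s using Finset.induction_on with
    | empty => rfl
    | insert m s hm ih =>
      rw [Finset.sum_insert hm, ih, Finset.sum_insert hm]
      ext1 <;> simp [loopIncl]
  rw [h1]
  ext1
  · simp only [Affine.loop_add, cartanIncl, ZeroMemClass.coe_zero, Finsupp.single_zero, add_zero]
    exact (Finsupp.sum_single X.loop).symm
  · simp [cartanIncl]
  · simp [cartanIncl]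

open LieAlgebra LieAlgebra.IsKilling LieModule

variable [FiniteDimensional ℂ 𝔤] [LieAlgebra.IsSimple ℂ 𝔤] [𝔥.IsCartanSubalgebra]

theorem cartanIncl_mem_rootSpaceHat (H : CartanHat 𝔥) : cartanIncl H ∈ rootSpaceHat 𝔥 0 := by
  intro H'
  rw [LinearMap.zero_apply, zero_smul]
  ext n
  · rw [cartanIncl_lie_loop]
    by_cases hn : n = 0
    · subst hn
      simp only [cartanIncl, Finsupp.single_eq_same, Int.cast_zero, mul_zero, zero_smul, add_zero]
      rw [cartan_lie_cartan]; rfl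
    · simp [cartanIncl, Finsupp.single_eq_of_ne hn]
  · exact cartanIncl_lie_cent _ _
  · rfl

/-- The affine weight `χ + n δ`. -/
def affineWeight (χ : LieModule.Weight ℂ 𝔥 𝔤) (n : ℤ) : Weight 𝔥 :=
  extend 𝔥 χ.toLinear + n • delta 𝔥

theorem affineWeight_apply (χ : LieModule.Weight ℂ 𝔥 𝔤) (n : ℤ) (H : CartanHat 𝔥) :
    affineWeight χ n H = χ H.1 + n * H.2.2 := by
  simp [affineWeight, extend, delta]

theorem loopIncl_mem {χ : LieModule.Weight ℂ 𝔥 𝔤} (n : ℤ) {x : 𝔤} (hx : x ∈ rootSpace 𝔥 χ) :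
    loopIncl 𝔤 n x ∈ rootSpaceHat 𝔥 (affineWeight χ n) := by
  intro H
  rw [affineWeight_apply]
  ext m
  · rw [cartanIncl_lie_loop]
    by_cases hm : m = n
    · subst hm
      simp only [loopIncl, LinearMap.coe_mk, AddHom.coe_mk, Finsupp.single_eq_same,
        Affine.loop_smul, Finsupp.smul_apply]
      rw [mem_rootSpace_iff.mp hx, add_smul, mul_comm]
    · simp [loopIncl, Finsupp.single_eq_of_ne hm]
  · rw [cartanIncl_lie_cent]; simp [loopIncl]
  · simp [loopIncl]


theorem affineWeight_eq_zero_iff {χ : LieModule.Weight ℂ 𝔥 𝔤} {n : ℤ} :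
    affineWeight χ n = 0 ↔ n = 0 ∧ χ.IsZero := by
  constructor
  · intro h
    have hn : n = 0 := by
      have := LinearMap.congr_fun h (0, 0, 1)
      rw [affineWeight_apply] at this
      have h0 : χ (0 : 𝔥) = 0 := map_zero χ.toLinear
      simpa [h0] using this
    refine ⟨hn, funext fun x => ?_⟩
    have := LinearMap.congr_fun h (x, 0, 0)
    rw [affineWeight_apply] at this
    simpa using this
  · rintro ⟨rfl, h⟩
    exact LinearMap.ext fun H => by simp [affineWeight_apply, h.eq]

/-- The shape of a root vector of the affine Kac–Moody algebra. -/
theorem rootSpaceHat_cases {β : Weight 𝔥} {X : Affine 𝔤} (hX : X ∈ rootSpaceHat 𝔥 β)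
    (hX0 : X ≠ 0) : (β = 0 ∧ ∃ H : CartanHat 𝔥, X = cartanIncl H) ∨
      ∃ (χ : LieModule.Weight ℂ 𝔥 𝔤) (n : ℤ), β = affineWeight χ n ∧ β ≠ 0 ∧
        ∃ x ∈ rootSpace 𝔥 χ, x ≠ 0 ∧ X = loopIncl 𝔤 n x := by
  have h1 (m : ℤ) (H : CartanHat 𝔥) :
      ⁅(H.1 : 𝔤), X.loop m⁆ + (H.2.2 * m) • X.loop m = β H • X.loop m := by
    rw [← cartanIncl_lie_loop, hX H]; rfl
  have hc (H : CartanHat 𝔥) : β H * X.cent = 0 := by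
    have := congrArg Affine.cent (hX H)
    rw [cartanIncl_lie_cent] at this
    exact this.symm
  have hd (H : CartanHat 𝔥) : β H * X.der = 0 := by
    have := congrArg Affine.der (hX H)
    exact this.symm
  by_cases hl : X.loop = 0
  · left
    have hXc : X = cartanIncl (𝔥 := 𝔥) (0, X.cent, X.der) := by
      ext1
      · simp [cartanIncl, hl]
      · rfl
      · rfl
    refine ⟨LinearMap.ext fun H => ?_, _, hXc⟩
    by_contra hβ
    have h2 := (mul_eq_zero.mp (hc H)).resolve_left hβ
    have h3 := (mul_eq_zero.mp (hd H)).resolve_left hβ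
    exact hX0 (by ext1; exacts [hl, h2, h3])
  obtain ⟨n, hn⟩ : ∃ n, X.loop n ≠ 0 := by
    by_contra! h
    exact hl (Finsupp.ext h)
  -- Evaluating at D shows that every degree in the support of X equals β(D), so X is concentrated
  -- in a single power of t.
  have hD (m : ℤ) (hm : X.loop m ≠ 0) : β (0, 0, 1) = m := by
    have := h1 m (0, 0, 1)
    simp only [ZeroMemClass.coe_zero, zero_lie, zero_add, one_mul] at this
    exact (smul_left_injective ℂ hm this).symm
  have hsupp (m : ℤ) (hm : m ≠ n) : X.loop m = 0 := by
    by_contra h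
    exact hm (by exact_mod_cast (hD m h).symm.trans (hD n hn))
  have hK : β (0, 1, 0) = 0 := by
    have := h1 n (0, 1, 0)
    simp only [ZeroMemClass.coe_zero, zero_lie, zero_add, zero_mul, zero_smul] at this
    exact (smul_eq_zero.mp this.symm).resolve_right hn
  have hmem : X.loop n ∈ rootSpace 𝔥 (fun h : 𝔥 => β (h, 0, 0)) := by
    rw [mem_rootSpace_iff]
    intro h
    have := h1 n (h, 0, 0)
    simpa using this
  let χ : LieModule.Weight ℂ 𝔥 𝔤 := ⟨fun h : 𝔥 => β (h, 0, 0), fun h => hn (by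
    rw [show rootSpace 𝔥 (fun h : 𝔥 => β (h, 0, 0)) = ⊥ from h] at hmem
    simpa using hmem)⟩
  have hχ : ∀ h, χ h = β (h, 0, 0) := fun _ => rfl
  have hβ : β = affineWeight χ n := by
    refine LinearMap.ext fun H => ?_
    have h3 : H = (H.1, 0, 0) + (H.2.1 • (0, 1, 0) + H.2.2 • (0, 0, 1)) := by ext <;> simp
    rw [affineWeight_apply, hχ, ← hD n hn]
    conv_lhs => rw [h3, map_add, map_add, map_smul, map_smul, hK]
    simp [mul_comm]
  have hloop : X.loop = Finsupp.single n (X.loop n) := by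
    ext m
    by_cases hm : m = n
    · subst hm; simp
    · rw [hsupp m hm, Finsupp.single_eq_of_ne hm]
  by_cases h0 : β = 0
  · left
    obtain ⟨hn0, hz⟩ := affineWeight_eq_zero_iff.mp (hβ ▸ h0)
    have h2 : X.loop n ∈ 𝔥 := by
      have h3 : X.loop n ∈ rootSpace 𝔥 (0 : 𝔥 → ℂ) := by
        have : (fun h : 𝔥 => β (h, 0, 0)) = 0 := by rw [h0]; rfl
        rwa [this] at hmem
      rw [rootSpace_zero_eq] at h3
      exact h3
    refine ⟨h0, (⟨X.loop n, h2⟩, X.cent, X.der), ?_⟩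
    ext1
    · exact hloop.trans (by simp [cartanIncl, hn0])
    · rfl
    · rfl
  · right
    refine ⟨χ, n, hβ, h0, X.loop n, hmem, hn, ?_⟩
    obtain ⟨H, hH⟩ : ∃ H, β H ≠ 0 := by
      by_contra! h
      exact h0 (LinearMap.ext h)
    ext1
    · exact hloop
    · exact (mul_eq_zero.mp (hc H)).resolve_left hH
    · exact (mul_eq_zero.mp (hd H)).resolve_left hH

/-- The strict bound C on all |χ(w)| serves to weight D so heavily that the power of t dominates the
degree. -/
theorem exists_weight_grading (h𝔟 : IsBorel 𝔟) (h𝔥𝔟 : 𝔥 ≤ 𝔟) : ∃ (w : 𝔥) (C : ℕ), 0 < C ∧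
    ∀ χ : LieModule.Weight ℂ 𝔥 𝔤, ∃ k : ℤ, χ w = k ∧ |k| < C ∧ (k = 0 ↔ χ.IsZero) ∧
      (χ.IsNonZero → ((rootSpace 𝔥 χ).toSubmodule ≤ 𝔟.toSubmodule ↔ 0 < k)) := by
  classical
  obtain ⟨w, hw⟩ := exists_borel_grading (𝔥 := 𝔥) h𝔟 h𝔥𝔟
  choose n hn hn0 hn1 using hw
  let C : ℕ := ∑ i : 𝔥.root, (n i).natAbs + 1
  refine ⟨w, C, Nat.succ_pos _, fun χ => ?_⟩
  by_cases hχ : χ.IsZero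
  · exact ⟨0, by simp [hχ.eq], by simp only [C, abs_zero]; positivity, by simp [hχ], fun h => absurd hχ h⟩
  · have hi : χ ∈ 𝔥.root := by simpa using hχ
    have h1 : (n ⟨χ, hi⟩).natAbs ≤ ∑ i : 𝔥.root, (n i).natAbs :=
      Finset.single_le_sum (f := fun i => (n i).natAbs) (fun _ _ => Nat.zero_le _)
        (Finset.mem_univ _)
    refine ⟨n ⟨χ, hi⟩, hn ⟨χ, hi⟩, ?_, ?_, fun _ => hn1 ⟨χ, hi⟩⟩
    · rw [Int.abs_eq_natAbs]; exact_mod_cast Nat.lt_succ_of_le h1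
    · simp [hn0, hχ]

theorem mem_posRoots_iff {χ : LieModule.Weight ℂ 𝔥 𝔤} (hχ : χ.IsNonZero)
    (h : (rootSpace 𝔥 χ).toSubmodule ≤ 𝔟.toSubmodule) : χ.toLinear ∈ posRoots 𝔥 𝔟 := by
  obtain ⟨x, hx, hx0⟩ := χ.exists_ne_zero
  refine ⟨fun h0 => hχ (funext fun y => LinearMap.congr_fun h0 y), x, h hx, hx0, fun y => ?_⟩
  exact mem_rootSpace_iff.mp hx y

theorem exists_weight_of_isRootVector {α : Module.Dual ℂ 𝔥} {x : 𝔤} (h : IsRootVector 𝔥 α x) :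
    ∃ χ : LieModule.Weight ℂ 𝔥 𝔤, χ.toLinear = α ∧ x ∈ rootSpace 𝔥 χ := by
  have hx : x ∈ rootSpace 𝔥 (α : 𝔥 → ℂ) := mem_rootSpace_iff.mpr h.2
  refine ⟨⟨α, fun h0 => h.1 ?_⟩, LinearMap.ext fun _ => rfl, hx⟩
  rw [show rootSpace 𝔥 (α : 𝔥 → ℂ) = ⊥ from h0] at hx
  simpa using hx


theorem loopIncl_mem_of_forall (V : Submodule ℂ (Affine 𝔤)) (n : ℤ) (W : Submodule ℂ 𝔤)
    (hW : ∀ h ∈ 𝔥, ∀ x ∈ W, ⁅h, x⁆ ∈ W)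
    (h : ∀ χ : LieModule.Weight ℂ 𝔥 𝔤, ∀ x ∈ rootSpace 𝔥 χ, x ∈ W → x ≠ 0 →
      rootSpaceHat 𝔥 (affineWeight χ n) ≤ V) {x : 𝔤} (hx : x ∈ W) : loopIncl 𝔤 n x ∈ V := by
  obtain ⟨s, f, rfl, hf⟩ := exists_sum_rootSpace hW hx
  rw [map_sum]
  refine sum_mem fun χ hχ => ?_
  by_cases h0 : f χ = 0
  · rw [h0, map_zero]; exact zero_mem _
  exact h χ (f χ) (hf χ hχ).1 (hf χ hχ).2 h0 (loopIncl_mem n (hf χ hχ).1)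

theorem loopIncl_injective (n : ℤ) : Function.Injective (loopIncl 𝔤 n) := fun _ _ h =>
  Finsupp.single_injective n (congrArg Affine.loop h)

/-- For a = w + C D the degree of χ + nδ is χ(w) + nC. Since |χ(w)| < C, its sign is that of n, or
that of χ(w) when n = 0, and it vanishes only for the weight 0. So positive degree singles out
exactly the positive affine roots. -/
theorem exists_isBorelGrading (h𝔟 : IsBorel 𝔟) (h𝔥𝔟 : 𝔥 ≤ 𝔟) :
    ∃ a : CartanHat 𝔥, IsBorelGrading 𝔥 𝔟 a := by
  classical
  obtain ⟨w, C, hC, hw⟩ := exists_weight_grading (𝔥 := 𝔥) h𝔟 h𝔥𝔟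
  choose k hk hkC hk0 hk1 using hw
  set a : CartanHat 𝔥 := (w, 0, (C : ℂ)) with ha
  have hval (χ : LieModule.Weight ℂ 𝔥 𝔤) (n : ℤ) : affineWeight χ n a = ((k χ + n * C : ℤ) : ℂ) := by
    rw [affineWeight_apply, ha, hk]; push_cast; rfl
  have hC' : (0 : ℤ) < C := by exact_mod_cast hC
  have hsign (m : ℤ) (χ) (h : 0 < k χ + m * C) : 0 < m ∨ m = 0 ∧ 0 < k χ := by
    have := abs_lt.mp (hkC χ)
    rcases lt_trichotomy m 0 with h1 | h1 | h1
    · exfalso; nlinarith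
    · right; subst h1; exact ⟨rfl, by simpa using h⟩
    · exact Or.inl h1
  have hzero (m : ℤ) (χ) (h : k χ + m * C = 0) : m = 0 ∧ k χ = 0 := by
    have := abs_lt.mp (hkC χ)
    have hm : m = 0 := by
      rcases lt_trichotomy m 0 with h1 | h1 | h1
      · exfalso; nlinarith
      · exact h1
      · exfalso; nlinarith
    subst hm; exact ⟨rfl, by simpa using h⟩
  have cases' {β : Weight 𝔥} (hβ : rootSpaceHat 𝔥 β ≠ ⊥) : β = 0 ∨
      ∃ (χ : LieModule.Weight ℂ 𝔥 𝔤) (n : ℤ), β = affineWeight χ n ∧ β ≠ 0 := by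
    obtain ⟨X, hX, hX0⟩ := Submodule.exists_mem_ne_zero_of_ne_bot hβ
    rcases rootSpaceHat_cases hX hX0 with h | ⟨χ, n, h1, h2, -⟩
    · exact Or.inl h.1
    · exact Or.inr ⟨χ, n, h1, h2⟩
  have hpos (χ : LieModule.Weight ℂ 𝔥 𝔤) (n : ℤ) (h0 : 0 < n ∨ n = 0 ∧ 0 < k χ) :
      affineWeight χ n ∈ affinePosRoots 𝔥 𝔟 := by
    by_cases hχ : χ.IsZero
    · rcases h0 with h0 | ⟨-, h0⟩
      · lift n to ℕ using h0.le
        refine Or.inr (Or.inr ⟨n, by exact_mod_cast h0, LinearMap.ext fun H => ?_⟩)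
        simp [affineWeight_apply, hχ.eq, delta]
      · exact absurd ((hk0 χ).mpr hχ) h0.ne'
    rcases h0 with h0 | ⟨rfl, h0⟩
    · lift n to ℕ using h0.le
      refine Or.inr (Or.inl ⟨χ.toLinear, ?_, n, by exact_mod_cast h0, LinearMap.ext fun H => ?_⟩)
      · obtain ⟨x, hx, hx0⟩ := χ.exists_ne_zero
        exact ⟨fun h => hχ (funext fun y => LinearMap.congr_fun h y), x, hx0,
          mem_rootSpace_iff.mp hx⟩
      · simp [affineWeight_apply, extend, delta]
    · refine Or.inl ⟨χ.toLinear, mem_posRoots_iff hχ ((hk1 χ hχ).mpr h0), LinearMap.ext fun H => ?_⟩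
      simp [affineWeight_apply, extend]
  have hW : ∀ h ∈ 𝔥, ∀ x ∈ (⊤ : Submodule ℂ 𝔤), ⁅h, x⁆ ∈ (⊤ : Submodule ℂ 𝔤) := by simp
  have hcart (H : CartanHat 𝔥) : cartanIncl H ∈ rootSpaceHat 𝔥 0 := cartanIncl_mem_rootSpaceHat H
  refine ⟨a, ⟨?_, ?_, ?_, ?_, ?_⟩, ?_, ?_, ?_⟩
  · intro β hβ
    rcases cases' hβ with rfl | ⟨χ, n, rfl, -⟩
    · exact ⟨0, by simp⟩
    · exact ⟨_, hval χ n⟩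
  · intro β hβ h0
    rcases cases' hβ with rfl | ⟨χ, n, rfl, -⟩
    · rfl
    · rw [hval, Int.cast_eq_zero] at h0
      obtain ⟨h1, h2⟩ := hzero n χ h0
      exact affineWeight_eq_zero_iff.mpr ⟨h1, (hk0 χ).mp h2⟩
  · intro X hX
    by_cases hX0 : X = 0
    · exact ⟨0, by rw [hX0]; ext1 <;> simp [cartanIncl]⟩
    rcases rootSpaceHat_cases hX hX0 with h | ⟨χ, n, h1, h2, -⟩
    · exact h.2
    · exact absurd rfl h2
  · rw [eq_top_iff]
    rintro X -
    rw [affine_eq_sum (𝔥 := 𝔥) X]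
    refine add_mem (sum_mem fun n _ => ?_) (Submodule.mem_iSup_of_mem 0 (hcart _))
    exact loopIncl_mem_of_forall _ n ⊤ hW (fun χ _ _ _ _ => le_iSup (rootSpaceHat 𝔥) _) trivial
  · intro n
    -- From mC = n - χ(w) and |χ(w)| < C it follows that |m| ≤ |n| + 1. Thus only finitely many
    -- powers of t occur in degree n, and the range of T contains them all.
    let I := Finset.Icc (-(|n| + 1)) (|n| + 1)
    let T : (I → 𝔤) × ℂ × ℂ →ₗ[ℂ] Affine 𝔤 :=
      { toFun := fun g => ⟨∑ n : I, Finsupp.single (n : ℤ) (g.1 n), g.2.1, g.2.2⟩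
        map_add' := fun g g' => by
          ext1
          · simp [Finset.sum_add_distrib]
          · simp
          · simp
        map_smul' := fun c g => by
          ext1
          · simp [Finset.smul_sum]
          · simp
          · simp }
    have hle : ⨆ β : Weight 𝔥, ⨆ (_ : β a = (n : ℂ)), rootSpaceHat 𝔥 β ≤ LinearMap.range T := by
      refine iSup₂_le fun β hβ X hX => ?_
      by_cases hX0 : X = 0
      · rw [hX0]; exact zero_mem _
      have hI0 : (0 : ℤ) ∈ I := by
        have := abs_nonneg n
        simp only [I, Finset.mem_Icc]; omega
      rcases rootSpaceHat_cases hX hX0 with ⟨-, H, rfl⟩ | ⟨χ, m, rfl, h2, x, hx, hx0, rfl⟩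
      · refine ⟨(fun i => if i = ⟨0, hI0⟩ then (H.1 : 𝔤) else 0, H.2.1, H.2.2), ?_⟩
        ext1
        · change ∑ i : I, Finsupp.single (i : ℤ) (if i = ⟨0, hI0⟩ then (H.1 : 𝔤) else 0) = _
          rw [Finset.sum_eq_single ⟨0, hI0⟩]
          · simp [cartanIncl]
          · intro i _ hi; simp [hi]
          · simp
        · rfl
        · rfl
      · rw [hval] at hβ
        have hβ' : k χ + m * C = n := by exact_mod_cast hβ
        have hm : m ∈ I := by
          have h3 := abs_lt.mp (hkC χ)
          have h4 := le_abs_self n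
          have h5 := neg_abs_le n
          have h6 : (1 : ℤ) ≤ C := hC'
          simp only [I, Finset.mem_Icc]
          constructor <;> by_contra! h7 <;> nlinarith
        refine ⟨(fun i => if i = ⟨m, hm⟩ then x else 0, 0, 0), ?_⟩
        ext1
        · change ∑ i : I, Finsupp.single (i : ℤ) (if i = ⟨m, hm⟩ then x else 0) = _
          rw [Finset.sum_eq_single ⟨m, hm⟩]
          · simp [loopIncl]
          · intro i _ hi; simp [hi]
          · simp
        · rfl
        · rfl
    exact Submodule.finiteDimensional_of_le hle
  · rintro β (⟨α, ⟨h0, x, hx, hα⟩, rfl⟩ | ⟨α, ⟨h0, x, hα⟩, n, hn, rfl⟩ | ⟨n, hn, rfl⟩)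
    · obtain ⟨χ, rfl, hx'⟩ := exists_weight_of_isRootVector hα
      have hχ : χ.IsNonZero := fun h => h0 (LinearMap.ext fun y => congrFun h y)
      have h1 := (hk1 χ hχ).mp (rootSpace_le_of_mem hχ hx' hα.1 hx)
      refine ⟨(k χ).toNat, by omega, ?_⟩
      have : ((k χ).toNat : ℂ) = (k χ : ℂ) := by
        exact_mod_cast congrArg (Int.cast : ℤ → ℂ) (Int.toNat_of_nonneg h1.le)
      rw [this, ← hk χ]; rfl
    · obtain ⟨χ, rfl, hx'⟩ := exists_weight_of_isRootVector hα
      have h1 : 0 < k χ + n * C := by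
        have h3 := abs_lt.mp (hkC χ)
        have h4 : (1 : ℤ) ≤ n := by exact_mod_cast hn
        nlinarith
      refine ⟨(k χ + n * C).toNat, by omega, ?_⟩
      have : ((k χ + n * C).toNat : ℂ) = ((k χ + n * C : ℤ) : ℂ) := by
        exact_mod_cast congrArg (Int.cast : ℤ → ℂ) (Int.toNat_of_nonneg h1.le)
      rw [this]
      have h2 := hval χ n
      rw [affineWeight] at h2
      rw [← h2]
      simp
    · exact ⟨n * C, Nat.mul_pos hn hC, by simp [delta, ha]⟩
  · rintro β hβ ⟨n, hn, hn'⟩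
    rcases cases' hβ with rfl | ⟨χ, m, rfl, -⟩
    · rw [LinearMap.zero_apply] at hn'
      exact absurd (by exact_mod_cast hn'.symm) hn.ne'
    · rw [hval] at hn'
      have h1 : k χ + m * C = n := by exact_mod_cast hn'
      exact hpos χ m (hsign m χ (by omega))
  · apply le_antisymm
    · intro X hX
      rw [affine_eq_sum (𝔥 := 𝔥) X]
      set V := ⨆ β : Weight 𝔥, ⨆ (_ : ∃ n : ℕ, β a = (n : ℂ)), rootSpaceHat 𝔥 β with hV
      have hVm {β : Weight 𝔥} (m : ℤ) (hm : 0 ≤ m) (h : β a = (m : ℂ)) : rootSpaceHat 𝔥 β ≤ V := by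
        lift m to ℕ using hm
        exact le_iSup₂_of_le β ⟨m, by simpa using h⟩ le_rfl
      have h0 : cartanIncl (𝔥 := 𝔥) (0, X.cent, X.der) ∈ V := hVm 0 le_rfl (by simp) (hcart _)
      refine add_mem ?_ h0
      have key : ∀ f ∈ loopBorel 𝔟, (⟨f, 0, 0⟩ : Affine 𝔤) ∈ V := by
        intro f hf
        induction hf using Submodule.span_induction with
        | zero => exact zero_mem V
        | add f g _ _ hf hg =>
          have : (⟨f + g, 0, 0⟩ : Affine 𝔤) = ⟨f, 0, 0⟩ + ⟨g, 0, 0⟩ := by ext1 <;> simp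
          rw [this]; exact add_mem hf hg
        | smul c f _ hf =>
          have : (⟨c • f, 0, 0⟩ : Affine 𝔤) = c • ⟨f, 0, 0⟩ := by ext1 <;> simp
          rw [this]; exact V.smul_mem c hf
        | mem f hf =>
          obtain ⟨n, x, h, rfl⟩ := hf
          change loopIncl 𝔤 n x ∈ V
          rcases h with h | ⟨rfl, hx⟩
          · refine loopIncl_mem_of_forall V n ⊤ hW (fun χ _ _ _ _ => hVm _ ?_ (hval χ n)) trivial
            have h3 := abs_lt.mp (hkC χ)
            nlinarith
          · refine loopIncl_mem_of_forall V 0 𝔟.toSubmodule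
              (fun h hh x hx => 𝔟.lie_mem (h𝔥𝔟 hh) hx) (fun χ y hy hyb hy0 => hVm _ ?_ (hval χ 0)) hx
            rw [zero_mul, add_zero]
            by_cases hχ : χ.IsZero
            · exact ((hk0 χ).mpr hχ).ge
            · exact ((hk1 χ hχ).mp (rootSpace_le_of_mem hχ hy hy0 hyb)).le
      have h2 : (∑ n ∈ X.loop.support, loopIncl 𝔤 n (X.loop n)) = ⟨X.loop, 0, 0⟩ := by
        have := affine_eq_sum (𝔥 := 𝔥) ⟨X.loop, 0, 0⟩
        have h3 : cartanIncl (𝔥 := 𝔥) (0, 0, 0) = 0 := by ext1 <;> simp [cartanIncl]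
        simp only [h3, add_zero] at this
        exact this.symm
      rw [h2]
      exact key _ hX
    · refine iSup₂_le fun β hβ X hX => ?_
      by_cases hX0 : X = 0
      · rw [hX0]; exact zero_mem _
      change X.loop ∈ loopBorel 𝔟
      rcases rootSpaceHat_cases hX hX0 with ⟨-, H, rfl⟩ | ⟨χ, m, rfl, h2, x, hx, hx0, rfl⟩
      · exact Submodule.subset_span ⟨0, H.1, Or.inr ⟨rfl, h𝔥𝔟 H.1.2⟩, rfl⟩
      · obtain ⟨n, hn⟩ := hβ
        rw [hval] at hn
        have h1 : k χ + m * C = n := by exact_mod_cast hn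
        refine Submodule.subset_span ⟨m, x, ?_, rfl⟩
        -- Degree 0 occurs only for the weight 0, which has been treated as the Cartan case.
        have h3 : 0 < k χ + m * C := by
          rcases (by omega : 0 < k χ + m * C ∨ k χ + m * C = 0) with h | h
          · exact h
          · obtain ⟨h4, h5⟩ := hzero m χ h
            exact absurd (affineWeight_eq_zero_iff.mpr ⟨h4, (hk0 χ).mp h5⟩) h2
        rcases hsign m χ h3 with h | ⟨h, h'⟩
        · exact Or.inl h
        · refine Or.inr ⟨h, (hk1 χ fun hz => ?_).mpr h' hx⟩
          exact h'.ne' ((hk0 χ).mpr hz)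

theorem rootSpaceHat_neg_ne_bot {β : Weight 𝔥} (h : rootSpaceHat 𝔥 β ≠ ⊥) :
    rootSpaceHat 𝔥 (-β) ≠ ⊥ := by
  obtain ⟨X, hX, hX0⟩ := Submodule.exists_mem_ne_zero_of_ne_bot h
  rcases rootSpaceHat_cases hX hX0 with ⟨rfl, -⟩ | ⟨χ, m, rfl, h2, x, hx, hx0, rfl⟩
  · rwa [neg_zero]
  · have h1 : affineWeight (-χ) (-m) = -affineWeight χ m :=
      LinearMap.ext fun H => by simp [affineWeight_apply]; ring
    obtain ⟨y, hy, hy0⟩ := (-χ).exists_ne_zero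
    rw [← h1]
    exact Submodule.ne_bot_iff _ |>.mpr ⟨_, loopIncl_mem (-m) hy, fun h =>
      hy0 (loopIncl_injective _ (h.trans (map_zero _).symm))⟩

end Grading

/-! ### Triangular decomposition defined by a grading element -/

section Parts

variable {𝔤 : Type u} [LieRing 𝔤] [LieAlgebra ℂ 𝔤] {𝔥 𝔟 : LieSubalgebra ℂ 𝔤}

theorem lie_mem_rootSpaceHat {β γ : Weight 𝔥} {X Y : Affine 𝔤} (hX : X ∈ rootSpaceHat 𝔥 β)
    (hY : Y ∈ rootSpaceHat 𝔥 γ) : ⁅X, Y⁆ ∈ rootSpaceHat 𝔥 (β + γ) := fun H => by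
  rw [leibniz_lie, hX H, hY H, smul_lie, lie_smul, LinearMap.add_apply, add_smul]

/-- The sum of the root spaces whose roots belong to a set. -/
def rootSum (Φ : Set (Weight 𝔥)) : Submodule ℂ (Affine 𝔤) := ⨆ β : Weight 𝔥, ⨆ (_ : β ∈ Φ), rootSpaceHat 𝔥 β

theorem rootSpaceHat_le_rootSum {Φ : Set (Weight 𝔥)} {β : Weight 𝔥} (h : β ∈ Φ) :
    rootSpaceHat 𝔥 β ≤ rootSum Φ := le_iSup₂_of_le β h le_rfl

theorem rootSum_le {Φ : Set (Weight 𝔥)} {V : Submodule ℂ (Affine 𝔤)}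
    (h : ∀ β ∈ Φ, ∀ X ∈ rootSpaceHat 𝔥 β, X ∈ V) : rootSum Φ ≤ V := iSup₂_le h

theorem rootSum_lie {Φ Ψ : Set (Weight 𝔥)} {V : Submodule ℂ (Affine 𝔤)}
    (h : ∀ β ∈ Φ, ∀ X ∈ rootSpaceHat 𝔥 β, ∀ γ ∈ Ψ, ∀ Y ∈ rootSpaceHat 𝔥 γ, ⁅X, Y⁆ ∈ V)
    {X Y : Affine 𝔤} (hX : X ∈ rootSum Φ) (hY : Y ∈ rootSum Ψ) : ⁅X, Y⁆ ∈ V := by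
  have h1 : rootSum Φ ≤ (⨅ Y : rootSum Ψ, V.comap
      ((LieModule.toEnd ℂ (Affine 𝔤) (Affine 𝔤) : Affine 𝔤 →ₗ[ℂ] Module.End ℂ (Affine 𝔤)).flip
        (Y : Affine 𝔤))) := by
    refine rootSum_le fun β hβ X hX => ?_
    rw [Submodule.mem_iInf]
    rintro ⟨Y, hY⟩
    change ⁅X, Y⁆ ∈ V
    have h2 : rootSum Ψ ≤ V.comap (LieModule.toEnd ℂ (Affine 𝔤) (Affine 𝔤) X) :=
      rootSum_le fun γ hγ Y hY => h β hβ X hX γ hγ Y hY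
    exact h2 hY
  exact (Submodule.mem_iInf _).mp (h1 hX) ⟨Y, hY⟩

theorem iSupIndep_rootSpaceHat : iSupIndep (rootSpaceHat 𝔥) := by
  rw [iSupIndep_def]
  intro γ
  rw [Submodule.disjoint_def]
  intro m hm hm'
  have h1 : m ∈ Submodule.span ℂ {z | ∃ γ' : Weight 𝔥,
      (∀ H : CartanHat 𝔥, (LieModule.toEnd ℂ (Affine 𝔤) (Affine 𝔤) (cartanIncl H)) z = γ' H • z) ∧
        γ' ≠ γ} := by
    refine (iSup₂_le fun γ' h z hz => ?_ : ⨆ γ', ⨆ (_ : γ' ≠ γ), rootSpaceHat 𝔥 γ' ≤ _) hm'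
    exact Submodule.subset_span ⟨γ', hz, h⟩
  have h2 := mem_span_of_eigenvector (θ := fun H : CartanHat 𝔥 =>
    LieModule.toEnd ℂ (Affine 𝔤) (Affine 𝔤) (cartanIncl H)) (c := fun (γ : Weight 𝔥) H => γ H) (fun γ γ' h => by
    obtain ⟨H, hH⟩ : ∃ H, (γ - γ') H ≠ 0 := by
      by_contra! h'
      exact h (sub_eq_zero.mp (LinearMap.ext h'))
    exact ⟨H, IsUnit.mk0 _ hH⟩) (P := fun γ' _ => γ' ≠ γ) hm h1
  have h3 : {z | (∀ H : CartanHat 𝔥, (LieModule.toEnd ℂ (Affine 𝔤) (Affine 𝔤) (cartanIncl H)) z =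
      γ H • z) ∧ γ ≠ γ} = ∅ := by ext; simp
  rw [h3] at h2
  simpa using h2

/-- The weights of positive integral degree with respect to `a`. -/
def posDeg (a : CartanHat 𝔥) : Set (Weight 𝔥) := {β | ∃ n : ℕ, 0 < n ∧ β a = (n : ℂ)}

/-- The weights of nonnegative integral degree with respect to `a`. -/
def nonnegDeg (a : CartanHat 𝔥) : Set (Weight 𝔥) := {β | ∃ n : ℕ, β a = (n : ℂ)}

theorem posDeg_add {a : CartanHat 𝔥} {β γ : Weight 𝔥} (h : β ∈ posDeg a) (h' : γ ∈ nonnegDeg a) :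
    β + γ ∈ posDeg a := by
  obtain ⟨n, hn, h⟩ := h
  obtain ⟨m, h'⟩ := h'
  exact ⟨n + m, by omega, by rw [LinearMap.add_apply, h, h', Nat.cast_add]⟩

theorem nonnegDeg_add {a : CartanHat 𝔥} {β γ : Weight 𝔥} (h : β ∈ nonnegDeg a)
    (h' : γ ∈ nonnegDeg a) : β + γ ∈ nonnegDeg a := by
  obtain ⟨n, h⟩ := h
  obtain ⟨m, h'⟩ := h'
  exact ⟨n + m, by rw [LinearMap.add_apply, h, h', Nat.cast_add]⟩

theorem posDeg_subset {a : CartanHat 𝔥} : posDeg a ⊆ nonnegDeg a := fun _ ⟨n, _, h⟩ => ⟨n, h⟩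

theorem zero_mem_nonnegDeg {a : CartanHat 𝔥} : 0 ∈ nonnegDeg a := ⟨0, by simp⟩

theorem notMem_nonnegDeg_neg {a : CartanHat 𝔥} {β : Weight 𝔥} (h : β ∈ posDeg a) :
    β ∉ nonnegDeg (-a) := by
  rintro ⟨m, hm⟩
  obtain ⟨n, hn, h⟩ := h
  rw [map_neg, h] at hm
  have : -(n : ℤ) = m := by exact_mod_cast hm
  omega

theorem neg_mem_posDeg {a : CartanHat 𝔥} {β : Weight 𝔥} : -β ∈ posDeg (-a) ↔ β ∈ posDeg a := by
  simp [posDeg]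

variable (a : CartanHat 𝔥)

/-- The subalgebra of elements of positive degree. -/
def nPart : LieSubalgebra ℂ (Affine 𝔤) where
  __ := rootSum (posDeg a)
  lie_mem' := rootSum_lie fun _ hβ _ hX _ hγ _ hY =>
    rootSpaceHat_le_rootSum (posDeg_add hβ (posDeg_subset hγ)) (lie_mem_rootSpaceHat hX hY)

/-- The subalgebra of elements of nonnegative degree. -/
def bPart : LieSubalgebra ℂ (Affine 𝔤) where
  __ := rootSum (nonnegDeg a)
  lie_mem' := rootSum_lie fun _ hβ _ hX _ hγ _ hY =>
    rootSpaceHat_le_rootSum (nonnegDeg_add hβ hγ) (lie_mem_rootSpaceHat hX hY)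

theorem nPart_toSubmodule : (nPart a).toSubmodule = rootSum (posDeg a) := rfl

theorem bPart_toSubmodule : (bPart a).toSubmodule = rootSum (nonnegDeg a) := rfl

variable {a}

theorem mem_nPart {β : Weight 𝔥} (h : β ∈ posDeg a) {X : Affine 𝔤} (hX : X ∈ rootSpaceHat 𝔥 β) :
    X ∈ nPart a := rootSpaceHat_le_rootSum h hX

theorem mem_bPart {β : Weight 𝔥} (h : β ∈ nonnegDeg a) {X : Affine 𝔤}
    (hX : X ∈ rootSpaceHat 𝔥 β) : X ∈ bPart a := rootSpaceHat_le_rootSum h hX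

theorem nPart_le_bPart : nPart a ≤ bPart a := fun _ hX =>
  rootSum_le (V := rootSum (nonnegDeg a))
    (fun _ hβ _ hX => rootSpaceHat_le_rootSum (posDeg_subset hβ) hX) hX

/-- The subalgebra of elements of positive degree lies in the derived algebra. -/
theorem nPart_le_span_lie (V : Submodule ℂ (Affine 𝔤)) (ha : cartanIncl a ∈ bPart a)
    (hV : ∀ X ∈ bPart a, ∀ Y ∈ bPart a, ⁅X, Y⁆ ∈ V) : (nPart a).toSubmodule ≤ V := by
  refine rootSum_le fun β hβ X hX => ?_
  obtain ⟨n, hn, h⟩ := hβ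
  -- Bracketing with a multiplies a root vector of positive degree n by n ≠ 0.
  have h1 := hV (cartanIncl a) ha X (mem_bPart ⟨n, h⟩ hX)
  rw [hX a, h] at h1
  exact (V.smul_mem_iff (by exact_mod_cast hn.ne')).mp h1

theorem IsGrading.neg (ha : IsGrading 𝔥 a) : IsGrading 𝔥 (-a) where
  integral β hβ := by
    obtain ⟨n, hn⟩ := ha.integral β hβ
    exact ⟨-n, by rw [map_neg, hn, Int.cast_neg]⟩
  eq_zero β hβ h := ha.eq_zero β hβ (by rwa [map_neg, neg_eq_zero] at h)
  cartan := ha.cartan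
  iSup_eq_top := ha.iSup_eq_top
  finite n := by
    have := ha.finite (-n)
    have h : (⨆ β : Weight 𝔥, ⨆ (_ : β (-a) = (n : ℂ)), rootSpaceHat 𝔥 β) =
        ⨆ β : Weight 𝔥, ⨆ (_ : β a = ((-n : ℤ) : ℂ)), rootSpaceHat 𝔥 β := by
      simp only [map_neg, Int.cast_neg, neg_eq_iff_eq_neg]
    rw [h]; exact this

theorem IsGrading.mem_cases (ha : IsGrading 𝔥 a) {β : Weight 𝔥} (h : rootSpaceHat 𝔥 β ≠ ⊥) :
    β ∈ posDeg a ∨ β = 0 ∨ β ∈ posDeg (-a) := by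
  obtain ⟨n, hn⟩ := ha.integral β h
  rcases lt_trichotomy n 0 with h1 | h1 | h1
  · refine Or.inr (Or.inr ⟨(-n).toNat, by omega, ?_⟩)
    have : (((-n).toNat : ℤ) : ℂ) = ((-n : ℤ) : ℂ) := by rw [Int.toNat_of_nonneg (by omega)]
    rw [map_neg, hn, ← Int.cast_neg, ← this, Int.cast_natCast]
  · exact Or.inr (Or.inl (ha.eq_zero β h (by rw [hn, h1, Int.cast_zero])))
  · refine Or.inl ⟨n.toNat, by omega, ?_⟩
    have : ((n.toNat : ℤ) : ℂ) = (n : ℂ) := by rw [Int.toNat_of_nonneg (by omega)]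
    rw [hn, ← this, Int.cast_natCast]

theorem IsGrading.isCompl (ha : IsGrading 𝔥 a) :
    IsCompl (nPart (-a)).toSubmodule (bPart a).toSubmodule := by
  constructor
  · rw [nPart_toSubmodule, bPart_toSubmodule]
    refine iSupIndep_rootSpaceHat.disjoint_biSup_biSup (s := posDeg (-a)) (t := nonnegDeg a) ?_
    rw [Set.disjoint_left]
    intro β h h'
    exact notMem_nonnegDeg_neg h (by rwa [neg_neg])
  · rw [codisjoint_iff, eq_top_iff, ← ha.iSup_eq_top]
    refine iSup_le fun β => ?_
    by_cases h : rootSpaceHat 𝔥 β = ⊥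
    · rw [h]; exact bot_le
    rcases ha.mem_cases h with h | rfl | h
    · exact (rootSpaceHat_le_rootSum (posDeg_subset h)).trans le_sup_right
    · exact (rootSpaceHat_le_rootSum zero_mem_nonnegDeg).trans le_sup_right
    · exact (rootSpaceHat_le_rootSum h).trans le_sup_left

/-- The nonnegative combinations of the roots of positive degree. -/
def rootCone (a : CartanHat 𝔥) : AddSubmonoid (Weight 𝔥) :=
  AddSubmonoid.closure {β | rootSpaceHat 𝔥 β ≠ ⊥ ∧ β ∈ posDeg a}

end Parts

/-! ### Weights in the enveloping algebra of the nilpotent part -/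

section Words

attribute [local instance 100] LieRing.ofAssociativeRing

variable {𝔤 : Type u} [LieRing 𝔤] [LieAlgebra ℂ 𝔤] {𝔥 𝔟 : LieSubalgebra ℂ 𝔤}
variable (a : CartanHat 𝔥) (A : Type v) [CommRing A] [Algebra ℂ A]

/-- The products of root vectors of total weight `ν` in the enveloping algebra of `nPart a`. -/
inductive IsWord : Weight 𝔥 → EnvAlg A (nPart a) → Prop
  | one : IsWord 0 1
  | mul {β ν : Weight 𝔥} {s : EnvAlg A (nPart a)} (X : nPart a) (hβ : β ∈ posDeg a)
      (hX : (X : Affine 𝔤) ∈ rootSpaceHat 𝔥 β) (hX0 : X ≠ 0) (h : IsWord ν s) :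
      IsWord (β + ν) (gen A X * s)

/-- The elements of weight `ν` in the enveloping algebra of `nPart a`. -/
def wordSpan (ν : Weight 𝔥) : Submodule A (EnvAlg A (nPart a)) :=
  Submodule.span A {s | IsWord a A ν s}

variable {a A}

theorem IsWord.mem_rootCone {ν : Weight 𝔥} {s : EnvAlg A (nPart a)} (h : IsWord a A ν s) :
    ν ∈ rootCone a := by
  induction h with
  | one => exact zero_mem _
  | mul X hβ hX hX0 _ ih =>
    refine add_mem (AddSubmonoid.subset_closure ⟨fun h0 => hX0 ?_, hβ⟩) ih
    rw [h0, Submodule.mem_bot] at hX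
    exact Subtype.ext hX

/-- Every factor has positive degree and is killed by the augmentation, so the empty word is the
only exception on both counts. -/
theorem IsWord.mem_deg {ν : Weight 𝔥} {s : EnvAlg A (nPart a)} (h : IsWord a A ν s) :
    ν = 0 ∧ s = 1 ∨ ν ∈ posDeg a ∧ augmentation s = 0 := by
  induction h with
  | one => exact Or.inl ⟨rfl, rfl⟩
  | @mul β ν s X hβ hX hX0 _ ih =>
    refine Or.inr ⟨posDeg_add hβ ?_, by rw [map_mul, augmentation_gen, zero_mul]⟩
    rcases ih with ⟨rfl, -⟩ | ⟨h, -⟩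
    · exact zero_mem_nonnegDeg
    · exact posDeg_subset h

theorem exists_isWord {ν : Weight 𝔥} {s : EnvAlg A (nPart a)} (hs : s ∈ wordSpan a A ν)
    (h0 : s ≠ 0) : ∃ s, IsWord a A ν s := by
  by_contra! h
  have : {s | IsWord a A ν s} = ∅ := by ext s; simp [h s]
  rw [wordSpan, this, Submodule.span_empty] at hs
  exact h0 hs

theorem mem_rootCone_of_mem_wordSpan {ν : Weight 𝔥} {s : EnvAlg A (nPart a)}
    (hs : s ∈ wordSpan a A ν) (h0 : s ≠ 0) : ν ∈ rootCone a := by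
  obtain ⟨s, h⟩ := exists_isWord hs h0
  exact h.mem_rootCone

theorem mem_deg_of_mem_wordSpan {ν : Weight 𝔥} {s : EnvAlg A (nPart a)}
    (hs : s ∈ wordSpan a A ν) (h0 : s ≠ 0) : ν = 0 ∨ ν ∈ posDeg a := by
  obtain ⟨s, h⟩ := exists_isWord hs h0
  exact h.mem_deg.imp And.left And.left

theorem posDeg_zero_notMem : (0 : Weight 𝔥) ∉ posDeg a := by
  rintro ⟨n, hn, h⟩
  rw [LinearMap.zero_apply] at h
  exact hn.ne (by exact_mod_cast h)

/-- A nonempty word has positive degree, so the only word of weight 0 is 1. -/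
theorem eq_algebraMap_of_mem_wordSpan_zero {s : EnvAlg A (nPart a)} (hs : s ∈ wordSpan a A 0) :
    s = algebraMap A _ (augmentation s) := by
  induction hs using Submodule.span_induction with
  | mem s h =>
    rcases h.mem_deg with ⟨-, rfl⟩ | ⟨h, -⟩
    · rw [map_one, map_one]
    · exact absurd h posDeg_zero_notMem
  | zero => rw [map_zero, map_zero]
  | add s t _ _ hs ht => rw [map_add, map_add, ← hs, ← ht]
  | smul c s _ hs => rw [map_smul, smul_eq_mul, map_mul, ← hs, ← Algebra.smul_def]

theorem augmentation_eq_zero_of_mem_wordSpan {ν : Weight 𝔥} {s : EnvAlg A (nPart a)}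
    (hs : s ∈ wordSpan a A ν) (h0 : ν ≠ 0) : augmentation s = 0 := by
  induction hs using Submodule.span_induction with
  | mem s h =>
    rcases h.mem_deg with ⟨h, -⟩ | ⟨-, h⟩
    · exact absurd h h0
    · exact h
  | zero => rw [map_zero]
  | add s t _ _ hs ht => rw [map_add, hs, ht, add_zero]
  | smul c s _ hs => rw [map_smul, hs, smul_zero]

theorem gen_mem_wordSpan {β : Weight 𝔥} (hβ : β ∈ posDeg a) (X : nPart a)
    (hX : (X : Affine 𝔤) ∈ rootSpaceHat 𝔥 β) {ν : Weight 𝔥} {s : EnvAlg A (nPart a)}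
    (hs : s ∈ wordSpan a A ν) : gen A X * s ∈ wordSpan a A (β + ν) := by
  induction hs using Submodule.span_induction with
  | mem s h =>
    by_cases hX0 : X = 0
    · rw [hX0, gen_zero, zero_mul]; exact zero_mem _
    · exact Submodule.subset_span (.mul X hβ hX hX0 h)
  | zero => rw [mul_zero]; exact zero_mem _
  | add s t _ _ hs ht => rw [mul_add]; exact add_mem hs ht
  | smul c s _ hs => rw [mul_smul_comm]; exact Submodule.smul_mem _ _ hs

/-- Induction over the elements of positive degree. -/
theorem nPart_induction {p : nPart a → Prop} (h0 : p 0) (hadd : ∀ X Y, p X → p Y → p (X + Y))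
    (hsmul : ∀ (c : ℂ) X, p X → p (c • X))
    (h : ∀ β ∈ posDeg a, ∀ X : nPart a, (X : Affine 𝔤) ∈ rootSpaceHat 𝔥 β → p X) (X : nPart a) :
    p X := by
  let V : Submodule ℂ (nPart a) :=
    { carrier := {X | p X}
      add_mem' := fun hX hY => hadd _ _ hX hY
      zero_mem' := h0
      smul_mem' := hsmul }
  have h1 : rootSum (posDeg a) ≤ V.map (nPart a).toSubmodule.subtype :=
    rootSum_le fun β hβ X hX => ⟨⟨X, mem_nPart hβ hX⟩, h β hβ _ hX, rfl⟩
  obtain ⟨Y, hY, hYX⟩ := h1 X.2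
  rwa [← show Y = X from Subtype.ext hYX]

theorem iSup_wordSpan : ⨆ ν, wordSpan a A ν = ⊤ := by
  refine envAlg_eq_top (Submodule.mem_iSup_of_mem 0 (Submodule.subset_span .one)) fun x s hs => ?_
  induction x using nPart_induction with
  | h0 => rw [gen_zero, zero_mul]; exact zero_mem _
  | hadd X Y hX hY => rw [gen_add, add_mul]; exact add_mem hX hY
  | hsmul c X hX =>
    rw [gen_smul, smul_mul_assoc]
    exact Submodule.smul_mem _ (algebraMap ℂ A c) hX
  | h β hβ X hX =>
    induction hs using Submodule.iSup_induction' with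
    | mem ν s hs => exact Submodule.mem_iSup_of_mem _ (gen_mem_wordSpan hβ X hX hs)
    | zero => rw [mul_zero]; exact zero_mem _
    | add s t _ _ hs ht => rw [mul_add]; exact add_mem hs ht

theorem span_isWord : Submodule.span A {s | ∃ ν, IsWord a A ν s} = ⊤ := by
  rw [eq_top_iff, ← iSup_wordSpan]
  exact iSup_le fun ν => Submodule.span_mono fun s h => ⟨ν, h⟩

/-- A word of degree k has at most k factors, each of degree at most k, and the sum of the root
spaces of degrees 0 to k is finite dimensional. So the words of weight ν lie in a power of a
finitely generated A-submodule, and A is Noetherian. -/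
theorem fg_wordSpan [IsNoetherianRing A] (ha : IsGrading 𝔥 a) (ν : Weight 𝔥) :
    (wordSpan a A ν).FG := by
  by_cases hν : wordSpan a A ν = ⊥
  · rw [hν]; exact Submodule.fg_bot
  obtain ⟨s, hs, hs0⟩ := Submodule.exists_mem_ne_zero_of_ne_bot hν
  obtain ⟨k, hk⟩ : ν ∈ nonnegDeg a := by
    rcases mem_deg_of_mem_wordSpan hs hs0 with rfl | h
    · exact zero_mem_nonnegDeg
    · exact posDeg_subset h
  let V : Submodule ℂ (Affine 𝔤) := ⨆ n : Fin (k + 1), ⨆ β : Weight 𝔥,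
    ⨆ (_ : β a = (((n : ℕ) : ℤ) : ℂ)), rootSpaceHat 𝔥 β
  have : ∀ n : Fin (k + 1), FiniteDimensional ℂ ↥(⨆ β : Weight 𝔥,
    ⨆ (_ : β a = (((n : ℕ) : ℤ) : ℂ)), rootSpaceHat 𝔥 β) := fun n => ha.finite _
  have hVfd : FiniteDimensional ℂ V := Submodule.finite_iSup _
  let V' : Submodule ℂ (nPart a) := V.comap (nPart a).toSubmodule.subtype
  have hV' : FiniteDimensional ℂ V' := by
    refine Module.Finite.of_injective (M := V') (N := V)
      (LinearMap.restrict (nPart a).toSubmodule.subtype (p := V') (q := V) fun x hx => hx)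
      fun x y h => ?_
    exact Subtype.ext (Subtype.ext (show ((x : nPart a) : Affine 𝔤) = (y : nPart a) from
      congrArg (fun z : V => (z : Affine 𝔤)) h))
  obtain ⟨t, ht⟩ := Module.Finite.iff_fg.mp hV'
  -- Including 1 makes the powers of T increase, so that T ^ k also contains the words with fewer
  -- than k factors.
  let T : Submodule A (EnvAlg A (nPart a)) := Submodule.span A (insert 1 (gen A '' (t : Set (nPart a))))
  have hT1 : 1 ∈ T := Submodule.subset_span (Set.mem_insert _ _)
  have hT : ∀ x ∈ V', gen A x ∈ T := by
    intro x hx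
    rw [← ht] at hx
    induction hx using Submodule.span_induction with
    | mem x hx => exact Submodule.subset_span (Set.mem_insert_of_mem _ ⟨x, hx, rfl⟩)
    | zero => rw [gen_zero]; exact zero_mem _
    | add x y _ _ hx hy => rw [gen_add]; exact add_mem hx hy
    | smul c x _ hx => rw [gen_smul]; exact Submodule.smul_mem _ (algebraMap ℂ A c) hx
  have hTfg : T.FG := Submodule.fg_span ((t.finite_toSet.image _).insert _)
  have key (ν : Weight 𝔥) (s) (h : IsWord a A ν s) : ∀ m : ℕ, m ≤ k → ν a = (m : ℂ) → s ∈ T ^ m := by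
    induction h with
    | one =>
      intro m _ h
      rw [LinearMap.zero_apply] at h
      have : m = 0 := by exact_mod_cast h.symm
      rw [this, pow_zero]; exact Submodule.one_le.mp le_rfl
    | @mul β ν s X hβ hX hX0 hs ih =>
      intro m hm h
      obtain ⟨n, hn, hβn⟩ := hβ
      obtain ⟨l, hl⟩ : ν ∈ nonnegDeg a := by
        rcases hs.mem_deg with ⟨rfl, -⟩ | ⟨h, -⟩
        · exact zero_mem_nonnegDeg
        · exact posDeg_subset h
      have hnl : n + l = m := by
        rw [LinearMap.add_apply, hβn, hl] at h
        exact_mod_cast h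
      have h1 : gen A X ∈ T := by
        refine hT X (Submodule.mem_iSup_of_mem ⟨n, by omega⟩ ?_)
        exact (le_iSup₂_of_le β (by simpa using hβn) le_rfl : rootSpaceHat 𝔥 β ≤ _) hX
      have h2 := ih l (by omega) hl
      have hpow : ∀ i j : ℕ, i ≤ j → T ^ i ≤ T ^ j := fun i j hij =>
        pow_le_pow_right' (Submodule.one_le.mpr hT1) hij
      have h3 : gen A X * s ∈ T ^ (1 + l) := by
        rw [pow_add, pow_one]; exact Submodule.mul_mem_mul h1 h2
      exact hpow _ _ (by omega) h3
  have hle : wordSpan a A ν ≤ T ^ k := Submodule.span_le.mpr fun s hs => key ν s hs k le_rfl hk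
  have hfin : Module.Finite A ↥(T ^ k) := Module.Finite.iff_fg.mpr (hTfg.pow k)
  have := isNoetherian_of_isNoetherianRing_of_finite A ↥(T ^ k)
  exact Submodule.FG.of_le_of_isNoetherian hle

end Words

/-! ### Modules free over the negative part on finitely many weight vectors -/

section Std

attribute [local instance 100] LieRing.ofAssociativeRing

variable {𝔤 : Type u} [LieRing 𝔤] [LieAlgebra ℂ 𝔤] {𝔥 𝔟 : LieSubalgebra ℂ 𝔤}
variable {a : CartanHat 𝔥}
variable {A : Type v} [CommRing A] [Algebra ℂ A] [Algebra (SymmetricAlgebra ℂ 𝔥) A]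
  [IsScalarTower ℂ (SymmetricAlgebra ℂ 𝔥) A]
variable {M : Type w} [AddCommGroup M] [Module A M] [Module (Env 𝔤 A) M]
  [IsScalarTower A (Env 𝔤 A) M]

theorem act_mul_comm (X Y : Affine 𝔤) :
    act A X * act A Y = act A ⁅X, Y⁆ + act A Y * act A X := by
  rw [act_lie, sub_add_cancel]

theorem act_smul_smul (X Y : Affine 𝔤) (m : M) :
    act A X • act A Y • m = act A ⁅X, Y⁆ • m + act A Y • act A X • m := by
  rw [smul_smul, act_mul_comm, add_smul, mul_smul]

theorem act_zero : act A (0 : Affine 𝔤) = 0 := gen_zero A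

theorem act_smul_mem_weightSpace {β γ : Weight 𝔥} {X : Affine 𝔤} (hX : X ∈ rootSpaceHat 𝔥 β) {m : M}
    (hm : m ∈ weightSpace 𝔥 A M γ) : act A X • m ∈ weightSpace 𝔥 A M (γ + β) := fun H => by
  rw [act_smul_smul, hX H, act_smul, hm H, deformedWeight_add, add_smul, smul_assoc,
    smul_comm (act A X) (deformedWeight 𝔥 A γ H) m]

theorem inclAlg_smul_mem_of_isWord {ν γ : Weight 𝔥} {s : EnvAlg A (nPart a)} (hs : IsWord a A ν s)
    {m : M} (hm : m ∈ weightSpace 𝔥 A M γ) :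
    inclAlg (nPart a) s • m ∈ weightSpace 𝔥 A M (γ + ν) := by
  induction hs with
  | one => rwa [map_one, one_smul, add_zero]
  | mul X hβ hX hX0 h ih =>
    rw [map_mul, inclAlg_gen, mul_smul, ← add_assoc, add_right_comm]
    exact act_smul_mem_weightSpace hX ih

variable {ι : Type} [Fintype ι]

variable (a A) in
/-- The map `s ↦ ∑ sᵢ mᵢ` with coefficients in the enveloping algebra of the negative part. -/
def stdSum (m : ι → M) : (ι → EnvAlg A (nPart (-a))) →ₗ[A] M :=
  ∑ i, (LinearMap.toSpanSingleton (Env 𝔤 A) M (m i)).restrictScalars A ∘ₗ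
    (inclAlg (nPart (-a))).toLinearMap ∘ₗ LinearMap.proj i

theorem stdSum_apply (m : ι → M) (s : ι → EnvAlg A (nPart (-a))) :
    stdSum a A m s = ∑ i, inclAlg (nPart (-a)) (s i) • m i := by
  simp [stdSum]

theorem stdSum_single [DecidableEq ι] (m : ι → M) (i : ι) (s : EnvAlg A (nPart (-a))) :
    stdSum a A m (Pi.single i s) = inclAlg (nPart (-a)) s • m i := by
  rw [stdSum_apply, Finset.sum_eq_single i]
  · rw [Pi.single_eq_same]
  · intro j _ hj
    rw [Pi.single_eq_of_ne hj, map_zero, zero_smul]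
  · simp

theorem stdSum_smul (m : ι → M) (u : EnvAlg A (nPart (-a))) (s : ι → EnvAlg A (nPart (-a))) :
    stdSum a A m (u • s) = inclAlg (nPart (-a)) u • stdSum a A m s := by
  simp only [stdSum_apply, Pi.smul_apply, smul_eq_mul, map_mul, mul_smul, Finset.smul_sum]

variable (a A) in
/-- A finite family of weight vectors that is a basis over the enveloping algebra of the negative
part. -/
structure IsStdBasis (wt : ι → Weight 𝔥) (m : ι → M) : Prop where
  mem : ∀ i, m i ∈ weightSpace 𝔥 A M (wt i)
  bij : Function.Bijective (stdSum a A m)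

theorem span_word_eq_range (m : ι → M) : Submodule.span A
    {z | ∃ i ν s, IsWord (-a) A ν s ∧ z = inclAlg (nPart (-a)) s • m i} =
      LinearMap.range (stdSum a A m) := by
  classical
  apply le_antisymm
  · rw [Submodule.span_le]
    rintro - ⟨i, ν, s, -, rfl⟩
    exact ⟨Pi.single i s, stdSum_single m i s⟩
  · rintro - ⟨s, rfl⟩
    rw [stdSum_apply]
    refine sum_mem fun i _ => ?_
    have h : s i ∈ Submodule.span A {s | ∃ ν, IsWord (-a) A ν s} := by rw [span_isWord]; trivial
    generalize s i = t at h
    induction h using Submodule.span_induction with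
    | mem t h =>
      obtain ⟨ν, h⟩ := h
      exact Submodule.subset_span ⟨i, ν, t, h, rfl⟩
    | zero => rw [map_zero, zero_smul]; exact zero_mem _
    | add s t _ _ hs ht => rw [map_add, add_smul]; exact add_mem hs ht
    | smul c s _ hs => rw [map_smul, smul_assoc]; exact Submodule.smul_mem _ _ hs

/-- Weight vectors are combinations of the `mᵢ` with coefficients of the right weights. -/
theorem exists_stdSum_eq {wt : ι → Weight 𝔥} {m : ι → M} (hm : ∀ i, m i ∈ weightSpace 𝔥 A M (wt i))
    {γ : Weight 𝔥} {x : M} (hx : x ∈ weightSpace 𝔥 A M γ) (h : x ∈ LinearMap.range (stdSum a A m)) :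
    ∃ s, (∀ i, s i ∈ wordSpan (-a) A (γ - wt i)) ∧ stdSum a A m s = x := by
  classical
  have h1 : x ∈ Submodule.span A {z | z ∈ weightSpace 𝔥 A M γ ∧
      ∃ i s, IsWord (-a) A (γ - wt i) s ∧ z = inclAlg (nPart (-a)) s • m i} := by
    refine mem_span_of_mem_weightSpace (P := fun γ z => ∃ i s, IsWord (-a) A (γ - wt i) s ∧
      z = inclAlg (nPart (-a)) s • m i) hx ?_
    rw [← span_word_eq_range] at h
    refine Submodule.span_mono ?_ h
    rintro - ⟨i, ν, s, hs, rfl⟩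
    exact ⟨wt i + ν, inclAlg_smul_mem_of_isWord hs (hm i), i, s, by rwa [add_sub_cancel_left], rfl⟩
  clear h hx
  induction h1 using Submodule.span_induction with
  | mem x h =>
    obtain ⟨-, i, s, hs, rfl⟩ := h
    refine ⟨Pi.single i s, fun j => ?_, stdSum_single m i s⟩
    by_cases hj : j = i
    · subst hj; rw [Pi.single_eq_same]; exact Submodule.subset_span hs
    · rw [Pi.single_eq_of_ne hj]; exact zero_mem _
  | zero => exact ⟨0, fun _ => zero_mem _, map_zero _⟩
  | add x y _ _ hx hy =>
    obtain ⟨s, hs, rfl⟩ := hx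
    obtain ⟨t, ht, rfl⟩ := hy
    exact ⟨s + t, fun i => add_mem (hs i) (ht i), map_add _ _ _⟩
  | smul c x _ hx =>
    obtain ⟨s, hs, rfl⟩ := hx
    exact ⟨c • s, fun i => Submodule.smul_mem _ _ (hs i), map_smul _ _ _⟩

namespace IsStdBasis

variable {wt : ι → Weight 𝔥} {m : ι → M}

theorem range_eq_top (h : IsStdBasis a A wt m) : LinearMap.range (stdSum a A m) = ⊤ :=
  LinearMap.range_eq_top.mpr h.bij.2

/-- Some coordinates of the right weights exist by `exists_stdSum_eq`; freeness makes them the given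
ones. -/
theorem coord_mem (h : IsStdBasis a A wt m) {γ : Weight 𝔥} {s : ι → EnvAlg A (nPart (-a))}
    (hs : stdSum a A m s ∈ weightSpace 𝔥 A M γ) (i : ι) : s i ∈ wordSpan (-a) A (γ - wt i) := by
  obtain ⟨t, ht, hts⟩ := exists_stdSum_eq h.mem hs ⟨s, rfl⟩
  rw [← h.bij.1 hts]
  exact ht i

end IsStdBasis

section Generated

variable {wt : ι → Weight 𝔥} {m : ι → M} (hm : ∀ i, m i ∈ weightSpace 𝔥 A M (wt i))
  (h : LinearMap.range (stdSum a A m) = ⊤)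
include hm h

theorem iSup_weightSpace_of_range_stdSum : ⨆ γ, weightSpace 𝔥 A M γ = ⊤ := by
  rw [eq_top_iff, ← h, ← span_word_eq_range, Submodule.span_le]
  rintro - ⟨i, ν, s, hs, rfl⟩
  exact Submodule.mem_iSup_of_mem _ (inclAlg_smul_mem_of_isWord hs (hm i))

theorem exists_of_weightSpace_ne_bot {γ : Weight 𝔥} (hγ : weightSpace 𝔥 A M γ ≠ ⊥) :
    ∃ i, γ - wt i ∈ rootCone (-a) := by
  obtain ⟨x, hx, hx0⟩ := Submodule.exists_mem_ne_zero_of_ne_bot hγ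
  obtain ⟨s, hs, rfl⟩ := exists_stdSum_eq hm hx (by rw [h]; trivial)
  obtain ⟨i, hi⟩ : ∃ i, s i ≠ 0 := by
    by_contra! h0
    exact hx0 (by rw [show s = 0 from funext h0, map_zero])
  exact ⟨i, mem_rootCone_of_mem_wordSpan (hs i) hi⟩

theorem fg_weightSpace_of_range_stdSum [IsNoetherianRing A] (ha : IsGrading 𝔥 a) (γ : Weight 𝔥) :
    (weightSpace 𝔥 A M γ).FG := by
  classical
  have hle : weightSpace 𝔥 A M γ ≤ ⨆ i, (wordSpan (-a) A (γ - wt i)).map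
      (((LinearMap.toSpanSingleton (Env 𝔤 A) M (m i)).restrictScalars A) ∘ₗ
        (inclAlg (nPart (-a))).toLinearMap) := by
    intro x hx
    obtain ⟨s, hs, rfl⟩ := exists_stdSum_eq hm hx (by rw [h]; trivial)
    rw [stdSum_apply]
    exact sum_mem fun i _ => Submodule.mem_iSup_of_mem i ⟨s i, hs i, rfl⟩
  exact Submodule.FG.of_le (Submodule.fg_iSup _ fun i => (fg_wordSpan ha.neg _).map _) hle

end Generated

/-- A subspace stable under the affine algebra as a submodule. -/
def envSubmodule (T : Submodule A M) (h : ∀ X : Affine 𝔤, ∀ t ∈ T, act A X • t ∈ T) :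
    Submodule (Env 𝔤 A) M where
  __ := T
  smul_mem' u := by
    induction u using env_induction with
    | hA c => intro t ht; rw [algebraMap_smul]; exact T.smul_mem c ht
    | hX X => intro t ht; exact h X t ht
    | hadd u v hu hv => intro t ht; rw [add_smul]; exact T.add_mem (hu ht) (hv ht)
    | hmul u v hu hv => intro t ht; rw [mul_smul]; exact hu (hv ht)

/-- To apply X to a product of elements of n̂₋ acting on a generator, commute X to the right past
one factor at a time. The commutators are again in ĝ, so the induction must run over all X at once.
At the generator X splits into a part in n̂₋ and a part in b̂. -/
theorem act_smul_mem_of_nPart {T : Submodule A M} (ha : IsGrading 𝔥 a) {G : Set M}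
    (hT : T = Submodule.span A {z | ∃ (s : EnvAlg A (nPart (-a))) (g : M), g ∈ G ∧
      z = inclAlg (nPart (-a)) s • g})
    (hG : ∀ g ∈ G, ∀ X ∈ bPart a, act A X • g ∈ T) (X : Affine 𝔤) (t : M) (ht : t ∈ T) :
    act A X • t ∈ T := by
  have hn (x : nPart (-a)) (t) (ht : t ∈ T) : act A (x : Affine 𝔤) • t ∈ T := by
    rw [hT] at ht ⊢
    induction ht using Submodule.span_induction with
    | mem t h =>
      obtain ⟨s, g, hg, rfl⟩ := h
      refine Submodule.subset_span ⟨gen A x * s, g, hg, ?_⟩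
      rw [map_mul, inclAlg_gen, mul_smul]; rfl
    | zero => rw [smul_zero]; exact zero_mem _
    | add s t _ _ hs ht => rw [smul_add]; exact add_mem hs ht
    | smul c s _ hs => rw [smul_comm]; exact Submodule.smul_mem _ _ hs
  have hG' (g) (hg : g ∈ G) : g ∈ T := by
    rw [hT]; exact Submodule.subset_span ⟨1, g, hg, by rw [map_one, one_smul]⟩
  have key (g) (hg : g ∈ G) (s : EnvAlg A (nPart (-a))) :
      ∀ X : Affine 𝔤, act A X • inclAlg (nPart (-a)) s • g ∈ T := by
    let T' : Submodule A (EnvAlg A (nPart (-a))) :=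
      { carrier := {s | ∀ X : Affine 𝔤, act A X • inclAlg (nPart (-a)) s • g ∈ T}
        add_mem' := fun hs ht X => by
          rw [map_add, add_smul, smul_add]; exact T.add_mem (hs X) (ht X)
        zero_mem' := fun X => by rw [map_zero, zero_smul, smul_zero]; exact T.zero_mem
        smul_mem' := fun c s hs X => by
          rw [map_smul, smul_assoc, smul_comm]; exact T.smul_mem c (hs X) }
    have hT' : T' = ⊤ := by
      refine envAlg_eq_top (fun X => ?_) fun x s hs X => ?_
      · rw [map_one, one_smul]
        have hX : X ∈ (nPart (-a)).toSubmodule ⊔ (bPart a).toSubmodule := by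
          rw [ha.isCompl.sup_eq_top]; trivial
        obtain ⟨n, hn', b, hb, rfl⟩ := Submodule.mem_sup.mp hX
        rw [act_add, add_smul]
        exact add_mem (hn ⟨n, hn'⟩ g (hG' g hg)) (hG g hg b hb)
      · rw [map_mul, inclAlg_gen, mul_smul]
        change act A X • act A (x : Affine 𝔤) • _ ∈ T
        rw [act_smul_smul]
        exact add_mem (hs _) (hn x _ (hs X))
    have : s ∈ T' := by rw [hT']; trivial
    exact this
  have ht' := ht
  rw [hT] at ht'
  induction ht' using Submodule.span_induction with
  | mem t h =>
    obtain ⟨s, g, hg, rfl⟩ := h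
    exact key g hg s X
  | zero => rw [smul_zero]; exact zero_mem _
  | add s t hs' ht' hs ht2 =>
    rw [← hT] at hs' ht'
    rw [smul_add]; exact add_mem (hs hs') (ht2 ht')
  | smul c s hs' hs => rw [← hT] at hs'; rw [smul_comm]; exact Submodule.smul_mem _ _ (hs hs')

variable (a A) in
/-- The coefficient vectors supported on the indices with a given property. -/
def coordSub (p : ι → Prop) : Submodule A (ι → EnvAlg A (nPart (-a))) where
  carrier := {s | ∀ i, ¬ p i → s i = 0}
  add_mem' := fun hs ht i hi => by rw [Pi.add_apply, hs i hi, ht i hi, add_zero]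
  zero_mem' := fun i _ => rfl
  smul_mem' := fun c s hs i hi => by rw [Pi.smul_apply, hs i hi, smul_zero]

theorem mem_coordSub {p : ι → Prop} {s : ι → EnvAlg A (nPart (-a))} :
    s ∈ coordSub a A p ↔ ∀ i, ¬ p i → s i = 0 := Iff.rfl

theorem span_set_eq_map {G : Set M} {m : ι → M} {p : ι → Prop}
    (hG : ∀ g, g ∈ G ↔ ∃ i, p i ∧ m i = g) :
    Submodule.span A {z | ∃ (s : EnvAlg A (nPart (-a))) (g : M), g ∈ G ∧
      z = inclAlg (nPart (-a)) s • g} = Submodule.map (stdSum a A m) (coordSub a A p) := by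
  classical
  apply le_antisymm
  · rw [Submodule.span_le]
    rintro - ⟨s, g, hg, rfl⟩
    obtain ⟨i, hi, rfl⟩ := (hG g).mp hg
    refine ⟨Pi.single i s, fun j hj => Pi.single_eq_of_ne ?_ _, stdSum_single m i s⟩
    rintro rfl
    exact hj hi
  · rintro - ⟨s, hs, rfl⟩
    rw [stdSum_apply]
    refine sum_mem fun i _ => ?_
    by_cases hi : p i
    · exact Submodule.subset_span ⟨s i, m i, (hG _).mpr ⟨i, hi, rfl⟩, rfl⟩
    · rw [hs i hi, map_zero, zero_smul]; exact zero_mem _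

/-- A bracket has degree 0 only if both factors have degree 0; then they lie in the abelian Cartan
subalgebra and the bracket is zero. -/
theorem bPart_lie_le (ha : IsGrading 𝔥 a) {X Y : Affine 𝔤} (hX : X ∈ bPart a) (hY : Y ∈ bPart a) :
    ⁅X, Y⁆ ∈ nPart a := by
  refine rootSum_lie (V := (nPart a).toSubmodule) ?_ hX hY
  intro β hβ X hX γ hγ Y hY
  by_cases hX0 : X = 0
  · rw [hX0, zero_lie]; exact zero_mem _
  by_cases hY0 : Y = 0
  · rw [hY0, lie_zero]; exact zero_mem _
  obtain ⟨n, hn⟩ := hβ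
  obtain ⟨k, hk⟩ := hγ
  rcases Nat.eq_zero_or_pos (n + k) with h | h
  · obtain rfl : β = 0 := ha.eq_zero β (fun h => hX0 (by simpa [h] using hX))
      (by rw [hn, (by omega : n = 0), Nat.cast_zero])
    obtain rfl : γ = 0 := ha.eq_zero γ (fun h => hY0 (by simpa [h] using hY))
      (by rw [hk, (by omega : k = 0), Nat.cast_zero])
    obtain ⟨H, rfl⟩ := ha.cartan X hX
    rw [hY H, LinearMap.zero_apply, zero_smul]
    exact zero_mem _
  · refine mem_nPart ⟨n + k, h, by rw [LinearMap.add_apply, hn, hk, Nat.cast_add]⟩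
      (lie_mem_rootSpaceHat hX hY)

theorem cartanIncl_injective : Function.Injective (cartanIncl (𝔥 := 𝔥)) := by
  intro H H' h
  have h1 : (H.1 : 𝔤) = H'.1 := Finsupp.single_injective 0 (congrArg Affine.loop h)
  exact Prod.ext (Subtype.ext h1) (Prod.ext (congrArg Affine.cent h) (congrArg Affine.der h))

/-- The projection onto the affine Cartan subalgebra. -/
theorem exists_cartanProj (ha : IsGrading 𝔥 a) (hc : ∀ H : CartanHat 𝔥, cartanIncl H ∈ rootSpaceHat 𝔥 0) :
    ∃ p : Affine 𝔤 →ₗ[ℂ] CartanHat 𝔥, (∀ H, p (cartanIncl H) = H) ∧ ∀ X ∈ nPart a, p X = 0 := by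
  let i : CartanHat 𝔥 →ₗ[ℂ] rootSpaceHat 𝔥 0 :=
    { toFun := fun H => ⟨cartanIncl H, hc H⟩
      map_add' := fun H H' => Subtype.ext (by ext1 <;> simp [cartanIncl])
      map_smul' := fun c H => Subtype.ext (by ext1 <;> simp [cartanIncl]) }
  have hi : Function.Bijective i := by
    refine ⟨fun H H' h => cartanIncl_injective (congrArg Subtype.val h), ?_⟩
    rintro ⟨X, hX⟩
    obtain ⟨H, rfl⟩ := ha.cartan X hX
    exact ⟨H, rfl⟩
  have hcompl : IsCompl (rootSpaceHat 𝔥 0) (rootSum {β : Weight 𝔥 | β ≠ 0}) := by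
    constructor
    · exact iSupIndep_rootSpaceHat 0
    · rw [codisjoint_iff, eq_top_iff, ← ha.iSup_eq_top]
      refine iSup_le fun β => ?_
      by_cases h : β = 0
      · rw [h]; exact le_sup_left
      · exact (rootSpaceHat_le_rootSum h).trans le_sup_right
  let e := LinearEquiv.ofBijective i hi
  refine ⟨e.symm.toLinearMap ∘ₗ Submodule.projectionOnto _ _ hcompl, fun H => ?_, fun X hX => ?_⟩
  · rw [LinearMap.comp_apply]
    have := Submodule.projectionOnto_apply_left hcompl (⟨cartanIncl H, hc H⟩ : rootSpaceHat 𝔥 0)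
    change e.symm (Submodule.projectionOnto _ _ hcompl (cartanIncl H)) = H
    rw [this, LinearEquiv.symm_apply_eq]; rfl
  · rw [LinearMap.comp_apply]
    have hX' : X ∈ rootSum {β : Weight 𝔥 | β ≠ 0} := rootSum_le (V := rootSum {β : Weight 𝔥 | β ≠ 0})
      (fun β hβ X hX => rootSpaceHat_le_rootSum (Φ := {β : Weight 𝔥 | β ≠ 0})
        (fun h => posDeg_zero_notMem (a := a) (h ▸ hβ)) hX) hX
    rw [(Submodule.projectionOnto_apply_eq_zero_iff hcompl).mpr hX', map_zero]

variable (A) in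
theorem deformedWeight_linear (lam : Weight 𝔥) : ∃ f : CartanHat 𝔥 →ₗ[ℂ] A,
    ∀ H, f H = deformedWeight 𝔥 A lam H :=
  ⟨{ toFun := deformedWeight 𝔥 A lam
     map_add' := fun H H' => by simp [deformedWeight]; ring
     map_smul' := fun c H => by
       have h1 : algebraMap (SymmetricAlgebra ℂ 𝔥) A (c • SymmetricAlgebra.ι ℂ 𝔥 H.1) =
           c • algebraMap (SymmetricAlgebra ℂ 𝔥) A (SymmetricAlgebra.ι ℂ 𝔥 H.1) :=
         map_smul (IsScalarTower.toAlgHom ℂ (SymmetricAlgebra ℂ 𝔥) A) c _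
       rw [RingHom.id_apply, deformedWeight, deformedWeight, smul_add, Prod.smul_fst, map_smul lam,
         map_smul (SymmetricAlgebra.ι ℂ 𝔥), h1, smul_eq_mul, map_mul, ← Algebra.smul_def] },
    fun _ => rfl⟩

end Std

/-! ### Verma modules: universal property and freeness -/

section Verma

attribute [local instance 100] LieRing.ofAssociativeRing

variable {𝔤 : Type u} [LieRing 𝔤] [LieAlgebra ℂ 𝔤] [FiniteDimensional ℂ 𝔤] [LieAlgebra.IsSimple ℂ 𝔤]
variable {𝔥 𝔟 : LieSubalgebra ℂ 𝔤} [𝔥.IsCartanSubalgebra]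
variable {A : Type v} [CommRing A] [Algebra ℂ A] [Algebra (SymmetricAlgebra ℂ 𝔥) A]
  [IsScalarTower ℂ (SymmetricAlgebra ℂ 𝔥) A]
variable {M : Type w} [AddCommGroup M] [Module A M] [Module (Env 𝔤 A) M]
  [IsScalarTower A (Env 𝔤 A) M]
variable {a : CartanHat 𝔥} (ha : IsBorelGrading 𝔥 𝔟 a) {lam : Weight 𝔥}

include ha in
theorem mem_borelHat_iff {X : Affine 𝔤} : X ∈ borelHat 𝔟 ↔ X ∈ bPart a := by
  rw [← LieSubalgebra.mem_toSubmodule, ha.borel]; rfl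

variable (𝔟 A lam) in
/-- The canonical generator of the Verma module. -/
def vermaGen : Verma 𝔥 𝔟 A lam := Submodule.Quotient.mk 1

theorem smul_vermaGen (u : Env 𝔤 A) :
    u • vermaGen 𝔟 A lam = Submodule.Quotient.mk u := by
  rw [vermaGen, ← Submodule.Quotient.mk_smul, smul_eq_mul, mul_one]

theorem vermaGen_mem : vermaGen 𝔟 A lam ∈ weightSpace 𝔥 A (Verma 𝔥 𝔟 A lam) lam := by
  intro H
  rw [← algebraMap_smul (Env 𝔤 A) (deformedWeight 𝔥 A lam H), smul_vermaGen, smul_vermaGen,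
    Submodule.Quotient.eq]
  exact Submodule.subset_span (Or.inl ⟨H, rfl⟩)

include ha in
-- The defining relations kill [b̂, b̂], which contains n̂₊ because a acts on each positive degree
-- by a nonzero scalar.
theorem act_smul_vermaGen {X : Affine 𝔤} (hX : X ∈ nPart a) : act A X • vermaGen 𝔟 A lam = 0 := by
  let V : Submodule ℂ (Affine 𝔤) :=
    { carrier := {X | act A X ∈ vermaIdeal 𝔥 𝔟 A lam}
      add_mem' := fun h h' => by
        rw [Set.mem_ofPred_eq, act_add]; exact add_mem h h'
      zero_mem' := by rw [Set.mem_ofPred_eq, act_zero]; exact zero_mem _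
      smul_mem' := fun c X h => by
        rw [Set.mem_ofPred_eq, act_smul, Algebra.smul_def]
        exact Submodule.smul_mem _ _ h }
  have h1 : X ∈ V := nPart_le_span_lie V
    (mem_bPart zero_mem_nonnegDeg (cartanIncl_mem_rootSpaceHat a))
    (fun X hX Y hY => Submodule.subset_span (Or.inr ⟨X, (mem_borelHat_iff ha).mpr hX, Y,
      (mem_borelHat_iff ha).mpr hY, rfl⟩)) hX
  rw [smul_vermaGen, Submodule.Quotient.mk_eq_zero]
  exact h1

include ha in
-- The relations of the Verma module hold for v: those of ĥ say that v has weight lam, and those of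
-- the derived algebra follow from [b̂, b̂] ⊆ n̂₊.
theorem exists_verma_hom {v : M} (hv : v ∈ weightSpace 𝔥 A M lam)
    (hn : ∀ X ∈ nPart a, act A X • v = 0) :
    ∃ f : Verma 𝔥 𝔟 A lam →ₗ[Env 𝔤 A] M, f (vermaGen 𝔟 A lam) = v := by
  have hle : vermaIdeal 𝔥 𝔟 A lam ≤ LinearMap.ker (LinearMap.toSpanSingleton (Env 𝔤 A) M v) := by
    rw [vermaIdeal, Submodule.span_le]
    rintro u (⟨H, rfl⟩ | ⟨X, hX, Y, hY, rfl⟩)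
    · rw [SetLike.mem_coe, LinearMap.mem_ker, LinearMap.toSpanSingleton_apply, sub_smul, hv H,
        algebraMap_smul, sub_self]
    · rw [SetLike.mem_coe, LinearMap.mem_ker, LinearMap.toSpanSingleton_apply]
      exact hn _ (bPart_lie_le ha.toIsGrading ((mem_borelHat_iff ha).mp hX) ((mem_borelHat_iff ha).mp hY))
  exact ⟨(vermaIdeal 𝔥 𝔟 A lam).liftQ _ hle, (Submodule.liftQ_apply _ _ _).trans (one_smul _ _)⟩

/-- In degree 0 only ĥ acts, and it multiplies a weight vector by scalars. So only n̂₊ has to be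
checked. -/
theorem act_mem_of_bPart {T : Submodule A M} {v : M} (hgr : IsGrading 𝔥 a)
    (hv : v ∈ weightSpace 𝔥 A M lam)
    (hn : ∀ X ∈ nPart a, act A X • v ∈ T) (hvT : v ∈ T) {X : Affine 𝔤} (hX : X ∈ bPart a) :
    act A X • v ∈ T := by
  let V : Submodule ℂ (Affine 𝔤) :=
    { carrier := {X | act A X • v ∈ T}
      add_mem' := fun h h' => by
        rw [Set.mem_ofPred_eq, act_add, add_smul]; exact add_mem h h'
      zero_mem' := by rw [Set.mem_ofPred_eq, act_zero, zero_smul]; exact zero_mem _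
      smul_mem' := fun c X h => by
        rw [Set.mem_ofPred_eq, act_smul, smul_assoc]; exact Submodule.smul_mem _ _ h }
  refine rootSum_le (V := V) (fun β hβ X hX => ?_) hX
  change act A X • v ∈ T
  by_cases hX0 : X = 0
  · rw [hX0, act_zero, zero_smul]; exact zero_mem _
  obtain ⟨n, h⟩ := hβ
  rcases Nat.eq_zero_or_pos n with rfl | hn0
  · obtain rfl : β = 0 := hgr.eq_zero β (fun h => hX0 (by simpa [h] using hX)) (by simpa using h)
    obtain ⟨H, rfl⟩ := hgr.cartan X hX
    rw [hv H]
    exact T.smul_mem _ hvT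
  · exact hn X (mem_nPart ⟨n, hn0, h⟩ hX)

theorem range_stdSum_unit (v : M) : LinearMap.range (stdSum a A (fun _ : Unit => v)) =
    Submodule.span A {z | ∃ (s : EnvAlg A (nPart (-a))) (g : M), g ∈ ({v} : Set M) ∧
      z = inclAlg (nPart (-a)) s • g} := by
  rw [span_set_eq_map (m := fun _ : Unit => v) (p := fun _ => True) (by simp [eq_comm])]
  rw [LinearMap.range_eq_map]
  congr 1
  ext s
  simp [mem_coordSub]

include ha in
-- Injectivity is read off after mapping to the module induced from the character lam + τ of b̂,
-- which is free over A ⊗ U(n̂₋) by construction. Surjectivity holds because the U(n̂₋)-span of the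
-- generator is stable under ĝ.
theorem isStdBasis_vermaGen :
    IsStdBasis a A (fun _ : Unit => lam) (fun _ : Unit => vermaGen 𝔟 A lam) where
  mem _ := vermaGen_mem
  bij := by
    constructor
    · obtain ⟨p, hp, hp0⟩ := exists_cartanProj ha.toIsGrading
        (fun H => cartanIncl_mem_rootSpaceHat (𝔥 := 𝔥) H)
      obtain ⟨f, hf⟩ := deformedWeight_linear A lam
      -- The character of b̂ factors through the projection to ĥ. It respects brackets because the
      -- projection kills n̂₊, which contains [b̂, b̂].
      let ρ : bPart a →ₗ⁅ℂ⁆ Module.End A (Unit → A) :=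
        { toFun := fun X => algebraMap A _ (f (p X))
          map_add' := fun X Y => by
            rw [AddMemClass.coe_add, map_add, map_add, map_add]
          map_smul' := fun c X => by
            rw [SetLike.val_smul, map_smul, map_smul, ← algebraMap_smul A c (f _), smul_eq_mul,
              map_mul, ← Algebra.smul_def, algebraMap_smul, RingHom.id_apply]
          map_lie' := fun {X Y} => by
            rw [LieSubalgebra.coe_bracket, hp0 _ (bPart_lie_le ha.toIsGrading X.2 Y.2), map_zero,
              map_zero, LieRing.of_associative_ring_bracket, Algebra.commutes, sub_self] }
      obtain ⟨W, _, _, _, _, i, hi, hbij⟩ := exists_induced ha.toIsGrading.isCompl ρ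
      set w := i (Pi.single () 1) with hw
      have hact (X : bPart a) : act A (X : Affine 𝔤) • w = f (p X) • w := by
        have h1 : ρ X (Pi.single () 1) = f (p X) • Pi.single () 1 := rfl
        rw [hw, ← map_smul i, ← h1]
        exact hi X _
      have hcart (H : CartanHat 𝔥) : cartanIncl H ∈ bPart a :=
        mem_bPart zero_mem_nonnegDeg (cartanIncl_mem_rootSpaceHat H)
      obtain ⟨φ, hφ⟩ := exists_verma_hom (𝔟 := 𝔟) (lam := lam) (v := w) ha
        (fun H => by rw [hact ⟨_, hcart H⟩, hp, hf])
        (fun X hX => by rw [hact ⟨X, nPart_le_bPart hX⟩, hp0 X hX, map_zero, zero_smul])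
      intro s t hst
      apply hbij.1
      have := congrArg φ hst
      simpa [stdSum_apply, hφ] using this
    · rw [← LinearMap.range_eq_top, range_stdSum_unit]
      set T := Submodule.span A {z | ∃ (s : EnvAlg A (nPart (-a))) (g : Verma 𝔥 𝔟 A lam),
        g ∈ ({vermaGen 𝔟 A lam} : Set (Verma 𝔥 𝔟 A lam)) ∧ z = inclAlg (nPart (-a)) s • g} with hT
      have hv : vermaGen 𝔟 A lam ∈ T :=
        Submodule.subset_span ⟨1, _, rfl, by rw [map_one, one_smul]⟩
      have h1 := act_smul_mem_of_nPart ha.toIsGrading hT (by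
        rintro g rfl X hX
        exact act_mem_of_bPart ha.toIsGrading vermaGen_mem
          (fun X hX => by rw [act_smul_vermaGen ha hX]; exact zero_mem _) hv hX)
      rw [eq_top_iff]
      rintro x -
      obtain ⟨u, rfl⟩ := Submodule.Quotient.mk_surjective _ x
      rw [← smul_vermaGen]
      exact (envSubmodule T h1).smul_mem u hv

end Verma

/-! ### The order on weights -/

section Order

variable {𝔤 : Type u} [LieRing 𝔤] [LieAlgebra ℂ 𝔤] [FiniteDimensional ℂ 𝔤] [LieAlgebra.IsSimple ℂ 𝔤]
variable {𝔥 𝔟 : LieSubalgebra ℂ 𝔤} [𝔥.IsCartanSubalgebra]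
variable {a : CartanHat 𝔥}

theorem WeightLE.refl (γ : Weight 𝔥) : WeightLE 𝔥 𝔟 γ γ := by
  rw [WeightLE, sub_self]; exact zero_mem _

theorem WeightLE.trans {γ γ' γ'' : Weight 𝔥} (h : WeightLE 𝔥 𝔟 γ γ') (h' : WeightLE 𝔥 𝔟 γ' γ'') :
    WeightLE 𝔥 𝔟 γ γ'' := by
  have := add_mem h h'
  rwa [sub_add_sub_cancel'] at this

variable (ha : IsBorelGrading 𝔥 𝔟 a)
include ha

/-- The grading element is positive on all positive affine roots. This is the source of antisymmetry
of the order. -/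
theorem eq_or_posDeg_of_mem_closure {ν : Weight 𝔥}
    (h : ν ∈ AddSubmonoid.closure (affinePosRoots 𝔥 𝔟)) : ν = 0 ∨ ν ∈ posDeg a := by
  induction h using AddSubmonoid.closure_induction with
  | mem β hβ => exact Or.inr (ha.pos β hβ)
  | zero => exact Or.inl rfl
  | add β γ _ _ hβ hγ =>
    rcases hβ with rfl | hβ
    · rwa [zero_add]
    · refine Or.inr (posDeg_add hβ ?_)
      rcases hγ with rfl | hγ
      · exact zero_mem_nonnegDeg
      · exact posDeg_subset hγ

theorem WeightLE.eq_or_posDeg {γ γ' : Weight 𝔥} (h : WeightLE 𝔥 𝔟 γ γ') :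
    γ = γ' ∨ γ' - γ ∈ posDeg a :=
  (eq_or_posDeg_of_mem_closure ha h).imp (fun h => (sub_eq_zero.mp h).symm) id

theorem WeightLE.antisymm {γ γ' : Weight 𝔥} (h : WeightLE 𝔥 𝔟 γ γ') (h' : WeightLE 𝔥 𝔟 γ' γ) :
    γ = γ' := by
  rcases h.eq_or_posDeg ha with h1 | h1
  · exact h1
  rcases h'.eq_or_posDeg ha with h2 | h2
  · exact h2.symm
  have := posDeg_add h1 (posDeg_subset h2)
  rw [sub_add_sub_cancel, sub_self] at this
  exact absurd this posDeg_zero_notMem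

theorem weightLE_add {β γ : Weight 𝔥} (hβ : β ∈ posDeg a) (h : rootSpaceHat 𝔥 β ≠ ⊥) :
    WeightLE 𝔥 𝔟 γ (γ + β) := by
  rw [WeightLE, add_sub_cancel_left]
  exact AddSubmonoid.subset_closure (ha.mem β h hβ)

theorem weightLE_of_mem_rootCone {γ γ' : Weight 𝔥} (h : γ' - γ ∈ rootCone a) : WeightLE 𝔥 𝔟 γ γ' :=
  AddSubmonoid.closure_mono (fun β hβ => ha.mem β hβ.1 hβ.2) h

theorem weightLE_of_mem_rootCone_neg {γ γ' : Weight 𝔥} (h : γ' - γ ∈ rootCone (-a)) :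
    WeightLE 𝔥 𝔟 γ' γ := by
  have key : ∀ ν ∈ rootCone (-a), -ν ∈ AddSubmonoid.closure (affinePosRoots 𝔥 𝔟) := by
    intro ν hν
    induction hν using AddSubmonoid.closure_induction with
    | mem β hβ =>
      refine AddSubmonoid.subset_closure (ha.mem _ (rootSpaceHat_neg_ne_bot hβ.1) ?_)
      have := neg_mem_posDeg.mpr hβ.2
      rwa [neg_neg] at this
    | zero => rw [neg_zero]; exact zero_mem _
    | add β γ _ _ hβ hγ => rw [neg_add]; exact add_mem hβ hγ
  have := key _ h
  rwa [neg_sub] at this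

end Order

/-! ### Triangularity and change of basis -/

section StdLemmas

attribute [local instance 100] LieRing.ofAssociativeRing

variable {𝔤 : Type u} [LieRing 𝔤] [LieAlgebra ℂ 𝔤] {𝔥 : LieSubalgebra ℂ 𝔤}
variable {a : CartanHat 𝔥}
variable {A : Type v} [CommRing A] [Algebra ℂ A] [Algebra (SymmetricAlgebra ℂ 𝔥) A]
  [IsScalarTower ℂ (SymmetricAlgebra ℂ 𝔥) A]
variable {M : Type w} [AddCommGroup M] [Module A M] [Module (Env 𝔤 A) M]
  [IsScalarTower A (Env 𝔤 A) M]
variable {M' : Type*} [AddCommGroup M'] [Module A M'] [Module (Env 𝔤 A) M']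
  [IsScalarTower A (Env 𝔤 A) M']
variable {ι κ : Type} [Fintype ι] [Fintype κ]

theorem map_stdSum (f : M →ₗ[Env 𝔤 A] M') (m : ι → M) (s : ι → EnvAlg A (nPart (-a))) :
    f (stdSum a A m s) = stdSum a A (fun i => f (m i)) s := by
  simp only [stdSum_apply, map_sum, map_smul]

theorem stdSum_reindex (e : κ ≃ ι) (m : ι → M) (s : ι → EnvAlg A (nPart (-a))) :
    stdSum a A (fun k => m (e k)) (fun k => s (e k)) = stdSum a A m s := by
  simp only [stdSum_apply]
  exact e.sum_comp fun i => inclAlg (nPart (-a)) (s i) • m i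

namespace IsStdBasis

variable {wt : ι → Weight 𝔥} {m : ι → M}

theorem reindex (h : IsStdBasis a A wt m) (e : κ ≃ ι) :
    IsStdBasis a A (fun k => wt (e k)) (fun k => m (e k)) where
  mem k := h.mem (e k)
  bij := by
    have h1 : (stdSum a A fun k => m (e k)) ∘ (fun s k => s (e k)) = stdSum a A m :=
      funext fun s => stdSum_reindex e m s
    have h2 : Function.Bijective (fun (s : ι → EnvAlg A (nPart (-a))) k => s (e k)) :=
      (Equiv.piCongrLeft' (fun _ => EnvAlg A (nPart (-a))) e.symm).bijective
    have h3 := h.bij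
    rw [← h1] at h3
    exact (Function.Bijective.of_comp_iff _ h2).mp h3

theorem map_equiv (h : IsStdBasis a A wt m) (f : M ≃ₗ[Env 𝔤 A] M') :
    IsStdBasis a A wt (fun i => f (m i)) where
  mem i := map_mem_weightSpace f.toLinearMap (h.mem i)
  bij := by
    have : (stdSum a A fun i => f (m i) : _ → M') = f ∘ stdSum a A m :=
      funext fun s => (map_stdSum f.toLinearMap m s).symm
    rw [this]
    exact f.bijective.comp h.bij

/-- The coefficient s j lies in U(n̂₋) and has weight wt i + β - wt j, so this weight has degree at
most 0, while β has positive degree. Thus n̂₊ only leads to basis vectors of higher weight. -/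
theorem posDeg_of_coord_ne_zero (h : IsStdBasis a A wt m) {β : Weight 𝔥} (hβ : β ∈ posDeg a)
    {X : Affine 𝔤} (hX : X ∈ rootSpaceHat 𝔥 β) {i j : ι} {s : ι → EnvAlg A (nPart (-a))}
    (hs : stdSum a A m s = act A X • m i) (hj : s j ≠ 0) : wt j - wt i ∈ posDeg a := by
  have h1 := h.coord_mem (hs ▸ act_smul_mem_weightSpace hX (h.mem i)) j
  have h2 : -(wt i + β - wt j) ∈ nonnegDeg a := by
    rcases mem_deg_of_mem_wordSpan h1 hj with h3 | h3
    · rw [h3, neg_zero]; exact zero_mem_nonnegDeg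
    · have := posDeg_subset (neg_mem_posDeg.mpr h3)
      rwa [neg_neg] at this
  have h3 := posDeg_add hβ h2
  rwa [show β + -(wt i + β - wt j) = wt j - wt i by abel] at h3

/-- A nonzero coefficient would put the difference of the single weight with itself into positive
degree. -/
theorem act_smul_unit {lam : Weight 𝔥} {v : M}
    (h : IsStdBasis a A (fun _ : Unit => lam) (fun _ => v)) {X : Affine 𝔤} (hX : X ∈ nPart a) :
    act A X • v = 0 := by
  let V : Submodule ℂ (Affine 𝔤) :=
    { carrier := {X | act A X • v = 0}
      add_mem' := fun h h' => by
        rw [Set.mem_ofPred_eq] at *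
        rw [act_add, add_smul, h, h', add_zero]
      zero_mem' := by rw [Set.mem_ofPred_eq, act_zero, zero_smul]
      smul_mem' := fun c X h => by
        rw [Set.mem_ofPred_eq] at *
        rw [act_smul, smul_assoc, h, smul_zero] }
  refine rootSum_le (V := V) (fun β hβ X hX => ?_) hX
  obtain ⟨s, hs⟩ := h.bij.2 (act A X • v)
  have h1 : s = 0 := by
    funext j
    by_contra hj
    have := h.posDeg_of_coord_ne_zero hβ hX (i := j) hs hj
    rw [sub_self] at this
    exact posDeg_zero_notMem this
  change act A X • v = 0
  rw [← hs, h1, map_zero]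

/-- A change of basis by an invertible matrix. -/
theorem of_isUnit [DecidableEq ι] (h : IsStdBasis a A wt m)
    {X : Matrix ι ι (EnvAlg A (nPart (-a)))} (hX : IsUnit X) {wt' : ι → Weight 𝔥} {m' : ι → M}
    (hm' : ∀ i, m' i ∈ weightSpace 𝔥 A M (wt' i)) (hm : ∀ i, m' i = stdSum a A m (X i)) :
    IsStdBasis a A wt' m' where
  mem := hm'
  bij := by
    have h1 : (stdSum a A m' : _ → M) = stdSum a A m ∘ fun s => Matrix.vecMul s X := by
      funext s
      simp only [Function.comp_apply, stdSum_apply, hm, Matrix.vecMul, dotProduct, map_sum, map_mul,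
        Finset.smul_sum, Finset.sum_smul, mul_smul]
      exact Finset.sum_comm
    rw [h1]
    refine h.bij.comp ?_
    obtain ⟨Y, hY, hY'⟩ := isUnit_iff_exists.mp hX
    refine Function.bijective_iff_has_inverse.mpr ⟨fun s => Matrix.vecMul s Y, fun s => ?_, fun s => ?_⟩
    · simp only [Matrix.vecMul_vecMul, hY, Matrix.vecMul_one]
    · simp only [Matrix.vecMul_vecMul, hY', Matrix.vecMul_one]

/-- A matrix over the enveloping algebra that is invertible modulo the augmentation ideal and
compatible with the weights is invertible. -/
theorem isUnit_of_augmentation [DecidableEq ι] {X : Matrix ι ι (EnvAlg A (nPart (-a)))}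
    (hX : ∀ i j, X i j ∈ wordSpan (-a) A (wt i - wt j))
    (hD : IsUnit (X.map (augmentation (A := A) (L := nPart (-a))))) : IsUnit X := by
  classical
  let S := EnvAlg A (nPart (-a))
  set D : Matrix ι ι A := X.map (augmentation (A := A) (L := nPart (-a))) with hDdef
  -- The number of indices whose weight has strictly larger a-degree by an integer. It converts the
  -- comparison of weights into a comparison of natural numbers: a higher weight has smaller ρ.
  let ρ : ι → ℕ := fun i => (Finset.univ.filter fun k => wt i - wt k ∈ posDeg (-a)).card
  have hρ {i j} (h : wt i - wt j ∈ posDeg (-a)) : ρ j < ρ i := by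
    refine Finset.card_lt_card ⟨fun k hk => ?_, fun hle => ?_⟩
    · simp only [Finset.mem_filter, Finset.mem_univ, true_and] at hk ⊢
      have := posDeg_add h (posDeg_subset hk)
      rwa [sub_add_sub_cancel] at this
    · have := hle (Finset.mem_filter.mpr ⟨Finset.mem_univ j, h⟩)
      simp only [Finset.mem_filter, Finset.mem_univ, true_and, sub_self] at this
      exact posDeg_zero_notMem this
  have hDρ {i j} (h : D i j ≠ 0) : ρ i = ρ j := by
    have : wt i - wt j = 0 := by
      by_contra h0
      exact h (augmentation_eq_zero_of_mem_wordSpan (hX i j) h0)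
    simp only [ρ, sub_eq_zero.mp this]
  let _ := hD.invertible
  -- D has nonzero entries only within the levels of ρ. The inverse of a block triangular matrix is
  -- block triangular; applied to ρ and to the reversed order, this shows that D⁻¹ respects the
  -- levels too.
  have hDi {i j} (h : D⁻¹ i j ≠ 0) : ρ i = ρ j := by
    by_contra hne
    rcases lt_or_gt_of_ne hne with h1 | h1
    · have := Matrix.blockTriangular_inv_of_blockTriangular (M := D) (b := OrderDual.toDual ∘ ρ)
        fun i j hij => by
          by_contra h0
          rw [Function.comp_apply, Function.comp_apply, hDρ h0] at hij
          exact lt_irrefl _ hij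
      exact h (this h1)
    · have := Matrix.blockTriangular_inv_of_blockTriangular (M := D) (b := ρ)
        fun i j hij => by
          by_contra h0
          rw [hDρ h0] at hij
          exact lt_irrefl _ hij
      exact h (this h1)
  let f : Matrix ι ι A →+* Matrix ι ι S := (algebraMap A S).mapMatrix
  let N : Matrix ι ι S := X - f D
  have hN {i j} (h : N i j ≠ 0) : ρ j < ρ i := by
    rcases eq_or_ne (X i j) 0 with h0 | h0
    · refine absurd ?_ h
      change X i j - algebraMap A S (augmentation (X i j)) = 0
      rw [h0, map_zero, map_zero, sub_zero]
    · rcases mem_deg_of_mem_wordSpan (hX i j) h0 with h1 | h1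
      · refine absurd ?_ h
        have h2 := hX i j
        rw [h1] at h2
        change X i j - algebraMap A S (augmentation (X i j)) = 0
        rw [← eq_algebraMap_of_mem_wordSpan_zero h2, sub_self]
      · exact hρ h1
  -- With this choice D⁻¹ X = 1 - Z. Each nonzero entry of Z strictly lowers ρ, which is bounded by
  -- the number of indices, so Z is nilpotent and 1 - Z is invertible, although the coefficient ring
  -- is not commutative.
  let Z : Matrix ι ι S := -(f D⁻¹ * N)
  have hZ {i j} (h : Z i j ≠ 0) : ρ j < ρ i := by
    obtain ⟨k, -, hk⟩ : ∃ k ∈ Finset.univ, f D⁻¹ i k * N k j ≠ 0 := by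
      apply Finset.exists_ne_zero_of_sum_ne_zero
      intro h0
      apply h
      change -((f D⁻¹ * N) i j) = 0
      rw [Matrix.mul_apply, h0, neg_zero]
    have h1 : D⁻¹ i k ≠ 0 := by
      intro h0
      apply hk
      change algebraMap A S (D⁻¹ i k) * _ = 0
      rw [h0, map_zero, zero_mul]
    rw [hDi h1]
    exact hN (right_ne_zero_of_mul hk)
  have hZn (n : ℕ) : ∀ i j, (Z ^ n) i j ≠ 0 → ρ j + n ≤ ρ i := by
    induction n with
    | zero =>
      intro i j h
      rw [pow_zero] at h
      by_cases hij : i = j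
      · subst hij; simp
      · exact absurd (Matrix.one_apply_ne hij) h
    | succ n ih =>
      intro i j h
      obtain ⟨k, -, hk⟩ : ∃ k ∈ Finset.univ, (Z ^ n) i k * Z k j ≠ 0 := by
        apply Finset.exists_ne_zero_of_sum_ne_zero
        rwa [pow_succ, Matrix.mul_apply] at h
      have h1 := ih i k (left_ne_zero_of_mul hk)
      have h2 := hZ (right_ne_zero_of_mul hk)
      omega
  have hZ0 : IsNilpotent Z := by
    refine ⟨Fintype.card ι + 1, ?_⟩
    ext i j
    by_contra h
    have h1 := hZn _ i j h
    have h2 : ρ i ≤ Fintype.card ι := Finset.card_le_univ _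
    omega
  have h1 : f D⁻¹ * X = 1 - Z := by
    have h2 : f D⁻¹ * f D = 1 := by rw [← map_mul, Matrix.inv_mul_of_invertible, map_one]
    change _ = 1 - -(f D⁻¹ * (X - f D))
    rw [mul_sub, h2]; abel
  have h3 : f D * (f D⁻¹ * X) = X := by
    rw [← mul_assoc, ← map_mul, Matrix.mul_inv_of_invertible, map_one, one_mul]
  rw [← h3, h1]
  exact (hD.map f).mul hZ0.isUnit_one_sub

end IsStdBasis

end StdLemmas

/-! ### Direct summands over a local ring -/

section Split

attribute [local instance 100] LieRing.ofAssociativeRing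

variable {𝔤 : Type u} [LieRing 𝔤] [LieAlgebra ℂ 𝔤] {𝔥 : LieSubalgebra ℂ 𝔤}
variable {a : CartanHat 𝔥}
variable {A : Type v} [CommRing A] [Algebra ℂ A] [Algebra (SymmetricAlgebra ℂ 𝔥) A]
  [IsScalarTower ℂ (SymmetricAlgebra ℂ 𝔥) A]
variable {M : Type w} [AddCommGroup M] [Module A M] [Module (Env 𝔤 A) M]
  [IsScalarTower A (Env 𝔤 A) M]
variable {M' : Type*} [AddCommGroup M'] [Module A M'] [Module (Env 𝔤 A) M']
  [IsScalarTower A (Env 𝔤 A) M']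
variable {ι κ : Type} [Fintype ι] [Fintype κ]

namespace IsStdBasis

variable {wt : ι → Weight 𝔥} {m : ι → M}

/-- For an idempotent endomorphism `e` there is a basis that is adapted to the decomposition of the
module into the image and the kernel of `e`. -/
theorem exists_adapted [IsLocalRing A] (h : IsStdBasis a A wt m) (e : M →ₗ[Env 𝔤 A] M)
    (he : ∀ x, e (e x) = e x) : ∃ (p : ι → Prop) (wt' : ι → Weight 𝔥) (m' : ι → M),
      IsStdBasis a A wt' m' ∧ ∀ i, (p i → e (m' i) = m' i) ∧ (¬ p i → e (m' i) = 0) := by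
  classical
  let S := EnvAlg A (nPart (-a))
  let K := IsLocalRing.ResidueField A
  choose X1 hX1 using fun i => h.bij.2 (e (m i))
  -- There are twice as many candidates as basis vectors, namely e(mᵢ) and mᵢ - e(mᵢ). All are
  -- weight vectors, and each is fixed or killed by e.
  let X : ι ⊕ ι → ι → S := Sum.elim X1 fun i => Pi.single i 1 - X1 i
  let wtc : ι ⊕ ι → Weight 𝔥 := Sum.elim wt wt
  let mc : ι ⊕ ι → M := Sum.elim (fun i => e (m i)) fun i => m i - e (m i)
  have hmc (t) : mc t = stdSum a A m (X t) := by
    rcases t with i | i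
    · exact (hX1 i).symm
    · simp only [mc, X, Sum.elim_inr]
      rw [map_sub, stdSum_single, map_one, one_smul, hX1]
  have hmcw (t) : mc t ∈ weightSpace 𝔥 A M (wtc t) := by
    rcases t with i | i
    · exact map_mem_weightSpace e (h.mem i)
    · exact sub_mem (h.mem i) (map_mem_weightSpace e (h.mem i))
  have hX (t) (j) : X t j ∈ wordSpan (-a) A (wtc t - wt j) :=
    h.coord_mem (s := X t) (by rw [← hmc]; exact hmcw t) j
  let φ : S →ₗ[A] A := (augmentation (A := A) (L := nPart (-a))).toLinearMap
  let vec : ι ⊕ ι → ι → K := fun t j => IsLocalRing.residue A (augmentation (X t j))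
  -- Modulo the augmentation ideal and the maximal ideal, the two candidates of index i add up to
  -- the i-th coordinate vector. So a basis of the reduced space can be extracted from the
  -- candidates.
  have hspan : Submodule.span K (Set.range vec) = ⊤ := by
    rw [eq_top_iff, ← (Pi.basisFun K ι).span_eq, Submodule.span_le]
    rintro - ⟨i, rfl⟩
    have h1 : Pi.basisFun K ι i = vec (Sum.inl i) + vec (Sum.inr i) := by
      funext j
      simp only [vec, X, Sum.elim_inl, Sum.elim_inr, Pi.add_apply, Pi.sub_apply, ← map_add,
        add_sub_cancel, Pi.basisFun_apply]
      by_cases hj : j = i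
      · subst hj; simp
      · simp [Pi.single_eq_of_ne hj]
    rw [h1]
    exact add_mem (Submodule.subset_span ⟨_, rfl⟩) (Submodule.subset_span ⟨_, rfl⟩)
  obtain ⟨κ, c, hc, hcspan, hli⟩ := exists_linearIndependent' K vec
  rw [hspan] at hcspan
  let bas := Module.Basis.mk hli hcspan.ge
  let eκ : κ ≃ ι := bas.indexEquiv (Pi.basisFun K ι)
  let c' : ι → ι ⊕ ι := c ∘ eκ.symm
  have hli' : LinearIndependent K (vec ∘ c') := hli.comp _ eκ.symm.injective
  let Db : Matrix ι ι K := Matrix.of (vec ∘ c')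
  have hDb : Db.det ≠ 0 := by
    have h1 : IsUnit Db := Matrix.linearIndependent_rows_iff_isUnit.mp hli'
    exact ((Matrix.isUnit_iff_isUnit_det _).mp h1).ne_zero
  -- A nonzero determinant has a nonzero term in its Leibniz expansion. The corresponding
  -- permutation matches each chosen candidate with a basis vector that occurs in it with nonzero
  -- reduction.
  obtain ⟨σ, hσ⟩ : ∃ σ : Equiv.Perm ι, ∀ i, Db (σ i) i ≠ 0 := by
    by_contra! h0
    apply hDb
    rw [Matrix.det_apply]
    refine Finset.sum_eq_zero fun σ _ => ?_
    obtain ⟨i, hi⟩ := h0 σ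
    have h1 : ∏ j, Db (σ j) j = 0 := Finset.prod_eq_zero (Finset.mem_univ i) hi
    exact (congrArg _ h1).trans (smul_zero _)
  let c'' : ι → ι ⊕ ι := c' ∘ σ
  -- A coefficient of nonzero weight has augmentation 0, so a nonzero diagonal entry forces equal
  -- weights.
  have hwt (i) : wtc (c'' i) = wt i := by
    by_contra h0
    refine hσ i ?_
    change IsLocalRing.residue A (augmentation (X (c'' i) i)) = 0
    rw [augmentation_eq_zero_of_mem_wordSpan (hX (c'' i) i) (sub_ne_zero.mpr h0), map_zero]
  let Y : Matrix ι ι S := Matrix.of fun i => X (c'' i)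
  have hY (i j) : Y i j ∈ wordSpan (-a) A (wt i - wt j) := by
    rw [← hwt i]; exact hX _ _
  have hYD : IsUnit (Y.map (augmentation (A := A) (L := nPart (-a)))) := by
    -- A determinant over the local ring A is a unit if its residue is nonzero, so independence over
    -- the residue field suffices.
    rw [Matrix.isUnit_iff_isUnit_det, ← IsLocalRing.residue_ne_zero_iff_isUnit, RingHom.map_det]
    have h1 : LinearIndependent K (vec ∘ c'') := hli'.comp _ σ.injective
    have h2 : IsUnit (Matrix.of (vec ∘ c'')) := Matrix.linearIndependent_rows_iff_isUnit.mp h1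
    exact ((Matrix.isUnit_iff_isUnit_det _).mp h2).ne_zero
  refine ⟨fun i => (c'' i).isLeft = true, fun i => wtc (c'' i), fun i => mc (c'' i),
    h.of_isUnit (isUnit_of_augmentation hY hYD) (fun i => hmcw _) (fun i => hmc _), fun i => ?_⟩
  have key (t : ι ⊕ ι) : (t.isLeft = true → e (mc t) = mc t) ∧ (¬ t.isLeft = true → e (mc t) = 0) := by
    rcases t with j | j
    · exact ⟨fun _ => he _, fun h => absurd rfl h⟩
    · refine ⟨fun h => by simp at h, fun _ => ?_⟩
      change e (m j - e (m j)) = 0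
      rw [map_sub, he, sub_self]
  exact key _

/-- A direct summand of a module with a basis has a basis, and so has the complement. -/
theorem exists_split [IsLocalRing A] (h : IsStdBasis a A wt m) (π : M →ₗ[Env 𝔤 A] M')
    (s : M' →ₗ[Env 𝔤 A] M) (hs : ∀ x, π (s x) = x) :
    ∃ (ι₁ ι₂ : Type) (_ : Fintype ι₁) (_ : Fintype ι₂) (wt₁ : ι₁ → Weight 𝔥) (m₁ : ι₁ → M')
      (wt₂ : ι₂ → Weight 𝔥) (m₂ : ι₂ → LinearMap.ker π), IsStdBasis a A wt₁ m₁ ∧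
      IsStdBasis a A wt₂ m₂ ∧ Fintype.card ι₁ + Fintype.card ι₂ = Fintype.card ι := by
  classical
  -- For the idempotent s ∘ π, the basis vectors that are fixed map to a basis of M', and those that
  -- are killed form a basis of the kernel of π.
  obtain ⟨p, wt', m', hm', hp⟩ := h.exists_adapted (s ∘ₗ π) (fun x => by simp [hs])
  have hker (i : {i // ¬ p i}) : m' i ∈ LinearMap.ker π := by
    have h1 := congrArg π ((hp i).2 i.2)
    simpa [hs] using h1
  have hsinj : Function.Injective s := Function.LeftInverse.injective hs
  have hsum (t : ι → EnvAlg A (nPart (-a))) : stdSum a A m' t =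
      stdSum a A (fun i : {i // p i} => m' i) (fun i => t i) +
        stdSum a A (fun i : {i // ¬ p i} => m' i) (fun i => t i) := by
    simp only [stdSum_apply]
    rw [← Fintype.sum_subtype_add_sum_subtype p]
  have hsp (i : {i // p i}) : s (π (m' i)) = m' i := (hp i).1 i.2
  have h1 (t : {i // p i} → EnvAlg A (nPart (-a))) :
      s (stdSum a A (fun i : {i // p i} => π (m' i)) t) =
        stdSum a A (fun i : {i // p i} => m' i) t := by
    rw [map_stdSum]
    simp only [hsp]
  have h2 (t : {i // ¬ p i} → EnvAlg A (nPart (-a))) :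
      (stdSum a A (fun i : {i // ¬ p i} => (⟨m' i, hker i⟩ : LinearMap.ker π)) t : M) =
        stdSum a A (fun i : {i // ¬ p i} => m' i) t :=
    map_stdSum (LinearMap.ker π).subtype _ t
  have hk (t : {i // ¬ p i} → EnvAlg A (nPart (-a))) :
      π (stdSum a A (fun i : {i // ¬ p i} => m' i) t) = 0 := by
    rw [← h2]; exact (stdSum a A _ t : LinearMap.ker π).2
  let ext1 (t : {i // p i} → EnvAlg A (nPart (-a))) (t' : {i // ¬ p i} → EnvAlg A (nPart (-a))) :
    ι → EnvAlg A (nPart (-a)) := fun i => if hi : p i then t ⟨i, hi⟩ else t' ⟨i, hi⟩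
  have hext (t t') : stdSum a A m' (ext1 t t') = stdSum a A (fun i : {i // p i} => m' i) t +
      stdSum a A (fun i : {i // ¬ p i} => m' i) t' := by
    rw [hsum]
    congr 2
    · funext i; simp [ext1, i.2]
    · funext i; simp [ext1, i.2]
  have hinj {t t' t1 t1'} (h : ext1 t t' = ext1 t1 t1') : t = t1 ∧ t' = t1' := by
    constructor
    · funext i
      have := congrFun h i
      simpa [ext1, i.2] using this
    · funext i
      have := congrFun h i
      simpa [ext1, i.2] using this
  refine ⟨{i // p i}, {i // ¬ p i}, inferInstance, inferInstance, fun i => wt' i,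
    fun i => π (m' i), fun i => wt' i, fun i => ⟨m' i, hker i⟩, ⟨fun i => map_mem_weightSpace π (hm'.mem i), fun t t' htt => ?_, fun x => ?_⟩,
    ⟨fun i => mem_weightSpace_of_injective (LinearMap.ker π).subtype
      (Submodule.injective_subtype _) (hm'.mem i), fun t t' htt => ?_, ?_⟩, by
      rw [← Fintype.card_sum]; exact Fintype.card_congr (Equiv.sumCompl p)⟩
  · have h3 := congrArg s htt
    rw [h1, h1] at h3
    have h4 : ext1 t 0 = ext1 t' 0 := hm'.bij.1 (by rw [hext, hext, h3])
    exact (hinj h4).1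
  · obtain ⟨t, ht⟩ := hm'.bij.2 (s x)
    refine ⟨fun i => t i, ?_⟩
    have h3 := congrArg π ht
    rw [hs, hsum, map_add, hk, add_zero, map_stdSum] at h3
    exact h3
  · have h3 := congrArg Subtype.val htt
    rw [h2, h2] at h3
    have h4 : ext1 0 t = ext1 0 t' := hm'.bij.1 (by rw [hext, hext, h3])
    exact (hinj h4).2
  · rintro ⟨x, hx⟩
    obtain ⟨t, ht⟩ := hm'.bij.2 x
    refine ⟨fun i => t i, Subtype.ext ?_⟩
    rw [h2]
    have h3 := congrArg π ht
    rw [LinearMap.mem_ker.mp hx, hsum, map_add, hk, add_zero] at h3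
    have h4 : stdSum a A (fun i : {i // p i} => m' i) (fun i => t i) = 0 := by
      rw [← h1]
      rw [map_stdSum] at h3
      rw [h3, map_zero]
    rw [hsum, h4, zero_add] at ht
    exact ht

end IsStdBasis

end Split

/-! ### Verma flags and bases over the negative part -/

section Flags

attribute [local instance 100] LieRing.ofAssociativeRing

variable {𝔤 : Type u} [LieRing 𝔤] [LieAlgebra ℂ 𝔤] [FiniteDimensional ℂ 𝔤] [LieAlgebra.IsSimple ℂ 𝔤]
variable {𝔥 𝔟 : LieSubalgebra ℂ 𝔤} [𝔥.IsCartanSubalgebra]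
variable {a : CartanHat 𝔥} (ha : IsBorelGrading 𝔥 𝔟 a)
variable {A : Type v} [CommRing A] [Algebra ℂ A] [Algebra (SymmetricAlgebra ℂ 𝔥) A]
  [IsScalarTower ℂ (SymmetricAlgebra ℂ 𝔥) A]
variable {M : Type w} [AddCommGroup M] [Module A M] [Module (Env 𝔤 A) M]
  [IsScalarTower A (Env 𝔤 A) M]
variable {ι : Type} [Fintype ι]

include ha in
/-- A module with a basis consisting of one element is a Verma module. -/
theorem IsStdBasis.nonempty_equiv_verma {lam : Weight 𝔥} {v : M}
    (h : IsStdBasis a A (fun _ : Unit => lam) (fun _ => v)) :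
    Nonempty (M ≃ₗ[Env 𝔤 A] Verma 𝔥 𝔟 A lam) := by
  obtain ⟨f, hf⟩ := exists_verma_hom (𝔟 := 𝔟) ha (h.mem ()) fun X hX => h.act_smul_unit hX
  have h1 : f ∘ stdSum a A (fun _ : Unit => vermaGen 𝔟 A lam) = stdSum a A (fun _ : Unit => v) := by
    funext s
    rw [Function.comp_apply, map_stdSum, hf]
  have h2 := h.bij
  rw [← h1] at h2
  have h3 := (Function.Bijective.of_comp_iff _ (isStdBasis_vermaGen ha).bij).mp h2
  exact ⟨(LinearEquiv.ofBijective f h3).symm⟩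

include ha in
-- The condition on p says that the selected indices are closed under passing to higher weights; by
-- `IsStdBasis.posDeg_of_coord_ne_zero` these are the only indices that n̂₊ can reach. Stability
-- under n̂₋ is automatic.
theorem act_smul_mem_map_coordSub {wt : ι → Weight 𝔥} {m : ι → M} (h : IsStdBasis a A wt m)
    {p : ι → Prop} (hp : ∀ i j, p i → wt j - wt i ∈ posDeg a → p j) (X : Affine 𝔤) (t : M)
    (ht : t ∈ (coordSub a A p).map (stdSum a A m)) :
    act A X • t ∈ (coordSub a A p).map (stdSum a A m) := by
  classical
  refine act_smul_mem_of_nPart ha.toIsGrading (G := {g | ∃ i, p i ∧ m i = g})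
    (span_set_eq_map fun g => Iff.rfl).symm ?_ X t ht
  rintro - ⟨i, hi, rfl⟩ X hX
  refine act_mem_of_bPart ha.toIsGrading (h.mem i) (fun X hX => ?_) ?_ hX
  · let V : Submodule ℂ (Affine 𝔤) :=
      { carrier := {X | act A X • m i ∈ (coordSub a A p).map (stdSum a A m)}
        add_mem' := fun h h' => by
          rw [Set.mem_ofPred_eq, act_add, add_smul]; exact add_mem h h'
        zero_mem' := by rw [Set.mem_ofPred_eq, act_zero, zero_smul]; exact zero_mem _
        smul_mem' := fun c X h => by
          rw [Set.mem_ofPred_eq, act_smul, smul_assoc]; exact Submodule.smul_mem _ _ h }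
    refine rootSum_le (V := V) (fun β hβ X hX => ?_) hX
    obtain ⟨s, hs⟩ := h.bij.2 (act A X • m i)
    refine ⟨s, fun j hj => ?_, hs⟩
    by_contra h0
    exact hj (hp i j hi (h.posDeg_of_coord_ne_zero hβ hX hs h0))
  · refine ⟨Pi.single i 1, fun j hj => Pi.single_eq_of_ne ?_ _, ?_⟩
    · rintro rfl; exact hj hi
    · rw [stdSum_single, map_one, one_smul]

include ha in
/-- A module with a basis over the negative part has a Verma flag. -/
theorem IsStdBasis.nonempty_vermaFlag {wt : ι → Weight 𝔥} {m : ι → M} (h : IsStdBasis a A wt m) :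
    Nonempty (VermaFlag 𝔥 𝔟 A M) := by
  classical
  -- The basis is renumbered so that higher weights come first, by sorting according to the number
  -- of indices of higher weight. Initial segments then span submodules.
  obtain ⟨n, wt, m, h, hmono⟩ : ∃ (n : ℕ) (wt : Fin n → Weight 𝔥) (m : Fin n → M),
      IsStdBasis a A wt m ∧ ∀ i j, wt j - wt i ∈ posDeg a → j < i := by
    let e := (Fintype.equivFin ι).symm
    let ρ : Fin (Fintype.card ι) → ℕ := fun i =>
      (Finset.univ.filter fun k : ι => wt k - wt (e i) ∈ posDeg a).card
    have hρ {i j} (h : wt (e j) - wt (e i) ∈ posDeg a) : ρ j < ρ i := by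
      refine Finset.card_lt_card ⟨fun k hk => ?_, fun hle => ?_⟩
      · simp only [Finset.mem_filter, Finset.mem_univ, true_and] at hk ⊢
        have := posDeg_add hk (posDeg_subset h)
        rwa [sub_add_sub_cancel] at this
      · have := hle (Finset.mem_filter.mpr ⟨Finset.mem_univ (e j), h⟩)
        simp only [Finset.mem_filter, Finset.mem_univ, true_and, sub_self] at this
        exact posDeg_zero_notMem this
    refine ⟨_, _, _, h.reindex ((Tuple.sort ρ).trans e), fun i j hij => ?_⟩
    by_contra! hle
    exact absurd (hρ hij) (not_lt.mpr (Tuple.monotone_sort ρ hle))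
  have hst (k : ℕ) : ∀ i j : Fin n, (i : ℕ) < k → wt j - wt i ∈ posDeg a → (j : ℕ) < k :=
    fun i j hi hij => lt_trans (hmono i j hij) hi
  let F : Fin (n + 1) → Submodule (Env 𝔤 A) M := fun k =>
    envSubmodule _ (act_smul_mem_map_coordSub ha h (p := fun i => (i : ℕ) < k) (hst k))
  have hF {k : Fin (n + 1)} {x : M} : x ∈ F k ↔ ∃ s, (∀ i : Fin n, ¬ (i : ℕ) < k → s i = 0) ∧
    stdSum a A m s = x := Iff.rfl
  refine ⟨⟨n, F, fun k l hkl x hx => ?_, ?_, ?_, wt, fun k => ?_⟩⟩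
  · obtain ⟨s, hs, rfl⟩ := hF.mp hx
    exact hF.mpr ⟨s, fun i hi => hs i fun h => hi (lt_of_lt_of_le h hkl), rfl⟩
  · rw [eq_bot_iff]
    intro x hx
    obtain ⟨s, hs, rfl⟩ := hF.mp hx
    rw [show s = 0 from funext fun i => hs i (by simp), map_zero]
    exact zero_mem _
  · rw [eq_top_iff]
    rintro x -
    obtain ⟨s, rfl⟩ := h.bij.2 x
    exact hF.mpr ⟨s, fun i hi => absurd i.2 hi, rfl⟩
  · have hmk : m k ∈ F k.succ := hF.mpr ⟨Pi.single k 1, fun i hi => Pi.single_eq_of_ne (by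
      rintro rfl; exact hi (by simp)) _, by rw [stdSum_single, map_one, one_smul]⟩
    -- The quotient of two consecutive steps is free over A ⊗ U(n̂₋) on the class of m k, which
    -- makes it a Verma module.
    let q := ((F k.castSucc).submoduleOf (F k.succ)).mkQ
    refine IsStdBasis.nonempty_equiv_verma (𝔟 := 𝔟) (v := q ⟨m k, hmk⟩) ha
      ⟨fun _ => map_mem_weightSpace q (mem_weightSpace_of_injective (F k.succ).subtype
        (Submodule.injective_subtype _) (h.mem k)), ?_, ?_⟩
    · rw [injective_iff_map_eq_zero]
      intro s hs
      rw [stdSum_apply, Fintype.sum_unique, ← map_smul] at hs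
      have h1 : inclAlg (nPart (-a)) (s ()) • m k ∈ F k.castSucc :=
        (Submodule.Quotient.mk_eq_zero ((F k.castSucc).submoduleOf (F k.succ))).mp hs
      obtain ⟨t, ht, hts⟩ := hF.mp h1
      rw [← stdSum_single] at hts
      have h2 := congrFun (h.bij.1 hts) k
      rw [ht k (by simp), Pi.single_eq_same] at h2
      funext x
      exact h2.symm
    · intro y
      obtain ⟨⟨x, hx⟩, rfl⟩ := Submodule.mkQ_surjective _ y
      obtain ⟨s, hs, rfl⟩ := hF.mp hx
      refine ⟨fun _ => s k, ?_⟩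
      rw [stdSum_apply, Fintype.sum_unique, ← map_smul]
      refine (Submodule.Quotient.eq _).mpr ?_
      change inclAlg (nPart (-a)) (s k) • m k - stdSum a A m s ∈ F k.castSucc
      refine hF.mpr ⟨Pi.single k (s k) - s, fun i hi => ?_, by rw [map_sub, stdSum_single]⟩
      by_cases hik : i = k
      · subst hik; rw [Pi.sub_apply, Pi.single_eq_same, sub_self]
      · have h3 : ¬ (i : ℕ) < k.succ := by
          simp only [Fin.val_castSucc, Fin.val_succ] at hi ⊢
          have := Fin.val_ne_of_ne hik
          omega
        rw [Pi.sub_apply, Pi.single_eq_of_ne hik, hs i h3, sub_zero]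

include ha in
/-- A Verma flag of a weight module yields a basis over the negative part. -/
theorem VermaFlag.exists_isStdBasis (hM : ⨆ γ, weightSpace 𝔥 A M γ = ⊤) (F : VermaFlag 𝔥 𝔟 A M) :
    ∃ m : Fin F.length → M, IsStdBasis a A F.wt m := by
  classical
  -- The highest weight vector of each Verma quotient is lifted to a weight vector of the same
  -- weight in the filtration step.
  have hex (k : Fin F.length) : ∃ y : F.filtration k.succ, (y : M) ∈ weightSpace 𝔥 A M (F.wt k) ∧
      Function.Bijective (fun s : EnvAlg A (nPart (-a)) => inclAlg (nPart (-a)) s •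
        ((F.filtration k.castSucc).submoduleOf (F.filtration k.succ)).mkQ y) := by
    obtain ⟨e⟩ := F.quotient_iso k
    have h1 := (isStdBasis_vermaGen (lam := F.wt k) (A := A) ha).map_equiv e.symm
    obtain ⟨y, hy, hye⟩ := exists_weight_lift (A := A) (𝔥 := 𝔥)
      (iSup_weightSpace_eq_top_of_injective hM (F.filtration k.succ).subtype
        (Submodule.injective_subtype _))
      ((F.filtration k.castSucc).submoduleOf (F.filtration k.succ)).mkQ
      (Submodule.mkQ_surjective _) (h1.mem ())
    refine ⟨y, map_mem_weightSpace (F.filtration k.succ).subtype hy, ?_⟩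
    rw [hye]
    have h2 := h1.bij.comp (Equiv.funUnique Unit (EnvAlg A (nPart (-a)))).symm.bijective
    convert h2 using 2 with s
    rw [Function.comp_apply, stdSum_apply, Fintype.sum_unique]
    rfl
  choose y hyw hyb using hex
  let m : Fin F.length → M := fun k => y k
  -- By induction along the filtration, the lifts with index below k form a basis of the k-th step:
  -- the top coefficient is determined in the quotient, the others in the previous step.
  have key (k : Fin (F.length + 1)) :
      (∀ s, (∀ i : Fin F.length, ¬ (i : ℕ) < k → s i = 0) → stdSum a A m s ∈ F.filtration k ∧
        (stdSum a A m s = 0 → s = 0)) ∧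
      ∀ x ∈ F.filtration k, ∃ s, (∀ i : Fin F.length, ¬ (i : ℕ) < k → s i = 0) ∧
        stdSum a A m s = x := by
    induction k using Fin.induction with
    | zero =>
      constructor
      · intro s hs
        have : s = 0 := funext fun i => hs i (by simp)
        rw [this, map_zero]
        exact ⟨zero_mem _, fun _ => rfl⟩
      · intro x hx
        rw [F.filtration_zero, Submodule.mem_bot] at hx
        exact ⟨0, fun _ _ => rfl, by rw [hx, map_zero]⟩
    | succ k ih =>
      have hsplit (s : Fin F.length → EnvAlg A (nPart (-a))) : stdSum a A m s =
          stdSum a A m (s - Pi.single k (s k)) + inclAlg (nPart (-a)) (s k) • m k := by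
        rw [map_sub, stdSum_single, sub_add_cancel]
      have hs0 (s : Fin F.length → EnvAlg A (nPart (-a)))
          (hs : ∀ i : Fin F.length, ¬ (i : ℕ) < k.succ → s i = 0) (i : Fin F.length)
          (hi : ¬ (i : ℕ) < k.castSucc) : (s - Pi.single k (s k) : Fin F.length → EnvAlg A (nPart (-a))) i = 0 := by
        by_cases hik : i = k
        · subst hik; rw [Pi.sub_apply, Pi.single_eq_same, sub_self]
        · have h3 : ¬ (i : ℕ) < k.succ := by
            simp only [Fin.val_castSucc, Fin.val_succ] at hi ⊢
            have := Fin.val_ne_of_ne hik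
            omega
          rw [Pi.sub_apply, Pi.single_eq_of_ne hik, hs i h3, sub_zero]
      have hle : F.filtration k.castSucc ≤ F.filtration k.succ :=
        F.monotone (Fin.castSucc_le_succ k)
      constructor
      · intro s hs
        obtain ⟨h1, h2⟩ := ih.1 _ (hs0 s hs)
        refine ⟨?_, fun h0 => ?_⟩
        · rw [hsplit]
          exact add_mem (hle h1) (Submodule.smul_mem _ _ (y k).2)
        · have h3 : s k = 0 := by
            refine (hyb k).1 ?_
            simp only [map_zero, zero_smul]
            rw [← map_smul]
            refine (Submodule.Quotient.mk_eq_zero _).mpr ?_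
            change inclAlg (nPart (-a)) (s k) • m k ∈ F.filtration k.castSucc
            rw [hsplit] at h0
            rw [eq_neg_of_add_eq_zero_right h0]
            exact neg_mem h1
          rw [h3, Pi.single_zero, sub_zero] at h2
          exact h2 h0
      · intro x hx
        obtain ⟨t, ht⟩ := (hyb k).2
          (((F.filtration k.castSucc).submoduleOf (F.filtration k.succ)).mkQ ⟨x, hx⟩)
        simp only [← map_smul] at ht
        have h1 : x - inclAlg (nPart (-a)) t • m k ∈ F.filtration k.castSucc :=
          (Submodule.Quotient.eq
            ((F.filtration k.castSucc).submoduleOf (F.filtration k.succ))).mp ht.symm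
        obtain ⟨s, hs, hsx⟩ := ih.2 _ h1
        refine ⟨s + Pi.single k t, fun i hi => ?_, by rw [map_add, hsx, stdSum_single, sub_add_cancel]⟩
        simp only [Fin.val_succ] at hi
        rw [Pi.add_apply, hs i (by simp only [Fin.val_castSucc]; omega), Pi.single_eq_of_ne, zero_add]
        rintro rfl
        omega
  refine ⟨m, hyw, ?_, fun x => ?_⟩
  · rw [injective_iff_map_eq_zero]
    intro s hs
    exact ((key (Fin.last _)).1 s fun i hi => absurd i.2 hi).2 hs
  · obtain ⟨s, -, hs⟩ := (key (Fin.last _)).2 x (by rw [F.filtration_last]; trivial)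
    exact ⟨s, hs⟩

end Flags

/-! ### Membership in the truncated category and maps defined on a basis -/

section Membership

attribute [local instance 100] LieRing.ofAssociativeRing

variable {𝔤 : Type u} [LieRing 𝔤] [LieAlgebra ℂ 𝔤] [FiniteDimensional ℂ 𝔤] [LieAlgebra.IsSimple ℂ 𝔤]
variable {𝔥 𝔟 : LieSubalgebra ℂ 𝔤} [𝔥.IsCartanSubalgebra]
variable {a : CartanHat 𝔥} (ha : IsBorelGrading 𝔥 𝔟 a)
variable {A : Type v} [CommRing A] [Algebra ℂ A] [Algebra (SymmetricAlgebra ℂ 𝔥) A]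
  [IsScalarTower ℂ (SymmetricAlgebra ℂ 𝔥) A]
variable {M : Type w} [AddCommGroup M] [Module A M] [Module (Env 𝔤 A) M]
  [IsScalarTower A (Env 𝔤 A) M]
variable {ι : Type} [Fintype ι] {J : Set (Weight 𝔥)}

include ha in
/-- A weight module with finitely generated weight spaces and weights in a locally bounded set
belongs to the truncated category `O`. -/
theorem isInTruncatedO_of_fg (hJ : IsLocallyBounded 𝔥 𝔟 J)
    (h1 : ⨆ γ, weightSpace 𝔥 A M γ = ⊤) (h2 : ∀ γ, (weightSpace 𝔥 A M γ).FG)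
    (h3 : ∀ γ, weightSpace 𝔥 A M γ ≠ ⊥ → γ ∈ J) : IsInTruncatedO 𝔥 𝔟 A M J where
  indep := iSupIndep_weightSpace
  iSup_eq_top := h1
  mem_of_weightSpace_ne_bot := h3
  locallyFinite m := by
    classical
    obtain ⟨s, f, rfl, hf⟩ := exists_sum_weight h1 m
    -- The stable submodule is the sum of the weight spaces for the weights in J above a weight of
    -- the given element. Local boundedness makes this a finite sum, and n̂₊ only raises weights.
    have hfin : {γ' | ∃ γ ∈ s, γ' ∈ J ∧ WeightLE 𝔥 𝔟 γ γ'}.Finite := by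
      have : {γ' | ∃ γ ∈ s, γ' ∈ J ∧ WeightLE 𝔥 𝔟 γ γ'} =
          ⋃ γ ∈ s, {γ' ∈ J | WeightLE 𝔥 𝔟 γ γ'} := by ext; simp; tauto
      rw [this]
      exact s.finite_toSet.biUnion fun γ _ => hJ γ
    let T := hfin.toFinset
    have hT {γ'} : γ' ∈ T ↔ ∃ γ ∈ s, γ' ∈ J ∧ WeightLE 𝔥 𝔟 γ γ' := by
      simp only [T, Set.Finite.mem_toFinset, Set.mem_ofPred_eq]
    have hmem {γ' : Weight 𝔥} {z : M} (hz : z ∈ weightSpace 𝔥 A M γ')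
        (h : ∃ γ ∈ s, WeightLE 𝔥 𝔟 γ γ') : z ∈ ⨆ γ ∈ T, weightSpace 𝔥 A M γ := by
      by_cases h0 : weightSpace 𝔥 A M γ' = ⊥
      · rw [h0, Submodule.mem_bot] at hz
        rw [hz]; exact zero_mem _
      · obtain ⟨γ, hγ, hle⟩ := h
        exact Submodule.mem_iSup_of_mem γ' (Submodule.mem_iSup_of_mem
          (hT.mpr ⟨γ, hγ, h3 γ' h0, hle⟩) hz)
    refine ⟨⨆ γ ∈ T, weightSpace 𝔥 A M γ, sum_mem fun γ hγ => hmem (hf γ) ⟨γ, hγ, .refl γ⟩,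
      Submodule.fg_biSup T _ fun γ _ => h2 γ, fun X hX n hn => ?_⟩
    have hle : ⨆ γ ∈ T, weightSpace 𝔥 A M γ ≤
        (⨆ γ ∈ T, weightSpace 𝔥 A M γ).comap (actLin M (act A X)) := by
      refine iSup₂_le fun γ' hγ' z hz => ?_
      obtain ⟨γ, hγ, hγJ, hle⟩ := hT.mp hγ'
      refine act_mem_of_bPart ha.toIsGrading hz (fun X hX => ?_) (hmem hz ⟨γ, hγ, hle⟩)
        ((mem_borelHat_iff ha).mp hX)
      let V : Submodule ℂ (Affine 𝔤) :=
        { carrier := {X | act A X • z ∈ ⨆ γ ∈ T, weightSpace 𝔥 A M γ}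
          add_mem' := fun h h' => by
            rw [Set.mem_ofPred_eq, act_add, add_smul]; exact add_mem h h'
          zero_mem' := by rw [Set.mem_ofPred_eq, act_zero, zero_smul]; exact zero_mem _
          smul_mem' := fun c X h => by
            rw [Set.mem_ofPred_eq, act_smul, smul_assoc]; exact Submodule.smul_mem _ _ h }
      refine rootSum_le (V := V) (fun β hβ X hX => ?_) hX
      change act A X • z ∈ ⨆ γ ∈ T, weightSpace 𝔥 A M γ
      by_cases hX0 : rootSpaceHat 𝔥 β = ⊥
      · rw [hX0, Submodule.mem_bot] at hX
        rw [hX, act_zero, zero_smul]; exact zero_mem _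
      exact hmem (act_smul_mem_weightSpace hX hz) ⟨γ, hγ, hle.trans (weightLE_add ha hβ hX0)⟩
    exact hle hn

include ha in
theorem IsStdBasis.weightLE {wt : ι → Weight 𝔥} {m : ι → M} (h : IsStdBasis a A wt m)
    {γ : Weight 𝔥} (hγ : weightSpace 𝔥 A M γ ≠ ⊥) : ∃ i, WeightLE 𝔥 𝔟 γ (wt i) := by
  obtain ⟨i, hi⟩ := exists_of_weightSpace_ne_bot h.mem h.range_eq_top hγ
  exact ⟨i, weightLE_of_mem_rootCone_neg ha hi⟩

include ha in
theorem IsStdBasis.isInTruncatedO [IsNoetherianRing A] {wt : ι → Weight 𝔥} {m : ι → M}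
    (h : IsStdBasis a A wt m) (hJo : IsOpenSet 𝔥 𝔟 J) (hJ : IsLocallyBounded 𝔥 𝔟 J)
    (hwt : ∀ i, wt i ∈ J) : IsInTruncatedO 𝔥 𝔟 A M J := by
  refine isInTruncatedO_of_fg ha hJ (iSup_weightSpace_of_range_stdSum h.mem h.range_eq_top)
    (fg_weightSpace_of_range_stdSum h.mem h.range_eq_top ha.toIsGrading) fun γ hγ => ?_
  obtain ⟨i, hi⟩ := h.weightLE ha hγ
  exact hJo _ (hwt i) _ hi

theorem IsStdBasis.basis_ne_zero [Nontrivial A] {wt : ι → Weight 𝔥} {m : ι → M}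
    (h : IsStdBasis a A wt m) (i : ι) : m i ≠ 0 := by
  classical
  intro h0
  have h1 : stdSum a A m (Pi.single i 1) = stdSum a A m 0 := by
    rw [stdSum_single, h0, smul_zero, map_zero]
  have h2 := congrFun (h.bij.1 h1) i
  rw [Pi.single_eq_same] at h2
  have h3 := congrArg (augmentation (A := A) (L := nPart (-a))) h2
  rw [map_one, Pi.zero_apply, map_zero] at h3
  exact one_ne_zero h3

/-- A homomorphism from a module with a basis over the negative part is given by a map on the basis
that is compatible with the action of the nonnegative part. -/
theorem exists_hom_of_basis (hgr : IsGrading 𝔥 a) {M' : Type*} [AddCommGroup M'] [Module A M']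
    [Module (Env 𝔤 A) M'] [IsScalarTower A (Env 𝔤 A) M'] {m : ι → M} {m' : ι → M'}
    (hbij : Function.Bijective (stdSum a A m))
    (h : ∀ X ∈ bPart a, ∀ i, ∃ c : ι → A, act A X • m i = ∑ j, c j • m j ∧
      act A X • m' i = ∑ j, c j • m' j) :
    ∃ f : M →ₗ[Env 𝔤 A] M', ∀ i, f (m i) = m' i := by
  classical
  -- The homomorphism is constructed through its graph, the U(n̂₋)-span of the pairs (mᵢ, m'ᵢ). The
  -- common coefficients c make it stable under ĝ, and freeness of M makes its projection to M
  -- bijective.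
  let p : ι → M × M' := fun i => (m i, m' i)
  have hst := act_smul_mem_of_nPart (M := M × M') (T := (coordSub a A fun _ : ι => True).map (stdSum a A p))
    hgr (span_set_eq_map fun g => (Iff.rfl : g ∈ {g | ∃ i, True ∧ p i = g} ↔ _)).symm (by
      rintro - ⟨i, -, rfl⟩ X hX
      obtain ⟨c, h1, h2⟩ := h X hX i
      have h3 : act A X • p i = ∑ j, c j • p j := by
        refine Prod.ext ?_ ?_
        · rw [Prod.fst_sum]; exact h1
        · rw [Prod.snd_sum]; exact h2
      rw [h3]
      refine sum_mem fun j _ => Submodule.smul_mem _ _ ⟨Pi.single j 1, fun k hk => absurd trivial hk, ?_⟩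
      rw [stdSum_single, map_one, one_smul])
  let T := envSubmodule _ hst
  have hfst (s) : (stdSum a A p s).1 = stdSum a A m s := map_stdSum (LinearMap.fst (Env 𝔤 A) M M') p s
  have hbijT : Function.Bijective ((LinearMap.fst (Env 𝔤 A) M M') ∘ₗ T.subtype) := by
    constructor
    · rintro ⟨-, s, hs, rfl⟩ ⟨-, t, ht, rfl⟩ hst
      change (stdSum a A p s).1 = (stdSum a A p t).1 at hst
      rw [hfst, hfst] at hst
      exact Subtype.ext (congrArg (stdSum a A p) (hbij.1 hst))
    · intro x
      obtain ⟨s, rfl⟩ := hbij.2 x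
      exact ⟨⟨stdSum a A p s, s, fun k hk => absurd trivial hk, rfl⟩, hfst s⟩
  let e := LinearEquiv.ofBijective _ hbijT
  refine ⟨LinearMap.snd (Env 𝔤 A) M M' ∘ₗ T.subtype ∘ₗ e.symm.toLinearMap, fun i => ?_⟩
  have hpi : p i ∈ T := ⟨Pi.single i 1, fun k hk => absurd trivial hk, by
    rw [stdSum_single, map_one, one_smul]⟩
  have h1 : e.symm (m i) = ⟨p i, hpi⟩ := by
    rw [LinearEquiv.symm_apply_eq]; rfl
  change (e.symm (m i) : M × M').2 = m' i
  rw [h1]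

end Membership

/-! ### Truncations of the universal module over the nilpotent part -/

section Truncated

attribute [local instance 100] LieRing.ofAssociativeRing

variable {𝔤 : Type u} [LieRing 𝔤] [LieAlgebra ℂ 𝔤] [FiniteDimensional ℂ 𝔤] [LieAlgebra.IsSimple ℂ 𝔤]
  {𝔥 : LieSubalgebra ℂ 𝔤} [𝔥.IsCartanSubalgebra]

/-- The finite dimensional truncations of the universal representation of the nonnegative part
generated by a vector of weight zero. -/
theorem exists_truncated_rep (b : CartanHat 𝔥) (hb : IsGrading 𝔥 b)
    (hc : ∀ H : CartanHat 𝔥, cartanIncl H ∈ rootSpaceHat 𝔥 0) (T : Set (Weight 𝔥))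
    (hT : {ν ∈ T | ν ∈ rootCone (-b)}.Finite)
    (hTc : ∀ ν, ν ∉ T → ∀ β ∈ posDeg (-b), rootSpaceHat 𝔥 β ≠ ⊥ → ν + β ∉ T) :
    ∃ (V : Type u) (_ : AddCommGroup V) (_ : Module ℂ V) (ρ : bPart (-b) →ₗ⁅ℂ⁆ Module.End ℂ V)
      (v₀ : V) (n : ℕ) (e : Module.Basis (Fin n) ℂ V) (ν : Fin n → Weight 𝔥),
      (∀ k, ν k ∈ T) ∧
      (∀ (H : CartanHat 𝔥) hH k, ρ ⟨cartanIncl H, hH⟩ (e k) = ν k H • e k) ∧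
      (∀ (H : CartanHat 𝔥) hH, ρ ⟨cartanIncl H, hH⟩ v₀ = 0) ∧
      (∀ S : Submodule ℂ V, v₀ ∈ S →
        (∀ X hX, X ∈ nPart (-b) → ∀ z ∈ S, ρ ⟨X, hX⟩ z ∈ S) → S = ⊤) ∧
      ∀ (Z : Type w) [AddCommGroup Z] [Module ℂ Z] (σ : nPart (-b) →ₗ⁅ℂ⁆ Module.End ℂ Z)
        (G : Weight 𝔥 → Submodule ℂ Z) (z₀ : Z), z₀ ∈ G 0 → (∀ γ, γ ∉ T → G γ = ⊥) →
        (∀ β ∈ posDeg (-b), ∀ X : nPart (-b), (X : Affine 𝔤) ∈ rootSpaceHat 𝔥 β → ∀ γ, ∀ z ∈ G γ,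
          σ X z ∈ G (β + γ)) →
        ∃ ψ : V →ₗ[ℂ] Z, ψ v₀ = z₀ ∧ (∀ k, ψ (e k) ∈ G (ν k)) ∧
          ∀ X (hX : X ∈ bPart (-b)) (hX' : X ∈ nPart (-b)) z, ψ (ρ ⟨X, hX⟩ z) = σ ⟨X, hX'⟩ (ψ z) := by
  classical
  -- Inducing the trivial module from the opposite Borel subalgebra `bPart b` gives a copy of U(n)
  -- with n = `nPart (-b)`, on which ĥ acts as well. So it is the universal n-module on a vector of
  -- weight 0, with its weights built in.
  obtain ⟨W, _, _, _, _, i, hi, hbij⟩ := exists_induced (A := ℂ) (ι := Unit) hb.isCompl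
    (0 : bPart b →ₗ⁅ℂ⁆ Module.End ℂ (Unit → ℂ))
  -- With 𝔥 acting on ℂ by zero the deformation τ vanishes, and the deformed weight theory over ℂ is
  -- the ordinary one.
  let _ : Algebra (SymmetricAlgebra ℂ 𝔥) ℂ :=
    (SymmetricAlgebra.lift (0 : 𝔥 →ₗ[ℂ] ℂ) : SymmetricAlgebra ℂ 𝔥 →ₐ[ℂ] ℂ).toAlgebra
  have : IsScalarTower ℂ (SymmetricAlgebra ℂ 𝔥) ℂ := IsScalarTower.of_algebraMap_eq fun c =>
    ((SymmetricAlgebra.lift (0 : 𝔥 →ₗ[ℂ] ℂ)).commutes c).symm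
  have hdw (γ : Weight 𝔥) (H) : deformedWeight 𝔥 ℂ γ H = γ H := by
    have : algebraMap (SymmetricAlgebra ℂ 𝔥) ℂ (SymmetricAlgebra.ι ℂ 𝔥 H.1) = 0 :=
      SymmetricAlgebra.lift_ι_apply _ _
    rw [deformedWeight, this, add_zero]; rfl
  set w : W := i (Pi.single () 1) with hw
  have hw0 (X : Affine 𝔤) (hX : X ∈ bPart b) : act ℂ X • w = 0 := by
    have := hi ⟨X, hX⟩ (Pi.single () 1)
    rw [LieHom.zero_apply, LinearMap.zero_apply, map_zero] at this
    exact this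
  have hstd : IsStdBasis b ℂ (fun _ : Unit => (0 : Weight 𝔥)) (fun _ => w) := by
    refine ⟨fun _ H => ?_, ?_⟩
    · rw [hw0 _ (mem_bPart zero_mem_nonnegDeg (hc H)), hdw, LinearMap.zero_apply, zero_smul]
    · convert hbij using 1
      funext s
      rw [stdSum_apply]
  have htop := iSup_weightSpace_of_range_stdSum hstd.mem hstd.range_eq_top
  let wsp : Weight 𝔥 → Submodule ℂ W := weightSpace 𝔥 ℂ W
  have hmemT {γ : Weight 𝔥} (h : wsp γ ≠ ⊥) : γ ∈ rootCone (-b) := by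
    obtain ⟨-, h⟩ := exists_of_weightSpace_ne_bot hstd.mem hstd.range_eq_top h
    rwa [sub_zero] at h
  -- The part to be divided out: all weights outside T. By `hTc` it is stable under `bPart (-b)`,
  -- and only finitely many finite dimensional weight spaces remain in the quotient.
  let W' : Submodule ℂ W := ⨆ γ, ⨆ (_ : γ ∉ T), wsp γ
  have hW'le {γ} (h : γ ∉ T) : wsp γ ≤ W' := le_iSup₂_of_le γ h le_rfl
  have hW' (X : bPart (-b)) : W' ≤ W'.comap (actLin W (act ℂ (X : Affine 𝔤))) := by
    refine iSup₂_le fun γ hγ z hz => ?_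
    refine act_mem_of_bPart hb.neg hz (fun X hX => ?_) (hW'le hγ hz) X.2
    let U : Submodule ℂ (Affine 𝔤) :=
      { carrier := {X | act ℂ X • z ∈ W'}
        add_mem' := fun h h' => by
          rw [Set.mem_ofPred_eq, act_add, add_smul]; exact add_mem h h'
        zero_mem' := by rw [Set.mem_ofPred_eq, act_zero, zero_smul]; exact zero_mem _
        smul_mem' := fun c X h => by
          rw [Set.mem_ofPred_eq, act_smul, smul_assoc]; exact Submodule.smul_mem _ _ h }
    refine rootSum_le (V := U) (fun β hβ X hX => ?_) hX
    change act ℂ X • z ∈ W'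
    by_cases hX0 : rootSpaceHat 𝔥 β = ⊥
    · rw [hX0, Submodule.mem_bot] at hX
      rw [hX, act_zero, zero_smul]; exact zero_mem _
    exact hW'le (hTc γ hγ β hβ hX0) (act_smul_mem_weightSpace hX hz)
  let V := W ⧸ W'
  let ρ : bPart (-b) →ₗ⁅ℂ⁆ Module.End ℂ V :=
    { toFun := fun X => W'.mapQ W' (actLin W (act ℂ (X : Affine 𝔤))) (hW' X)
      map_add' := fun X Y => by
        refine LinearMap.ext fun z => ?_
        obtain ⟨z, rfl⟩ := W'.mkQ_surjective z
        change W'.mkQ (act ℂ ((X : Affine 𝔤) + (Y : Affine 𝔤)) • z) = W'.mkQ _ + W'.mkQ _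
        rw [act_add, add_smul, map_add]; rfl
      map_smul' := fun c X => by
        refine LinearMap.ext fun z => ?_
        obtain ⟨z, rfl⟩ := W'.mkQ_surjective z
        change W'.mkQ (act ℂ (c • (X : Affine 𝔤)) • z) = c • W'.mkQ _
        rw [act_smul, smul_assoc, ← map_smul]; rfl
      map_lie' := fun {X Y} => by
        refine LinearMap.ext fun z => ?_
        obtain ⟨z, rfl⟩ := W'.mkQ_surjective z
        change W'.mkQ (act ℂ ⁅(X : Affine 𝔤), (Y : Affine 𝔤)⁆ • z) =
          W'.mkQ (act ℂ (X : Affine 𝔤) • act ℂ (Y : Affine 𝔤) • z) -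
            W'.mkQ (act ℂ (Y : Affine 𝔤) • act ℂ (X : Affine 𝔤) • z)
        rw [act_lie, sub_smul, mul_smul, mul_smul, map_sub] }
  have hρ (X : bPart (-b)) (z : W) : ρ X (W'.mkQ z) = W'.mkQ (act ℂ (X : Affine 𝔤) • z) := rfl
  let G₀ : Set V := {x | ∃ γ ∈ T, ∃ z ∈ wsp γ, W'.mkQ z = x}
  have hG₀ : Submodule.span ℂ G₀ = ⊤ := by
    have h1 : (⊤ : Submodule ℂ W) ≤ (Submodule.span ℂ G₀).comap W'.mkQ := by
      rw [← htop]
      refine iSup_le fun γ z hz => ?_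
      by_cases hγ : γ ∈ T
      · exact Submodule.subset_span ⟨γ, hγ, z, hz, rfl⟩
      · have : W'.mkQ z = 0 := (Submodule.Quotient.mk_eq_zero _).mpr (hW'le hγ hz)
        change W'.mkQ z ∈ Submodule.span ℂ G₀
        rw [this]; exact zero_mem _
    rw [eq_top_iff]
    rintro x -
    obtain ⟨z, rfl⟩ := W'.mkQ_surjective x
    exact h1 trivial
  have hfin : Module.Finite ℂ V := by
    have h1 : (⨆ γ ∈ hT.toFinset, wsp γ).map W'.mkQ = ⊤ := by
      rw [eq_top_iff, ← hG₀, Submodule.span_le]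
      rintro - ⟨γ, hγ, z, hz, rfl⟩
      by_cases h0 : wsp γ = ⊥
      · rw [h0, Submodule.mem_bot] at hz
        rw [hz, map_zero]; exact zero_mem _
      · refine ⟨z, ?_, rfl⟩
        refine Submodule.mem_iSup_of_mem γ (Submodule.mem_iSup_of_mem ?_ hz)
        simpa using ⟨hγ, hmemT h0⟩
    rw [Module.finite_def, ← h1]
    exact (Submodule.fg_biSup _ _ fun γ _ =>
      fg_weightSpace_of_range_stdSum hstd.mem hstd.range_eq_top hb γ).map _
  -- The basis is chosen among the images of weight vectors with weight in T, so that each basis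
  -- vector has a weight.
  obtain ⟨B, hBG, hBspan, hBli⟩ := exists_linearIndependent ℂ G₀
  let e₀ : Module.Basis B ℂ V := Module.Basis.mk hBli (by rw [Subtype.range_coe, hBspan, hG₀])
  have : Finite B := Module.Finite.finite_basis e₀
  let eq := Finite.equivFin B
  let e := e₀.reindex eq
  have he (k) : e k ∈ G₀ := by
    have : e k = (eq.symm k : V) := by
      simp only [e, Module.Basis.reindex_apply, e₀, Module.Basis.mk_apply]
    rw [this]
    exact hBG (eq.symm k).2
  choose ν hνT zk hzk hzke using he
  refine ⟨V, inferInstance, inferInstance, ρ, W'.mkQ w, _, e, ν, hνT, fun H hH k => ?_,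
    fun H hH => ?_, fun S hS hSt => ?_, ?_⟩
  · rw [← hzke, hρ, hzk k H, hdw, map_smul]
  · rw [hρ, hstd.mem () H, hdw, LinearMap.zero_apply, zero_smul, map_zero]
  · rw [eq_top_iff]
    rintro x -
    obtain ⟨z, rfl⟩ := W'.mkQ_surjective x
    obtain ⟨s, rfl⟩ := hstd.bij.2 z
    rw [stdSum_apply, Fintype.sum_unique]
    generalize s default = t
    let S' : Submodule ℂ (EnvAlg ℂ (nPart (-b))) := S.comap (W'.mkQ ∘ₗ
      (LinearMap.toSpanSingleton (Env 𝔤 ℂ) W w).restrictScalars ℂ ∘ₗ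
        (inclAlg (nPart (-b))).toLinearMap)
    have hS' : S' = ⊤ := by
      refine envAlg_eq_top ?_ fun X s hs => ?_
      · have : W'.mkQ (inclAlg (nPart (-b)) (1 : EnvAlg ℂ (nPart (-b))) • w) ∈ S := by
          rwa [map_one, one_smul]
        exact this
      · change W'.mkQ (inclAlg (nPart (-b)) (gen ℂ X * s) • w) ∈ S
        rw [map_mul, inclAlg_gen, mul_smul]
        exact hSt X (nPart_le_bPart X.2) X.2 _ hs
    have : t ∈ S' := by rw [hS']; trivial
    exact this
  · intro Z _ _ σ G z₀ hz₀ hG hσ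
    let f := repAlgHom (A := ℂ) σ
    let eU : EnvAlg ℂ (nPart (-b)) ≃ₗ[ℂ] W :=
      (LinearEquiv.funUnique Unit ℂ (EnvAlg ℂ (nPart (-b)))).symm.trans
        (LinearEquiv.ofBijective _ hstd.bij)
    have heU (s) : eU s = inclAlg (nPart (-b)) s • w := by
      change stdSum b ℂ (fun _ : Unit => w) _ = _
      rw [stdSum_apply, Fintype.sum_unique]; rfl
    -- As W is free of rank one over U(n), the generator may be sent to z₀. Words of weight γ land
    -- in G γ, which is zero for γ outside T, so the map factors through the quotient.
    let ψ₀ : W →ₗ[ℂ] Z := (LinearMap.applyₗ z₀ ∘ₗ f.toLinearMap) ∘ₗ eU.symm.toLinearMap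
    have hψ₀ (s) : ψ₀ (inclAlg (nPart (-b)) s • w) = f s z₀ := by
      rw [← heU]
      simp [ψ₀]
    have hword {γ s} (h : IsWord (-b) ℂ γ s) : f s z₀ ∈ G γ := by
      induction h with
      | one => rw [map_one]; exact hz₀
      | mul X hβ hX hX0 h ih =>
        rw [map_mul, repAlgHom_gen]
        exact hσ _ hβ X hX _ _ ih
    have hψG {γ z} (hz : z ∈ wsp γ) : ψ₀ z ∈ G γ := by
      obtain ⟨s, rfl⟩ := hstd.bij.2 z
      have h1 := hstd.coord_mem hz ()
      rw [sub_zero] at h1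
      rw [stdSum_apply, Fintype.sum_unique, hψ₀]
      change f (s ()) z₀ ∈ G γ
      generalize s () = t at h1
      induction h1 using Submodule.span_induction with
      | mem t h => exact hword h
      | zero => rw [map_zero]; exact zero_mem _
      | add s t _ _ hs ht => rw [map_add]; exact add_mem hs ht
      | smul c s _ hs => rw [map_smul]; exact Submodule.smul_mem _ _ hs
    have hker : W' ≤ LinearMap.ker ψ₀ := by
      refine iSup₂_le fun γ hγ z hz => ?_
      have := hψG hz
      rwa [hG γ hγ] at this
    refine ⟨W'.liftQ ψ₀ hker, ?_, fun k => ?_, fun X hX hX' x => ?_⟩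
    · change ψ₀ w = z₀
      have := hψ₀ 1
      rwa [map_one, one_smul, map_one] at this
    · rw [← hzke]
      exact hψG (hzk k)
    · obtain ⟨z, rfl⟩ := W'.mkQ_surjective x
      rw [hρ]
      change ψ₀ (act ℂ X • z) = σ ⟨X, hX'⟩ (ψ₀ z)
      obtain ⟨s, rfl⟩ := hstd.bij.2 z
      rw [stdSum_apply, Fintype.sum_unique, hψ₀, smul_smul]
      have h1 : act ℂ X * inclAlg (nPart (-b)) (s default) =
          inclAlg (nPart (-b)) (gen ℂ ⟨X, hX'⟩ * s default) := by
        rw [map_mul, inclAlg_gen]; rfl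
      rw [h1, hψ₀, map_mul, repAlgHom_gen]; rfl

end Truncated

/-! ### The object representing weight vectors of weight μ -/

section Generator

attribute [local instance 100] LieRing.ofAssociativeRing

variable {𝔤 : Type u} [LieRing 𝔤] [LieAlgebra ℂ 𝔤] [FiniteDimensional ℂ 𝔤] [LieAlgebra.IsSimple ℂ 𝔤]
variable {𝔥 𝔟 : LieSubalgebra ℂ 𝔤} [𝔥.IsCartanSubalgebra]
variable {a : CartanHat 𝔥}

theorem cartanIncl_mem_bPart (H : CartanHat 𝔥) : cartanIncl H ∈ bPart a :=
  mem_bPart zero_mem_nonnegDeg (cartanIncl_mem_rootSpaceHat H)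

theorem exists_cartan_add_of_mem_bPart (hgr : IsGrading 𝔥 a) {X : Affine 𝔤} (hX : X ∈ bPart a) :
    ∃ H : CartanHat 𝔥, ∃ Y ∈ nPart a, X = cartanIncl H + Y := by
  let V : Submodule ℂ (Affine 𝔤) :=
    { carrier := {X | ∃ H : CartanHat 𝔥, ∃ Y ∈ nPart a, X = cartanIncl H + Y}
      add_mem' := by
        rintro - - ⟨H, Y, hY, rfl⟩ ⟨H', Y', hY', rfl⟩
        refine ⟨H + H', Y + Y', add_mem hY hY', ?_⟩
        have : cartanIncl (H + H') = cartanIncl H + cartanIncl H' := by ext1 <;> simp [cartanIncl]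
        rw [this]; abel
      zero_mem' := ⟨0, 0, zero_mem _, by ext1 <;> simp [cartanIncl]⟩
      smul_mem' := by
        rintro c - ⟨H, Y, hY, rfl⟩
        refine ⟨c • H, c • Y, (nPart a).smul_mem c hY, ?_⟩
        have : cartanIncl (c • H) = c • cartanIncl H := by ext1 <;> simp [cartanIncl]
        rw [this, smul_add] }
  refine rootSum_le (V := V) (fun β hβ X hX => ?_) hX
  obtain ⟨n, hn⟩ := hβ
  rcases Nat.eq_zero_or_pos n with rfl | h
  · by_cases h0 : rootSpaceHat 𝔥 β = ⊥
    · rw [h0, Submodule.mem_bot] at hX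
      rw [hX]; exact zero_mem V
    · obtain rfl := hgr.eq_zero β h0 (by rw [hn, Nat.cast_zero])
      obtain ⟨H, rfl⟩ := hgr.cartan X hX
      exact ⟨H, 0, zero_mem _, (add_zero _).symm⟩
  · exact ⟨0, X, mem_nPart ⟨n, h, hn⟩ hX, by ext1 <;> simp [cartanIncl]⟩

variable (ha : IsBorelGrading 𝔥 𝔟 a)
variable (A : Type v) [CommRing A] [IsNoetherianRing A] [Algebra ℂ A]
  [Algebra (SymmetricAlgebra ℂ 𝔥) A] [IsScalarTower ℂ (SymmetricAlgebra ℂ 𝔥) A]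
variable {J : Set (Weight 𝔥)} (hJo : IsOpenSet 𝔥 𝔟 J) (hJ : IsLocallyBounded 𝔥 𝔟 J)

include ha hJo hJ in
/-- The functor of taking weight vectors of weight `μ` is representable in the truncated
category. -/
theorem exists_projective_generator (μ : Weight 𝔥) :
    ∃ (Q : Type (max u v)) (_ : AddCommGroup Q) (_ : Module A Q) (_ : Module (Env 𝔤 A) Q)
      (_ : IsScalarTower A (Env 𝔤 A) Q) (n : ℕ) (wt : Fin n → Weight 𝔥) (q : Fin n → Q) (q₀ : Q),
      IsStdBasis a A wt q ∧ (∀ k, wt k ∈ J) ∧ q₀ ∈ weightSpace 𝔥 A Q μ ∧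
      Submodule.span (Env 𝔤 A) {q₀} = ⊤ ∧
      ∀ (M : Type (max u v)) [AddCommGroup M] [Module A M] [Module (Env 𝔤 A) M]
        [IsScalarTower A (Env 𝔤 A) M], IsInTruncatedO 𝔥 𝔟 A M J → ∀ m ∈ weightSpace 𝔥 A M μ,
          ∃ f : Q →ₗ[Env 𝔤 A] M, f q₀ = m := by
  classical
  have hgr := ha.toIsGrading
  -- Weights ν of U(n̂₊) satisfy μ + ν ≥ μ, so local boundedness leaves finitely many with μ + ν ∈
  -- J. Openness of J gives `hTc`: a sum with a positive root does not return to J.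
  have hT : {ν ∈ {ν | μ + ν ∈ J} | ν ∈ rootCone (-(-a))}.Finite := by
    rw [neg_neg]
    refine Set.Finite.of_finite_image (f := fun ν => μ + ν) ((hJ μ).subset ?_)
      (add_right_injective μ).injOn
    rintro - ⟨ν, ⟨h1, h2⟩, rfl⟩
    exact ⟨h1, weightLE_of_mem_rootCone ha (by rwa [add_sub_cancel_left])⟩
  have hTc : ∀ ν, ν ∉ {ν | μ + ν ∈ J} → ∀ β ∈ posDeg (-(-a)), rootSpaceHat 𝔥 β ≠ ⊥ →
      ν + β ∉ {ν | μ + ν ∈ J} := by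
    intro ν hν β hβ h0 h
    rw [neg_neg] at hβ
    exact hν (hJo _ h _ (by rw [← add_assoc]; exact weightLE_add ha hβ h0))
  -- Applied to -a, the truncation concerns the nilpotent part n̂₊ of -(-a) = a, while the induction
  -- below uses n̂₋.
  obtain ⟨V, _, _, ρ₀, v₀, n, e, ν, hνT, hcart, hcart₀, hgen, huniv⟩ :=
    exists_truncated_rep.{u, max u v} (-a) hgr.neg
      (fun H => cartanIncl_mem_rootSpaceHat (𝔥 := 𝔥) H) _ hT hTc
  revert ρ₀
  rw [neg_neg]
  intro ρ₀ hcart hcart₀ hgen huniv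
  obtain ⟨p, hp, hp0⟩ := exists_cartanProj hgr
    (fun H => cartanIncl_mem_rootSpaceHat (𝔥 := 𝔥) H)
  obtain ⟨f, hf⟩ := deformedWeight_linear A μ
  let ca : V →ₗ[ℂ] (Fin n → A) :=
    { toFun := fun z k => algebraMap ℂ A (e.repr z k)
      map_add' := fun y z => by funext k; simp
      map_smul' := fun c z => by funext k; simp [Algebra.smul_def] }
  have hca (k) : ca (e k) = Pi.single k 1 := by
    funext j
    change algebraMap ℂ A (e.repr (e k) j) = _
    rw [e.repr_self, Finsupp.single_apply, Pi.single_apply]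
    by_cases h : k = j
    · rw [if_pos h, if_pos h.symm, map_one]
    · rw [if_neg h, if_neg (Ne.symm h), map_zero]
  have hcas (c : ℂ) (x : Fin n → A) : c • x = algebraMap ℂ A c • x := (algebraMap_smul A c x).symm
  let φ (S : Module.End ℂ V) : Module.End A (Fin n → A) :=
    ∑ k, (LinearMap.toSpanSingleton A (Fin n → A) (ca (S (e k)))) ∘ₗ LinearMap.proj k
  have hφ (S : Module.End ℂ V) (x : Fin n → A) : φ S x = ∑ k, x k • ca (S (e k)) := by
    simp [φ]
  have hφca (S : Module.End ℂ V) (z : V) : φ S (ca z) = ca (S z) := by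
    rw [hφ]
    conv_rhs => rw [← e.sum_repr z, map_sum, map_sum]
    refine Finset.sum_congr rfl fun k _ => ?_
    rw [map_smul, map_smul, hcas]
    rfl
  -- The b̂-module V ⊗ A_μ: the action on V, extended to A, plus the scalar (μ + τ) ∘ p. The scalar
  -- part is additive and kills brackets, so the sum is again a representation.
  let ρ : bPart a →ₗ⁅ℂ⁆ Module.End A (Fin n → A) :=
    { toFun := fun X => φ (ρ₀ X) + algebraMap A _ (f (p X))
      map_add' := fun X Y => by
        have h1 : φ (ρ₀ (X + Y)) = φ (ρ₀ X) + φ (ρ₀ Y) := by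
          refine LinearMap.ext fun x => ?_
          rw [LinearMap.add_apply, hφ, hφ, hφ, ← Finset.sum_add_distrib]
          refine Finset.sum_congr rfl fun k _ => ?_
          rw [map_add ρ₀, LinearMap.add_apply, map_add, smul_add]
        rw [h1, AddMemClass.coe_add, map_add, map_add, map_add]; abel
      map_smul' := fun c X => by
        have h1 : φ (ρ₀ (c • X)) = c • φ (ρ₀ X) := by
          refine LinearMap.ext fun x => ?_
          rw [LinearMap.smul_apply, hφ, hφ, Finset.smul_sum]
          refine Finset.sum_congr rfl fun k _ => ?_
          rw [map_smul ρ₀, LinearMap.smul_apply, map_smul, smul_comm]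
        rw [h1, SetLike.val_smul, map_smul, map_smul, ← algebraMap_smul A c (f _), smul_eq_mul,
          map_mul, ← Algebra.smul_def, algebraMap_smul, RingHom.id_apply, smul_add]
      map_lie' := fun {X Y} => by
        have h1 : φ (ρ₀ ⁅X, Y⁆) = φ (ρ₀ X) * φ (ρ₀ Y) - φ (ρ₀ Y) * φ (ρ₀ X) := by
          refine LinearMap.ext fun x => ?_
          rw [LinearMap.sub_apply, Module.End.mul_apply, Module.End.mul_apply, hφ,
            hφ (ρ₀ Y) x, hφ (ρ₀ X) x, map_sum, map_sum, ← Finset.sum_sub_distrib]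
          refine Finset.sum_congr rfl fun k _ => ?_
          rw [map_smul, map_smul, hφca, hφca, ← smul_sub, ← map_sub, LieHom.map_lie,
            LieRing.of_associative_ring_bracket]
          rfl
        rw [LieSubalgebra.coe_bracket, hp0 _ (bPart_lie_le hgr X.2 Y.2), map_zero,
          map_zero, add_zero, h1, LieRing.of_associative_ring_bracket]
        have h2 := Algebra.commutes (f (p X)) (φ (ρ₀ Y))
        have h3 := Algebra.commutes (f (p Y)) (φ (ρ₀ X))
        have h4 := Algebra.commutes (f (p X)) (algebraMap A (Module.End A (Fin n → A)) (f (p Y)))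
        simp only [add_mul, mul_add]
        rw [h2, h3, h4]
        abel }
  have hρ (X : bPart a) (x) : ρ X x = φ (ρ₀ X) x + f (p X) • x := rfl
  obtain ⟨Q, _, _, _, _, i, hi, hbij⟩ := exists_induced hgr.isCompl ρ
  let q : Fin n → Q := fun k => i (Pi.single k 1)
  have hiq (x : Fin n → A) : i x = ∑ k, x k • q k := by
    rw [LinearMap.pi_apply_eq_sum_univ i x]
    refine Finset.sum_congr rfl fun k _ => congrArg (x k • i ·) (funext fun j => ?_)
    rw [Pi.single_apply]
    exact if_congr eq_comm rfl rfl
  have hact (X : bPart a) (x) : act A (X : Affine 𝔤) • i x = i (ρ X x) := hi X x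
  have hstd : IsStdBasis a A (fun k => μ + ν k) q := by
    refine ⟨fun k H => ?_, ?_⟩
    · rw [hact ⟨_, cartanIncl_mem_bPart H⟩, hρ, ← hca, hφca, hcart, map_smul, hp, hf, hcas,
        ← add_smul, ← deformedWeight_add, map_smul, hca]
    · convert hbij using 1
      funext s
      rw [stdSum_apply]
  refine ⟨Q, inferInstance, inferInstance, inferInstance, inferInstance, n, _, q, i (ca v₀), hstd,
    hνT, fun H => ?_, ?_, ?_⟩
  · rw [hact ⟨_, cartanIncl_mem_bPart H⟩, hρ, hφca, hcart₀, map_zero, zero_add, hp, hf, map_smul]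
  · let N := Submodule.span (Env 𝔤 A) {i (ca v₀)}
    let S : Submodule ℂ V :=
      { carrier := {z | i (ca z) ∈ N}
        add_mem' := fun h h' => by
          rw [Set.mem_ofPred_eq, map_add, map_add]; exact add_mem h h'
        zero_mem' := by rw [Set.mem_ofPred_eq, map_zero, map_zero]; exact zero_mem _
        smul_mem' := fun c z h => by
          rw [Set.mem_ofPred_eq, map_smul, hcas, map_smul, ← algebraMap_smul (Env 𝔤 A)]
          exact N.smul_mem _ h }
    -- On n̂₊ the twisting character vanishes, so the vectors of V whose image lies in the submodule
    -- generated by v₀ are stable under n̂₊ and exhaust V.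
    have hS := hgen S (Submodule.mem_span_singleton_self _) fun X hX hX' z hz => by
      change i (ca (ρ₀ ⟨X, hX⟩ z)) ∈ N
      have h1 : ρ ⟨X, hX⟩ (ca z) = ca (ρ₀ ⟨X, hX⟩ z) := by
        rw [hρ, hφca, hp0 X hX', map_zero, zero_smul, add_zero]
      rw [← h1, ← hact]
      exact N.smul_mem _ hz
    rw [eq_top_iff]
    rintro x -
    obtain ⟨s, rfl⟩ := hstd.bij.2 x
    rw [stdSum_apply]
    refine sum_mem fun k _ => Submodule.smul_mem _ _ ?_
    have : e k ∈ S := by rw [hS]; trivial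
    change i (Pi.single k 1) ∈ N
    rw [← hca]; exact this
  · intro M _ _ _ _ hM m hm
    let _ : Module ℂ M := Module.compHom M (algebraMap ℂ A)
    have hcm (c : ℂ) (x : M) : c • x = algebraMap ℂ A c • x := rfl
    have : IsScalarTower ℂ A M := ⟨fun c x y => by
      rw [hcm, smul_smul, Algebra.smul_def]⟩
    let θ (X : Affine 𝔤) : Module.End ℂ M :=
      { toFun := fun y => act A X • y
        map_add' := smul_add _
        map_smul' := fun c y => by rw [hcm, RingHom.id_apply, hcm, smul_comm] }
    let σ : nPart a →ₗ⁅ℂ⁆ Module.End ℂ M :=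
      { toFun := fun X => θ X
        map_add' := fun X Y => by
          refine LinearMap.ext fun y => ?_
          change act A ((X : Affine 𝔤) + (Y : Affine 𝔤)) • y = _
          rw [act_add, add_smul]; rfl
        map_smul' := fun c X => by
          refine LinearMap.ext fun y => ?_
          change act A (c • (X : Affine 𝔤)) • y = algebraMap ℂ A c • act A (X : Affine 𝔤) • y
          rw [act_smul, smul_assoc, algebraMap_smul]
        map_lie' := fun {X Y} => by
          refine LinearMap.ext fun y => ?_
          change act A ⁅(X : Affine 𝔤), (Y : Affine 𝔤)⁆ • y =
            act A (X : Affine 𝔤) • act A (Y : Affine 𝔤) • y -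
              act A (Y : Affine 𝔤) • act A (X : Affine 𝔤) • y
          rw [act_lie, sub_smul, mul_smul, mul_smul] }
    -- The universal property of V yields the n̂₊-map v₀ ↦ m; the weight spaces of M outside J
    -- vanish, as the truncation requires. Since ψ also respects weights, it is a b̂-map on V ⊗ A_μ
    -- and extends to Q.
    obtain ⟨ψ, hψ0, hψw, hψ⟩ := huniv M σ
      (fun γ => (weightSpace 𝔥 A M (μ + γ)).restrictScalars ℂ) m (by rwa [add_zero])
      (fun γ hγ => by
        by_contra h0
        refine hγ (hM.mem_of_weightSpace_ne_bot _ fun h => h0 ?_)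
        rw [h]; rfl)
      (fun β hβ X hX γ z hz => by
        have := act_smul_mem_weightSpace hX hz
        rw [add_assoc, add_comm γ] at this
        exact this)
    have hψc (z : V) : ψ z = ∑ k, ca z k • ψ (e k) := by
      conv_lhs => rw [← e.sum_repr z, map_sum]
      refine Finset.sum_congr rfl fun k _ => ?_
      rw [map_smul, hcm]; rfl
    have hψX (X : Affine 𝔤) (hX : X ∈ bPart a) (k) :
        act A X • ψ (e k) = ψ (ρ₀ ⟨X, hX⟩ (e k)) + f (p X) • ψ (e k) := by
      obtain ⟨H, Y, hY, rfl⟩ := exists_cartan_add_of_mem_bPart hgr hX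
      have h1 : (⟨cartanIncl H + Y, hX⟩ : bPart a) =
        ⟨cartanIncl H, cartanIncl_mem_bPart H⟩ + ⟨Y, nPart_le_bPart hY⟩ := rfl
      have h2 : act A Y • ψ (e k) = ψ (ρ₀ ⟨Y, nPart_le_bPart hY⟩ (e k)) :=
        (hψ Y (nPart_le_bPart hY) hY (e k)).symm
      rw [h1, map_add ρ₀, LinearMap.add_apply, map_add ψ, hcart, map_smul ψ, map_add p, hp, hp0 Y hY,
        add_zero, hf, act_add, add_smul, h2, hψw k H, deformedWeight_add, add_smul, hcm]
      abel
    obtain ⟨F, hF⟩ := exists_hom_of_basis (m := q) (m' := fun k => ψ (e k)) hgr hstd.bij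
      (fun X hX k => ⟨ρ ⟨X, hX⟩ (Pi.single k 1), by rw [← hiq]; exact hact ⟨X, hX⟩ _, by
        rw [hψX X hX, hψc, hρ, ← hca, hφca]
        simp only [Pi.add_apply, add_smul, Finset.sum_add_distrib]
        congr 1
        rw [hca, Finset.sum_eq_single k]
        · rw [Pi.smul_apply, Pi.single_eq_same, smul_eq_mul, mul_one]
        · intro j _ hj
          rw [Pi.smul_apply, Pi.single_eq_of_ne hj, smul_zero, zero_smul]
        · simp⟩)
    refine ⟨F, ?_⟩
    rw [hiq, map_sum, ← hψ0, hψc]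
    refine Finset.sum_congr rfl fun k _ => ?_
    rw [env_map_smul, hF]

end Generator

/-! ### The simple objects of the truncated category -/

section Simple

attribute [local instance 100] LieRing.ofAssociativeRing

variable {𝔤 : Type u} [LieRing 𝔤] [LieAlgebra ℂ 𝔤] [FiniteDimensional ℂ 𝔤] [LieAlgebra.IsSimple ℂ 𝔤]
variable {𝔥 𝔟 : LieSubalgebra ℂ 𝔤} [𝔥.IsCartanSubalgebra]
variable {a : CartanHat 𝔥} (ha : IsBorelGrading 𝔥 𝔟 a)

section Verma

variable {A : Type v} [CommRing A] [Algebra ℂ A]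
  [Algebra (SymmetricAlgebra ℂ 𝔥) A] [IsScalarTower ℂ (SymmetricAlgebra ℂ 𝔥) A]

include ha in
-- The coefficient of y lies in the weight 0 part of A ⊗ U(n̂₋), which consists of scalars.
theorem exists_smul_vermaGen {lam : Weight 𝔥} {y : Verma 𝔥 𝔟 A lam}
    (hy : y ∈ weightSpace 𝔥 A (Verma 𝔥 𝔟 A lam) lam) : ∃ c : A, y = c • vermaGen 𝔟 A lam := by
  have h := isStdBasis_vermaGen (A := A) (lam := lam) ha
  obtain ⟨s, rfl⟩ := h.bij.2 y
  have h1 := h.coord_mem hy ()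
  rw [sub_self] at h1
  have hc := eq_algebraMap_of_mem_wordSpan_zero h1
  generalize augmentation (s ()) = c at hc
  refine ⟨c, ?_⟩
  rw [stdSum_apply, Fintype.sum_unique]
  change inclAlg (nPart (-a)) (s ()) • _ = _
  rw [hc, AlgHom.commutes, algebraMap_smul]

theorem span_vermaGen (lam : Weight 𝔥) :
    Submodule.span (Env 𝔤 A) {vermaGen 𝔟 A lam} = ⊤ := by
  rw [eq_top_iff]
  rintro x -
  obtain ⟨u, rfl⟩ := Submodule.Quotient.mk_surjective _ x
  rw [← smul_vermaGen]
  exact Submodule.smul_mem _ _ (Submodule.mem_span_singleton_self _)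

theorem iSup_weightSpace_verma (ha : IsBorelGrading 𝔥 𝔟 a) (lam : Weight 𝔥) :
    ⨆ γ, weightSpace 𝔥 A (Verma 𝔥 𝔟 A lam) γ = ⊤ :=
  iSup_weightSpace_of_range_stdSum (isStdBasis_vermaGen ha).mem
    (isStdBasis_vermaGen ha).range_eq_top

end Verma

section Field

variable {F : Type v} [Field F] [Algebra ℂ F]
  [Algebra (SymmetricAlgebra ℂ 𝔥) F] [IsScalarTower ℂ (SymmetricAlgebra ℂ 𝔥) F]

include ha in
-- A submodule contains the weight components of its elements. A proper one has no component in the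
-- line of highest weight, as this line generates everything. So all proper submodules, and their
-- sum, lie in the sum of the other weight spaces.
theorem vermaGen_notMem_max (lam : Weight 𝔥) :
    vermaGen 𝔟 F lam ∉ vermaMaxSubmodule 𝔥 𝔟 F lam := by
  classical
  let V := Verma 𝔥 𝔟 F lam
  let N₀ : Submodule F V := ⨆ γ, ⨆ (_ : γ ≠ lam), weightSpace 𝔥 F V γ
  have key (N : Submodule (Env 𝔤 F) V) (hN : N ≠ ⊤) (x : V) (hx : x ∈ N) : x ∈ N₀ := by
    obtain ⟨s, f, rfl, hf⟩ := exists_sum_weight (iSup_weightSpace_verma ha lam) x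
    have h1 := mem_of_sum_weight_mem (N := N.restrictScalars F)
      (fun H m hm => N.smul_mem _ hm) s f (fun γ _ => hf γ) hx
    refine sum_mem fun γ hγ => ?_
    by_cases h : γ = lam
    · subst h
      obtain ⟨c, hc⟩ := exists_smul_vermaGen ha (hf γ)
      by_cases hc0 : c = 0
      · rw [hc, hc0, zero_smul]; exact zero_mem _
      · refine absurd ?_ hN
        rw [eq_top_iff, ← span_vermaGen γ, Submodule.span_singleton_le_iff_mem]
        have h2 : c⁻¹ • f γ ∈ N.restrictScalars F := Submodule.smul_mem _ _ (h1 γ hγ)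
        rwa [hc, smul_smul, inv_mul_cancel₀ hc0, one_smul] at h2
    · exact Submodule.mem_iSup_of_mem γ (Submodule.mem_iSup_of_mem h (hf γ))
  have h2 (x : V) (hx : x ∈ vermaMaxSubmodule 𝔥 𝔟 F lam) : x ∈ N₀ := by
    rw [vermaMaxSubmodule, sSup_eq_iSup'] at hx
    induction hx using Submodule.iSup_induction' with
    | mem N x hx => exact key N.1 N.2 x hx
    | zero => exact zero_mem _
    | add x y _ _ hx hy => exact add_mem hx hy
  intro h
  have h3 := (iSupIndep_weightSpace (𝔥 := 𝔥) (A := F) (M := V)) lam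
  have h4 := (Submodule.disjoint_def.mp h3) _ (vermaGen_mem (lam := lam)) (h2 _ h)
  exact (isStdBasis_vermaGen (A := F) ha).basis_ne_zero () h4

include ha in
theorem isSimpleModule_simpleQuotient (lam : Weight 𝔥) :
    IsSimpleModule (Env 𝔤 F) (SimpleQuotient 𝔥 𝔟 F lam) := by
  rw [isSimpleModule_iff_isCoatom]
  refine ⟨fun h => vermaGen_notMem_max ha lam (by rw [h]; trivial), fun N hN => ?_⟩
  by_contra h
  exact absurd (le_sSup (α := Submodule (Env 𝔤 F) (Verma 𝔥 𝔟 F lam)) h : N ≤ vermaMaxSubmodule 𝔥 𝔟 F lam)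
    (not_le_of_gt hN)

end Field

variable {A : Type v} [CommRing A] [IsLocalRing A] [Algebra ℂ A]
  [Algebra (SymmetricAlgebra ℂ 𝔥) A] [IsScalarTower ℂ (SymmetricAlgebra ℂ 𝔥) A]

theorem envResidue_act (X : Affine 𝔤) :
    envResidue A (act A X) = act (IsLocalRing.ResidueField A) X := by
  rw [act, envResidue, Algebra.TensorProduct.map_tmul, map_one]; rfl

/-- Consequently submodules and homomorphisms over A ⊗ U(ĝ) between modules inflated from the
residue field are the same as over 𝕂 ⊗ U(ĝ). -/
theorem envResidue_surjective : Function.Surjective (envResidue (𝔤 := 𝔤) A) := by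
  intro u
  induction u using env_induction with
  | hA c =>
    obtain ⟨c, rfl⟩ := IsLocalRing.residue_surjective c
    refine ⟨algebraMap A _ c, ?_⟩
    rw [Algebra.algebraMap_eq_smul_one, envResidue_smul, map_one, ← Algebra.algebraMap_eq_smul_one]
    rfl
  | hX X => exact ⟨_, envResidue_act X⟩
  | hadd u v hu hv =>
    obtain ⟨u, rfl⟩ := hu
    obtain ⟨v, rfl⟩ := hv
    exact ⟨u + v, map_add _ _ _⟩
  | hmul u v hu hv =>
    obtain ⟨u, rfl⟩ := hu
    obtain ⟨v, rfl⟩ := hv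
    exact ⟨u * v, map_mul _ _ _⟩

theorem deformedWeight_residueField (γ : Weight 𝔥) (H : CartanHat 𝔥) :
    deformedWeight 𝔥 (IsLocalRing.ResidueField A) γ H =
      algebraMap A (IsLocalRing.ResidueField A) (deformedWeight 𝔥 A γ H) := by
  rw [deformedWeight, deformedWeight, map_add, ← IsScalarTower.algebraMap_apply,
    ← IsScalarTower.algebraMap_apply]

variable (𝔟 A) in
/-- The highest weight vector of `L_A(lam)`. -/
def simpleGen (lam : Weight 𝔥) : SimpleObject 𝔥 𝔟 A lam :=
  (vermaMaxSubmodule 𝔥 𝔟 (IsLocalRing.ResidueField A) lam).mkQ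
    (vermaGen 𝔟 (IsLocalRing.ResidueField A) lam)

include ha in
theorem simpleGen_ne_zero (lam : Weight 𝔥) : simpleGen 𝔟 A lam ≠ 0 := fun h =>
  vermaGen_notMem_max ha lam ((Submodule.Quotient.mk_eq_zero
    (vermaMaxSubmodule 𝔥 𝔟 (IsLocalRing.ResidueField A) lam)).mp h)

theorem simpleObject_smul {lam : Weight 𝔥} (u : Env 𝔤 A) (x : SimpleObject 𝔥 𝔟 A lam) :
    u • x = (envResidue A u • (show SimpleQuotient 𝔥 𝔟 (IsLocalRing.ResidueField A) lam from x) :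
      SimpleQuotient 𝔥 𝔟 (IsLocalRing.ResidueField A) lam) := rfl

theorem simpleGen_mem (lam : Weight 𝔥) :
    simpleGen 𝔟 A lam ∈ weightSpace 𝔥 A (SimpleObject 𝔥 𝔟 A lam) lam := fun H => by
  have h := map_mem_weightSpace
    (vermaMaxSubmodule 𝔥 𝔟 (IsLocalRing.ResidueField A) lam).mkQ (vermaGen_mem (lam := lam)) H
  rw [deformedWeight_residueField] at h
  rw [simpleObject_smul, envResidue_act]
  exact h

theorem span_simpleGen (lam : Weight 𝔥) :
    Submodule.span (Env 𝔤 A) {simpleGen 𝔟 A lam} = ⊤ := by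
  rw [eq_top_iff]
  rintro x -
  obtain ⟨y, hy⟩ := Submodule.mkQ_surjective
    (vermaMaxSubmodule 𝔥 𝔟 (IsLocalRing.ResidueField A) lam) x
  obtain ⟨u, rfl⟩ := Submodule.Quotient.mk_surjective _ y
  obtain ⟨u, rfl⟩ := envResidue_surjective u
  rw [← smul_vermaGen, map_smul] at hy
  rw [← hy]
  exact Submodule.smul_mem _ u (Submodule.mem_span_singleton_self _)

theorem smul_simpleObject_eq_zero {lam : Weight 𝔥} {c : A} (hc : ¬ IsUnit c)
    (x : SimpleObject 𝔥 𝔟 A lam) : c • x = 0 := by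
  have h : algebraMap A (IsLocalRing.ResidueField A) c = 0 :=
    (IsLocalRing.residue_eq_zero_iff c).mpr hc
  change algebraMap A (IsLocalRing.ResidueField A) c • x = 0
  rw [h, zero_smul]

include ha in
theorem isSimpleModule_simpleObject (lam : Weight 𝔥) :
    IsSimpleModule (Env 𝔤 A) (SimpleObject 𝔥 𝔟 A lam) := by
  have h := isSimpleModule_simpleQuotient (F := IsLocalRing.ResidueField A) ha lam
  rw [isSimpleModule_iff_toSpanSingleton_surjective] at h ⊢
  refine ⟨⟨simpleGen 𝔟 A lam, 0, simpleGen_ne_zero ha lam⟩, fun x hx y => ?_⟩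
  obtain ⟨u, hu⟩ := h.2 x hx y
  obtain ⟨u, rfl⟩ := envResidue_surjective u
  exact ⟨u, hu⟩

variable (A) in
include ha in
theorem exists_verma_hom_simpleObject (lam : Weight 𝔥) :
    ∃ π : Verma 𝔥 𝔟 A lam →ₗ[Env 𝔤 A] SimpleObject 𝔥 𝔟 A lam,
      π (vermaGen 𝔟 A lam) = simpleGen 𝔟 A lam ∧ Function.Surjective π := by
  obtain ⟨π, hπ⟩ := exists_verma_hom (𝔟 := 𝔟) ha (simpleGen_mem (A := A) (𝔟 := 𝔟) lam) fun X hX => by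
    rw [simpleObject_smul, envResidue_act]
    have := congrArg (vermaMaxSubmodule 𝔥 𝔟 (IsLocalRing.ResidueField A) lam).mkQ
      (act_smul_vermaGen (A := IsLocalRing.ResidueField A) (lam := lam) ha hX)
    rw [map_smul, map_zero] at this
    exact this
  refine ⟨π, hπ, ?_⟩
  rw [← LinearMap.range_eq_top, eq_top_iff, ← span_simpleGen, Submodule.span_singleton_le_iff_mem]
  exact ⟨_, hπ⟩

include ha in
theorem exists_smul_simpleGen {lam : Weight 𝔥} {y : SimpleObject 𝔥 𝔟 A lam}
    (hy : y ∈ weightSpace 𝔥 A (SimpleObject 𝔥 𝔟 A lam) lam) : ∃ c : A, y = c • simpleGen 𝔟 A lam := by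
  obtain ⟨π, hπ, hs⟩ := exists_verma_hom_simpleObject ha A lam
  obtain ⟨x, hx, rfl⟩ := exists_weight_lift (iSup_weightSpace_verma ha lam) π hs hy
  obtain ⟨c, rfl⟩ := exists_smul_vermaGen ha hx
  exact ⟨c, by rw [env_map_smul, hπ]⟩

include ha in
theorem weightLE_of_simpleObject {lam γ : Weight 𝔥} {y : SimpleObject 𝔥 𝔟 A lam}
    (hy : y ∈ weightSpace 𝔥 A (SimpleObject 𝔥 𝔟 A lam) γ) (hy0 : y ≠ 0) : WeightLE 𝔥 𝔟 γ lam := by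
  obtain ⟨π, hπ, hs⟩ := exists_verma_hom_simpleObject ha A lam
  obtain ⟨x, hx, rfl⟩ := exists_weight_lift (iSup_weightSpace_verma ha lam) π hs hy
  have h : weightSpace 𝔥 A (Verma 𝔥 𝔟 A lam) γ ≠ ⊥ := fun h => by
    rw [h, Submodule.mem_bot] at hx
    exact hy0 (by rw [hx, map_zero])
  obtain ⟨-, h1⟩ := (isStdBasis_vermaGen (A := A) ha).weightLE ha h
  exact h1

theorem isInTruncatedO_simpleObject [IsNoetherianRing A] (ha : IsBorelGrading 𝔥 𝔟 a)
    {J : Set (Weight 𝔥)} (hJo : IsOpenSet 𝔥 𝔟 J)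
    (hJ : IsLocallyBounded 𝔥 𝔟 J) {lam : Weight 𝔥} (hlam : lam ∈ J) :
    IsInTruncatedO 𝔥 𝔟 A (SimpleObject 𝔥 𝔟 A lam) J := by
  obtain ⟨π, hπ, hs⟩ := exists_verma_hom_simpleObject ha A lam
  exact ((isStdBasis_vermaGen ha).isInTruncatedO ha hJo hJ fun _ => hlam).of_surjective π hs

variable {M : Type w} [AddCommGroup M] [Module A M] [Module (Env 𝔤 A) M]
  [IsScalarTower A (Env 𝔤 A) M]

include ha in
/-- Every simple object of the truncated category is isomorphic to some `L_A(lam)`. -/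
theorem exists_equiv_simpleObject [IsSimpleModule (Env 𝔤 A) M] {J : Set (Weight 𝔥)}
    (hJ : IsLocallyBounded 𝔥 𝔟 J) (hM : IsInTruncatedO 𝔥 𝔟 A M J) :
    ∃ lam ∈ J, Nonempty (M ≃ₗ[Env 𝔤 A] SimpleObject 𝔥 𝔟 A lam) := by
  classical
  have hnt : Nontrivial M := IsSimpleModule.nontrivial (Env 𝔤 A) M
  obtain ⟨γ, hγ⟩ : ∃ γ, weightSpace 𝔥 A M γ ≠ ⊥ := by
    by_contra! h
    have h1 := hM.iSup_eq_top
    simp only [h, iSup_bot] at h1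
    obtain ⟨x, hx⟩ := exists_ne (0 : M)
    have h2 : x ∈ (⊤ : Submodule A M) := trivial
    rw [← h1, Submodule.mem_bot] at h2
    exact hx h2
  have hfin : {γ' | WeightLE 𝔥 𝔟 γ γ' ∧ weightSpace 𝔥 A M γ' ≠ ⊥}.Finite :=
    (hJ γ).subset fun γ' h => ⟨hM.mem_of_weightSpace_ne_bot _ h.2, h.1⟩
  -- Local boundedness provides a maximal weight; its vectors are killed by n̂₊ and receive a map
  -- from the Verma module.
  obtain ⟨lam, ⟨h1, h2⟩, hmax⟩ : ∃ lam, (WeightLE 𝔥 𝔟 γ lam ∧ weightSpace 𝔥 A M lam ≠ ⊥) ∧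
      ∀ γ', weightSpace 𝔥 A M γ' ≠ ⊥ → WeightLE 𝔥 𝔟 lam γ' → γ' = lam := by
    let _ : PartialOrder (Weight 𝔥) :=
      { le := WeightLE 𝔥 𝔟
        le_refl := WeightLE.refl
        le_trans := fun _ _ _ => WeightLE.trans
        le_antisymm := fun _ _ => WeightLE.antisymm ha }
    obtain ⟨lam, hlam⟩ := hfin.exists_maximal ⟨γ, WeightLE.refl γ, hγ⟩
    exact ⟨lam, hlam.1, fun γ' h h' =>
      (hlam.eq_of_le ⟨hlam.1.1.trans h', h⟩ h').symm⟩
  obtain ⟨v, hv, hv0⟩ := (Submodule.ne_bot_iff _).mp h2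
  obtain ⟨f, hf⟩ := exists_verma_hom (𝔟 := 𝔟) ha hv fun X hX => by
    let V : Submodule ℂ (Affine 𝔤) :=
      { carrier := {X | act A X • v = 0}
        add_mem' := fun h h' => by
          rw [Set.mem_ofPred_eq] at *; rw [act_add, add_smul, h, h', add_zero]
        zero_mem' := by rw [Set.mem_ofPred_eq, act_zero, zero_smul]
        smul_mem' := fun c X h => by
          rw [Set.mem_ofPred_eq] at *; rw [act_smul, smul_assoc, h, smul_zero] }
    refine rootSum_le (V := V) (fun β hβ X hX => ?_) hX
    by_contra h0
    have h3 : weightSpace 𝔥 A M (lam + β) ≠ ⊥ := fun h => h0 (by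
      have := act_smul_mem_weightSpace hX hv
      rwa [h, Submodule.mem_bot] at this)
    have h4 : rootSpaceHat 𝔥 β ≠ ⊥ := fun h => h0 (by
      rw [h, Submodule.mem_bot] at hX
      rw [hX]; exact zero_mem V)
    have h5 := hmax _ h3 (weightLE_add ha hβ h4)
    rw [add_eq_left] at h5
    exact posDeg_zero_notMem (h5 ▸ hβ)
  have hf0 : f ≠ 0 := fun h => hv0 (by rw [← hf, h, LinearMap.zero_apply])
  have hfs : Function.Surjective f := LinearMap.surjective_of_ne_zero hf0
  obtain ⟨π, hπ, hs⟩ := exists_verma_hom_simpleObject ha A lam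
  have := isSimpleModule_simpleObject (A := A) ha lam
  -- Otherwise π maps ker f onto L_A(lam), so ker f contains c times the generator for some c acting
  -- as 1 on the highest weight vector of L_A(lam). Nonunits act by zero there, so c is a unit and f
  -- kills the generator, against f(generator) = v ≠ 0.
  have hker : LinearMap.ker f ≤ LinearMap.ker π := by
    by_contra hle
    let g := π ∘ₗ (LinearMap.ker f).subtype
    have hg0 : g ≠ 0 := fun h => hle fun x hx => LinearMap.congr_fun h ⟨x, hx⟩
    have hgs : Function.Surjective g := LinearMap.surjective_of_ne_zero hg0
    obtain ⟨y, hy, hy'⟩ := exists_weight_lift (iSup_weightSpace_eq_top_of_injective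
      (iSup_weightSpace_verma ha lam) _ (Submodule.injective_subtype (LinearMap.ker f))) g hgs
      (simpleGen_mem (A := A) (𝔟 := 𝔟) lam)
    obtain ⟨c, hc⟩ := exists_smul_vermaGen ha
      (map_mem_weightSpace (LinearMap.ker f).subtype hy)
    have hc' : c • simpleGen 𝔟 A lam = simpleGen 𝔟 A lam := by
      rw [← hπ, ← env_map_smul, ← hc, hπ, ← hy']; rfl
    have hcu : IsUnit c := by
      by_contra h
      rw [smul_simpleObject_eq_zero h] at hc'
      exact simpleGen_ne_zero ha lam hc'.symm
    have h1 : c • v = 0 := by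
      rw [← hf, ← env_map_smul, ← hc]
      exact y.2
    exact hv0 ((hcu.smul_eq_zero).mp h1)
  have hkereq : LinearMap.ker f = LinearMap.ker π := by
    have hco : IsCoatom (LinearMap.ker f) := by
      rw [← isSimpleModule_iff_isCoatom]
      exact IsSimpleModule.congr (f.quotKerEquivOfSurjective hfs)
    refine (hco.le_iff.mp hker).resolve_left (fun h => ?_) |>.symm
    apply simpleGen_ne_zero (A := A) ha lam
    rw [← hπ]
    have : vermaGen 𝔟 A lam ∈ LinearMap.ker π := by rw [h]; trivial
    exact this
  exact ⟨lam, hM.mem_of_weightSpace_ne_bot _ h2,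
    ⟨(f.quotKerEquivOfSurjective hfs).symm.trans ((Submodule.quotEquivOfEq _ _ hkereq).trans
      (π.quotKerEquivOfSurjective hs))⟩⟩

end Simple

/-! ### Projective covers -/

section Covers

attribute [local instance 100] LieRing.ofAssociativeRing

variable {𝔤 : Type u} [LieRing 𝔤] [LieAlgebra ℂ 𝔤] [FiniteDimensional ℂ 𝔤] [LieAlgebra.IsSimple ℂ 𝔤]
variable {𝔥 𝔟 : LieSubalgebra ℂ 𝔤} [𝔥.IsCartanSubalgebra]
variable {a : CartanHat 𝔥} (ha : IsBorelGrading 𝔥 𝔟 a)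
variable {A : Type v} [CommRing A] [IsNoetherianRing A] [IsLocalRing A] [Algebra ℂ A]
  [Algebra (SymmetricAlgebra ℂ 𝔥) A] [IsScalarTower ℂ (SymmetricAlgebra ℂ 𝔥) A]
variable {J : Set (Weight 𝔥)}

section Hom

variable {R : Type*} [Ring R] {M N : Type*} [AddCommGroup M] [AddCommGroup N] [Module R M]
  [Module R N]

theorem linearMap_ext_of_span {x : M} (hx : Submodule.span R {x} = ⊤) {f g : M →ₗ[R] N}
    (h : f x = g x) : f = g :=
  LinearMap.ext_on hx fun y hy => by rw [Set.mem_singleton_iff.mp hy]; exact h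

theorem surjective_of_mem_range {x : N} (hx : Submodule.span R {x} = ⊤) {f : M →ₗ[R] N} {y : M}
    (h : f y = x) : Function.Surjective f := by
  rw [← LinearMap.range_eq_top, eq_top_iff, ← hx, Submodule.span_singleton_le_iff_mem]
  exact ⟨y, h⟩

end Hom

variable {P : Type (max u v)} [AddCommGroup P] [Module A P] [Module (Env 𝔤 A) P]
  [IsScalarTower A (Env 𝔤 A) P]

/-- Lifting homomorphisms reduces to lifting a vector of weight μ, which is possible because weight
vectors lift through surjections. -/
theorem isProjectiveObject_of_generator (hP : IsInTruncatedO 𝔥 𝔟 A P J) {μ : Weight 𝔥} {p : P}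
    (hp : p ∈ weightSpace 𝔥 A P μ) (hs : Submodule.span (Env 𝔤 A) {p} = ⊤)
    (h : ∀ (M : Type (max u v)) [AddCommGroup M] [Module A M] [Module (Env 𝔤 A) M]
        [IsScalarTower A (Env 𝔤 A) M], IsInTruncatedO 𝔥 𝔟 A M J → ∀ m ∈ weightSpace 𝔥 A M μ,
          ∃ f : P →ₗ[Env 𝔤 A] M, f p = m) : IsProjectiveObject 𝔥 𝔟 A J P where
  isInTruncatedO := hP
  exists_lift M N _ _ _ _ _ _ _ _ hM hN f g hf := by
    obtain ⟨m, hm, hm'⟩ := exists_weight_lift hM.iSup_eq_top f hf (map_mem_weightSpace g hp)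
    obtain ⟨k, rfl⟩ := h M hM m hm
    exact ⟨k, linearMap_ext_of_span hs hm'⟩

theorem IsProjectiveObject.exists_section (hP : IsProjectiveObject 𝔥 𝔟 A J P) {M : Type (max u v)}
    [AddCommGroup M] [Module A M] [Module (Env 𝔤 A) M] [IsScalarTower A (Env 𝔤 A) M]
    (hM : IsInTruncatedO 𝔥 𝔟 A M J) (f : M →ₗ[Env 𝔤 A] P) (hf : Function.Surjective f) :
    ∃ s : P →ₗ[Env 𝔤 A] M, ∀ x, f (s x) = x := by
  obtain ⟨s, hs⟩ := hP.exists_lift M P hM hP.isInTruncatedO f LinearMap.id hf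
  exact ⟨s, fun x => LinearMap.congr_fun hs x⟩

theorem IsProjectiveObject.of_retract (hP : IsProjectiveObject 𝔥 𝔟 A J P) {M : Type (max u v)}
    [AddCommGroup M] [Module A M] [Module (Env 𝔤 A) M] [IsScalarTower A (Env 𝔤 A) M]
    (i : M →ₗ[Env 𝔤 A] P) (r : P →ₗ[Env 𝔤 A] M) (h : ∀ x, r (i x) = x) :
    IsProjectiveObject 𝔥 𝔟 A J M where
  isInTruncatedO := hP.isInTruncatedO.of_injective i (Function.LeftInverse.injective h)
  exists_lift K N _ _ _ _ _ _ _ _ hK hN f g hf := by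
    obtain ⟨k, hk⟩ := hP.exists_lift K N hK hN f (g ∘ₗ r) hf
    refine ⟨k ∘ₗ i, LinearMap.ext fun x => ?_⟩
    have := LinearMap.congr_fun hk (i x)
    rw [LinearMap.comp_apply, LinearMap.comp_apply, h] at this
    exact this

variable (𝔥 𝔟 A J) in
/-- `L_A(μ)` has a projective cover in the truncated category. -/
def HasProjectiveCover (μ : Weight 𝔥) : Prop :=
  ∃ (P : Type (max u v)) (_ : AddCommGroup P) (_ : Module A P) (_ : Module (Env 𝔤 A) P)
    (_ : IsScalarTower A (Env 𝔤 A) P) (c : P →ₗ[Env 𝔤 A] SimpleObject 𝔥 𝔟 A μ),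
    IsProjectiveCover 𝔥 𝔟 A J μ P c

include ha in
/-- A projective object generated by a vector of weight `μ`, without homomorphisms to simple objects
other than `L_A(μ)`, is a projective cover of `L_A(μ)`. -/
theorem isProjectiveCover_of_forall (hJ : IsLocallyBounded 𝔥 𝔟 J) {μ : Weight 𝔥}
    (hP : IsProjectiveObject 𝔥 𝔟 A J P) {x : P} (hx : x ∈ weightSpace 𝔥 A P μ)
    (hs : Submodule.span (Env 𝔤 A) {x} = ⊤) (c : P →ₗ[Env 𝔤 A] SimpleObject 𝔥 𝔟 A μ)
    (hc : Function.Surjective c)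
    (h : ∀ lam ∈ J, lam ≠ μ → ∀ f : P →ₗ[Env 𝔤 A] SimpleObject 𝔥 𝔟 A lam, f = 0) :
    IsProjectiveCover 𝔥 𝔟 A J μ P c where
  isProjectiveObject := hP
  surjective := hc
  essential M _ _ _ _ hM g hcg := by
    by_contra hg
    rw [← LinearMap.range_eq_top] at hg
    have : Module.Finite (Env 𝔤 A) P := ⟨⟨{x}, by simpa using hs⟩⟩
    -- If g is not surjective, its range lies in a maximal submodule Y. The simple quotient P / Y is
    -- some L_A(lam), and lam = μ by the assumption on homomorphisms.
    obtain ⟨Y, hY, hle⟩ := (eq_top_or_exists_le_coatom (LinearMap.range g)).resolve_left hg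
    have : IsSimpleModule (Env 𝔤 A) (P ⧸ Y) := isSimpleModule_iff_isCoatom.mpr hY
    obtain ⟨lam, hlam, ⟨e⟩⟩ := exists_equiv_simpleObject ha hJ
      (hP.isInTruncatedO.of_surjective Y.mkQ Y.mkQ_surjective)
    let f : P →ₗ[Env 𝔤 A] SimpleObject 𝔥 𝔟 A lam := e.toLinearMap ∘ₗ Y.mkQ
    have hfY (z : P) : f z = 0 ↔ z ∈ Y := by
      change e (Y.mkQ z) = 0 ↔ _
      rw [LinearEquiv.map_eq_zero_iff, ← LinearMap.mem_ker, Submodule.ker_mkQ]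
    have hfx : f x ≠ 0 := fun h0 => hY.1 (by
      rwa [eq_top_iff, ← hs, Submodule.span_singleton_le_iff_mem, ← hfY])
    obtain rfl : lam = μ := by
      by_contra hne
      exact hfx (by rw [h lam hlam hne f, LinearMap.zero_apply])
    obtain ⟨r, hr⟩ := exists_smul_simpleGen ha (map_mem_weightSpace f hx)
    obtain ⟨b, hb⟩ := exists_smul_simpleGen ha (map_mem_weightSpace c hx)
    have hbu : IsUnit b := by
      by_contra hbu
      rw [smul_simpleObject_eq_zero hbu] at hb
      obtain ⟨y, hy⟩ := hc (simpleGen 𝔟 A lam)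
      have : c = 0 := linearMap_ext_of_span hs (by rw [hb, LinearMap.zero_apply])
      exact simpleGen_ne_zero ha lam (by rw [← hy, this, LinearMap.zero_apply])
    obtain ⟨b, rfl⟩ := hbu
    -- Both f and c send the generator x to multiples of the highest weight vector, so f is a
    -- multiple of c. As c ∘ g is surjective and f vanishes on the range of g, it follows that f =
    -- 0.
    have hfc (z : P) : f z = (r * ((b⁻¹ : Aˣ) : A)) • c z := by
      have hz : z ∈ Submodule.span (Env 𝔤 A) {x} := by rw [hs]; trivial
      obtain ⟨u, rfl⟩ := Submodule.mem_span_singleton.mp hz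
      rw [map_smul, map_smul, hr, hb, smul_comm _ u, smul_smul, Units.inv_mul_cancel_right]
    obtain ⟨m, hm⟩ := hcg (c x)
    have h1 : f x = f (g m) := by
      rw [hfc, hfc]
      exact congrArg _ hm.symm
    exact hfx (h1.trans ((hfY _).mpr (hle ⟨m, rfl⟩)))

include ha in
-- If X has a nonzero map to L_A(lam) with lam ≠ μ, then lam > μ, since the generator of weight μ
-- has nonzero image. The map lifts to the cover P of L_A(lam); the lift is surjective by
-- essentiality and splits because P is projective. Its kernel is again projective, generated in
-- weight μ, and has a smaller basis. Once no such map is left, `isProjectiveCover_of_forall`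
-- applies.
theorem hasProjectiveCover_of_isStdBasis (hJo : IsOpenSet 𝔥 𝔟 J) (hJ : IsLocallyBounded 𝔥 𝔟 J)
    {μ : Weight 𝔥}
    (hcov : ∀ lam ∈ J, lam ≠ μ → WeightLE 𝔥 𝔟 μ lam → HasProjectiveCover 𝔥 𝔟 A J lam) (n : ℕ) :
    ∀ (X : Type (max u v)) [AddCommGroup X] [Module A X] [Module (Env 𝔤 A) X]
      [IsScalarTower A (Env 𝔤 A) X] (ι : Type) [Fintype ι] (wt : ι → Weight 𝔥) (m : ι → X) (x : X)
      (c : X →ₗ[Env 𝔤 A] SimpleObject 𝔥 𝔟 A μ), IsProjectiveObject 𝔥 𝔟 A J X →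
      IsStdBasis a A wt m → Fintype.card ι = n → x ∈ weightSpace 𝔥 A X μ →
      Submodule.span (Env 𝔤 A) {x} = ⊤ → Function.Surjective c →
      HasProjectiveCover 𝔥 𝔟 A J μ := by
  induction n using Nat.strong_induction_on with
  | _ n ih =>
  intro X _ _ _ _ ι _ wt m x c hX hm hn hx hs hc
  by_cases hex : ∀ lam ∈ J, lam ≠ μ → ∀ f : X →ₗ[Env 𝔤 A] SimpleObject 𝔥 𝔟 A lam, f = 0
  · exact ⟨X, _, _, _, _, c, isProjectiveCover_of_forall ha hJ hX hx hs c hc hex⟩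
  push Not at hex
  obtain ⟨lam, hlam, hne, h, h0⟩ := hex
  have hsimp := isSimpleModule_simpleObject (A := A) ha lam
  have hsimp' := isSimpleModule_simpleObject (A := A) ha μ
  have hhx : h x ≠ 0 := fun h' => h0 (linearMap_ext_of_span hs (by rw [h', LinearMap.zero_apply]))
  have hle := weightLE_of_simpleObject ha (map_mem_weightSpace h hx) hhx
  obtain ⟨P, _, _, _, _, d, hd⟩ := hcov lam hlam hne hle
  have hP := hd.isProjectiveObject
  obtain ⟨k, hk⟩ := hX.exists_lift P _ hP.isInTruncatedO
    (isInTruncatedO_simpleObject ha hJo hJ hlam) d h hd.surjective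
  have hks : Function.Surjective k := hd.essential X hX.isInTruncatedO k
    (by rw [hk]; exact LinearMap.surjective_of_ne_zero h0)
  obtain ⟨s, hsk⟩ := hP.exists_section hX.isInTruncatedO k hks
  obtain ⟨ι₁, ι₂, _, _, wt₁, m₁, wt₂, m₂, h₁, h₂, hcard⟩ := hm.exists_split k s hsk
  -- P is nonzero, so its basis is nonempty and the kernel has strictly fewer basis vectors than X.
  have hcard1 : 0 < Fintype.card ι₁ := by
    by_contra h1
    have : IsEmpty ι₁ := Fintype.card_eq_zero_iff.mp (by omega)
    obtain ⟨y, hy⟩ := hd.surjective (simpleGen 𝔟 A lam)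
    obtain ⟨t, rfl⟩ := h₁.bij.2 y
    rw [stdSum_apply, Finset.univ_eq_empty, Finset.sum_empty, map_zero] at hy
    exact simpleGen_ne_zero ha lam hy.symm
  let r₀ : X →ₗ[Env 𝔤 A] X := LinearMap.id - s ∘ₗ k
  have hr₀ (z : X) : r₀ z = z - s (k z) := rfl
  let r : X →ₗ[Env 𝔤 A] LinearMap.ker k := r₀.codRestrict _ fun z => by
    rw [LinearMap.mem_ker, hr₀, map_sub, hsk, sub_self]
  have hrk (z : LinearMap.ker k) : r z = z := Subtype.ext (by
    change r₀ z = z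
    rw [hr₀, LinearMap.mem_ker.mp z.2, map_zero, sub_zero])
  have hspan : Submodule.span (Env 𝔤 A) {r x} = ⊤ := by
    rw [eq_top_iff]
    rintro z -
    have hz : (z : X) ∈ Submodule.span (Env 𝔤 A) {x} := by rw [hs]; trivial
    obtain ⟨w, hw⟩ := Submodule.mem_span_singleton.mp hz
    rw [← hrk z, ← hw, map_smul]
    exact Submodule.smul_mem _ _ (Submodule.mem_span_singleton_self _)
  refine ih (Fintype.card ι₂) (by omega) (LinearMap.ker k) ι₂ wt₂ m₂ (r x)
    (c ∘ₗ (LinearMap.ker k).subtype) (hX.of_retract (LinearMap.ker k).subtype r hrk) h₂ rfl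
    -- It remains to see that c does not vanish on the kernel of k. Otherwise c factors through the
    -- summand P, and L_A(μ) becomes a quotient of the cover of L_A(lam).
    (map_mem_weightSpace r hx) hspan (LinearMap.surjective_of_ne_zero fun hc0 => ?_)
  have hck (z : X) (hz : k z = 0) : c z = 0 := LinearMap.congr_fun hc0 ⟨z, hz⟩
  have hcs (z : X) : c (s (k z)) = c z := by
    rw [← sub_eq_zero, ← map_sub]
    exact hck _ (by rw [map_sub, hsk, sub_self])
  let c' := c ∘ₗ s
  have hc's : Function.Surjective c' := fun y => by
    obtain ⟨z, rfl⟩ := hc y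
    exact ⟨k z, hcs z⟩
  -- If d were nonzero on ker c', it would map ker c' onto the simple L_A(lam), and essentiality
  -- would force ker c' = P.
  have hker : d ∘ₗ (LinearMap.ker c').subtype = 0 := by
    by_contra hne0
    have h1 := hd.essential _ (hP.isInTruncatedO.of_injective _
      (Submodule.injective_subtype (LinearMap.ker c'))) (LinearMap.ker c').subtype
      (LinearMap.surjective_of_ne_zero hne0)
    obtain ⟨y, hy⟩ := hc's (simpleGen 𝔟 A μ)
    obtain ⟨z, rfl⟩ := h1 y
    exact simpleGen_ne_zero ha μ (hy.symm.trans z.2)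
  obtain ⟨y, hy, hdy⟩ := exists_weight_lift hP.isInTruncatedO.iSup_eq_top d hd.surjective
    (simpleGen_mem (A := A) (𝔟 := 𝔟) lam)
  -- A nonzero c' y would be a vector of weight lam in L_A(μ), giving lam ≤ μ. So y lies in ker c',
  -- on which d vanishes, although d y is the generator of L_A(lam).
  have hcy : c' y = 0 := by
    by_contra hcy
    exact hne ((weightLE_of_simpleObject ha (map_mem_weightSpace c' hy) hcy).antisymm ha hle)
  exact simpleGen_ne_zero ha lam (hdy.symm.trans (LinearMap.congr_fun hker ⟨y, hcy⟩))

include ha in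
-- The induction is on the number of weights in J above μ. For lam > μ this number is smaller, as μ
-- itself is no longer counted.
theorem hasProjectiveCover (hJo : IsOpenSet 𝔥 𝔟 J) (hJ : IsLocallyBounded 𝔥 𝔟 J)
    {μ : Weight 𝔥} (hμ : μ ∈ J) : HasProjectiveCover 𝔥 𝔟 A J μ := by
  induction hn : {γ ∈ J | WeightLE 𝔥 𝔟 μ γ}.ncard using Nat.strong_induction_on generalizing μ with
  | _ n ih =>
  obtain ⟨Q, _, _, _, _, k, wt, q, q₀, hq, hwt, hq₀, hspan, huniv⟩ :=
    exists_projective_generator ha A hJo hJ μ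
  have hQ := hq.isInTruncatedO ha hJo hJ hwt
  obtain ⟨c, hc⟩ := huniv _ (isInTruncatedO_simpleObject ha hJo hJ hμ) _
    (simpleGen_mem (A := A) (𝔟 := 𝔟) μ)
  refine hasProjectiveCover_of_isStdBasis ha hJo hJ (fun lam hlam hne hle => ?_) _ Q (Fin k) wt q
    q₀ c (isProjectiveObject_of_generator hQ hq₀ hspan huniv) hq rfl hq₀ hspan
    (surjective_of_mem_range (span_simpleGen μ) hc)
  refine ih _ ?_ hlam rfl
  rw [← hn]
  refine Set.ncard_lt_ncard ⟨fun γ h => ⟨h.1, hle.trans h.2⟩, fun h => ?_⟩ (hJ μ)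
  exact hne ((h ⟨hμ, WeightLE.refl μ⟩).2.antisymm ha hle)

include ha in
-- The submodule generated by a lift of the highest weight vector still maps onto L_A(μ), so
-- essentiality makes it everything.
theorem IsProjectiveCover.exists_generator {μ : Weight 𝔥}
    {c : P →ₗ[Env 𝔤 A] SimpleObject 𝔥 𝔟 A μ} (h : IsProjectiveCover 𝔥 𝔟 A J μ P c) :
    ∃ p ∈ weightSpace 𝔥 A P μ, c p = simpleGen 𝔟 A μ ∧ Submodule.span (Env 𝔤 A) {p} = ⊤ := by
  have hP := h.isProjectiveObject.isInTruncatedO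
  obtain ⟨p, hp, hcp⟩ := exists_weight_lift hP.iSup_eq_top c h.surjective
    (simpleGen_mem (A := A) (𝔟 := 𝔟) μ)
  refine ⟨p, hp, hcp, ?_⟩
  have h1 := h.essential _ (hP.of_injective _
    (Submodule.injective_subtype (Submodule.span (Env 𝔤 A) {p}))) (Submodule.subtype _)
    (surjective_of_mem_range (span_simpleGen μ)
      (y := ⟨p, Submodule.mem_span_singleton_self p⟩) hcp)
  rw [← LinearMap.range_eq_top, Submodule.range_subtype] at h1
  exact h1

include ha in
-- A generator of weight μ makes P a quotient of the representing object Q, hence a summand by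
-- projectivity, and summands inherit a basis.
theorem IsProjectiveCover.exists_isStdBasis (hJo : IsOpenSet 𝔥 𝔟 J) (hJ : IsLocallyBounded 𝔥 𝔟 J)
    {μ : Weight 𝔥} {c : P →ₗ[Env 𝔤 A] SimpleObject 𝔥 𝔟 A μ}
    (h : IsProjectiveCover 𝔥 𝔟 A J μ P c) :
    ∃ (ι : Type) (_ : Fintype ι) (wt : ι → Weight 𝔥) (m : ι → P), IsStdBasis a A wt m := by
  obtain ⟨p, hp, -, hs⟩ := h.exists_generator ha
  obtain ⟨Q, _, _, _, _, k, wt, q, q₀, hq, hwt, hq₀, hspan, huniv⟩ :=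
    exists_projective_generator ha A hJo hJ μ
  obtain ⟨f, hf⟩ := huniv P h.isProjectiveObject.isInTruncatedO p hp
  obtain ⟨s, hsf⟩ := h.isProjectiveObject.exists_section (hq.isInTruncatedO ha hJo hJ hwt) f
    (surjective_of_mem_range hs hf)
  obtain ⟨ι₁, ι₂, _, _, wt₁, m₁, wt₂, m₂, h₁, h₂, hcard⟩ := hq.exists_split f s hsf
  exact ⟨ι₁, _, wt₁, m₁, h₁⟩

end Covers

/-! ### The inverse of the Chevalley automorphism -/

section Chevalley

attribute [local instance 100] LieRing.ofAssociativeRing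

variable {𝔤 : Type u} [LieRing 𝔤] [LieAlgebra ℂ 𝔤] [FiniteDimensional ℂ 𝔤] [LieAlgebra.IsSimple ℂ 𝔤]
variable {𝔥 𝔟 : LieSubalgebra ℂ 𝔤} [𝔥.IsCartanSubalgebra]
variable {a : CartanHat 𝔥}

theorem map_mem_rootSpaceHat_neg {θ : Affine 𝔤 →ₗ⁅ℂ⁆ Affine 𝔤}
    (hθ : ∀ H : CartanHat 𝔥, θ (cartanIncl H) = -cartanIncl H) {β : Weight 𝔥} {X : Affine 𝔤}
    (hX : X ∈ rootSpaceHat 𝔥 β) : θ X ∈ rootSpaceHat 𝔥 (-β) := fun H => by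
  have h1 := congrArg θ (hX H)
  rw [LieHom.map_lie, hθ, neg_lie, map_smul θ] at h1
  rw [LinearMap.neg_apply, neg_smul, ← h1, neg_neg]

theorem map_mem_nPart_neg {θ : Affine 𝔤 →ₗ⁅ℂ⁆ Affine 𝔤}
    (hθ : ∀ H : CartanHat 𝔥, θ (cartanIncl H) = -cartanIncl H) {X : Affine 𝔤}
    (hX : X ∈ nPart a) : θ X ∈ nPart (-a) :=
  rootSum_le (V := (nPart (-a)).toSubmodule.comap (θ : Affine 𝔤 →ₗ[ℂ] Affine 𝔤))
    (fun β hβ X hX => mem_nPart (by rw [neg_mem_posDeg]; exact hβ)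
      (map_mem_rootSpaceHat_neg hθ hX)) hX

variable (𝔥) in
-- The automorphism of 𝔤 is only known to be -1 on 𝔥 and need not be its own inverse, so the inverse
-- is treated as a separate map.
theorem exists_chevalleyHat_inv : ∃ θ : Affine 𝔤 →ₗ⁅ℂ⁆ Affine 𝔤,
    (∀ X, θ (chevalleyHat 𝔥 X) = X) ∧ (∀ X, chevalleyHat 𝔥 (θ X) = X) ∧
      ∀ H : CartanHat 𝔥, θ (cartanIncl H) = -cartanIncl H := by
  let inv : Loop 𝔤 →ₗ[ℂ] Loop 𝔤 :=
    Finsupp.lsum ℂ fun n => Finsupp.lsingle (-n) ∘ₗ ((chevalley 𝔥).symm : 𝔤 →ₗ[ℂ] 𝔤)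
  have hinv (n : ℤ) (x : 𝔤) :
      inv (Finsupp.single n x) = Finsupp.single (-n) ((chevalley 𝔥).symm x) := by
    simp [inv]
  have h1 : inv ∘ₗ chevalleyLoop 𝔥 = LinearMap.id := by
    refine Finsupp.lhom_ext fun n x => ?_
    rw [LinearMap.comp_apply, chevalleyLoop_single, hinv, neg_neg, LieEquiv.symm_apply_apply]; rfl
  have h2 : chevalleyLoop 𝔥 ∘ₗ inv = LinearMap.id := by
    refine Finsupp.lhom_ext fun n x => ?_
    rw [LinearMap.comp_apply, hinv, chevalleyLoop_single, neg_neg, LieEquiv.apply_symm_apply]; rfl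
  have hbij : Function.Bijective (chevalleyHat 𝔥) := by
    refine Function.bijective_iff_has_inverse.mpr ⟨fun X => ⟨inv X.loop, -X.cent, -X.der⟩,
      fun X => ?_, fun X => ?_⟩
    · ext1
      · exact LinearMap.congr_fun h1 X.loop
      · exact neg_neg _
      · exact neg_neg _
    · ext1
      · exact LinearMap.congr_fun h2 X.loop
      · exact neg_neg _
      · exact neg_neg _
  let e := LieEquiv.ofBijective (chevalleyHat 𝔥) hbij
  have he (X) : e X = chevalleyHat 𝔥 X := rfl
  refine ⟨e.symm, fun X => e.symm_apply_apply X, fun X => e.apply_symm_apply X, fun H => ?_⟩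
  change e.symm (cartanIncl H) = _
  rw [LieEquiv.symm_apply_eq, he, map_neg, chevalleyHat_cartanIncl, neg_neg]

end Chevalley

/-! ### Restricted duals -/

section Dual

attribute [local instance 100] LieRing.ofAssociativeRing

variable {𝔤 : Type u} [LieRing 𝔤] [LieAlgebra ℂ 𝔤] [FiniteDimensional ℂ 𝔤] [LieAlgebra.IsSimple ℂ 𝔤]
variable {𝔥 𝔟 : LieSubalgebra ℂ 𝔤} [𝔥.IsCartanSubalgebra]
variable {a : CartanHat 𝔥} (ha : IsBorelGrading 𝔥 𝔟 a)
variable {F : Type v} [Field F] [Algebra ℂ F] 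
variable {M : Type w} [AddCommGroup M] [Module F M] [Module (Env 𝔤 F) M]
  [IsScalarTower F (Env 𝔤 F) M]

theorem act_neg (A : Type*) [CommRing A] [Algebra ℂ A] (X : Affine 𝔤) :
    act A (-X) = -act A X := by
  rw [eq_neg_iff_add_eq_zero, ← act_add, neg_add_cancel, act_zero]

variable (F M 𝔥) in
/-- The elements of the twisted dual as linear forms. -/
def TwistedDual.toDual : TwistedDual F M 𝔥 ≃ₗ[F] Module.Dual F M := LinearEquiv.refl F _

theorem toDual_act (X : Affine 𝔤) (f : TwistedDual F M 𝔥) (m : M) :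
    TwistedDual.toDual 𝔥 F M (act F X • f) m =
      -TwistedDual.toDual 𝔥 F M f (act F (chevalleyHat 𝔥 X) • m) :=
  act_smul_twistedDual 𝔥 F M X f m

/-- The sign of the dual action and the sign of ω on ĥ cancel, so the dual has the weights of M and
not their negatives. -/
theorem toDual_cartan (H : CartanHat 𝔥) (f : TwistedDual F M 𝔥) (m : M) :
    TwistedDual.toDual 𝔥 F M (act F (cartanIncl H) • f) m =
      TwistedDual.toDual 𝔥 F M f (act F (cartanIncl H) • m) := by
  rw [toDual_act, chevalleyHat_cartanIncl, act_neg, neg_smul, map_neg, neg_neg]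

theorem twistedDual_ext {f g : TwistedDual F M 𝔥}
    (h : ∀ m, TwistedDual.toDual 𝔥 F M f m = TwistedDual.toDual 𝔥 F M g m) : f = g :=
  (TwistedDual.toDual 𝔥 F M).injective (LinearMap.ext h)

variable [Algebra (SymmetricAlgebra ℂ 𝔥) F] [IsScalarTower ℂ (SymmetricAlgebra ℂ 𝔥) F]

theorem toDual_eq_zero {γ γ' : Weight 𝔥} (h : γ ≠ γ') {f : TwistedDual F M 𝔥}
    (hf : f ∈ weightSpace 𝔥 F (TwistedDual F M 𝔥) γ) {m : M} (hm : m ∈ weightSpace 𝔥 F M γ') :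
    TwistedDual.toDual 𝔥 F M f m = 0 := by
  obtain ⟨H, hH⟩ := exists_isUnit_deformedWeight_sub (A := F) γ γ' h
  have h1 := toDual_cartan H f m
  rw [hf H, hm H, map_smul, map_smul, LinearMap.smul_apply, ← sub_eq_zero, ← sub_smul] at h1
  exact hH.smul_eq_zero.mp h1

theorem weightSpace_twistedDual_le_cartanFinite {γ : Weight 𝔥} {N : Type*} [AddCommGroup N]
    [Module F N] [Module (Env 𝔤 F) N] [IsScalarTower F (Env 𝔤 F) N] {f : N}
    (hf : f ∈ weightSpace 𝔥 F N γ) : f ∈ cartanFinite 𝔥 F N := by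
  refine ⟨Submodule.span F {f}, Submodule.mem_span_singleton_self f,
    Submodule.fg_span_singleton f, fun H n hn => ?_⟩
  obtain ⟨c, rfl⟩ := Submodule.mem_span_singleton.mp hn
  rw [smul_comm, hf H, smul_comm]
  exact Submodule.smul_mem _ _ (Submodule.mem_span_singleton_self f |> Submodule.smul_mem _ c)

/-- A `ĥ`-finite linear form on a weight module vanishes on almost all weight spaces. -/
theorem finite_setOf_toDual_ne_zero {f : TwistedDual F M 𝔥}
    (hf : f ∈ cartanFinite 𝔥 F (TwistedDual F M 𝔥)) :
    {γ | ∃ y ∈ weightSpace 𝔥 F M γ, TwistedDual.toDual 𝔥 F M f y ≠ 0}.Finite := by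
  obtain ⟨N, hfN, hfg, hst⟩ := hf
  have : Module.Finite F N := Module.Finite.iff_fg.mpr hfg
  choose y hy hfy using fun γ : {γ | ∃ y ∈ weightSpace 𝔥 F M γ,
    TwistedDual.toDual 𝔥 F M f y ≠ 0} => γ.2
  let ℓ (m : M) : Module.Dual F N := LinearMap.applyₗ m ∘ₗ
    (TwistedDual.toDual 𝔥 F M).toLinearMap ∘ₗ N.subtype
  let θ (H : CartanHat 𝔥) : Module.End F (Module.Dual F N) :=
    Module.Dual.transpose ((actLin (TwistedDual F M 𝔥) (act F (cartanIncl H))).restrict (hst H))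
  have hθ (H : CartanHat 𝔥) (m : M) {γ : Weight 𝔥} (hm : m ∈ weightSpace 𝔥 F M γ) :
      θ H (ℓ m) = deformedWeight 𝔥 F γ H • ℓ m := by
    refine LinearMap.ext fun g => ?_
    change TwistedDual.toDual 𝔥 F M (act F (cartanIncl H) • (g : TwistedDual F M 𝔥)) m =
      deformedWeight 𝔥 F γ H • TwistedDual.toDual 𝔥 F M g m
    rw [toDual_cartan, hm H, map_smul]
  -- The evaluations at the chosen y γ are eigenvectors of ĥ on the dual of the finite dimensional
  -- space N, with pairwise different weights, and nonzero because f detects y γ. Hence they are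
  -- independent and finite in number.
  have hli : LinearIndependent F fun γ => ℓ (y γ) := by
    classical
    rw [linearIndependent_iff']
    intro s b hb γ hγ
    have h1 := mem_of_sum_mem (θ := θ)
      (c := fun γ : {γ | ∃ y ∈ weightSpace 𝔥 F M γ, TwistedDual.toDual 𝔥 F M f y ≠ 0} =>
        deformedWeight 𝔥 F (γ : Weight 𝔥))
      (fun γ γ' h => exists_isUnit_deformedWeight_sub _ _ fun h' => h (Subtype.ext h'))
      (N := ⊥) (fun H m hm => by
        rw [Submodule.mem_bot] at hm ⊢
        rw [hm, map_zero]) s (fun γ => b γ • ℓ (y γ))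
      (fun γ _ H => by rw [map_smul, hθ H _ (hy γ), smul_comm]) (by rw [hb]; exact zero_mem _) γ hγ
    have h2 := LinearMap.congr_fun ((Submodule.mem_bot F).mp h1) ⟨f, hfN⟩
    exact (mul_eq_zero.mp h2).resolve_right (hfy γ)
  exact Set.finite_coe_iff.mp hli.finite

/-- Composing f with the projections of M to its weight spaces gives its components, which are
weight vectors; only finitely many are nonzero by `finite_setOf_toDual_ne_zero`. -/
theorem iSup_weightSpace_cartanFinite (hM : ⨆ γ, weightSpace 𝔥 F M γ = ⊤) :
    ⨆ γ, weightSpace 𝔥 F (cartanFinite 𝔥 F (TwistedDual F M 𝔥)) γ = ⊤ := by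
  classical
  rw [eq_top_iff]
  rintro ⟨f, hf⟩ -
  have hfin := finite_setOf_toDual_ne_zero hf
  have hcompl (γ : Weight 𝔥) : IsCompl (weightSpace 𝔥 F M γ)
      (⨆ γ', ⨆ (_ : γ' ≠ γ), weightSpace 𝔥 F M γ') := by
    refine ⟨iSupIndep_weightSpace γ, ?_⟩
    rw [codisjoint_iff, eq_top_iff, ← hM]
    refine iSup_le fun γ' => ?_
    by_cases h : γ' = γ
    · rw [h]; exact le_sup_left
    · exact (le_iSup₂_of_le (f := fun γ' (_ : γ' ≠ γ) => weightSpace 𝔥 F M γ') γ' h le_rfl).trans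
        le_sup_right
  let fγ (γ : Weight 𝔥) : TwistedDual F M 𝔥 := (TwistedDual.toDual 𝔥 F M).symm
    (TwistedDual.toDual 𝔥 F M f ∘ₗ (weightSpace 𝔥 F M γ).subtype ∘ₗ
      Submodule.projectionOnto _ _ (hcompl γ))
  have h1 (γ : Weight 𝔥) (m : M) (hm : m ∈ weightSpace 𝔥 F M γ) :
      TwistedDual.toDual 𝔥 F M (fγ γ) m = TwistedDual.toDual 𝔥 F M f m := by
    have := Submodule.projectionOnto_apply_left (hcompl γ) ⟨m, hm⟩
    change TwistedDual.toDual 𝔥 F M f (Submodule.projectionOnto _ _ (hcompl γ) m : M) = _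
    rw [this]
  have h2 (γ γ' : Weight 𝔥) (h : γ' ≠ γ) (m : M) (hm : m ∈ weightSpace 𝔥 F M γ') :
      TwistedDual.toDual 𝔥 F M (fγ γ) m = 0 := by
    have := (Submodule.projectionOnto_apply_eq_zero_iff (hcompl γ)).mpr
      (Submodule.mem_iSup_of_mem γ' (Submodule.mem_iSup_of_mem h hm))
    change TwistedDual.toDual 𝔥 F M f (Submodule.projectionOnto _ _ (hcompl γ) m : M) = _
    rw [this, ZeroMemClass.coe_zero, map_zero]
  have hext {x y : TwistedDual F M 𝔥} (h : ∀ γ, ∀ m ∈ weightSpace 𝔥 F M γ,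
      TwistedDual.toDual 𝔥 F M x m = TwistedDual.toDual 𝔥 F M y m) : x = y := by
    refine twistedDual_ext fun m => ?_
    obtain ⟨s, g, rfl, hg⟩ := exists_sum_weight hM m
    rw [map_sum, map_sum]
    exact Finset.sum_congr rfl fun γ _ => h γ _ (hg γ)
  have h3 (γ : Weight 𝔥) : fγ γ ∈ weightSpace 𝔥 F (TwistedDual F M 𝔥) γ := fun H => by
    refine hext fun γ' m hm => ?_
    rw [toDual_cartan, hm H, map_smul, map_smul, LinearMap.smul_apply]
    by_cases h : γ' = γ
    · rw [h]
    · rw [h2 γ γ' h m hm, smul_zero, smul_zero]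
  let fc (γ : Weight 𝔥) : cartanFinite 𝔥 F (TwistedDual F M 𝔥) :=
    ⟨fγ γ, weightSpace_twistedDual_le_cartanFinite (h3 γ)⟩
  have h4 : (⟨f, hf⟩ : cartanFinite 𝔥 F (TwistedDual F M 𝔥)) = ∑ γ ∈ hfin.toFinset, fc γ := by
    refine Subtype.ext (hext fun γ m hm => ?_)
    rw [AddSubmonoidClass.coe_finsetSum, map_sum, LinearMap.sum_apply]
    by_cases h : γ ∈ hfin.toFinset
    · rw [Finset.sum_eq_single γ, h1 γ m hm]
      · intro γ' _ hne
        exact h2 γ' γ hne.symm m hm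
      · exact fun h' => absurd h h'
    · have h0 : TwistedDual.toDual 𝔥 F M f m = 0 := by
        by_contra h0
        exact h (hfin.mem_toFinset.mpr ⟨m, hm, h0⟩)
      rw [h0, Finset.sum_eq_zero]
      intro γ' hγ'
      exact h2 γ' γ (fun h' => h (h' ▸ hγ')) m hm
  rw [h4]
  exact sum_mem fun γ _ => Submodule.mem_iSup_of_mem γ
    (mem_weightSpace_of_injective (cartanFinite 𝔥 F (TwistedDual F M 𝔥)).subtype
      (Submodule.injective_subtype _) (h3 γ))

theorem weightSpace_cartanFinite_ext (hM : ⨆ γ, weightSpace 𝔥 F M γ = ⊤) {γ : Weight 𝔥}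
    {f : cartanFinite 𝔥 F (TwistedDual F M 𝔥)}
    (hf : f ∈ weightSpace 𝔥 F (cartanFinite 𝔥 F (TwistedDual F M 𝔥)) γ)
    (h : ∀ m ∈ weightSpace 𝔥 F M γ, TwistedDual.toDual 𝔥 F M f m = 0) : f = 0 := by
  classical
  refine Subtype.ext (twistedDual_ext fun m => ?_)
  obtain ⟨s, g, rfl, hg⟩ := exists_sum_weight hM m
  rw [map_sum, Finset.sum_eq_zero, ZeroMemClass.coe_zero, map_zero, LinearMap.zero_apply]
  intro γ' _
  by_cases hγ : γ = γ'
  · subst hγ; exact h _ (hg γ)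
  · exact toDual_eq_zero hγ (map_mem_weightSpace (Submodule.subtype _) hf) (hg γ')

/-- Restriction embeds the weight space of the dual into the dual of the weight space of the same
weight. -/
theorem fg_weightSpace_cartanFinite (hM : ⨆ γ, weightSpace 𝔥 F M γ = ⊤) {γ : Weight 𝔥}
    (hfg : (weightSpace 𝔥 F M γ).FG) :
    (weightSpace 𝔥 F (cartanFinite 𝔥 F (TwistedDual F M 𝔥)) γ).FG := by
  have : Module.Finite F (weightSpace 𝔥 F M γ) := Module.Finite.iff_fg.mpr hfg
  let r : weightSpace 𝔥 F (cartanFinite 𝔥 F (TwistedDual F M 𝔥)) γ →ₗ[F]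
      Module.Dual F (weightSpace 𝔥 F M γ) :=
    { toFun := fun f => TwistedDual.toDual 𝔥 F M f ∘ₗ (weightSpace 𝔥 F M γ).subtype
      map_add' := fun f g => rfl
      map_smul' := fun c f => rfl }
  have hr : Function.Injective r := by
    intro f f' hff
    refine Subtype.ext (sub_eq_zero.mp (weightSpace_cartanFinite_ext hM (sub_mem f.2 f'.2)
      fun m hm => ?_))
    have h1 : TwistedDual.toDual 𝔥 F M f m = TwistedDual.toDual 𝔥 F M f' m :=
      LinearMap.congr_fun hff ⟨m, hm⟩
    change TwistedDual.toDual 𝔥 F M (f.1.1 - f'.1.1) m = 0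
    rw [map_sub, LinearMap.sub_apply, sub_eq_zero]
    exact h1
  exact Module.Finite.iff_fg.mp (Module.Finite.of_injective r hr)

end Dual

/-! ### Modules over the residue field regarded over A -/

section Inflation

attribute [local instance 100] LieRing.ofAssociativeRing

open IsLocalRing

variable {𝔤 : Type u} [LieRing 𝔤] [LieAlgebra ℂ 𝔤] [FiniteDimensional ℂ 𝔤] [LieAlgebra.IsSimple ℂ 𝔤]
  {𝔥 : LieSubalgebra ℂ 𝔤} [𝔥.IsCartanSubalgebra]
variable (A : Type v) [CommRing A] [IsLocalRing A] [Algebra ℂ A]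

/-- A module over the residue field of `A`, as a module over `A`. -/
def Inflate (_ : Type v) (Y : Type w) : Type w := Y

variable {Y : Type w} [AddCommGroup Y] [Module (ResidueField A) Y]
  [Module (Env 𝔤 (ResidueField A)) Y] [IsScalarTower (ResidueField A) (Env 𝔤 (ResidueField A)) Y]

instance : AddCommGroup (Inflate A Y) := inferInstanceAs (AddCommGroup Y)

instance : Module (ResidueField A) (Inflate A Y) := inferInstanceAs (Module (ResidueField A) Y)

instance : Module A (Inflate A Y) :=
  Module.compHom _ (algebraMap A (ResidueField A))

instance : IsScalarTower A (ResidueField A) (Inflate A Y) where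
  smul_assoc c d y := by
    rw [Algebra.smul_def, mul_smul]; rfl

instance : Module (Env 𝔤 A) (Inflate A Y) :=
  letI : Module (Env 𝔤 (ResidueField A)) (Inflate A Y) :=
    inferInstanceAs (Module (Env 𝔤 (ResidueField A)) Y)
  Module.compHom _ (envResidue A).toRingHom

variable (Y) in
/-- The identity map from the inflated module. -/
def Inflate.out : Inflate A Y ≃ₗ[ResidueField A] Y := LinearEquiv.refl _ _

variable {A}

theorem out_smul (u : Env 𝔤 A) (y : Inflate A Y) :
    Inflate.out A Y (u • y) = envResidue A u • Inflate.out A Y y := rfl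

theorem out_smul' (c : A) (y : Inflate A Y) :
    Inflate.out A Y (c • y) = algebraMap A (ResidueField A) c • Inflate.out A Y y := rfl

theorem out_act (X : Affine 𝔤) (y : Inflate A Y) :
    Inflate.out A Y (act A X • y) = act (ResidueField A) X • Inflate.out A Y y := by
  rw [out_smul, envResidue_act]

instance : IsScalarTower A (Env 𝔤 A) (Inflate A Y) where
  smul_assoc c u y := by
    apply (Inflate.out A Y).injective
    rw [out_smul, out_smul', out_smul, envResidue_smul, smul_assoc]

instance : SMulCommClass (Env 𝔤 A) (ResidueField A) (Inflate A Y) where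
  smul_comm u c y := by
    apply (Inflate.out A Y).injective
    rw [out_smul, map_smul, map_smul, out_smul]
    exact smul_comm _ _ _

/-- Additive maps that commute with scalars and with the affine Kac–Moody algebra are linear. -/
theorem map_env_smul_of_act {P Z : Type*} [AddCommGroup P] [Module A P] [Module (Env 𝔤 A) P]
    [IsScalarTower A (Env 𝔤 A) P] [AddCommGroup Z] [Module A Z] [Module (Env 𝔤 A) Z]
    [IsScalarTower A (Env 𝔤 A) Z] (g : P →+ Z) (hA : ∀ (c : A) x, g (c • x) = c • g x)
    (hX : ∀ (X : Affine 𝔤) x, g (act A X • x) = act A X • g x) (u : Env 𝔤 A) (x : P) : g (u • x) = u • g x := by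
  induction u using env_induction generalizing x with
  | hA c => rw [algebraMap_smul, algebraMap_smul, hA]
  | hX X => exact hX X x
  | hadd u v hu hv => rw [add_smul, map_add, hu, hv, add_smul]
  | hmul u v hu hv => rw [mul_smul, hu, hv, mul_smul]

variable [Algebra (SymmetricAlgebra ℂ 𝔥) A] [IsScalarTower ℂ (SymmetricAlgebra ℂ 𝔥) A]

theorem mem_weightSpace_inflate {γ : Weight 𝔥} {y : Inflate A Y} :
    y ∈ weightSpace 𝔥 A (Inflate A Y) γ ↔
      Inflate.out A Y y ∈ weightSpace 𝔥 (ResidueField A) Y γ := by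
  refine forall_congr' fun H => ?_
  rw [← (Inflate.out A Y).injective.eq_iff, out_act, out_smul', deformedWeight_residueField]

theorem iSup_weightSpace_inflate (h : ⨆ γ, weightSpace 𝔥 (ResidueField A) Y γ = ⊤) :
    ⨆ γ, weightSpace 𝔥 A (Inflate A Y) γ = ⊤ := by
  rw [eq_top_iff]
  rintro y -
  obtain ⟨s, f, hs, hf⟩ := exists_sum_weight h (Inflate.out A Y y)
  have h1 : y = ∑ γ ∈ s, (Inflate.out A Y).symm (f γ) := by
    rw [← map_sum, ← hs, LinearEquiv.symm_apply_apply]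
  rw [h1]
  exact sum_mem fun γ _ => Submodule.mem_iSup_of_mem γ (mem_weightSpace_inflate.mpr (by
    rw [LinearEquiv.apply_symm_apply]; exact hf γ))

theorem fg_weightSpace_inflate {γ : Weight 𝔥} (h : (weightSpace 𝔥 (ResidueField A) Y γ).FG) :
    (weightSpace 𝔥 A (Inflate A Y) γ).FG := by
  have h1 : weightSpace 𝔥 A (Inflate A Y) γ = ((weightSpace 𝔥 (ResidueField A) Y γ).comap
      (Inflate.out A Y).toLinearMap).restrictScalars A := by
    ext y
    exact mem_weightSpace_inflate
  rw [h1]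
  refine Submodule.FG.restrictScalars_of_surjective ?_ IsLocalRing.residue_surjective
  exact h

end Inflation

/-! ### Homomorphisms into dual Verma modules -/

section DualVerma

attribute [local instance 100] LieRing.ofAssociativeRing

open IsLocalRing

variable {𝔤 : Type u} [LieRing 𝔤] [LieAlgebra ℂ 𝔤] [FiniteDimensional ℂ 𝔤] [LieAlgebra.IsSimple ℂ 𝔤]
variable {𝔥 𝔟 : LieSubalgebra ℂ 𝔤} [𝔥.IsCartanSubalgebra]
variable {a : CartanHat 𝔥} (ha : IsBorelGrading 𝔥 𝔟 a)
variable {A : Type v} [CommRing A] [IsLocalRing A] [Algebra ℂ A]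
  [Algebra (SymmetricAlgebra ℂ 𝔥) A] [IsScalarTower ℂ (SymmetricAlgebra ℂ 𝔥) A]

include ha in
theorem isInTruncatedO_dualVerma {J : Set (Weight 𝔥)} (hJo : IsOpenSet 𝔥 𝔟 J)
    (hJ : IsLocallyBounded 𝔥 𝔟 J) {lam : Weight 𝔥} (hlam : lam ∈ J) :
    IsInTruncatedO 𝔥 𝔟 A (Inflate A (DualVerma 𝔥 𝔟 (ResidueField A) lam)) J := by
  have hV := iSup_weightSpace_verma (A := ResidueField A) ha lam
  have hstd := isStdBasis_vermaGen (A := ResidueField A) (lam := lam) ha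
  refine isInTruncatedO_of_fg ha hJ (iSup_weightSpace_inflate (iSup_weightSpace_cartanFinite hV))
    (fun γ => fg_weightSpace_inflate (fg_weightSpace_cartanFinite hV
      (fg_weightSpace_of_range_stdSum hstd.mem hstd.range_eq_top ha.toIsGrading γ)))
    fun γ hγ => ?_
  obtain ⟨y, hy, hy0⟩ := (Submodule.ne_bot_iff _).mp hγ
  have h1 : weightSpace 𝔥 (ResidueField A) (Verma 𝔥 𝔟 (ResidueField A) lam) γ ≠ ⊥ := fun h =>
    hy0 (weightSpace_cartanFinite_ext hV (mem_weightSpace_inflate.mp hy) fun m hm => by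
      rw [h, Submodule.mem_bot] at hm
      rw [hm, map_zero])
  obtain ⟨-, h2⟩ := hstd.weightLE ha h1
  exact hJo _ hlam _ h2

variable {P : Type w} [AddCommGroup P] [Module A P] [Module (Env 𝔤 A) P]
  [IsScalarTower A (Env 𝔤 A) P] {ι : Type} [Fintype ι]

/-- The pairing of the value of a homomorphism to a dual Verma module with the highest weight
vector. -/
def homPairing (lam : Weight 𝔥)
    (g : P →ₗ[Env 𝔤 A] Inflate A (DualVerma 𝔥 𝔟 (ResidueField A) lam)) (x : P)
    (y : Verma 𝔥 𝔟 (ResidueField A) lam) : ResidueField A :=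
  TwistedDual.toDual 𝔥 (ResidueField A) _ (Inflate.out A _ (g x)).1 y

variable {lam : Weight 𝔥}

theorem homPairing_act (g : P →ₗ[Env 𝔤 A] Inflate A (DualVerma 𝔥 𝔟 (ResidueField A) lam)) (x : P)
    (y : Verma 𝔥 𝔟 (ResidueField A) lam) (X : Affine 𝔤) :
    homPairing lam g (act A X • x) y =
      -homPairing lam g x (act (ResidueField A) (chevalleyHat 𝔥 X) • y) := by
  rw [homPairing, map_smul g, out_act, Submodule.coe_smul, toDual_act]; rfl

/-- The highest weight vector generates the Verma module, and pairing g x with X·y amounts, up to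
sign, to pairing g(ω⁻¹(X)·x) with y. So the form x ↦ ⟨g x, highest weight vector⟩ determines g. -/
theorem hom_ext_of_pairing {g : P →ₗ[Env 𝔤 A] Inflate A (DualVerma 𝔥 𝔟 (ResidueField A) lam)}
    (h : ∀ x, homPairing lam g x (vermaGen 𝔟 (ResidueField A) lam) = 0) : g = 0 := by
  obtain ⟨θ, hθ1, hθ2, hθ⟩ := exists_chevalleyHat_inv 𝔥
  have key (u : Env 𝔤 (ResidueField A)) (y) (hy : ∀ x, homPairing lam g x y = 0) (x) :
      homPairing lam g x (u • y) = 0 := by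
    induction u using env_induction generalizing y x with
    | hA c =>
      rw [algebraMap_smul, homPairing, map_smul]
      exact (congrArg (c • ·) (hy x)).trans (smul_zero c)
    | hX X =>
      rw [← hθ2 X, ← neg_eq_zero, ← homPairing_act]
      exact hy _
    | hadd u v hu hv =>
      rw [add_smul, homPairing, map_add]
      exact (congrArg₂ (· + ·) (hu y hy x) (hv y hy x)).trans (add_zero 0)
    | hmul u v hu hv =>
      rw [mul_smul]
      exact hu _ (hv y hy) x
  refine LinearMap.ext fun x => (Inflate.out A _).injective (Subtype.ext (twistedDual_ext fun y => ?_))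
  obtain ⟨u, rfl⟩ := Submodule.Quotient.mk_surjective _ y
  rw [← smul_vermaGen]
  exact key u _ h x

include ha in
-- The form attached to g vanishes on n̂₋P, because ω exchanges n̂₋ and n̂₊ and n̂₊ kills the
-- highest weight vector. Modulo n̂₋P only the basis vectors remain, and those of weight other than
-- lam pair to zero.
theorem hom_ext_of_isStdBasis {wt : ι → Weight 𝔥} {m : ι → P} (h : IsStdBasis a A wt m)
    {g : P →ₗ[Env 𝔤 A] Inflate A (DualVerma 𝔥 𝔟 (ResidueField A) lam)}
    (hg : ∀ i, wt i = lam → homPairing lam g (m i) (vermaGen 𝔟 (ResidueField A) lam) = 0) :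
    g = 0 := by
  refine hom_ext_of_pairing fun x => ?_
  have h1 (i) : homPairing lam g (m i) (vermaGen 𝔟 (ResidueField A) lam) = 0 := by
    by_cases hi : wt i = lam
    · exact hg i hi
    · exact toDual_eq_zero hi (map_mem_weightSpace
        (cartanFinite 𝔥 (ResidueField A) (TwistedDual (ResidueField A)
          (Verma 𝔥 𝔟 (ResidueField A) lam) 𝔥)).subtype
        (mem_weightSpace_inflate.mp (map_mem_weightSpace g (h.mem i)))) vermaGen_mem
  let pr : P →ₗ[A] ResidueField A :=
    { toFun := fun x => homPairing lam g x (vermaGen 𝔟 (ResidueField A) lam)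
      map_add' := fun x y => by simp only [homPairing, map_add]; rfl
      map_smul' := fun c x => by
        rw [homPairing, env_map_smul, out_smul', Algebra.smul_def]; rfl }
  have h2 (i) (s : EnvAlg A (nPart (-a))) : pr (inclAlg (nPart (-a)) s • m i) = 0 := by
    let T : Submodule A (EnvAlg A (nPart (-a))) := LinearMap.ker (pr ∘ₗ
      (LinearMap.toSpanSingleton (Env 𝔤 A) P (m i)).restrictScalars A ∘ₗ
        (inclAlg (nPart (-a))).toLinearMap)
    have hT : T = ⊤ := by
      refine envAlg_eq_top ?_ fun X s hs => ?_
      · change pr (inclAlg (nPart (-a)) (1 : EnvAlg A (nPart (-a))) • m i) = 0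
        rw [map_one, one_smul]; exact h1 i
      · change pr (inclAlg (nPart (-a)) (gen A X * s) • m i) = 0
        rw [map_mul, inclAlg_gen, mul_smul]
        change homPairing lam g (act A (X : Affine 𝔤) • _) _ = 0
        have hX := map_mem_nPart_neg (chevalleyHat_cartanIncl 𝔥) X.2
        rw [neg_neg] at hX
        rw [homPairing_act, act_smul_vermaGen ha hX, homPairing, map_zero, neg_zero]
    have : s ∈ T := by rw [hT]; trivial
    exact this
  obtain ⟨s, rfl⟩ := h.bij.2 x
  change pr _ = 0
  rw [stdSum_apply, map_sum]
  exact Finset.sum_eq_zero fun i _ => h2 i (s i)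

/-- The representation on the linear forms on `P` with values in the residue field, twisted by an
endomorphism of the affine Kac–Moody algebra. -/
def contragredient (θ : Affine 𝔤 →ₗ⁅ℂ⁆ Affine 𝔤) (P : Type w) [AddCommGroup P] [Module A P]
    [Module (Env 𝔤 A) P] [IsScalarTower A (Env 𝔤 A) P] :
    Affine 𝔤 →ₗ⁅ℂ⁆ Module.End (ResidueField A) (P →ₗ[A] ResidueField A) where
  toFun X :=
    { toFun := fun χ => -(χ ∘ₗ actLin P (act A (θ X)))
      map_add' := fun χ χ' => by rw [LinearMap.add_comp, neg_add]
      map_smul' := fun c χ => by rw [LinearMap.smul_comp, RingHom.id_apply, smul_neg] }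
  map_add' X Y := by
    refine LinearMap.ext fun χ => LinearMap.ext fun x => ?_
    change -χ (act A (θ (X + Y)) • x) = -χ (act A (θ X) • x) + -χ (act A (θ Y) • x)
    rw [map_add, act_add, add_smul, map_add, neg_add]
  map_smul' c X := by
    refine LinearMap.ext fun χ => LinearMap.ext fun x => ?_
    change -χ (act A (θ (c • X)) • x) = c • -χ (act A (θ X) • x)
    rw [map_smul θ, act_smul, smul_assoc, map_smul, algebraMap_smul, smul_neg]
  map_lie' {X Y} := by
    refine LinearMap.ext fun χ => LinearMap.ext fun x => ?_
    change -χ (act A (θ ⁅X, Y⁆) • x) =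
      -(-χ (act A (θ Y) • act A (θ X) • x)) - -(-χ (act A (θ X) • act A (θ Y) • x))
    rw [LieHom.map_lie, act_lie, sub_smul, mul_smul, mul_smul, map_sub]
    abel

include ha in
-- The conditions on χ say that it is a vector of weight lam killed by n̂₊ in the space of linear
-- forms on P, with the action twisted by ω⁻¹. So it receives a map from the Verma module, and g is
-- the transpose of that map.
theorem exists_hom_of_functional (hP : ⨆ γ, weightSpace 𝔥 A P γ = ⊤) (χ : P →ₗ[A] ResidueField A)
    (hχw : ∀ γ, γ ≠ lam → ∀ x ∈ weightSpace 𝔥 A P γ, χ x = 0)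
    (hχn : ∀ X ∈ nPart (-a), ∀ x, χ (act A X • x) = 0) :
    ∃ g : P →ₗ[Env 𝔤 A] Inflate A (DualVerma 𝔥 𝔟 (ResidueField A) lam),
      ∀ x, homPairing lam g x (vermaGen 𝔟 (ResidueField A) lam) = χ x := by
  classical
  obtain ⟨θ, hθ1, hθ2, hθ⟩ := exists_chevalleyHat_inv 𝔥
  let ρ := contragredient (A := A) θ P
  let _ : Module (Env 𝔤 (ResidueField A)) (P →ₗ[A] ResidueField A) :=
    Module.compHom _ (repAlgHom (A := ResidueField A) ρ).toRingHom
  have hsm (u : Env 𝔤 (ResidueField A)) (ψ : P →ₗ[A] ResidueField A) :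
      u • ψ = repAlgHom (A := ResidueField A) ρ u ψ := rfl
  have : IsScalarTower (ResidueField A) (Env 𝔤 (ResidueField A)) (P →ₗ[A] ResidueField A) :=
    ⟨fun c u ψ => by rw [hsm, hsm, map_smul]; rfl⟩
  have hact (X : Affine 𝔤) (ψ : P →ₗ[A] ResidueField A) (x : P) :
      (act (ResidueField A) X • ψ) x = -ψ (act A (θ X) • x) := by
    have h1 : repAlgHom (A := ResidueField A) ρ (act (ResidueField A) X) = ρ X :=
      repAlgHom_gen ρ X
    rw [hsm, h1]; rfl
  obtain ⟨Φ, hΦ⟩ := exists_verma_hom (𝔟 := 𝔟) (lam := lam) (v := χ) ha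
    (fun H => LinearMap.ext fun x => by
      rw [hact, hθ, act_neg, neg_smul, map_neg, neg_neg, LinearMap.smul_apply,
        deformedWeight_residueField, algebraMap_smul]
      obtain ⟨s, f, rfl, hf⟩ := exists_sum_weight hP x
      rw [Finset.smul_sum, map_sum, map_sum, Finset.smul_sum]
      refine Finset.sum_congr rfl fun γ _ => ?_
      rw [hf γ H, map_smul]
      by_cases hγ : γ = lam
      · rw [hγ]
      · rw [hχw γ hγ _ (hf γ), smul_zero, smul_zero])
    (fun X hX => LinearMap.ext fun x => by
      rw [hact, hχn _ (map_mem_nPart_neg hθ hX), neg_zero, LinearMap.zero_apply])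
  let V := Verma 𝔥 𝔟 (ResidueField A) lam
  let T := TwistedDual (ResidueField A) V 𝔥
  let g₀ : P →+ Inflate A T :=
    { toFun := fun x => (Inflate.out A T).symm ((TwistedDual.toDual 𝔥 (ResidueField A) V).symm
        { toFun := fun y => Φ y x
          map_add' := fun y y' => by rw [map_add, LinearMap.add_apply]
          map_smul' := fun c y => by
            rw [env_map_smul, LinearMap.smul_apply, RingHom.id_apply] })
      map_zero' := by
        apply (Inflate.out A T).injective
        exact twistedDual_ext fun y => map_zero (Φ y)
      map_add' := fun x x' => by
        apply (Inflate.out A T).injective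
        exact twistedDual_ext fun y => map_add (Φ y) x x' }
  have hg₀ (x y) : TwistedDual.toDual 𝔥 (ResidueField A) V (Inflate.out A T (g₀ x)) y = Φ y x := rfl
  let g₁ : P →ₗ[Env 𝔤 A] Inflate A T :=
    { __ := g₀
      map_smul' := fun u x => map_env_smul_of_act g₀ (fun c x => by
        apply (Inflate.out A T).injective
        refine twistedDual_ext fun y => ?_
        rw [hg₀, out_smul', map_smul (TwistedDual.toDual 𝔥 (ResidueField A) V), LinearMap.smul_apply,
          hg₀, map_smul (Φ y), algebraMap_smul])
        (fun X x => by
        apply (Inflate.out A T).injective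
        refine twistedDual_ext fun y => ?_
        rw [out_act, toDual_act, hg₀, hg₀, map_smul Φ, hact, hθ1, neg_neg]) u x }
  -- The transpose a priori takes values in the full dual; since P is a weight module, they are sums
  -- of weight vectors and hence ĥ-finite.
  have hfin (x : P) : Inflate.out A T (g₁ x) ∈ cartanFinite 𝔥 (ResidueField A) T := by
    obtain ⟨s, f, rfl, hf⟩ := exists_sum_weight hP x
    rw [map_sum, map_sum]
    exact sum_mem fun γ _ => weightSpace_twistedDual_le_cartanFinite
      (mem_weightSpace_inflate.mp (map_mem_weightSpace g₁ (hf γ)))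
  refine ⟨{ toFun := fun x => (Inflate.out A (DualVerma 𝔥 𝔟 (ResidueField A) lam)).symm
              ⟨Inflate.out A T (g₁ x), hfin x⟩
            map_add' := fun x x' => ?_
            map_smul' := fun u x => ?_ }, fun x => ?_⟩
  · apply (Inflate.out A _).injective
    apply Subtype.ext
    change Inflate.out A T (g₁ (x + x')) = _
    rw [map_add, map_add]; rfl
  · apply (Inflate.out A _).injective
    apply Subtype.ext
    change Inflate.out A T (g₁ (u • x)) = _
    rw [map_smul, out_smul]; rfl
  · change Φ (vermaGen 𝔟 (ResidueField A) lam) x = χ x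
    rw [hΦ]

include ha in
-- In coordinates the form is ∑ ε(sᵢ) bᵢ with ε the augmentation. It kills n̂₋P because ε does, and
-- the weights other than lam because ε vanishes on nonzero weights and b on basis vectors of other
-- weights.
theorem exists_hom_pairing_eq {wt : ι → Weight 𝔥} {m : ι → P} (h : IsStdBasis a A wt m)
    (b : ι → ResidueField A) (hb : ∀ i, wt i ≠ lam → b i = 0) :
    ∃ g : P →ₗ[Env 𝔤 A] Inflate A (DualVerma 𝔥 𝔟 (ResidueField A) lam),
      ∀ i, homPairing lam g (m i) (vermaGen 𝔟 (ResidueField A) lam) = b i := by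
  classical
  let e := LinearEquiv.ofBijective (stdSum a A m) h.bij
  let χ₀ : (ι → EnvAlg A (nPart (-a))) →ₗ[A] ResidueField A :=
    ∑ i, (LinearMap.toSpanSingleton A (ResidueField A) (b i)) ∘ₗ
      (augmentation (A := A) (L := nPart (-a))).toLinearMap ∘ₗ LinearMap.proj i
  have hχ₀ (s) : χ₀ s = ∑ i, augmentation (s i) • b i := by simp [χ₀]
  let χ := χ₀ ∘ₗ e.symm.toLinearMap
  have hχ (s) : χ (stdSum a A m s) = ∑ i, augmentation (s i) • b i := by
    rw [← hχ₀]
    exact congrArg χ₀ (e.symm_apply_apply s)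
  obtain ⟨g, hg⟩ := exists_hom_of_functional (𝔟 := 𝔟) (lam := lam) ha
    (iSup_weightSpace_of_range_stdSum h.mem h.range_eq_top) χ
    (fun γ hγ x hx => by
      obtain ⟨s, rfl⟩ := h.bij.2 x
      rw [hχ]
      refine Finset.sum_eq_zero fun i _ => ?_
      by_cases hi : wt i = lam
      · rw [augmentation_eq_zero_of_mem_wordSpan (h.coord_mem hx i)
          (by rw [hi]; exact sub_ne_zero.mpr hγ), zero_smul]
      · rw [hb i hi, smul_zero])
    (fun X hX x => by
      obtain ⟨s, rfl⟩ := h.bij.2 x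
      have h1 : act A X • stdSum a A m s =
          stdSum a A m (gen A (⟨X, hX⟩ : nPart (-a)) • s) := by
        rw [stdSum_smul, inclAlg_gen]; rfl
      rw [h1, hχ]
      refine Finset.sum_eq_zero fun i _ => ?_
      rw [Pi.smul_apply, smul_eq_mul, map_mul, augmentation_gen, zero_mul, zero_smul])
  refine ⟨g, fun i => ?_⟩
  have h1 : m i = stdSum a A m (Pi.single i 1) := by rw [stdSum_single, map_one, one_smul]
  rw [hg, h1, hχ, Finset.sum_eq_single i]
  · rw [Pi.single_eq_same, map_one, one_smul]
  · intro j _ hj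
    rw [Pi.single_eq_of_ne hj, map_zero, zero_smul]
  · simp

include ha in
/-- Homomorphisms from a module with a basis over the negative part to a dual Verma module. -/
theorem nonempty_hom_equiv {wt : ι → Weight 𝔥} {m : ι → P} (h : IsStdBasis a A wt m)
    (lam : Weight 𝔥) :
    Nonempty ((P →ₗ[Env 𝔤 A] Inflate A (DualVerma 𝔥 𝔟 (ResidueField A) lam)) ≃ₗ[ResidueField A]
      ({i // wt i = lam} → ResidueField A)) := by
  classical
  let ev : (P →ₗ[Env 𝔤 A] Inflate A (DualVerma 𝔥 𝔟 (ResidueField A) lam)) →ₗ[ResidueField A]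
      ({i // wt i = lam} → ResidueField A) :=
    { toFun := fun g i => homPairing lam g (m i) (vermaGen 𝔟 (ResidueField A) lam)
      map_add' := fun g g' => rfl
      map_smul' := fun c g => rfl }
  refine ⟨LinearEquiv.ofBijective ev ⟨fun g g' hgg => ?_, fun b => ?_⟩⟩
  · rw [← sub_eq_zero]
    refine hom_ext_of_isStdBasis ha h fun i hi => ?_
    have h1 : ev (g - g') = 0 := by rw [map_sub, hgg, sub_self]
    exact congrFun h1 ⟨i, hi⟩
  · obtain ⟨g, hg⟩ := exists_hom_pairing_eq (𝔟 := 𝔟) (lam := lam) ha h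
      (fun i => if hi : wt i = lam then b ⟨i, hi⟩ else 0) fun i hi => dif_neg hi
    exact ⟨g, funext fun i => (hg i).trans (dif_pos i.2)⟩

end DualVerma

/-! ### Counting subquotients in chains -/

section Chains

variable {R : Type*} [Ring R] {Y : Type*} [AddCommGroup Y] [Module R Y] (L : Type*)
  [AddCommGroup L] [Module R L]

/-- The quotient `N' / N` is isomorphic to `L`. -/
def IsSubquotient (N N' : Submodule R Y) : Prop :=
  Nonempty ((N' ⧸ N.submoduleOf N') ≃ₗ[R] L)

theorem encard_le_subquotientMultiplicity {n : ℕ} (c : Fin (n + 1) →o Submodule R Y) :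
    Set.encard {i : Fin n | IsSubquotient L (c i.castSucc) (c i.succ)} ≤
      subquotientMultiplicity R Y L :=
  le_iSup₂ (f := fun (n : ℕ) (c : Fin (n + 1) →o Submodule R Y) =>
    Set.encard {i : Fin n | IsSubquotient L (c i.castSucc) (c i.succ)}) n c

/-- There is a chain of submodules ending with `N` that has at least `k` subquotients isomorphic
to `L`. -/
def HasChain (k : ℕ) (N : Submodule R Y) : Prop :=
  ∃ (n : ℕ) (c : Fin (n + 1) →o Submodule R Y), c (Fin.last n) = N ∧
    (k : ℕ∞) ≤ Set.encard {i : Fin n | IsSubquotient L (c i.castSucc) (c i.succ)}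

variable {L}

theorem hasChain_zero (N : Submodule R Y) : HasChain L 0 N :=
  ⟨0, ⟨fun _ => N, fun _ _ _ => le_rfl⟩, rfl, by simp⟩

theorem HasChain.le_multiplicity {k : ℕ} {N : Submodule R Y} (h : HasChain L k N) :
    (k : ℕ∞) ≤ subquotientMultiplicity R Y L := by
  obtain ⟨n, c, -, h⟩ := h
  exact h.trans (encard_le_subquotientMultiplicity L c)

/-- Appending N' keeps all earlier subquotients, and the new step adds one if it is isomorphic to L.
Steps of other kinds are allowed, so gaps in a chain do no harm. -/
theorem HasChain.extend {k : ℕ} {N N' : Submodule R Y} (h : HasChain L k N) (hle : N ≤ N') :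
    HasChain L k N' ∧ (IsSubquotient L N N' → HasChain L (k + 1) N') := by
  obtain ⟨n, c, rfl, hk⟩ := h
  let d : Fin (n + 2) → Submodule R Y := Fin.snoc (α := fun _ => Submodule R Y) c N'
  have hd1 (i : Fin (n + 1)) : d i.castSucc = c i := Fin.snoc_castSucc (α := fun _ => Submodule R Y) ..
  have hd2 : d (Fin.last (n + 1)) = N' := Fin.snoc_last (α := fun _ => Submodule R Y) ..
  have hmono : Monotone d := by
    refine Fin.monotone_iff_le_succ.mpr fun i => ?_
    induction i using Fin.lastCases with
    | last => rw [Fin.succ_last, hd2, hd1]; exact hle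
    | cast i =>
      rw [Fin.succ_castSucc, hd1, hd1]
      exact c.monotone i.castSucc_lt_succ.le
  let d' : Fin (n + 2) →o Submodule R Y := ⟨d, hmono⟩
  set S := {i : Fin n | IsSubquotient L (c i.castSucc) (c i.succ)} with hS
  have h1 : Fin.castSucc '' S ⊆ {i | IsSubquotient L (d' i.castSucc) (d' i.succ)} := by
    rintro - ⟨i, hi, rfl⟩
    change IsSubquotient L (d _) (d _)
    rw [Fin.succ_castSucc, hd1, hd1]
    exact hi
  have h2 : (Fin.castSucc '' S).encard = S.encard :=
    (Fin.castSucc_injective n).encard_image S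
  refine ⟨⟨n + 1, d', hd2, hk.trans (h2 ▸ Set.encard_le_encard h1)⟩, fun hsub =>
    ⟨n + 1, d', hd2, ?_⟩⟩
  have h3 : Fin.last n ∉ Fin.castSucc '' S := by
    rintro ⟨i, -, hi⟩
    exact (Fin.castSucc_lt_last i).ne hi
  have h4 : insert (Fin.last n) (Fin.castSucc '' S) ⊆
      {i | IsSubquotient L (d' i.castSucc) (d' i.succ)} := by
    refine Set.insert_subset ?_ h1
    change IsSubquotient L (d _) (d _)
    rw [Fin.succ_last, hd1, hd2]
    exact hsub
  refine le_trans ?_ (Set.encard_le_encard h4)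
  rw [Set.encard_insert_of_notMem h3, h2, Nat.cast_add, Nat.cast_one]
  gcongr

/-- The values of f just before its jumps are distinct and smaller than the last value. -/
theorem encard_jumps_le {n : ℕ} {f : Fin (n + 1) → ℕ} (hf : Monotone f) :
    Set.encard {i : Fin n | f i.castSucc < f i.succ} ≤ f (Fin.last n) := by
  have h1 : Set.encard {i : Fin n | f i.castSucc < f i.succ} ≤
      Set.encard (↑(Finset.range (f (Fin.last n))) : Set ℕ) := by
    refine Set.encard_le_encard_of_injOn (f := fun i => f i.castSucc) (fun i hi => ?_) ?_
    · rw [Finset.mem_coe, Finset.mem_range]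
      exact lt_of_lt_of_le hi (hf (Fin.le_last _))
    · refine StrictMonoOn.injOn fun i hi j hj hij => ?_
      exact lt_of_lt_of_le hi (hf (Fin.castSucc_lt_iff_succ_le.mp (Fin.castSucc_lt_castSucc_iff.mpr hij)))
  rwa [Set.encard_coe_eq_coe_finsetCard, Finset.card_range] at h1

end Chains

/-! ### Hom from a projective cover counts the simple subquotients -/

section Multiplicity

attribute [local instance 100] LieRing.ofAssociativeRing

open IsLocalRing

variable {𝔤 : Type u} [LieRing 𝔤] [LieAlgebra ℂ 𝔤] [FiniteDimensional ℂ 𝔤] [LieAlgebra.IsSimple ℂ 𝔤]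
variable {𝔥 𝔟 : LieSubalgebra ℂ 𝔤} [𝔥.IsCartanSubalgebra]
variable {a : CartanHat 𝔥} (ha : IsBorelGrading 𝔥 𝔟 a)
variable {A : Type v} [CommRing A] [IsLocalRing A] [Algebra ℂ A]

section HomInto

variable {P : Type*} [AddCommGroup P] [Module A P] [Module (Env 𝔤 A) P]
  [IsScalarTower A (Env 𝔤 A) P]
variable {Y : Type w} [AddCommGroup Y] [Module (ResidueField A) Y]
  [Module (Env 𝔤 (ResidueField A)) Y] [IsScalarTower (ResidueField A) (Env 𝔤 (ResidueField A)) Y]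

variable (A P) in
/-- The homomorphisms with values in a submodule. -/
def homInto (N : Submodule (Env 𝔤 (ResidueField A)) Y) :
    Submodule (ResidueField A) (P →ₗ[Env 𝔤 A] Inflate A Y) where
  carrier := {g | ∀ x, Inflate.out A Y (g x) ∈ N}
  add_mem' := fun h h' x => by
    rw [LinearMap.add_apply, map_add]; exact add_mem (h x) (h' x)
  zero_mem' := fun x => by rw [LinearMap.zero_apply, map_zero]; exact zero_mem N
  smul_mem' := fun c g h x => by
    rw [LinearMap.smul_apply, map_smul]
    exact (N.restrictScalars (ResidueField A)).smul_mem c (h x)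

theorem homInto_mono {N N' : Submodule (Env 𝔤 (ResidueField A)) Y} (h : N ≤ N') :
    homInto A P N ≤ homInto A P N' := fun _ hg x => h (hg x)

/-- The image of a submodule. -/
def imageSubmodule (g : P →ₗ[Env 𝔤 A] Inflate A Y) (S : Submodule (Env 𝔤 A) P) :
    Submodule (Env 𝔤 (ResidueField A)) Y where
  carrier := {y | ∃ x ∈ S, Inflate.out A Y (g x) = y}
  add_mem' := by
    rintro - - ⟨x, hx, rfl⟩ ⟨x', hx', rfl⟩
    exact ⟨x + x', add_mem hx hx', by rw [map_add, map_add]⟩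
  zero_mem' := ⟨0, zero_mem S, by rw [map_zero, map_zero]⟩
  smul_mem' := by
    rintro u - ⟨x, hx, rfl⟩
    obtain ⟨u, rfl⟩ := envResidue_surjective u
    exact ⟨u • x, S.smul_mem u hx, by rw [map_smul g, out_smul]⟩

/-- The elements that are mapped to a submodule. -/
def preimageSubmodule (g : P →ₗ[Env 𝔤 A] Inflate A Y)
    (N : Submodule (Env 𝔤 (ResidueField A)) Y) : Submodule (Env 𝔤 A) P where
  carrier := {x | Inflate.out A Y (g x) ∈ N}
  add_mem' := fun h h' => by
    rw [Set.mem_ofPred_eq, map_add, map_add]; exact add_mem h h'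
  zero_mem' := by rw [Set.mem_ofPred_eq, map_zero, map_zero]; exact zero_mem N
  smul_mem' := fun u x h => by
    rw [Set.mem_ofPred_eq, map_smul g, out_smul]; exact N.smul_mem _ h

/-- A homomorphism with values in a submodule, modulo a smaller submodule. -/
def homQuotient (N N' : Submodule (Env 𝔤 (ResidueField A)) Y) (g : P →ₗ[Env 𝔤 A] Inflate A Y)
    (hg : g ∈ homInto A P N') : P →ₗ[Env 𝔤 A] Inflate A (N' ⧸ N.submoduleOf N') where
  toFun x := (Inflate.out A (N' ⧸ N.submoduleOf N')).symm
    ((N.submoduleOf N').mkQ ⟨Inflate.out A Y (g x), hg x⟩)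
  map_add' x y := by
    rw [← map_add (Inflate.out A (N' ⧸ N.submoduleOf N')).symm, ← map_add]
    refine congrArg _ (congrArg _ (Subtype.ext ?_))
    change Inflate.out A Y (g (x + y)) = Inflate.out A Y (g x) + Inflate.out A Y (g y)
    rw [map_add, map_add]
  map_smul' u x := by
    apply (Inflate.out A (N' ⧸ N.submoduleOf N')).injective
    rw [LinearEquiv.apply_symm_apply, RingHom.id_apply, out_smul, LinearEquiv.apply_symm_apply,
      ← map_smul]
    refine congrArg _ (Subtype.ext ?_)
    change Inflate.out A Y (g (u • x)) = envResidue A u • Inflate.out A Y (g x)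
    rw [map_smul g, out_smul]

theorem homQuotient_eq_zero {N N' : Submodule (Env 𝔤 (ResidueField A)) Y}
    {g : P →ₗ[Env 𝔤 A] Inflate A Y} {hg : g ∈ homInto A P N'} {x : P} :
    homQuotient N N' g hg x = 0 ↔ Inflate.out A Y (g x) ∈ N :=
  (Submodule.Quotient.mk_eq_zero (N.submoduleOf N'))

end HomInto

variable [Algebra (SymmetricAlgebra ℂ 𝔥) A] [IsScalarTower ℂ (SymmetricAlgebra ℂ 𝔥) A]

/-- A homomorphism to a simple quotient of a Verma module, as a homomorphism to `L_A(μ)`. -/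
def toSimpleObject {Y : Type w} [AddCommGroup Y] [Module (ResidueField A) Y]
    [Module (Env 𝔤 (ResidueField A)) Y]
    [IsScalarTower (ResidueField A) (Env 𝔤 (ResidueField A)) Y] {μ : Weight 𝔥}
    (f : Y →ₗ[Env 𝔤 (ResidueField A)] SimpleQuotient 𝔥 𝔟 (ResidueField A) μ) :
    Inflate A Y →ₗ[Env 𝔤 A] SimpleObject 𝔥 𝔟 A μ where
  toFun y := f (Inflate.out A Y y)
  map_add' y y' := by rw [map_add, map_add]; rfl
  map_smul' u y := by rw [out_smul, map_smul f]; rfl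

variable {P : Type (max u v)} [AddCommGroup P] [Module A P] [Module (Env 𝔤 A) P]
  [IsScalarTower A (Env 𝔤 A) P]
variable {J : Set (Weight 𝔥)} {μ : Weight 𝔥}

include ha in
-- A homomorphism is determined by the image of the generator, which lies in the highest weight line
-- of L_A(μ).
theorem exists_smul_eq_of_hom {p : P} (hp : p ∈ weightSpace 𝔥 A P μ)
    (hs : Submodule.span (Env 𝔤 A) {p} = ⊤) (f g : P →ₗ[Env 𝔤 A] SimpleObject 𝔥 𝔟 A μ)
    (hg : g ≠ 0) : ∃ r : A, ∀ z, f z = r • g z := by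
  obtain ⟨r, hr⟩ := exists_smul_simpleGen ha (map_mem_weightSpace f hp)
  obtain ⟨b, hb⟩ := exists_smul_simpleGen ha (map_mem_weightSpace g hp)
  have hbu : IsUnit b := by
    by_contra hbu
    rw [smul_simpleObject_eq_zero hbu] at hb
    exact hg (linearMap_ext_of_span hs (by rw [hb, LinearMap.zero_apply]))
  obtain ⟨b, rfl⟩ := hbu
  refine ⟨r * ((b⁻¹ : Aˣ) : A), fun z => ?_⟩
  have hz : z ∈ Submodule.span (Env 𝔤 A) {p} := by rw [hs]; trivial
  obtain ⟨u, rfl⟩ := Submodule.mem_span_singleton.mp hz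
  rw [map_smul, map_smul, hr, hb, smul_comm _ u, smul_smul, Units.inv_mul_cancel_right]

variable [IsNoetherianRing A]
variable {Y : Type (max u v)} [AddCommGroup Y] [Module (ResidueField A) Y]
  [Module (Env 𝔤 (ResidueField A)) Y] [IsScalarTower (ResidueField A) (Env 𝔤 (ResidueField A)) Y]

include ha in
-- By projectivity the surjection P → L_A(μ) lifts through N' → N' / N ≅ L_A(μ), and the lift does
-- not take values in N.
theorem homInto_lt_of_isSubquotient (hP : IsProjectiveObject 𝔥 𝔟 A J P)
    {c : P →ₗ[Env 𝔤 A] SimpleObject 𝔥 𝔟 A μ} (hc : Function.Surjective c)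
    (hY : IsInTruncatedO 𝔥 𝔟 A (Inflate A Y) J) {N N' : Submodule (Env 𝔤 (ResidueField A)) Y}
    (hN : N ≤ N') (h : IsSubquotient (SimpleQuotient 𝔥 𝔟 (ResidueField A) μ) N N') :
    homInto A P N < homInto A P N' := by
  obtain ⟨e⟩ := h
  let i : Inflate A N' →ₗ[Env 𝔤 A] Inflate A Y :=
    { toFun := fun y => (Inflate.out A Y).symm (N'.subtype (Inflate.out A N' y))
      map_add' := fun y y' => rfl
      map_smul' := fun u y => rfl }
  have hi : Function.Injective i := fun y y' h => Subtype.ext h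
  let q : Inflate A N' →ₗ[Env 𝔤 A] SimpleObject 𝔥 𝔟 A μ :=
    toSimpleObject (e.toLinearMap ∘ₗ (N.submoduleOf N').mkQ)
  have hq : Function.Surjective q :=
    e.surjective.comp (Submodule.mkQ_surjective (N.submoduleOf N'))
  have hN'O := hY.of_injective i hi
  obtain ⟨k, hk⟩ := hP.exists_lift _ _ hN'O (hN'O.of_surjective q hq) q c hq
  refine lt_of_le_of_ne (homInto_mono hN) fun heq => ?_
  have h1 : i ∘ₗ k ∈ homInto A P N' := fun x => (Inflate.out A N' (k x)).2
  rw [← heq] at h1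
  obtain ⟨x, hx⟩ := hc (simpleGen 𝔟 A μ)
  refine simpleGen_ne_zero ha μ (hx.symm.trans ?_)
  rw [← hk]
  change e ((N.submoduleOf N').mkQ (Inflate.out A N' (k x))) = 0
  have h2 : (N.submoduleOf N').mkQ (Inflate.out A N' (k x)) = 0 :=
    (Submodule.Quotient.mk_eq_zero (N.submoduleOf N')).mpr (h1 x)
  rw [h2, map_zero]

include ha in
-- Along a chain the dimension of the homomorphisms into its members is monotone and jumps at each
-- subquotient L_𝕂(μ), so there are at most as many of these as the final dimension.
theorem subquotientMultiplicity_le (hP : IsProjectiveObject 𝔥 𝔟 A J P)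
    {c : P →ₗ[Env 𝔤 A] SimpleObject 𝔥 𝔟 A μ} (hc : Function.Surjective c)
    (hY : IsInTruncatedO 𝔥 𝔟 A (Inflate A Y) J)
    [Module.Finite (ResidueField A) (P →ₗ[Env 𝔤 A] Inflate A Y)] :
    subquotientMultiplicity (Env 𝔤 (ResidueField A)) Y (SimpleQuotient 𝔥 𝔟 (ResidueField A) μ) ≤
      (Module.finrank (ResidueField A) (P →ₗ[Env 𝔤 A] Inflate A Y) : ℕ) := by
  refine iSup₂_le fun n d => ?_
  let f : Fin (n + 1) → ℕ := fun i => Module.finrank (ResidueField A) (homInto A P (d i))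
  have hf : Monotone f := fun i j hij => Submodule.finrank_mono (homInto_mono (d.monotone hij))
  refine le_trans (Set.encard_le_encard fun i hi => ?_) ((encard_jumps_le hf).trans
    (Nat.cast_le.mpr (Submodule.finrank_le _)))
  exact Submodule.finrank_lt_finrank_of_lt (homInto_lt_of_isSubquotient ha hP hc hY
    (d.monotone i.castSucc_lt_succ.le) hi)

include ha in
-- Among the homomorphisms not taking values in N, choose g with the space of homomorphisms into N +
-- im g as small as possible. Then N₂ = N + im g and N₁ = N + g(ker c) have quotient P / ker c ≅
-- L_A(μ). A homomorphism into N₂ is a multiple of g up to one into N₁, and minimality forces the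
-- latter into N. So passing from N to N₂ adds at most one dimension.
theorem exists_extension {c : P →ₗ[Env 𝔤 A] SimpleObject 𝔥 𝔟 A μ}
    (hP : IsProjectiveCover 𝔥 𝔟 A J μ P c)
    [Module.Finite (ResidueField A) (P →ₗ[Env 𝔤 A] Inflate A Y)]
    {N : Submodule (Env 𝔤 (ResidueField A)) Y} (hN : homInto A P N ≠ ⊤) :
    ∃ N₁ N₂, N ≤ N₁ ∧ N₁ ≤ N₂ ∧ IsSubquotient (SimpleQuotient 𝔥 𝔟 (ResidueField A) μ) N₁ N₂ ∧
      Module.finrank (ResidueField A) (homInto A P N₂) ≤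
        Module.finrank (ResidueField A) (homInto A P N) + 1 := by
  obtain ⟨p, hp, -, hs⟩ := hP.exists_generator ha
  have hsimp := isSimpleModule_simpleObject (A := A) ha μ
  let rk (g : P →ₗ[Env 𝔤 A] Inflate A Y) : ℕ :=
    Module.finrank (ResidueField A) (homInto A P (N ⊔ imageSubmodule g ⊤))
  obtain ⟨g, hg, hmin⟩ : ∃ g, g ∉ homInto A P N ∧ ∀ h, h ∉ homInto A P N → rk g ≤ rk h := by
    have hne : {g | g ∉ homInto A P N}.Nonempty := by
      by_contra! h
      exact hN (eq_top_iff.mpr fun g _ => by_contra fun hg => (h ▸ hg : g ∈ (∅ : Set _)))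
    obtain ⟨g, hg, hmin⟩ := WellFounded.has_min (measure rk).wf _ hne
    exact ⟨g, hg, fun h hh => not_lt.mp (hmin h hh)⟩
  set N₁ := N ⊔ imageSubmodule g (LinearMap.ker c) with hN₁
  set N₂ := N ⊔ imageSubmodule g ⊤ with hN₂
  have h12 : N₁ ≤ N₂ := sup_le_sup_left
    (fun y hy => by obtain ⟨x, -, hx⟩ := hy; exact ⟨x, trivial, hx⟩) N
  have hgN₂ : g ∈ homInto A P N₂ := fun x =>
    (le_sup_right : _ ≤ N₂) ⟨x, trivial, rfl⟩
  -- If g took values in N₁, every x would differ by an element of ker c from some x' with g x' ∈ N.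
  -- So the preimage of N would map onto L_A(μ) and by essentiality be all of P.
  have hgN₁ : g ∉ homInto A P N₁ := by
    intro hgN₁
    let M := preimageSubmodule g N
    have h1 : Function.Surjective (c ∘ₗ M.subtype) := by
      intro y
      obtain ⟨x, rfl⟩ := hP.surjective y
      obtain ⟨n, hn, z, ⟨x', hx', rfl⟩, hsum⟩ := Submodule.mem_sup.mp (hgN₁ x)
      refine ⟨⟨x - x', ?_⟩, ?_⟩
      · change Inflate.out A Y (g (x - x')) ∈ N
        rw [map_sub, map_sub, ← hsum, add_sub_cancel_right]
        exact hn
      · change c (x - x') = c x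
        rw [map_sub, LinearMap.mem_ker.mp hx', sub_zero]
    have h2 := hP.essential M (hP.isProjectiveObject.isInTruncatedO.of_injective _
      (Submodule.injective_subtype M)) M.subtype h1
    refine hg fun x => ?_
    obtain ⟨⟨x, hx⟩, rfl⟩ := h2 x
    exact hx
  let ψ := homQuotient N₁ N₂ g hgN₂
  have hψs : Function.Surjective ψ := by
    intro y
    obtain ⟨⟨y', hy⟩, hyy⟩ := Submodule.mkQ_surjective (N₁.submoduleOf N₂)
      (Inflate.out A (N₂ ⧸ N₁.submoduleOf N₂) y)
    obtain ⟨n, hn, z, ⟨x, -, rfl⟩, hsum⟩ := Submodule.mem_sup.mp hy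
    refine ⟨x, (Inflate.out A (N₂ ⧸ N₁.submoduleOf N₂)).injective ?_⟩
    rw [← hyy]
    refine (Submodule.Quotient.eq (N₁.submoduleOf N₂)).mpr ?_
    change Inflate.out A Y (g x) - y' ∈ N₁
    rw [← hsum, sub_add_cancel_right]
    exact neg_mem ((le_sup_left : N ≤ N₁) hn)
  have hker : LinearMap.ker ψ = LinearMap.ker c := by
    have hco : IsCoatom (LinearMap.ker c) := by
      rw [← isSimpleModule_iff_isCoatom]
      exact IsSimpleModule.congr (c.quotKerEquivOfSurjective hP.surjective)
    refine (hco.le_iff.mp fun x hx => ?_).resolve_left fun h => hgN₁ fun x => ?_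
    · exact homQuotient_eq_zero.mpr ((le_sup_right : _ ≤ N₁) ⟨x, hx, rfl⟩)
    · refine (homQuotient_eq_zero (hg := hgN₂)).mp ?_
      have : x ∈ LinearMap.ker ψ := by rw [h]; trivial
      exact this
  let e : Inflate A (N₂ ⧸ N₁.submoduleOf N₂) ≃ₗ[Env 𝔤 A] SimpleObject 𝔥 𝔟 A μ :=
    (ψ.quotKerEquivOfSurjective hψs).symm.trans ((Submodule.quotEquivOfEq _ _ hker).trans
      (c.quotKerEquivOfSurjective hP.surjective))
  refine ⟨N₁, N₂, le_sup_left, h12, ⟨{ e.toAddEquiv with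
    map_smul' := fun u y => ?_ }⟩, ?_⟩
  · obtain ⟨u, rfl⟩ := envResidue_surjective u
    exact e.map_smul u y
  have hsup : homInto A P N₂ ≤ homInto A P N ⊔ Submodule.span (ResidueField A) {g} := by
    intro h hh
    obtain ⟨r, hr⟩ := exists_smul_eq_of_hom ha hp hs
      (e.toLinearMap ∘ₗ homQuotient N₁ N₂ h hh) (e.toLinearMap ∘ₗ ψ) (fun h0 => hgN₁ fun x => by
        refine (homQuotient_eq_zero (hg := hgN₂)).mp ?_
        have := LinearMap.congr_fun h0 x
        rwa [LinearMap.comp_apply, LinearMap.zero_apply, LinearEquiv.coe_coe,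
          LinearEquiv.map_eq_zero_iff] at this)
    let h' := h - algebraMap A (ResidueField A) r • g
    have hh' : h' ∈ homInto A P N₁ := fun x => by
      have h1 := hr x
      rw [LinearMap.comp_apply, LinearMap.comp_apply, ← env_map_smul, LinearEquiv.coe_coe,
        e.injective.eq_iff, ← env_map_smul] at h1
      have h2 := (Submodule.Quotient.eq (N₁.submoduleOf N₂)).mp h1
      change Inflate.out A Y (h x) - Inflate.out A Y (g (r • x)) ∈ N₁ at h2
      rw [env_map_smul, out_smul'] at h2
      exact h2
    -- Otherwise h' competes with g. Its space of homomorphisms is contained in that of g and no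
    -- smaller, hence equal, so g would take values in N + im h' ⊆ N₁.
    have hh'N : h' ∈ homInto A P N := by
      by_contra hnot
      have hle : N ⊔ imageSubmodule h' ⊤ ≤ N₁ := sup_le le_sup_left (by
        rintro - ⟨x, -, rfl⟩
        exact hh' x)
      have h1 := Submodule.eq_of_le_of_finrank_le
        (homInto_mono (A := A) (P := P) (hle.trans h12)) (hmin h' hnot)
      have h2 : g ∈ homInto A P (N ⊔ imageSubmodule h' ⊤) := by rw [h1]; exact hgN₂
      exact hgN₁ (homInto_mono hle h2)
    have h3 : h = h' + algebraMap A (ResidueField A) r • g := (sub_add_cancel _ _).symm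
    rw [h3]
    exact Submodule.add_mem_sup hh'N (Submodule.smul_mem _ _ (Submodule.mem_span_singleton_self g))
  calc Module.finrank (ResidueField A) (homInto A P N₂)
      ≤ Module.finrank (ResidueField A)
          (homInto A P N ⊔ Submodule.span (ResidueField A) {g} : Submodule _ _) :=
        Submodule.finrank_mono hsup
    _ ≤ Module.finrank (ResidueField A) (homInto A P N) +
          Module.finrank (ResidueField A) (Submodule.span (ResidueField A) {g}) :=
        Submodule.finrank_add_le_finrank_add_finrank _ _
    _ ≤ _ := by
      gcongr
      simpa using finrank_span_le_card (R := ResidueField A) ({g} : Set (P →ₗ[Env 𝔤 A] Inflate A Y))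

include ha in
-- Starting from ⊥, each application of `exists_extension` gains one subquotient and at most one
-- dimension, so it can be repeated until the full dimension is reached.
theorem le_subquotientMultiplicity {c : P →ₗ[Env 𝔤 A] SimpleObject 𝔥 𝔟 A μ}
    (hP : IsProjectiveCover 𝔥 𝔟 A J μ P c)
    [Module.Finite (ResidueField A) (P →ₗ[Env 𝔤 A] Inflate A Y)] :
    (Module.finrank (ResidueField A) (P →ₗ[Env 𝔤 A] Inflate A Y) : ℕ) ≤
      subquotientMultiplicity (Env 𝔤 (ResidueField A)) Y
        (SimpleQuotient 𝔥 𝔟 (ResidueField A) μ) := by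
  have key (k : ℕ) (hk : k ≤ Module.finrank (ResidueField A) (P →ₗ[Env 𝔤 A] Inflate A Y)) :
      ∃ N : Submodule (Env 𝔤 (ResidueField A)) Y,
        HasChain (SimpleQuotient 𝔥 𝔟 (ResidueField A) μ) k N ∧
        Module.finrank (ResidueField A) (homInto A P N) ≤ k := by
    induction k with
    | zero =>
      refine ⟨⊥, hasChain_zero _, ?_⟩
      have : homInto A P (⊥ : Submodule (Env 𝔤 (ResidueField A)) Y) = ⊥ := by
        rw [eq_bot_iff]
        intro g hg
        exact LinearMap.ext fun x => (Inflate.out A Y).injective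
          (((Submodule.mem_bot (Env 𝔤 (ResidueField A))).mp (hg x)).trans (map_zero _).symm)
      rw [this, finrank_bot]
    | succ k ih =>
      obtain ⟨N, hchain, hrk⟩ := ih (by omega)
      obtain ⟨N₁, N₂, h1, h2, h3, h4⟩ := exists_extension ha hP (N := N) fun htop => by
        rw [htop, finrank_top] at hrk
        omega
      exact ⟨N₂, ((hchain.extend h1).1.extend h2).2 h3, h4.trans (by omega)⟩
  obtain ⟨N, h, -⟩ := key _ le_rfl
  exact h.le_multiplicity

include ha in
/-- The multiplicities in a Verma flag of a projective cover. -/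
theorem VermaFlag.multiplicity_eq (hJo : IsOpenSet 𝔥 𝔟 J) (hJ : IsLocallyBounded 𝔥 𝔟 J)
    {c : P →ₗ[Env 𝔤 A] SimpleObject 𝔥 𝔟 A μ} (hP : IsProjectiveCover 𝔥 𝔟 A J μ P c)
    (F : VermaFlag 𝔥 𝔟 A P) {lam : Weight 𝔥} (hlam : lam ∈ J) :
    (F.multiplicity lam : ℕ∞) = subquotientMultiplicity (Env 𝔤 (ResidueField A))
      (DualVerma 𝔥 𝔟 (ResidueField A) lam) (SimpleQuotient 𝔥 𝔟 (ResidueField A) μ) := by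
  classical
  obtain ⟨m, hm⟩ := F.exists_isStdBasis ha hP.isProjectiveObject.isInTruncatedO.iSup_eq_top
  obtain ⟨e⟩ := nonempty_hom_equiv ha hm lam
  have := Module.Finite.equiv e.symm
  -- The flag computes the dimension of Hom(P, ∇(lam)) as its number of indices of weight lam; the
  -- cover property computes the same dimension as a subquotient multiplicity.
  have h1 : F.multiplicity lam = Module.finrank (ResidueField A)
      (P →ₗ[Env 𝔤 A] Inflate A (DualVerma 𝔥 𝔟 (ResidueField A) lam)) := by
    rw [e.finrank_eq, Module.finrank_fintype_fun_eq_card, VermaFlag.multiplicity,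
      Nat.card_eq_fintype_card]
  rw [h1]
  exact le_antisymm (le_subquotientMultiplicity ha hP)
    (subquotientMultiplicity_le ha hP.isProjectiveObject hP.surjective
      (isInTruncatedO_dualVerma ha hJo hJ hlam))

include ha in
theorem VermaFlag.multiplicity_eq_zero (hP : IsInTruncatedO 𝔥 𝔟 A P J)
    (F : VermaFlag 𝔥 𝔟 A P) {lam : Weight 𝔥} (hlam : lam ∉ J) : F.multiplicity lam = 0 := by
  obtain ⟨m, hm⟩ := F.exists_isStdBasis ha hP.iSup_eq_top
  have : IsEmpty {i // F.wt i = lam} := by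
    refine ⟨fun ⟨i, hi⟩ => hlam (hP.mem_of_weightSpace_ne_bot lam ?_)⟩
    exact (Submodule.ne_bot_iff _).mpr ⟨m i, hi ▸ hm.mem i, hm.basis_ne_zero i⟩
  rw [VermaFlag.multiplicity, Nat.card_eq_zero]
  exact Or.inl this

end Multiplicity

end AffineO

end

theorem mainTheorem5 {𝔤 : Type u} [LieRing 𝔤] [LieAlgebra ℂ 𝔤] [FiniteDimensional ℂ 𝔤]
    [LieAlgebra.IsSimple ℂ 𝔤] (𝔥 𝔟 : LieSubalgebra ℂ 𝔤) [𝔥.IsCartanSubalgebra]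
    (h𝔟 : AffineO.IsBorel 𝔟) (h𝔥𝔟 : 𝔥 ≤ 𝔟)
    (A : Type v) [CommRing A] [IsNoetherianRing A] [IsLocalRing A] [Algebra ℂ A]
    [Algebra (SymmetricAlgebra ℂ 𝔥) A] [IsScalarTower ℂ (SymmetricAlgebra ℂ 𝔥) A]
    (J : Set (AffineO.Weight 𝔥)) (hJopen : AffineO.IsOpenSet 𝔥 𝔟 J)
    (hJbdd : AffineO.IsLocallyBounded 𝔥 𝔟 J) (μ : AffineO.Weight 𝔥) (hμ : μ ∈ J) :
    (∃ (P : Type (max u v)) (_ : AddCommGroup P) (_ : Module A P)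
      (_ : Module (AffineO.Env 𝔤 A) P) (_ : IsScalarTower A (AffineO.Env 𝔤 A) P)
      (c : P →ₗ[AffineO.Env 𝔤 A] AffineO.SimpleObject 𝔥 𝔟 A μ),
      AffineO.IsProjectiveCover 𝔥 𝔟 A J μ P c) ∧
    ∀ (P : Type (max u v)) [AddCommGroup P] [Module A P] [Module (AffineO.Env 𝔤 A) P]
      [IsScalarTower A (AffineO.Env 𝔤 A) P]
      (c : P →ₗ[AffineO.Env 𝔤 A] AffineO.SimpleObject 𝔥 𝔟 A μ),
      AffineO.IsProjectiveCover 𝔥 𝔟 A J μ P c →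
        Nonempty (AffineO.VermaFlag 𝔥 𝔟 A P) ∧
        ∀ (F : AffineO.VermaFlag 𝔥 𝔟 A P) (lam : AffineO.Weight 𝔥),
          (lam ∈ J → (F.multiplicity lam : ℕ∞) =
            AffineO.subquotientMultiplicity
              (AffineO.Env 𝔤 (IsLocalRing.ResidueField A))
              (AffineO.DualVerma 𝔥 𝔟 (IsLocalRing.ResidueField A) lam)
              (AffineO.SimpleQuotient 𝔥 𝔟 (IsLocalRing.ResidueField A) μ)) ∧
          (lam ∉ J → F.multiplicity lam = 0) := by
  obtain ⟨a, ha⟩ := AffineO.exists_isBorelGrading h𝔟 h𝔥𝔟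
  refine ⟨AffineO.hasProjectiveCover ha hJopen hJbdd hμ, fun P _ _ _ _ c hP => ⟨?_, fun F lam =>
    ⟨fun hlam => F.multiplicity_eq ha hJopen hJbdd hP hlam,
      fun hlam => F.multiplicity_eq_zero ha hP.isProjectiveObject.isInTruncatedO hlam⟩⟩⟩
  obtain ⟨ι, _, wt, m, hm⟩ := hP.exists_isStdBasis ha hJopen hJbdd
  exact hm.nonempty_vermaFlag ha
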